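/- For a finite 2-group $G$, its exponent is the maximum of the orders of its elements and its rank is the minimal cardinality of a generating set. An involution is an element of order exactly 2, and $G$ is generated by involutions if its involutions generate $G$. **Classes.** $\mathcal N_{II}(m)$ ($m\ge 6$): the groups $G$ of order $2^m$ and exponent $2^{m-2}$ having an element $p$ of order $2^{m-2}$ with $g^2\in\langle p\rangle$ for all $g\in G$. $\mathcal M_{II}(m)$ ($m\ge 7$): the groups $G$ of order $2^m$ and exponent $2^{m-3}$ having an element $p$ of order $2^{m-3}$ with $g^4\in\langle p\rangle$ for all $g\in G$ and an element $q$ with $q^2\notin\langle p\rangle$ and $|\langle p,q\rangle|=2^{m-1}$. $\mathcal M_{III}(m)$ ($m\ge 7$): the groups $G$ of order $2^m$ and exponent $2^{m-3}$ having an element $p$ of order $2^{m-3}$ with $g^2\in\langle p\rangle$ for all $g\in G$. **Listed groups.** The listed groups are given by the following presentations, where $n$ determines the integer parameters $(e_1,e_2,\dots)$ by the tables below. $\mathcal N_{II,n}(m)=\langle p,q,r\mid p^{2^{m-2}}=1,\ q^2=1,\ r^2=p^{2^{m-3}e_5},\ q^{-1}pq=p^{1+2^{m-3}e_2},\ r^{-1}pr=p^{e_1+2^{m-3}e_3},\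 r^{-1}qr=qp^{2^{m-3}e_4}\rangle$ $\mathcal M_{II-A,n}(m)=\langle p,q,r\mid p^{2^{m-3}}=1,\ q^4=1,\ r^2=q^{2e_3}p^{2^{m-4}e_4},\ q^{-1}pq=p^{1+2^{m-5}e_7},\ r^{-1}pr=q^{2e_1}p^{e_8+2^{m-4}e_5},\ r^{-1}qr=q^{1+2e_2}p^{2^{m-5}e_6}\rangle$ $\mathcal M_{II-B,n}(m)=\langle p,q,r\mid p^{2^{m-3}}=1,\ q^4=1,\ r^2=q^{2e_3},\ q^{-1}pq=p^{-1+2^{m-5}e_6},\ r^{-1}pr=q^{2e_1}p^{e_7+2^{m-4}e_5},\ r^{-1}qr=q^{1+2e_2}p^{2^ue_4}\rangle$ $\mathcal M_{II-C,n}(m)=\langle p,q,r\mid p^{2^{m-3}}=1,\ q^4=p^{2^{m-4}},\ r^2=1,\ q^{-1}pq=p^{-1},\ r^{-1}pr=p^{1+2^{m-4}e_2},\ r^{-1}qr=q^{1+2e_1}\rangle$ $\mathcal M_{II-D,n}(m)=\langle p,q,r\mid p^{2^{m-3}}=1,\ q^4=1,\ r^2=q^{2e_3},\ q^{-1}pq=q^2p^{-1+2^{m-4}e_7},\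 q^{-2}pq^2=p^{1+2^{m-4}e_6},\ r^{-1}pr=q^{2e_1}p^{e_8+2^{m-4}e_5},\ r^{-1}qr=q^{1+2e_2}p^{2^ue_4}\rangle$ $\mathcal M_{II-E,n}(m)=\langle p,q,r\mid p^{2^{m-3}}=1,\ q^4=1,\ r^2=1,\ q^{-1}pq=q^2p^{1-2^{m-5}e_2},\ q^{-2}pq^2=p^{1+2^{m-4}e_2},\ r^{-1}pr=p^{e_1+2^{m-4}e_4},\ r^{-1}qr=qp^{2^{m-5}e_3}\rangle$ $\mathcal M_{II-F,n}(m)=\langle p,q,r\mid p^{2^{m-3}}=1,\ q^4=p^{2^{m-4}},\ r^2=1,\ q^{-1}pq=q^2p^{-1+2^{m-4}e_5},\ q^{-2}pq^2=p^{1+2^{m-4}e_1},\ r^{-1}pr=q^{2e_3}p^{1+2^{m-4}e_2},\ r^{-1}qr=q^{1+2e_3}p^{2^{m-4}e_4}\rangle$ $\mathcal M_{II-G,n}(m)=\langle p,q,r\mid p^{2^{m-3}}=1,\ q^4=p^4,\ r^2=1,\ q^{-1}pq=q^2p^{-1+2^{m-5}e_4},\ q^{-2}pq^2=p^{1+2^{m-4}e_1},\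 r^{-1}pr=p^{1+2^{m-4}e_3},\ r^{-1}qr=qp^{2^{m-4}e_2}\rangle$ $\mathcal M_{III,n}(m)=\langle p,q,r,s\mid p^{2^{m-3}}=1,\ q^2=1,\ r^2=p^{2^{m-4}e_8},\ s^2=p^{2^{m-4}e_5},\ q^{-1}pq=p,\ r^{-1}pr=p^{e_2+2^{m-4}e_3},\ s^{-1}ps=p^{e_1+2^{m-4}e_6},\ r^{-1}qr=q,\ s^{-1}qs=qp^{2^{m-4}e_4},\ s^{-1}rs=rp^{2^{m-4}e_7}\rangle$ Here $u=1$ for $\mathcal M_{II-B,27},\mathcal M_{II-B,28},\mathcal M_{II-D,10},\mathcal M_{II-D,11}$, and $u=m-4$ otherwise. The parameters, written $n:(e_1,e_2,\dots)$, are - $\mathcal N_{II}$: $1:(1,0,0,1,0)$; $2:(-1,1,1,1,0)$; $3:(-1,0,0,1,0)$; $4:(-1,1,1,0,0)$; $5:(-1,0,0,0,0)$; $6:(-1,0,1,0,0)$; $7:(-1,0,0,0,1)$; $8:(1,0,1,0,0)$; $9:(1,0,0,0,0)$. - $\mathcal M_{II-A}$: $1:(0,0,0,0,0,0,0,1)$;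 $2:(0,0,0,0,0,0,2,1)$; $3:(0,0,0,0,0,0,1,1)$; $4:(1,0,0,0,0,0,1,1)$; $5:(0,0,0,0,0,2,1,1)$; $6:(1,0,0,0,0,0,0,1)$; $7:(1,0,0,0,0,0,2,1)$; $8:(0,0,0,0,1,0,0,1)$; $9:(0,0,0,0,0,2,0,1)$; $10:(1,0,0,0,0,2,0,1)$; $11:(1,0,0,0,0,2,1,1)$; $12:(0,0,0,0,1,0,0,-1)$; $13:(0,0,0,0,1,0,2,-1)$; $14:(0,1,0,0,1,2,2,-1)$; $15:(1,1,0,0,0,2,0,-1)$; $16:(1,1,0,0,0,2,2,-1)$; $17:(0,1,1,0,0,0,0,1)$; $18:(0,1,1,0,1,0,0,1)$; $19:(0,0,0,1,0,0,0,-1)$; $20:(0,0,0,1,0,0,2,-1)$; $21:(1,1,0,1,0,0,0,-1)$; $22:(1,1,1,0,1,0,0,-1)$; $23:(1,1,0,1,0,0,2,-1)$; $24:(1,1,1,0,1,2,2,-1)$; $25:(0,1,0,1,0,0,0,-1)$; $26:(0,1,1,0,0,0,0,-1)$; $27:(0,1,1,0,0,0,2,-1)$; $28:(0,1,1,0,1,0,0,-1)$;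 $29:(0,1,1,0,0,2,0,-1)$; $30:(0,0,0,0,0,0,0,-1)$; $31:(0,0,0,0,0,0,2,-1)$; $32:(0,1,0,0,0,2,0,-1)$; $33:(1,1,0,0,0,0,0,-1)$; $34:(1,1,0,0,0,0,2,-1)$; $35:(0,1,0,0,1,0,0,-1)$; $36:(0,1,0,0,1,0,0,1)$; $37:(0,1,0,0,0,0,0,1)$; $38:(0,1,0,0,0,0,2,1)$; $39:(0,1,0,0,0,0,0,-1)$; $40:(0,1,0,0,0,0,2,-1)$; $41:(0,0,0,0,0,1,0,-1)$; $42:(0,0,0,0,0,1,2,-1)$; $43:(0,0,0,0,0,0,1,-1)$; $44:(0,0,0,0,1,1,1,-1)$; $45:(0,1,0,0,0,1,0,1)$; $46:(0,1,0,0,0,1,2,1)$. - $\mathcal M_{II-B}$: $1:(0,0,0,0,0,0,1)$; $2:(0,0,0,0,0,2,1)$; $3:(0,0,0,0,0,1,1)$; $4:(1,1,0,1,0,1,1)$; $5:(0,0,0,1,0,1,1)$; $6:(1,0,0,1,0,0,1)$; $7:(0,0,0,0,1,0,1)$; $8:(0,1,0,1,0,0,1)$; $9:(0,0,0,1,0,0,1)$;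 $10:(1,0,0,0,0,2,1)$; $11:(1,0,0,0,1,0,1)$; $12:(0,1,0,1,1,2,1)$; $13:(1,0,0,1,1,0,1)$; $14:(1,0,0,0,0,0,1)$; $15:(1,0,0,0,1,2,1)$; $16:(1,0,1,1,0,0,1)$; $17:(1,0,1,1,1,0,1)$; $18:(1,0,1,1,1,2,1)$; $19:(0,1,0,0,0,0,1)$; $20:(0,1,0,0,1,2,1)$; $21:(1,0,1,0,0,0,1)$; $22:(1,0,1,0,0,2,1)$; $23:(1,0,1,0,1,2,1)$; $24:(0,1,0,0,0,2,1)$; $25:(0,1,0,0,1,0,1)$; $26:(1,1,0,0,0,1,1)$; $27:(1,1,0,1,0,1,-1)$; $28:(1,1,0,1,1,1,-1)$. - $\mathcal M_{II-C}$: $1:(0,0)$; $2:(0,1)$; $3:(1,0)$; $4:(1,1)$; $5:(-1,0)$. - $\mathcal M_{II-D}$: $1:(0,0,0,1,0,1,0,1)$; $2:(1,1,0,1,0,1,0,1)$; $3:(1,1,0,0,0,1,0,1)$; $4:(0,0,0,0,0,1,0,1)$; $5:(0,0,0,0,0,0,0,1)$; $6:(0,0,0,1,1,0,0,1)$; $7:(1,1,0,1,1,0,0,1)$;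 $8:(1,0,1,1,1,0,1,1)$; $9:(0,0,0,0,1,0,1,-1)$; $10:(0,1,0,1,1,0,1,-1)$; $11:(0,1,0,1,1,0,0,-1)$; $12:(0,0,0,0,1,0,0,1)$; $13:(0,0,0,1,0,0,0,1)$; $14:(1,1,0,1,0,0,0,1)$; $15:(1,0,1,1,0,0,0,1)$; $16:(0,0,0,0,1,0,0,-1)$; $17:(1,1,0,0,1,0,0,1)$; $18:(0,0,0,0,0,0,0,-1)$; $19:(1,1,0,0,0,0,0,1)$; $20:(1,1,0,0,0,0,1,1)$; $21:(0,0,0,1,1,0,1,1)$; $22:(1,1,0,1,1,0,1,1)$; $23:(0,0,0,0,0,0,1,1)$. - $\mathcal M_{II-E}$: $1:(-1,1,1,0)$; $2:(-1,1,3,0)$; $3:(-1,1,1,1)$; $4:(1,1,2,1)$; $5:(1,0,0,0)$; $6:(1,1,0,0)$; $7:(1,0,2,0)$; $8:(1,0,0,1)$. - $\mathcal M_{II-F}$: $1:(0,0,0,0,0)$; $2:(1,0,0,0,0)$; $3:(1,0,0,0,1)$; $4:(0,1,0,0,0)$; $5:(1,1,0,0,0)$; $6:(0,1,1,0,0)$;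 $7:(0,0,1,0,0)$; $8:(0,0,1,1,0)$; $9:(0,1,1,1,0)$. - $\mathcal M_{II-G}$: $1:(0,0,0,0)$; $2:(0,1,1,0)$; $3:(0,0,1,0)$; $4:(1,0,0,0)$; $5:(1,0,0,1)$; $6:(1,0,1,0)$; $7:(1,1,0,1)$. - $\mathcal M_{III}$: $1:(1,1,0,0,0,0,1,0)$; $2:(-1,1,1,0,0,1,1,0)$; $3:(-1,1,0,0,0,0,1,0)$; $4:(-1,1,1,0,0,1,0,0)$; $5:(-1,1,0,0,0,0,0,0)$; $6:(-1,1,0,0,0,1,0,0)$; $7:(-1,1,0,0,1,0,0,0)$; $8:(1,1,0,0,0,1,0,0)$; $9:(1,1,0,0,0,0,0,0)$; $10:(1,-1,0,1,1,0,0,0)$; $11:(1,-1,1,1,1,0,0,0)$; $12:(1,1,1,1,0,0,0,0)$; $13:(-1,1,1,1,0,0,0,0)$; $14:(-1,-1,0,1,0,0,0,1)$. **Proposition.** Let $\Gamma=\Gamma_1\cup\Gamma_2\cup\Gamma_3$ (22 groups for each $m\ge7$), where $\Gamma_1=\{\mathcal N_{II,n}(m): n=3,4,5\}$; $\Gamma_2=\{\mathcal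 M_{II-A,39}(m),\mathcal M_{II-A,40}(m),\mathcal M_{II-B,19}(m),\mathcal M_{II-B,20}(m),\mathcal M_{II-C,5}(m),\mathcal M_{II-D,3}(m),\mathcal M_{II-D,17}(m),\mathcal M_{II-D,18}(m),\mathcal M_{II-D,19}(m),\mathcal M_{II-E,1}(m),\mathcal M_{II-F,8}(m),\mathcal M_{II-F,9}(m)\}$; $\Gamma_3=\{\mathcal M_{III,n}(m): n=3,4,5,10,11,13,14\}$. Let $m\ge 6$ in the statements about $\mathcal N_{II}$ and $\Gamma_1$, and $m\ge7$ in those about $\mathcal M_{II},\mathcal M_{III},\Gamma_2,\Gamma_3$. 1. A listed group is generated by involutions if and only if it is one of those named in $\Gamma$. 2. For every listed group $G$ not named in $\Gamma$ there is a nonempty set $X$ of its generators $p,q,r$ (and $s$) such that $x\mapsto -1$ for the generators $x\in X$ and $x\mapsto 1$ for the other generators defines a homomorphism $\varphi_X:G\to\{1,-1\}$, and $\varphi_X(g)=1$ for every involution $g\in G$. 3. The 3 groups in $\Gamma_1$ lie in the class $\mathcal N_{II}(m)$ and have exponent $2^{m-2}$ and rank 3; the 12 groups in $\Gamma_2$ lie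 in $\mathcal M_{II}(m)$ and have exponent $2^{m-3}$ and rank 3; the 7 groups in $\Gamma_3$ lie in $\mathcal M_{III}(m)$ and have exponent $2^{m-3}$ and rank 4. For a given $m$, the groups in $\Gamma$ are pairwise non-isomorphic. 4. A group in the class $\mathcal N_{II}(m)$ (respectively $\mathcal M_{II}(m)$, $\mathcal M_{III}(m)$) is generated by involutions if and only if it is isomorphic to one of the groups in $\Gamma_1$ (respectively $\Gamma_2$, $\Gamma_3$). -/

import Mathlib

namespace TwoGroups

/-- `G` is generated by its involutions, the elements of order exactly 2. -/
def GeneratedByInvolutions (G : Type*) [Group G] : Prop :=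
  Subgroup.closure {g : G | orderOf g = 2} = ⊤

/-! ### The classes of 2-groups

For a finite 2-group, the largest order of an element is `Monoid.exponent`. -/

/-- `G` has order `2 ^ m` and exponent `2 ^ (m - 2)`, and there is an element `p` of that maximal
order such that every square lies in `⟨p⟩`. -/
def ClassNII (m : ℕ) (G : Type*) [Group G] : Prop :=
  Nat.card G = 2 ^ m ∧ Monoid.exponent G = 2 ^ (m - 2) ∧
    ∃ p : G, orderOf p = 2 ^ (m - 2) ∧ ∀ g : G, g ^ 2 ∈ Subgroup.zpowers p

/-- `G` has order `2 ^ m` and exponent `2 ^ (m - 3)`, and there are an element `p` of that maximal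
order such that every fourth power lies in `⟨p⟩`, and an element `q` whose square does not lie
in `⟨p⟩`, such that `⟨p, q⟩` has order `2 ^ (m - 1)`. -/
def ClassMII (m : ℕ) (G : Type*) [Group G] : Prop :=
  Nat.card G = 2 ^ m ∧ Monoid.exponent G = 2 ^ (m - 3) ∧
    ∃ p : G, orderOf p = 2 ^ (m - 3) ∧ (∀ g : G, g ^ 4 ∈ Subgroup.zpowers p) ∧
      ∃ q : G, q ^ 2 ∉ Subgroup.zpowers p ∧
        Nat.card (Subgroup.closure ({p, q} : Set G)) = 2 ^ (m - 1)

/-- `G` has order `2 ^ m` and exponent `2 ^ (m - 3)`, and there is an element `p` of that maximal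
order such that every square lies in `⟨p⟩`. -/
def ClassMIII (m : ℕ) (G : Type*) [Group G] : Prop :=
  Nat.card G = 2 ^ m ∧ Monoid.exponent G = 2 ^ (m - 3) ∧
    ∃ p : G, orderOf p = 2 ^ (m - 3) ∧ ∀ g : G, g ^ 2 ∈ Subgroup.zpowers p

/-! ### The presentations

A relation `a = b` is entered as the relator `a * b⁻¹`.  The integers `e₁, e₂, …` are the
parameters of the family; `p, q, r` (and `s`) are the generators `0, 1, 2` (and `3`). -/

/-- The relators of the family `NII` with parameters `e₁, e₂, e₃, e₄, e₅`. -/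
def relNII (m : ℕ) (e₁ e₂ e₃ e₄ e₅ : ℤ) : Set (FreeGroup (Fin 3)) :=
  let p := FreeGroup.of 0
  let q := FreeGroup.of 1
  let r := FreeGroup.of 2
  {p ^ 2 ^ (m - 2),
    q ^ 2,
    r ^ 2 * (p ^ (2 ^ (m - 3) * e₅))⁻¹,
    q⁻¹ * p * q * (p ^ (1 + 2 ^ (m - 3) * e₂))⁻¹,
    r⁻¹ * p * r * (p ^ (e₁ + 2 ^ (m - 3) * e₃))⁻¹,
    r⁻¹ * q * r * (q * p ^ (2 ^ (m - 3) * e₄))⁻¹}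

/-- The relators of the family `MIIA` with parameters `e₁, e₂, e₃, e₄, e₅, e₆, e₇, e₈`. -/
def relMIIA (m : ℕ) (e₁ e₂ e₃ e₄ e₅ e₆ e₇ e₈ : ℤ) : Set (FreeGroup (Fin 3)) :=
  let p := FreeGroup.of 0
  let q := FreeGroup.of 1
  let r := FreeGroup.of 2
  {p ^ 2 ^ (m - 3),
    q ^ 4,
    r ^ 2 * (q ^ (2 * e₃) * p ^ (2 ^ (m - 4) * e₄))⁻¹,
    q⁻¹ * p * q * (p ^ (1 + 2 ^ (m - 5) * e₇))⁻¹,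
    r⁻¹ * p * r * (q ^ (2 * e₁) * p ^ (e₈ + 2 ^ (m - 4) * e₅))⁻¹,
    r⁻¹ * q * r * (q ^ (1 + 2 * e₂) * p ^ (2 ^ (m - 5) * e₆))⁻¹}

/-- The relators of the family `MIIB` with parameters `e₁, e₂, e₃, e₄, e₅, e₆, e₇`. -/
def relMIIB (m u : ℕ) (e₁ e₂ e₃ e₄ e₅ e₆ e₇ : ℤ) : Set (FreeGroup (Fin 3)) :=
  let p := FreeGroup.of 0
  let q := FreeGroup.of 1
  let r := FreeGroup.of 2
  {p ^ 2 ^ (m - 3),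
    q ^ 4,
    r ^ 2 * (q ^ (2 * e₃))⁻¹,
    q⁻¹ * p * q * (p ^ (-1 + 2 ^ (m - 5) * e₆))⁻¹,
    r⁻¹ * p * r * (q ^ (2 * e₁) * p ^ (e₇ + 2 ^ (m - 4) * e₅))⁻¹,
    r⁻¹ * q * r * (q ^ (1 + 2 * e₂) * p ^ (2 ^ u * e₄))⁻¹}

/-- The relators of the family `MIIC` with parameters `e₁, e₂`. -/
def relMIIC (m : ℕ) (e₁ e₂ : ℤ) : Set (FreeGroup (Fin 3)) :=
  let p := FreeGroup.of 0
  let q := FreeGroup.of 1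
  let r := FreeGroup.of 2
  {p ^ 2 ^ (m - 3),
    q ^ 4 * (p ^ 2 ^ (m - 4))⁻¹,
    r ^ 2,
    q⁻¹ * p * q * p,
    r⁻¹ * p * r * (p ^ (1 + 2 ^ (m - 4) * e₂))⁻¹,
    r⁻¹ * q * r * (q ^ (1 + 2 * e₁))⁻¹}

/-- The relators of the family `MIID` with parameters `e₁, e₂, e₃, e₄, e₅, e₆, e₇, e₈`. -/
def relMIID (m u : ℕ) (e₁ e₂ e₃ e₄ e₅ e₆ e₇ e₈ : ℤ) : Set (FreeGroup (Fin 3)) :=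
  let p := FreeGroup.of 0
  let q := FreeGroup.of 1
  let r := FreeGroup.of 2
  {p ^ 2 ^ (m - 3),
    q ^ 4,
    r ^ 2 * (q ^ (2 * e₃))⁻¹,
    q⁻¹ * p * q * (q ^ 2 * p ^ (-1 + 2 ^ (m - 4) * e₇))⁻¹,
    (q ^ 2)⁻¹ * p * q ^ 2 * (p ^ (1 + 2 ^ (m - 4) * e₆))⁻¹,
    r⁻¹ * p * r * (q ^ (2 * e₁) * p ^ (e₈ + 2 ^ (m - 4) * e₅))⁻¹,
    r⁻¹ * q * r * (q ^ (1 + 2 * e₂) * p ^ (2 ^ u * e₄))⁻¹}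

/-- The relators of the family `MIIE` with parameters `e₁, e₂, e₃, e₄`. -/
def relMIIE (m : ℕ) (e₁ e₂ e₃ e₄ : ℤ) : Set (FreeGroup (Fin 3)) :=
  let p := FreeGroup.of 0
  let q := FreeGroup.of 1
  let r := FreeGroup.of 2
  {p ^ 2 ^ (m - 3),
    q ^ 4,
    r ^ 2,
    q⁻¹ * p * q * (q ^ 2 * p ^ (1 - 2 ^ (m - 5) * e₂))⁻¹,
    (q ^ 2)⁻¹ * p * q ^ 2 * (p ^ (1 + 2 ^ (m - 4) * e₂))⁻¹,
    r⁻¹ * p * r * (p ^ (e₁ + 2 ^ (m - 4) * e₄))⁻¹,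
    r⁻¹ * q * r * (q * p ^ (2 ^ (m - 5) * e₃))⁻¹}

/-- The relators of the family `MIIF` with parameters `e₁, e₂, e₃, e₄, e₅`. -/
def relMIIF (m : ℕ) (e₁ e₂ e₃ e₄ e₅ : ℤ) : Set (FreeGroup (Fin 3)) :=
  let p := FreeGroup.of 0
  let q := FreeGroup.of 1
  let r := FreeGroup.of 2
  {p ^ 2 ^ (m - 3),
    q ^ 4 * (p ^ 2 ^ (m - 4))⁻¹,
    r ^ 2,
    q⁻¹ * p * q * (q ^ 2 * p ^ (-1 + 2 ^ (m - 4) * e₅))⁻¹,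
    (q ^ 2)⁻¹ * p * q ^ 2 * (p ^ (1 + 2 ^ (m - 4) * e₁))⁻¹,
    r⁻¹ * p * r * (q ^ (2 * e₃) * p ^ (1 + 2 ^ (m - 4) * e₂))⁻¹,
    r⁻¹ * q * r * (q ^ (1 + 2 * e₃) * p ^ (2 ^ (m - 4) * e₄))⁻¹}

/-- The relators of the family `MIIG` with parameters `e₁, e₂, e₃, e₄`. -/
def relMIIG (m : ℕ) (e₁ e₂ e₃ e₄ : ℤ) : Set (FreeGroup (Fin 3)) :=
  let p := FreeGroup.of 0
  let q := FreeGroup.of 1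
  let r := FreeGroup.of 2
  {p ^ 2 ^ (m - 3),
    q ^ 4 * (p ^ 4)⁻¹,
    r ^ 2,
    q⁻¹ * p * q * (q ^ 2 * p ^ (-1 + 2 ^ (m - 5) * e₄))⁻¹,
    (q ^ 2)⁻¹ * p * q ^ 2 * (p ^ (1 + 2 ^ (m - 4) * e₁))⁻¹,
    r⁻¹ * p * r * (p ^ (1 + 2 ^ (m - 4) * e₃))⁻¹,
    r⁻¹ * q * r * (q * p ^ (2 ^ (m - 4) * e₂))⁻¹}

/-- The relators of the family `MIII` with parameters `e₁, e₂, e₃, e₄, e₅, e₆, e₇, e₈`. -/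
def relMIII (m : ℕ) (e₁ e₂ e₃ e₄ e₅ e₆ e₇ e₈ : ℤ) : Set (FreeGroup (Fin 4)) :=
  let p := FreeGroup.of 0
  let q := FreeGroup.of 1
  let r := FreeGroup.of 2
  let s := FreeGroup.of 3
  {p ^ 2 ^ (m - 3),
    q ^ 2,
    r ^ 2 * (p ^ (2 ^ (m - 4) * e₈))⁻¹,
    s ^ 2 * (p ^ (2 ^ (m - 4) * e₅))⁻¹,
    q⁻¹ * p * q * p⁻¹,
    r⁻¹ * p * r * (p ^ (e₂ + 2 ^ (m - 4) * e₃))⁻¹,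
    s⁻¹ * p * s * (p ^ (e₁ + 2 ^ (m - 4) * e₆))⁻¹,
    r⁻¹ * q * r * q⁻¹,
    s⁻¹ * q * s * (q * p ^ (2 ^ (m - 4) * e₄))⁻¹,
    s⁻¹ * r * s * (r * p ^ (2 ^ (m - 4) * e₇))⁻¹}

/-- The relators of the `n`-th group of the family `NII`, for `1 ≤ n ≤ 9`. -/
def presNII (m : ℕ) : ℕ → Set (FreeGroup (Fin 3))
  | 1 => relNII m 1 0 0 1 0
  | 2 => relNII m (-1) 1 1 1 0
  | 3 => relNII m (-1) 0 0 1 0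
  | 4 => relNII m (-1) 1 1 0 0
  | 5 => relNII m (-1) 0 0 0 0
  | 6 => relNII m (-1) 0 1 0 0
  | 7 => relNII m (-1) 0 0 0 1
  | 8 => relNII m 1 0 1 0 0
  | 9 => relNII m 1 0 0 0 0
  | _ => ∅

/-- The relators of the `n`-th group of the family `MIIA`, for `1 ≤ n ≤ 46`. -/
def presMIIA (m : ℕ) : ℕ → Set (FreeGroup (Fin 3))
  | 1 => relMIIA m 0 0 0 0 0 0 0 1
  | 2 => relMIIA m 0 0 0 0 0 0 2 1
  | 3 => relMIIA m 0 0 0 0 0 0 1 1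
  | 4 => relMIIA m 1 0 0 0 0 0 1 1
  | 5 => relMIIA m 0 0 0 0 0 2 1 1
  | 6 => relMIIA m 1 0 0 0 0 0 0 1
  | 7 => relMIIA m 1 0 0 0 0 0 2 1
  | 8 => relMIIA m 0 0 0 0 1 0 0 1
  | 9 => relMIIA m 0 0 0 0 0 2 0 1
  | 10 => relMIIA m 1 0 0 0 0 2 0 1
  | 11 => relMIIA m 1 0 0 0 0 2 1 1
  | 12 => relMIIA m 0 0 0 0 1 0 0 (-1)
  | 13 => relMIIA m 0 0 0 0 1 0 2 (-1)
  | 14 => relMIIA m 0 1 0 0 1 2 2 (-1)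
  | 15 => relMIIA m 1 1 0 0 0 2 0 (-1)
  | 16 => relMIIA m 1 1 0 0 0 2 2 (-1)
  | 17 => relMIIA m 0 1 1 0 0 0 0 1
  | 18 => relMIIA m 0 1 1 0 1 0 0 1
  | 19 => relMIIA m 0 0 0 1 0 0 0 (-1)
  | 20 => relMIIA m 0 0 0 1 0 0 2 (-1)
  | 21 => relMIIA m 1 1 0 1 0 0 0 (-1)
  | 22 => relMIIA m 1 1 1 0 1 0 0 (-1)
  | 23 => relMIIA m 1 1 0 1 0 0 2 (-1)
  | 24 => relMIIA m 1 1 1 0 1 2 2 (-1)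
  | 25 => relMIIA m 0 1 0 1 0 0 0 (-1)
  | 26 => relMIIA m 0 1 1 0 0 0 0 (-1)
  | 27 => relMIIA m 0 1 1 0 0 0 2 (-1)
  | 28 => relMIIA m 0 1 1 0 1 0 0 (-1)
  | 29 => relMIIA m 0 1 1 0 0 2 0 (-1)
  | 30 => relMIIA m 0 0 0 0 0 0 0 (-1)
  | 31 => relMIIA m 0 0 0 0 0 0 2 (-1)
  | 32 => relMIIA m 0 1 0 0 0 2 0 (-1)
  | 33 => relMIIA m 1 1 0 0 0 0 0 (-1)
  | 34 => relMIIA m 1 1 0 0 0 0 2 (-1)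
  | 35 => relMIIA m 0 1 0 0 1 0 0 (-1)
  | 36 => relMIIA m 0 1 0 0 1 0 0 1
  | 37 => relMIIA m 0 1 0 0 0 0 0 1
  | 38 => relMIIA m 0 1 0 0 0 0 2 1
  | 39 => relMIIA m 0 1 0 0 0 0 0 (-1)
  | 40 => relMIIA m 0 1 0 0 0 0 2 (-1)
  | 41 => relMIIA m 0 0 0 0 0 1 0 (-1)
  | 42 => relMIIA m 0 0 0 0 0 1 2 (-1)
  | 43 => relMIIA m 0 0 0 0 0 0 1 (-1)
  | 44 => relMIIA m 0 0 0 0 1 1 1 (-1)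
  | 45 => relMIIA m 0 1 0 0 0 1 0 1
  | 46 => relMIIA m 0 1 0 0 0 1 2 1
  | _ => ∅

/-- The relators of the `n`-th group of the family `MIIB`, for `1 ≤ n ≤ 28`. -/
def presMIIB (m : ℕ) : ℕ → Set (FreeGroup (Fin 3))
  | 1 => relMIIB m (m - 4) 0 0 0 0 0 0 1
  | 2 => relMIIB m (m - 4) 0 0 0 0 0 2 1
  | 3 => relMIIB m (m - 4) 0 0 0 0 0 1 1
  | 4 => relMIIB m (m - 4) 1 1 0 1 0 1 1
  | 5 => relMIIB m (m - 4) 0 0 0 1 0 1 1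
  | 6 => relMIIB m (m - 4) 1 0 0 1 0 0 1
  | 7 => relMIIB m (m - 4) 0 0 0 0 1 0 1
  | 8 => relMIIB m (m - 4) 0 1 0 1 0 0 1
  | 9 => relMIIB m (m - 4) 0 0 0 1 0 0 1
  | 10 => relMIIB m (m - 4) 1 0 0 0 0 2 1
  | 11 => relMIIB m (m - 4) 1 0 0 0 1 0 1
  | 12 => relMIIB m (m - 4) 0 1 0 1 1 2 1
  | 13 => relMIIB m (m - 4) 1 0 0 1 1 0 1
  | 14 => relMIIB m (m - 4) 1 0 0 0 0 0 1
  | 15 => relMIIB m (m - 4) 1 0 0 0 1 2 1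
  | 16 => relMIIB m (m - 4) 1 0 1 1 0 0 1
  | 17 => relMIIB m (m - 4) 1 0 1 1 1 0 1
  | 18 => relMIIB m (m - 4) 1 0 1 1 1 2 1
  | 19 => relMIIB m (m - 4) 0 1 0 0 0 0 1
  | 20 => relMIIB m (m - 4) 0 1 0 0 1 2 1
  | 21 => relMIIB m (m - 4) 1 0 1 0 0 0 1
  | 22 => relMIIB m (m - 4) 1 0 1 0 0 2 1
  | 23 => relMIIB m (m - 4) 1 0 1 0 1 2 1
  | 24 => relMIIB m (m - 4) 0 1 0 0 0 2 1
  | 25 => relMIIB m (m - 4) 0 1 0 0 1 0 1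
  | 26 => relMIIB m (m - 4) 1 1 0 0 0 1 1
  | 27 => relMIIB m 1 1 1 0 1 0 1 (-1)
  | 28 => relMIIB m 1 1 1 0 1 1 1 (-1)
  | _ => ∅

/-- The relators of the `n`-th group of the family `MIIC`, for `1 ≤ n ≤ 5`. -/
def presMIIC (m : ℕ) : ℕ → Set (FreeGroup (Fin 3))
  | 1 => relMIIC m 0 0
  | 2 => relMIIC m 0 1
  | 3 => relMIIC m 1 0
  | 4 => relMIIC m 1 1
  | 5 => relMIIC m (-1) 0
  | _ => ∅

/-- The relators of the `n`-th group of the family `MIID`, for `1 ≤ n ≤ 23`. -/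
def presMIID (m : ℕ) : ℕ → Set (FreeGroup (Fin 3))
  | 1 => relMIID m (m - 4) 0 0 0 1 0 1 0 1
  | 2 => relMIID m (m - 4) 1 1 0 1 0 1 0 1
  | 3 => relMIID m (m - 4) 1 1 0 0 0 1 0 1
  | 4 => relMIID m (m - 4) 0 0 0 0 0 1 0 1
  | 5 => relMIID m (m - 4) 0 0 0 0 0 0 0 1
  | 6 => relMIID m (m - 4) 0 0 0 1 1 0 0 1
  | 7 => relMIID m (m - 4) 1 1 0 1 1 0 0 1
  | 8 => relMIID m (m - 4) 1 0 1 1 1 0 1 1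
  | 9 => relMIID m (m - 4) 0 0 0 0 1 0 1 (-1)
  | 10 => relMIID m 1 0 1 0 1 1 0 1 (-1)
  | 11 => relMIID m 1 0 1 0 1 1 0 0 (-1)
  | 12 => relMIID m (m - 4) 0 0 0 0 1 0 0 1
  | 13 => relMIID m (m - 4) 0 0 0 1 0 0 0 1
  | 14 => relMIID m (m - 4) 1 1 0 1 0 0 0 1
  | 15 => relMIID m (m - 4) 1 0 1 1 0 0 0 1
  | 16 => relMIID m (m - 4) 0 0 0 0 1 0 0 (-1)
  | 17 => relMIID m (m - 4) 1 1 0 0 1 0 0 1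
  | 18 => relMIID m (m - 4) 0 0 0 0 0 0 0 (-1)
  | 19 => relMIID m (m - 4) 1 1 0 0 0 0 0 1
  | 20 => relMIID m (m - 4) 1 1 0 0 0 0 1 1
  | 21 => relMIID m (m - 4) 0 0 0 1 1 0 1 1
  | 22 => relMIID m (m - 4) 1 1 0 1 1 0 1 1
  | 23 => relMIID m (m - 4) 0 0 0 0 0 0 1 1
  | _ => ∅

/-- The relators of the `n`-th group of the family `MIIE`, for `1 ≤ n ≤ 8`. -/
def presMIIE (m : ℕ) : ℕ → Set (FreeGroup (Fin 3))
  | 1 => relMIIE m (-1) 1 1 0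
  | 2 => relMIIE m (-1) 1 3 0
  | 3 => relMIIE m (-1) 1 1 1
  | 4 => relMIIE m 1 1 2 1
  | 5 => relMIIE m 1 0 0 0
  | 6 => relMIIE m 1 1 0 0
  | 7 => relMIIE m 1 0 2 0
  | 8 => relMIIE m 1 0 0 1
  | _ => ∅

/-- The relators of the `n`-th group of the family `MIIF`, for `1 ≤ n ≤ 9`. -/
def presMIIF (m : ℕ) : ℕ → Set (FreeGroup (Fin 3))
  | 1 => relMIIF m 0 0 0 0 0
  | 2 => relMIIF m 1 0 0 0 0
  | 3 => relMIIF m 1 0 0 0 1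
  | 4 => relMIIF m 0 1 0 0 0
  | 5 => relMIIF m 1 1 0 0 0
  | 6 => relMIIF m 0 1 1 0 0
  | 7 => relMIIF m 0 0 1 0 0
  | 8 => relMIIF m 0 0 1 1 0
  | 9 => relMIIF m 0 1 1 1 0
  | _ => ∅

/-- The relators of the `n`-th group of the family `MIIG`, for `1 ≤ n ≤ 7`. -/
def presMIIG (m : ℕ) : ℕ → Set (FreeGroup (Fin 3))
  | 1 => relMIIG m 0 0 0 0
  | 2 => relMIIG m 0 1 1 0
  | 3 => relMIIG m 0 0 1 0
  | 4 => relMIIG m 1 0 0 0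
  | 5 => relMIIG m 1 0 0 1
  | 6 => relMIIG m 1 0 1 0
  | 7 => relMIIG m 1 1 0 1
  | _ => ∅

/-- The relators of the `n`-th group of the family `MIII`, for `1 ≤ n ≤ 14`. -/
def presMIII (m : ℕ) : ℕ → Set (FreeGroup (Fin 4))
  | 1 => relMIII m 1 1 0 0 0 0 1 0
  | 2 => relMIII m (-1) 1 1 0 0 1 1 0
  | 3 => relMIII m (-1) 1 0 0 0 0 1 0
  | 4 => relMIII m (-1) 1 1 0 0 1 0 0
  | 5 => relMIII m (-1) 1 0 0 0 0 0 0
  | 6 => relMIII m (-1) 1 0 0 0 1 0 0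
  | 7 => relMIII m (-1) 1 0 0 1 0 0 0
  | 8 => relMIII m 1 1 0 0 0 1 0 0
  | 9 => relMIII m 1 1 0 0 0 0 0 0
  | 10 => relMIII m 1 (-1) 0 1 1 0 0 0
  | 11 => relMIII m 1 (-1) 1 1 1 0 0 0
  | 12 => relMIII m 1 1 1 1 0 0 0 0
  | 13 => relMIII m (-1) 1 1 1 0 0 0 0
  | 14 => relMIII m (-1) (-1) 0 1 0 0 0 1
  | _ => ∅

/-- The names of the nine families of presentations. -/
inductive Family
  | NII | MIIA | MIIB | MIIC | MIID | MIIE | MIIF | MIIG | MIII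
  deriving DecidableEq

namespace Family

/-- The number of presentations listed in the family. -/
def count : Family → ℕ
  | NII => 9
  | MIIA => 46
  | MIIB => 28
  | MIIC => 5
  | MIID => 23
  | MIIE => 8
  | MIIF => 9
  | MIIG => 7
  | MIII => 14

/-- The number of generators in the presentations of the family. -/
def rank : Family → ℕ
  | MIII => 4
  | _ => 3

/-- The groups of the family have exponent `2 ^ (m - coexp)`. -/
def coexp : Family → ℕ
  | NII => 2
  | _ => 3

/-- The smallest value of `m` that is considered. -/
def minM : Family → ℕ
  | NII => 6
  | _ => 7

/-- The class to which the family belongs. -/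
def InClass (m : ℕ) (G : Type*) [Group G] : Family → Prop
  | NII => ClassNII m G
  | MIII => ClassMIII m G
  | _ => ClassMII m G

/-- The relators of the `n`-th group of the family, of intended order `2 ^ m`. -/
def relators (m n : ℕ) : (F : Family) → Set (FreeGroup (Fin F.rank))
  | NII => presNII m n
  | MIIA => presMIIA m n
  | MIIB => presMIIB m n
  | MIIC => presMIIC m n
  | MIID => presMIID m n
  | MIIE => presMIIE m n
  | MIIF => presMIIF m n
  | MIIG => presMIIG m n
  | MIII => presMIII m n

end Family

/-- The `n`-th group of the family `F`, of intended order `2 ^ m`. -/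
abbrev Grp (F : Family) (n m : ℕ) : Type := PresentedGroup (F.relators m n)

instance instFGPresentedGroup {α : Type*} [Finite α] (rels : Set (FreeGroup α)) :
    Group.FG (PresentedGroup rels) :=
  inferInstanceAs (Group.FG (FreeGroup α ⧸ Subgroup.normalClosure rels))

open Family in
/-- The part of `Γ` that lies in the class `ClassNII`. -/
def gammaNII : Finset (Family × ℕ) := {(NII, 3), (NII, 4), (NII, 5)}

open Family in
/-- The part of `Γ` that lies in the class `ClassMII`. -/
def gammaMII : Finset (Family × ℕ) :=
  {(MIIA, 39), (MIIA, 40), (MIIB, 19), (MIIB, 20), (MIIC, 5), (MIID, 3), (MIID, 17), (MIID, 18),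
    (MIID, 19), (MIIE, 1), (MIIF, 8), (MIIF, 9)}

open Family in
/-- The part of `Γ` that lies in the class `ClassMIII`. -/
def gammaMIII : Finset (Family × ℕ) :=
  {(MIII, 3), (MIII, 4), (MIII, 5), (MIII, 10), (MIII, 11), (MIII, 13), (MIII, 14)}

/-- The set `Γ` of (names of) groups. -/
def gamma : Finset (Family × ℕ) := gammaNII ∪ gammaMII ∪ gammaMIII

end TwoGroups

/-! Write `p` for the first generator. Its order is `2 ^ (n + 4)`, where `m = n + 6` for the family
`NII` and `m = n + 7` otherwise; let `z = p ^ 2 ^ (n + 3)` be the involution in `⟨p⟩`. A computation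
that is uniform in `n` deals with the listed groups, and a structural argument deals with arbitrary
groups in the classes.

Computation. A listed group is built from `⟨p⟩` by extensions of degree 2, so its order is at most
`J * 2 ^ (n + 4)` with `J = 4` or `J = 8` (`card_closure_insert_le`). If its elements are written as
`p ^ a * tr j`, then right multiplication by a generator permutes the indices `j` and shifts `a` by
an amount that depends only on `j`. These shifts have the form `a + b * 2 ^ (n + 2)` with integers
`a, b` that do not depend on `n`, so one small table describes the regular representation for all
`n`. When the table satisfies the relations, the group acts transitively on `J * 2 ^ (n + 4)`
points, hence regularly (`Realizes.pt_bijective`), and identities can be read off the table. Since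
`p ^ 4` translates every fibre by `4` or `-4`, an element `p ^ (4 * s) * w` depends on `s` in a
controlled way, and tests of `4 * J` words cover the whole group (`Realizes.exists_rep`,
`Realizes.pt_pow`). This yields the sign homomorphisms that kill all involutions outside `gamma`,
and inside `gamma` the exponents, the ranks and the invariants that separate the groups.

Structure. Let `G` in one of the classes be generated by involutions. The centralizer of `p ^ 2 ^ (n
+ 2)` has index at most 2, and it contains a subgroup `H` of index 2 in `G` with `p ∈ H`. On `H` the
map `x ↦ x ^ 2 ^ (n + 3)` is a homomorphism to `⟨z⟩` (`IsTower.pow_half_mul`). It extends to `G`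
with value 1 at an involution `t` outside `H`. Its kernel is proper and so misses an involution `s`,
and then `t * s` is an element of `H` of maximal order that `t` inverts (`IsTower.exists_dihedral`).
Hence `p` may be assumed to be inverted by `t`. If all squares lie in `⟨p⟩`, then `H` is generated
by `p` and one or two involutions, and all remaining commutators lie in `⟨z⟩`. In the class
`ClassMII`, three elements generate `G`, and counting sign homomorphisms gives an involution `s`
with `G = ⟨s, t, p⟩` (`exists_sq_eq_one_of_closure`). Let `w` be `s` or `t * s`, whichever lies in
`H`; the cases are whether `w = s` and whether `w` normalizes `⟨p⟩`. Each case ends in a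
presentation `Std` with Boolean parameters.

Conclusion. A group with a presentation `Std` has bounded order, and two groups that attain the
bound for the same presentation are isomorphic (`IsStd.nonempty_mulEquiv`). The tables identify
every such presentation with a group in `gamma` (`Std.check_eq_true`), and every group in `gamma`
occurs. Groups with these presentations are generated by involutions because `p = t * (t * p)`. -/

namespace TwoGroups

/-! ### Permutations of `A × ι` that translate each fibre -/

/-- The map `(a, j) ↦ (a + sh j, idx j)` of `A × ι`. -/
@[ext]
structure Mono (ι A : Type*) where
  idx : ι → ι
  sh : ι → A

namespace Mono

variable {ι A B : Type*}

/-- The left factor acts first, so products act from the right. This fits right multiplication on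
elements `p ^ a * tr j`, which commutes with left multiplication by `p` and therefore only
translates fibres. -/
instance [AddMonoid A] : Monoid (Mono ι A) where
  one := ⟨id, fun _ => 0⟩
  mul f g := { idx := fun j => g.idx (f.idx j), sh := fun j => f.sh j + g.sh (f.idx j) }
  mul_assoc _ _ _ :=
     Mono.ext rfl (funext fun j => add_assoc _ _ _)
  one_mul _ := Mono.ext rfl (funext fun j => zero_add _)
  mul_one _ := Mono.ext rfl (funext fun j => add_zero _)

theorem one_idx [AddMonoid A] (j : ι) : (1 : Mono ι A).idx j = j := rfl

theorem one_sh [AddMonoid A] (j : ι) : (1 : Mono ι A).sh j = 0 := rfl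

theorem mul_idx [AddMonoid A] (f g : Mono ι A) (j : ι) : (f * g).idx j = g.idx (f.idx j) := rfl

theorem mul_sh [AddMonoid A] (f g : Mono ι A) (j : ι) :
    (f * g).sh j = f.sh j + g.sh (f.idx j) := rfl

/-- The map that translates the fibres by `s`. -/
def diag (s : ι → A) : Mono ι A := ⟨id, s⟩

theorem diag_mul_diag [AddMonoid A] (s t : ι → A) : diag s * diag t = diag (s + t) := rfl

theorem diag_zero [AddMonoid A] : (diag 0 : Mono ι A) = 1 := rfl

theorem diag_pow [AddMonoid A] (s : ι → A) (n : ℕ) : diag s ^ n = diag (n • s) := by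
  induction n with
  | zero => simp [diag_zero]
  | succ n ih => rw [pow_succ, ih, diag_mul_diag, succ_nsmul]

/-- Change of the group of translations. -/
def map [AddMonoid A] [AddMonoid B] (φ : A →+ B) : Mono ι A →* Mono ι B where
  toFun f := ⟨f.idx, fun j => φ (f.sh j)⟩
  map_one' := Mono.ext rfl (funext fun _ => φ.map_zero)
  map_mul' _ _ := Mono.ext rfl (funext fun _ => φ.map_add _ _)

end Mono

/-- The value of the symbolic translation `(a, b)`, which is `a + b * 2 ^ (n + 2)`. -/
def symVal (n : ℕ) : ℤ × ℤ →+ ZMod (2 ^ (n + 4)) where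
  toFun x := (x.1 : ZMod (2 ^ (n + 4))) + x.2 * 2 ^ (n + 2)
  map_zero' := by simp
  map_add' x y := by simp; ring

theorem symVal_apply (n : ℕ) (a b : ℤ) :
    symVal n (a, b) = ((a + b * 2 ^ (n + 2) : ℤ) : ZMod (2 ^ (n + 4))) := by
  simp [symVal]

theorem symVal_eq_zero_iff {n : ℕ} (a b : ℤ) :
    symVal n (a, b) = 0 ↔ (2 : ℤ) ^ (n + 4) ∣ a + b * 2 ^ (n + 2) := by
  rw [symVal_apply, ZMod.intCast_zmod_eq_zero_iff_dvd]
  norm_cast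

theorem symVal_congr {n : ℕ} {a b b' : ℤ} (h : (b - b') % 4 = 0) :
    symVal n (a, b) = symVal n (a, b') := by
  rw [← sub_eq_zero, ← map_sub, Prod.mk_sub_mk, symVal_eq_zero_iff]
  obtain ⟨c, hc⟩ := Int.dvd_of_emod_eq_zero h
  exact ⟨c, by rw [hc]; ring⟩

/-- A sufficient criterion for `4 * s * c + a + b * 2 ^ (n + 2)` to be nonzero modulo `2 ^ (n + 4)`
for all `s`, where `c` is even. -/
def nonzeroTest (c a b : ℤ) : Bool :=
  a % 4 != 0 || (if c = 0 then a == 0 && b % 4 != 0 else a % 8 != 0 && b % 2 == 0)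

/-- Modulo 4 only `a` survives. If `4 ∣ a` and `c ≠ 0`, then `c` and `b` being even makes every term
except `a` divisible by 8. If `c = 0` and `a = 0`, only `b * 2 ^ (n + 2)` is left. -/
theorem symVal_ne_zero_of_nonzeroTest {n : ℕ} {c a b : ℤ} (s : ℤ) (hc : c % 2 = 0)
    (h : nonzeroTest c a b = true) : symVal n (4 * s * c + a, b) ≠ 0 := by
  rw [Ne, symVal_eq_zero_iff]
  obtain ⟨c, rfl⟩ := Int.dvd_of_emod_eq_zero hc
  rw [pow_add, pow_add]
  rintro ⟨d, hd⟩
  simp only [nonzeroTest, Bool.or_eq_true, bne_iff_ne, ne_eq] at h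
  rcases h with h | h
  · apply h
    apply Int.emod_eq_zero_of_dvd
    exact ⟨4 * 2 ^ n * d - b * 2 ^ n - s * (2 * c), by linear_combination hd⟩
  · split_ifs at h with hc0
    · simp only [Bool.and_eq_true, beq_iff_eq, bne_iff_ne, ne_eq] at h
      apply h.2
      apply Int.emod_eq_zero_of_dvd
      refine ⟨d, ?_⟩
      have : (4 * 2 ^ n) * b = (4 * 2 ^ n) * (4 * d) := by
        rw [hc0, h.1] at hd
        linear_combination hd
      exact mul_left_cancel₀ (by positivity) this
    · simp only [Bool.and_eq_true, beq_iff_eq, bne_iff_ne, ne_eq] at h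
      obtain ⟨b, rfl⟩ := Int.dvd_of_emod_eq_zero h.2
      apply h.1
      apply Int.emod_eq_zero_of_dvd
      exact ⟨2 * 2 ^ n * d - b * 2 ^ n - s * c, by linear_combination hd⟩

/-! ### Symbolic tables

A table is a list of natural numbers, one for each generator.  The number encodes a map of
`(ℤ × ℤ) × Fin J` that translates the fibres: the `j`-th digit to the base `512` gives the index
of the target fibre and the translation. -/

section Table

variable (J : ℕ) [NeZero J]

/-- The map with the given code. -/
def ofCode (c : ℕ) : Mono (Fin J) (ℤ × ℤ) where
  idx j := Fin.ofNat J (c / 512 ^ j.val % 8)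
  sh j := (((c / 512 ^ j.val / 8 % 16 : ℕ) : ℤ) - 8, ((c / 512 ^ j.val / 128 % 4 : ℕ) : ℤ))

variable {J}

/-- The inverse map. -/
def Mono.symm (f : Mono (Fin J) (ℤ × ℤ)) : Mono (Fin J) (ℤ × ℤ) :=
  -- The default value is harmless, because `isModel` verifies that the result is a two-sided
  -- inverse.
  let inv : Fin J → Fin J := fun j => ((List.finRange J).find? fun i => f.idx i == j).getD 0
  ⟨inv, fun j => (-(f.sh (inv j)).1, -(f.sh (inv j)).2)⟩

/-- Equality of symbolic maps, where `4 * 2 ^ (n + 2)` counts as zero. -/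
def Mono.eqv (f g : Mono (Fin J) (ℤ × ℤ)) : Bool :=
  (List.finRange J).all fun j =>
    f.idx j == g.idx j && (f.sh j).1 == (g.sh j).1 && ((f.sh j).2 - (g.sh j).2) % 4 == 0

theorem Mono.map_eq_of_eqv {I : ℕ} (n : ℕ) {f g : Mono (Fin I) (ℤ × ℤ)}
    (h : f.eqv g = true) : Mono.map (symVal n) f = Mono.map (symVal n) g := by
  simp only [Mono.eqv, List.all_eq_true, List.mem_finRange, true_implies, Bool.and_eq_true,
    beq_iff_eq] at h
  refine Mono.ext (funext fun j => (h j).1.1) (funext fun j => ?_)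
  change symVal n ((f.sh j).1, (f.sh j).2) = symVal n ((g.sh j).1, (g.sh j).2)
  rw [(h j).1.2]
  exact symVal_congr (h j).2

variable (J) (T : List ℕ)

/-- The `i`-th generator of a table. -/
def gen (i : ℕ) : Mono (Fin J) (ℤ × ℤ) :=
  match T[i]? with
  | some c => ofCode J c
  | none => 1

/-- The inverse of the `i`-th generator of a table. -/
def genInv (i : ℕ) : Mono (Fin J) (ℤ × ℤ) :=
  match T[i]? with
  | some c => (ofCode J c).symm
  | none => 1

/-- The fourth power of the generator `0` translates the fibre `j` by `4 * sgn j`. -/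
def sgn (j : Fin J) : ℤ := ((gen J T 0 ^ 4).sh j).1 / 4

/-- The power of the generator `0` with the exponent `2 ^ (n + 2) * e`. -/
def quarter (e : ℤ) : Mono (Fin J) (ℤ × ℤ) := Mono.diag fun j => (0, e * sgn J T j)

/-- The `n`-th power of the letter `i`, where the letter `4` is a power of the generator `0`. -/
def letter (i : ℕ) (n : ℤ) : Mono (Fin J) (ℤ × ℤ) :=
  if i = 4 then quarter J T n else
    match n with
    | Int.ofNat n => gen J T i ^ n
    | Int.negSucc n => genInv J T i ^ (n + 1)

/-- The symbolic value of a word. -/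
def symEval (w : List (ℕ × ℤ)) : Mono (Fin J) (ℤ × ℤ) :=
  w.foldr (fun x f => letter J T x.1 x.2 * f) 1

/-- The table describes permutations, and the fourth power of the generator `0` translates the
fibres by `± 4`; it translates the fibre `0` by `1`. -/
def isModel : Bool :=
  ((List.range T.length).all fun i =>
    (gen J T i * genInv J T i).eqv 1 && (genInv J T i * gen J T i).eqv 1) &&
  (gen J T 0).idx 0 == 0 && (gen J T 0).sh 0 == (1, 0) &&
  (gen J T 0 ^ 4).eqv (Mono.diag fun j => (4 * sgn J T j, 0)) &&
  ((List.finRange J).all fun j => sgn J T j == 1 || sgn J T j == -1)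

end Table

/-- The value of a word in a group. -/
def wordEval {H : Type*} [Group H] (v : ℕ → H) (w : List (ℕ × ℤ)) : H :=
  (w.map fun x => v x.1 ^ x.2).prod

theorem map_wordEval {H H' : Type*} [Group H] [Group H'] (f : H →* H') (v : ℕ → H)
    (w : List (ℕ × ℤ)) : f (wordEval v w) = wordEval (fun i => f (v i)) w := by
  simp [wordEval, map_list_prod, Function.comp_def]

theorem wordEval_append {H : Type*} [Group H] (v : ℕ → H) (w w' : List (ℕ × ℤ)) :
    wordEval v (w ++ w') = wordEval v w * wordEval v w' := by
  simp [wordEval]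

theorem wordEval_cons {H : Type*} [Group H] (v : ℕ → H) (x : ℕ × ℤ) (w : List (ℕ × ℤ)) :
    wordEval v (x :: w) = v x.1 ^ x.2 * wordEval v w := by
  simp [wordEval]

section Table

variable {J : ℕ} [NeZero J] {T : List ℕ}

theorem isModel_iff : isModel J T = true ↔
    (∀ i < T.length, (gen J T i * genInv J T i).eqv 1 = true ∧
      (genInv J T i * gen J T i).eqv 1 = true) ∧
    ((gen J T 0).idx 0 = 0 ∧ (gen J T 0).sh 0 = (1, 0)) ∧
    (gen J T 0 ^ 4).eqv (Mono.diag fun j => (4 * sgn J T j, 0)) = true ∧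
    ∀ j, sgn J T j = 1 ∨ sgn J T j = -1 := by
  simp [isModel, and_assoc]

theorem gen_mul_genInv (hT : isModel J T = true) (i : ℕ) :
    (gen J T i * genInv J T i).eqv 1 = true ∧ (genInv J T i * gen J T i).eqv 1 = true := by
  rcases lt_or_ge i T.length with hi | hi
  · exact (isModel_iff.1 hT).1 i hi
  · have h : ∀ f : Mono (Fin J) (ℤ × ℤ), f.eqv f = true := fun f => by simp [Mono.eqv]
    simp [gen, genInv, List.getElem?_eq_none hi, h]

/-- The `i`-th generator of a table as a permutation of `ZMod (2 ^ (n + 4)) × Fin J`. -/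
def genUnit (n : ℕ) (hT : isModel J T = true) (i : ℕ) :
    (Mono (Fin J) (ZMod (2 ^ (n + 4))))ˣ where
  val := Mono.map (symVal n) (gen J T i)
  inv := Mono.map (symVal n) (genInv J T i)
  val_inv := by
    rw [← map_mul, Mono.map_eq_of_eqv n (gen_mul_genInv hT i).1, map_one]
  inv_val := by
    rw [← map_mul, Mono.map_eq_of_eqv n (gen_mul_genInv hT i).2, map_one]

/-- The letters of words as permutations of `ZMod (2 ^ (n + 4)) × Fin J`. -/
def letterUnit (n : ℕ) (hT : isModel J T = true) (i : ℕ) :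
    (Mono (Fin J) (ZMod (2 ^ (n + 4))))ˣ :=
  if i = 4 then genUnit n hT 0 ^ 2 ^ (n + 2) else genUnit n hT i

theorem Mono.val_zpow_eq_diag {ι A : Type*} [AddCommGroup A] {u : (Mono ι A)ˣ} {s : ι → A}
    (h : (u : Mono ι A) = Mono.diag s) (z : ℤ) : ((u ^ z : (Mono ι A)ˣ) : Mono ι A) =
      Mono.diag (z • s) := by
  obtain ⟨e, rfl | rfl⟩ := z.eq_nat_or_neg
  · rw [zpow_natCast, Units.val_pow_eq_pow_val, h, Mono.diag_pow, natCast_zsmul]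
  · rw [zpow_neg, zpow_natCast]
    apply Units.inv_eq_of_mul_eq_one_right
    rw [Units.val_pow_eq_pow_val, h, Mono.diag_pow, Mono.diag_mul_diag, neg_smul, natCast_zsmul,
      add_neg_cancel, Mono.diag_zero]

variable (n : ℕ) (hT : isModel J T = true)

/-- Arbitrary powers of `p ^ 4` are explicit translations. This is what lets a finite table control
exponents of unbounded size. -/
theorem val_zpow_letterUnit_zero (s : ℤ) :
    ((letterUnit n hT 0 ^ (4 * s) : (Mono (Fin J) (ZMod (2 ^ (n + 4))))ˣ) :
      Mono (Fin J) (ZMod (2 ^ (n + 4)))) =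
    Mono.diag fun j => ((4 * s * sgn J T j : ℤ) : ZMod (2 ^ (n + 4))) := by
  have h4 : ((letterUnit n hT 0 ^ 4 : (Mono (Fin J) (ZMod (2 ^ (n + 4))))ˣ) :
      Mono (Fin J) (ZMod (2 ^ (n + 4)))) =
      Mono.diag fun j => ((4 * sgn J T j : ℤ) : ZMod (2 ^ (n + 4))) := by
    rw [Units.val_pow_eq_pow_val]
    change (Mono.map (symVal n) (gen J T 0)) ^ 4 = _
    rw [← map_pow, Mono.map_eq_of_eqv n (isModel_iff.1 hT).2.2.1]
    refine Mono.ext rfl (funext fun j => ?_)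
    change symVal n (_, _) = _
    simp [symVal_apply, Mono.diag]
  rw [zpow_mul, ← zpow_natCast] at *
  rw [show (4 : ℤ) = (4 : ℕ) from rfl, Mono.val_zpow_eq_diag h4]
  congr 1
  funext j
  simp
  ring

theorem letterUnit_four_eq : letterUnit n hT 4 = letterUnit n hT 0 ^ 2 ^ (n + 2) := rfl

theorem val_letterUnit_zpow (i : ℕ) (e : ℤ) :
    ((letterUnit n hT i ^ e : (Mono (Fin J) (ZMod (2 ^ (n + 4))))ˣ) :
      Mono (Fin J) (ZMod (2 ^ (n + 4)))) = Mono.map (symVal n) (letter J T i e) := by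
  by_cases hi : i = 4
  · subst hi
    -- Since `2 ^ (n + 2) = 4 * 2 ^ n`, the letter `4` is a power of `p ^ 4`, and the signs of the
    -- fibres determine its action.
    rw [letterUnit_four_eq, ← zpow_natCast, ← zpow_mul,
      show ((2 ^ (n + 2) : ℕ) : ℤ) * e = 4 * (2 ^ n * e) by push_cast; ring,
      val_zpow_letterUnit_zero]
    refine Mono.ext rfl (funext fun j => ?_)
    change ((_ : ℤ) : ZMod (2 ^ (n + 4))) = symVal n (0, _)
    rw [symVal_apply]
    congr 1
    ring
  · rw [letterUnit, if_neg hi]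
    cases e with
    | ofNat e =>
      simp only [letter, if_neg hi, map_pow]
      rw [Int.ofNat_eq_natCast, zpow_natCast, Units.val_pow_eq_pow_val]
      rfl
    | negSucc e =>
      simp only [letter, if_neg hi, map_pow]
      rw [zpow_negSucc, ← inv_pow, Units.val_pow_eq_pow_val]
      rfl

theorem val_wordEval_letterUnit (w : List (ℕ × ℤ)) :
    ((wordEval (letterUnit n hT) w : (Mono (Fin J) (ZMod (2 ^ (n + 4))))ˣ) :
      Mono (Fin J) (ZMod (2 ^ (n + 4)))) = Mono.map (symVal n) (symEval J T w) := by
  induction w with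
  | nil => simp [wordEval, symEval]
  | cons x w ih => rw [wordEval_cons, Units.val_mul, ih, val_letterUnit_zpow, ← map_mul]; rfl

/-- The hypothesis does not mention `n`: one symbolic comparison proves the equation for every `n`.
-/
theorem wordEval_letterUnit_eq {w w' : List (ℕ × ℤ)}
    (h : (symEval J T w).eqv (symEval J T w') = true) :
    wordEval (letterUnit n hT) w = wordEval (letterUnit n hT) w' := by
  rw [← Units.val_inj, val_wordEval_letterUnit, val_wordEval_letterUnit, Mono.map_eq_of_eqv n h]

end Table

/-! ### Bounds for the order of a group given by generators and relations -/

/-- The products `g ^ i * h` with `i < d` and `h` in `⟨S⟩` form a subgroup: conjugation by `g` moves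
the powers of `g` to the left, and `g ^ d` is absorbed into `⟨S⟩`. -/
theorem card_closure_insert_le {G : Type*} [Group G] {S : Set G} {g : G} {d c : ℕ} (hd : 0 < d)
    (hS : Finite (Subgroup.closure S)) (hc : Nat.card (Subgroup.closure S) ≤ c)
    (hconj : ∀ s ∈ S, g⁻¹ * s * g ∈ Subgroup.closure S) (hg : g ^ d ∈ Subgroup.closure S) :
    Finite (Subgroup.closure (insert g S)) ∧ Nat.card (Subgroup.closure (insert g S)) ≤ d * c := by
  set H := Subgroup.closure S with hH
  have hconj' : ∀ h ∈ H, g⁻¹ * h * g ∈ H := by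
    intro h hh
    have : H ≤ H.comap (MulAut.conj g⁻¹).toMonoidHom := by
      rw [hH, Subgroup.closure_le]
      intro s hs
      simpa using hconj s hs
    simpa using this hh
  have hpow : ∀ (i : ℕ), ∀ h ∈ H, (g ^ i)⁻¹ * h * g ^ i ∈ H := by
    intro i
    induction i with
    | zero => simp
    | succ i ih =>
      intro h hh
      have := hconj' _ (ih h hh)
      simpa [pow_succ, mul_assoc] using this
  let f : Fin d × H → G := fun x => g ^ x.1.val * x.2
  have hf1 : ∀ (i : ℕ) (h : H), ∃ x, f x = g ^ i * h := by
    intro i h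
    refine ⟨(⟨i % d, Nat.mod_lt _ hd⟩, ⟨(g ^ d) ^ (i / d) * h, H.mul_mem (H.pow_mem hg _) h.2⟩), ?_⟩
    change g ^ (i % d) * ((g ^ d) ^ (i / d) * h) = _
    rw [← mul_assoc, ← pow_mul, ← pow_add, Nat.mod_add_div]
  have hmul : ∀ x y, ∃ z, f z = f x * f y := by
    intro x y
    obtain ⟨z, hz⟩ := hf1 (x.1 + y.1) ⟨_, H.mul_mem (hpow y.1 _ x.2.2) y.2.2⟩
    refine ⟨z, hz.trans ?_⟩
    simp only [f, pow_add]
    group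
  have hinv : ∀ i : ℕ, (g ^ i)⁻¹ ∈ Set.range f := by
    intro i
    -- The inverse is written with a nonnegative power, `g ^ (d * i - i) * (g ^ d) ^ (-i)`, so that
    -- conjugation by `g` is needed in one direction only.
    obtain ⟨z, hz⟩ := hf1 (d * i - i) ⟨((g ^ d) ^ i)⁻¹, H.inv_mem (H.pow_mem hg _)⟩
    refine ⟨z, hz.trans ?_⟩
    have : i ≤ d * i := Nat.le_mul_of_pos_left _ hd
    simp only
    have hcomm : Commute (g ^ (d * i)) (g ^ i)⁻¹ := ((Commute.refl g).pow_pow _ _).inv_right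
    rw [← pow_mul, pow_sub _ this, hcomm.eq, mul_assoc, mul_inv_cancel, mul_one]
  let K : Subgroup G :=
    { carrier := Set.range f
      mul_mem' := by
        rintro _ _ ⟨x, rfl⟩ ⟨y, rfl⟩
        exact hmul x y
      one_mem' := by simpa using hf1 0 1
      inv_mem' := by
        rintro _ ⟨x, rfl⟩
        obtain ⟨y, hy⟩ := hinv x.1
        obtain ⟨z, hz⟩ := hf1 0 x.2⁻¹
        obtain ⟨w, hw⟩ := hmul z y
        refine ⟨w, ?_⟩
        rw [hw, hz, hy]
        simp [f] }
  have hK : Subgroup.closure (insert g S) ≤ K := by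
    rw [Subgroup.closure_le]
    intro s hs
    rcases hs with rfl | hs
    · obtain ⟨x, hx⟩ := hf1 1 1
      exact ⟨x, by rw [hx]; simp⟩
    · obtain ⟨x, hx⟩ := hf1 0 ⟨s, Subgroup.subset_closure hs⟩
      exact ⟨x, by rw [hx]; simp⟩
  have : Finite (Set.range f) := Set.finite_range f
  have hKf : Finite K := this
  refine ⟨Finite.Set.subset (K : Set G) hK, ?_⟩
  calc Nat.card (Subgroup.closure (insert g S)) ≤ Nat.card K :=
        Nat.card_le_card_of_injective _ (Subgroup.inclusion_injective hK)
    _ ≤ Nat.card (Fin d × H) := Finite.card_range_le f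
    _ ≤ d * c := by
      rw [Nat.card_prod, Nat.card_eq_fintype_card, Fintype.card_fin]
      exact Nat.mul_le_mul_left _ hc

theorem card_closure_singleton_le {G : Type*} [Group G] {p : G} {N : ℕ} (hN : 0 < N)
    (hp : p ^ N = 1) : Finite (Subgroup.closure ({p} : Set G)) ∧
      Nat.card (Subgroup.closure ({p} : Set G)) ≤ N := by
  rw [← Subgroup.zpowers_eq_closure]
  have h : IsOfFinOrder p := isOfFinOrder_iff_pow_eq_one.2 ⟨N, hN, hp⟩
  refine ⟨finite_zpowers.2 h, ?_⟩
  rw [Nat.card_zpowers]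
  exact orderOf_le_of_pow_eq_one hN hp

theorem finite_of_closure_eq_top {G : Type*} [Group G] {S : Set G} {c : ℕ}
    (hS : Subgroup.closure S = ⊤)
    (h : Finite (Subgroup.closure S) ∧ Nat.card (Subgroup.closure S) ≤ c) :
    Finite G ∧ Nat.card G ≤ c := by
  rw [hS] at h
  refine ⟨?_, ?_⟩
  · have := h.1
    exact Finite.of_equiv _ (Subgroup.topEquiv (G := G)).toEquiv
  · rw [← Nat.card_congr (Subgroup.topEquiv (G := G)).toEquiv]
    exact h.2

open Subgroup in
/-- A bound for a group that is built from the cyclic group `⟨p⟩` by three extensions of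
degree 2. -/
theorem card_le_of_extensions {G : Type*} [Group G] {p a q r : G} {N : ℕ} (hN : 0 < N)
    (htop : closure {r, q, a, p} = ⊤) (hp : p ^ N = 1)
    (ha : a ^ 2 ∈ closure {p}) (hap : a⁻¹ * p * a ∈ closure {p})
    (hq : q ^ 2 ∈ closure {a, p}) (hqp : q⁻¹ * p * q ∈ closure {a, p})
    (hqa : q⁻¹ * a * q ∈ closure {a, p})
    (hr : r ^ 2 ∈ closure {q, a, p}) (hrp : r⁻¹ * p * r ∈ closure {q, a, p})
    (hra : r⁻¹ * a * r ∈ closure {q, a, p}) (hrq : r⁻¹ * q * r ∈ closure {q, a, p}) :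
    Finite G ∧ Nat.card G ≤ 8 * N := by
  have h1 := card_closure_singleton_le hN hp
  have h2 := card_closure_insert_le two_pos h1.1 h1.2 (by simpa using hap) ha
  have h3 := card_closure_insert_le two_pos h2.1 h2.2 (by simpa using ⟨hqa, hqp⟩) hq
  have h4 := card_closure_insert_le two_pos h3.1 h3.2 (by simpa using ⟨hrq, hra, hrp⟩) hr
  have := finite_of_closure_eq_top htop h4
  exact ⟨this.1, by linarith [this.2]⟩

open Subgroup in
/-- A bound for a group that is built from the cyclic group `⟨p⟩` by two extensions of
degree 2. -/
theorem card_le_of_two_extensions {G : Type*} [Group G] {p q r : G} {N : ℕ} (hN : 0 < N)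
    (htop : closure {r, q, p} = ⊤) (hp : p ^ N = 1)
    (hq : q ^ 2 ∈ closure {p}) (hqp : q⁻¹ * p * q ∈ closure {p})
    (hr : r ^ 2 ∈ closure {q, p}) (hrp : r⁻¹ * p * r ∈ closure {q, p})
    (hrq : r⁻¹ * q * r ∈ closure {q, p}) :
    Finite G ∧ Nat.card G ≤ 4 * N := by
  have h1 := card_closure_singleton_le hN hp
  have h2 := card_closure_insert_le two_pos h1.1 h1.2 (by simpa using hqp) hq
  have h3 := card_closure_insert_le two_pos h2.1 h2.2 (by simpa using ⟨hrq, hrp⟩) hr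
  have := finite_of_closure_eq_top htop h3
  exact ⟨this.1, by linarith [this.2]⟩

/-! ### Groups that act regularly through a table -/

section Table

variable (J : ℕ) [NeZero J] (T : List ℕ)

/-- The words `tr j` lead from the base point to the base points of the fibres. -/
def isTransversal (tr : ℕ → List (ℕ × ℤ)) : Bool :=
  (List.finRange J).all fun j =>
    (symEval J T (tr j.val)).idx 0 == j && (symEval J T (tr j.val)).sh 0 == (0, 0)

/-- Two words agree on the base point. -/
def agree (w w' : List (ℕ × ℤ)) : Bool :=
  let f := symEval J T w
  let g := symEval J T w'
  f.idx 0 == g.idx 0 && (f.sh 0).1 == (g.sh 0).1 && ((f.sh 0).2 - (g.sh 0).2) % 4 == 0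

/-- The fibre, the translation and the sum of the signs on the path of the `e`-th power of an
element `x ^ (4 * s) * w`, where `x` is the generator `0`. -/
def powerPath (w : List (ℕ × ℤ)) : ℕ → Fin J × (ℤ × ℤ) × ℤ
  | 0 => (0, (0, 0), 0)
  | e + 1 =>
    let t := powerPath w e
    -- The factor `x ^ (4 * s)` acts before `w`, in the fibre `t.1`, and adds `4 * s` times the sign
    -- of that fibre.
    ((symEval J T w).idx t.1, t.2.1 + (symEval J T w).sh t.1, t.2.2 + sgn J T t.1)

/-- A test for all elements `x ^ (4 * s) * w`, where `x` is the generator `0` and `w` runs through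
representatives. -/
def allReps (tr : ℕ → List (ℕ × ℤ)) (test : List (ℕ × ℤ) → Bool) : Bool :=
  (List.range 4).all fun r => (List.range J).all fun j => test ((0, (r : ℤ)) :: tr j)

/-- The elements `x ^ (4 * s) * w` are not involutions. -/
def notInvolution (w : List (ℕ × ℤ)) : Bool :=
  let t := powerPath J T w 2
  t.1 != 0 || (t.2.2 % 2 == 0 && nonzeroTest t.2.2 t.2.1.1 t.2.1.2)

end Table

/-- A group of order at most `J * 2 ^ (n + 4)` with elements that act like the generators of a
table. -/
structure Realizes (n J : ℕ) [NeZero J] (T : List ℕ) (tr : ℕ → List (ℕ × ℤ)) {H : Type*} [Group H]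
    (x : ℕ → H) : Prop where
  finite : Finite H
  card_le : Nat.card H ≤ J * 2 ^ (n + 4)
  model : isModel J T = true
  trans : isTransversal J T tr = true
  hom : ∃ ρ : H →* (Mono (Fin J) (ZMod (2 ^ (n + 4))))ˣ, ∀ i, ρ (x i) = letterUnit n model i

namespace Realizes

variable {n J : ℕ} [NeZero J] {T : List ℕ} {tr : ℕ → List (ℕ × ℤ)} {H : Type*} [Group H]
  {x : ℕ → H}

/-- The homomorphism to the permutations of `ZMod (2 ^ (n + 4)) × Fin J`. -/
noncomputable def rho (R : Realizes n J T tr x) : H →* (Mono (Fin J) (ZMod (2 ^ (n + 4))))ˣ :=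
  R.hom.choose

theorem rho_apply (R : Realizes n J T tr x) (i : ℕ) : R.rho (x i) = letterUnit n R.model i :=
  R.hom.choose_spec i

/-- The action on `ZMod (2 ^ (n + 4)) × Fin J` from the right. -/
noncomputable def act (R : Realizes n J T tr x) (h : H) (a : ZMod (2 ^ (n + 4)) × Fin J) :
    ZMod (2 ^ (n + 4)) × Fin J :=
  (a.1 + (R.rho h).val.sh a.2, (R.rho h).val.idx a.2)

theorem act_mul (R : Realizes n J T tr x) (g h : H) (a : ZMod (2 ^ (n + 4)) × Fin J) :
    R.act (g * h) a = R.act h (R.act g a) := by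
  simp [act, Mono.mul_idx, Mono.mul_sh, add_assoc]

theorem act_one (R : Realizes n J T tr x) (a : ZMod (2 ^ (n + 4)) × Fin J) : R.act 1 a = a := by
  simp [act, Mono.one_idx, Mono.one_sh]

theorem act_word (R : Realizes n J T tr x) (w : List (ℕ × ℤ)) (a : ZMod (2 ^ (n + 4)) × Fin J) :
    R.act (wordEval x w) a =
      (a.1 + symVal n ((symEval J T w).sh a.2), (symEval J T w).idx a.2) := by
  simp only [act]
  rw [map_wordEval, show (fun i => R.rho (x i)) = letterUnit n R.model from funext R.rho_apply,
    val_wordEval_letterUnit]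
  rfl

theorem act_zpow (R : Realizes n J T tr x) (s : ℤ) (a : ZMod (2 ^ (n + 4)) × Fin J) :
    R.act (x 0 ^ (4 * s)) a =
      (a.1 + ((4 * s * sgn J T a.2 : ℤ) : ZMod (2 ^ (n + 4))), a.2) := by
  simp only [act]
  rw [map_zpow, rho_apply, val_zpow_letterUnit_zero]
  rfl

theorem act_pow_zero (R : Realizes n J T tr x) (e : ℕ) (a : ZMod (2 ^ (n + 4))) :
    R.act (x 0 ^ e) (a, 0) = (a + e, 0) := by
  induction e with
  | zero => simp [act_one]
  | succ e ih =>
    have h := (isModel_iff.1 R.model).2.1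
    have h2 : x 0 = wordEval x [(0, 1)] := by simp [wordEval]
    have h3 : symEval J T [(0, 1)] = gen J T 0 := by
      change letter J T 0 1 * 1 = _
      rw [mul_one]
      exact pow_one _
    rw [pow_succ (x 0), act_mul, ih]
    conv_lhs => rw [h2]
    rw [act_word, h3, h.1, h.2, symVal_apply]
    simp [add_assoc]

theorem act_zpow_zero (R : Realizes n J T tr x) (e : ℤ) (a : ZMod (2 ^ (n + 4))) :
    R.act (x 0 ^ e) (a, 0) = (a + e, 0) := by
  obtain ⟨e, rfl | rfl⟩ := e.eq_nat_or_neg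
  · rw [zpow_natCast, act_pow_zero]
    simp
  · have h := R.act_pow_zero e (a + (-e : ℤ))
    rw [show a + ((-e : ℤ) : ZMod (2 ^ (n + 4))) + (e : ZMod (2 ^ (n + 4))) = a by simp] at h
    conv_lhs => rw [← h]
    rw [← act_mul, zpow_neg, zpow_natCast, mul_inv_cancel, act_one]

/-- The image of the base point. -/
noncomputable def pt (R : Realizes n J T tr x) (h : H) : ZMod (2 ^ (n + 4)) × Fin J :=
  R.act h (0, 0)

/-- This gives the points their meaning: `(e, j)` stands for the element `x 0 ^ e * tr j`. -/
theorem pt_zpow_mul_tr (R : Realizes n J T tr x) (e : ℤ) (j : Fin J) :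
    R.pt (x 0 ^ e * wordEval x (tr j)) = ((e : ZMod (2 ^ (n + 4))), j) := by
  have h := R.trans
  simp only [isTransversal, List.all_eq_true, List.mem_finRange, true_implies, Bool.and_eq_true,
    beq_iff_eq] at h
  rw [pt, act_mul, act_zpow_zero, act_word, (h j).1, (h j).2]
  simp [symVal_apply]

theorem pt_surjective (R : Realizes n J T tr x) : Function.Surjective R.pt := by
  rintro ⟨a, j⟩
  refine ⟨x 0 ^ (a.cast : ℤ) * wordEval x (tr j), ?_⟩
  rw [pt_zpow_mul_tr]
  simp

/-- The action is transitive and the group is no larger than the set, so the action is regular. From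
here on, equality of elements is decided at the base point. -/
theorem pt_bijective (R : Realizes n J T tr x) : Function.Bijective R.pt := by
  have := R.finite
  refine (Nat.bijective_iff_surjective_and_card _).2 ⟨R.pt_surjective, le_antisymm ?_ ?_⟩
  · refine R.card_le.trans (le_of_eq ?_)
    rw [Nat.card_prod, Nat.card_zmod, Nat.card_eq_fintype_card, Fintype.card_fin, mul_comm]
  · exact Nat.card_le_card_of_surjective _ R.pt_surjective

theorem card_eq (R : Realizes n J T tr x) : Nat.card H = J * 2 ^ (n + 4) := by
  rw [Nat.card_congr (Equiv.ofBijective _ R.pt_bijective), Nat.card_prod, Nat.card_zmod,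
    Nat.card_eq_fintype_card, Fintype.card_fin, mul_comm]

theorem wordEval_eq (R : Realizes n J T tr x) {w w' : List (ℕ × ℤ)} (h : agree J T w w' = true) :
    wordEval x w = wordEval x w' := by
  simp only [agree, Bool.and_eq_true, beq_iff_eq] at h
  apply R.pt_bijective.1
  rw [pt, pt, act_word, act_word, h.1.1]
  congr 2
  change symVal n ((symEval J T w).sh 0) = symVal n ((symEval J T w').sh 0)
  rw [← Prod.mk.eta (p := (symEval J T w).sh 0), h.1.2]
  exact symVal_congr h.2

/-- Division of the exponent of `x 0` by 4 leaves `4 * J` words to be tested; the unbounded quotient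
`s` is carried along as a parameter. -/
theorem exists_rep (R : Realizes n J T tr x) (h : H) : ∃ s : ℤ, ∃ r < 4, ∃ j < J,
    h = x 0 ^ (4 * s) * wordEval x ((0, ((r : ℕ) : ℤ)) :: tr j) := by
  obtain ⟨e, he⟩ := ZMod.intCast_surjective (R.pt h).1
  refine ⟨e / 4, (e % 4).toNat, by omega, (R.pt h).2, Fin.is_lt _, R.pt_bijective.1 ?_⟩
  rw [wordEval_cons, ← mul_assoc, ← zpow_add, Int.toNat_of_nonneg (by omega),
    Int.mul_ediv_add_emod, pt_zpow_mul_tr, he]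

theorem of_allReps (R : Realizes n J T tr x) {test : List (ℕ × ℤ) → Bool}
    (ht : allReps J tr test = true) (h : H) :
    ∃ (s : ℤ) (w : List (ℕ × ℤ)), test w = true ∧ h = x 0 ^ (4 * s) * wordEval x w := by
  simp only [allReps, List.all_eq_true, List.mem_range] at ht
  obtain ⟨s, r, hr, j, hj, h⟩ := R.exists_rep h
  exact ⟨s, _, ht r hr j hj, h⟩

/-- Each visit to a fibre adds `4 * s` times its sign. The result is affine in `s`, and its slope is
four times the sum of the signs along the path. -/
theorem pt_pow (R : Realizes n J T tr x) (s : ℤ) (w : List (ℕ × ℤ)) (e : ℕ) :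
    R.pt ((x 0 ^ (4 * s) * wordEval x w) ^ e) =
      (symVal n (4 * s * (powerPath J T w e).2.2 + (powerPath J T w e).2.1.1,
        (powerPath J T w e).2.1.2), (powerPath J T w e).1) := by
  induction e with
  | zero =>
    simp only [powerPath, pow_zero, pt, act_one]
    simp [symVal_apply]
  | succ e ih =>
    rw [pow_succ (_ * _), pt, act_mul, ← pt, ih, act_mul, act_zpow, act_word]
    refine Prod.ext ?_ rfl
    simp only [powerPath]
    obtain ⟨a, b⟩ := (symEval J T w).sh (powerPath J T w e).1
    simp only [symVal_apply, Prod.fst_add, Prod.snd_add]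
    push_cast
    ring

theorem pow_two_ne_one (R : Realizes n J T tr x) (s : ℤ) {w : List (ℕ × ℤ)}
    (hw : notInvolution J T w = true) : (x 0 ^ (4 * s) * wordEval x w) ^ 2 ≠ 1 := by
  intro h
  have h2 := R.pt_pow s w 2
  rw [h, pt, act_one] at h2
  simp only [notInvolution, Bool.or_eq_true, Bool.and_eq_true, bne_iff_ne, ne_eq, beq_iff_eq] at hw
  rcases hw with hw | hw
  · exact hw (congrArg Prod.snd h2).symm
  · exact symVal_ne_zero_of_nonzeroTest s hw.1 hw.2 (congrArg Prod.fst h2).symm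

/-- If all the representatives with the sign `-1` fail to be involutions, then the homomorphism
kills the involutions. -/
theorem apply_eq_one_of_sq_eq_one (R : Realizes n J T tr x) (φ : H →* ℤˣ) (v : ℕ → ℤˣ)
    (hv : ∀ i, φ (x i) = v i)
    (ht : allReps J tr (fun w => wordEval v w == 1 || notInvolution J T w) = true) (h : H)
    (hh : h ^ 2 = 1) : φ h = 1 := by
  obtain ⟨s, w, hw, rfl⟩ := R.of_allReps ht h
  simp only [Bool.or_eq_true, beq_iff_eq] at hw
  rcases hw with hw | hw
  -- Fourth powers have sign 1, so the sign of the element is the sign of the word, whatever `s` is.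
  · have h4 : ∀ u : ℤˣ, u ^ (4 : ℤ) = 1 := by decide
    rw [map_mul, map_wordEval, map_zpow, zpow_mul, h4, one_zpow, one_mul]
    simp only [hv, hw]
  · exact absurd hh (R.pow_two_ne_one s hw)

end Realizes

/-! ### The relators of the families -/

section Relators

variable {H : Type*} [Group H]

theorem relNII_iff (n : ℕ) (e₁ e₂ e₃ e₄ e₅ : ℤ) (f : Fin 3 → H) :
    (∀ r ∈ relNII (n + 6) e₁ e₂ e₃ e₄ e₅, FreeGroup.lift f r = 1) ↔
      f 0 ^ 2 ^ (n + 4) = 1 ∧ f 1 ^ 2 = 1 ∧ f 2 ^ 2 = f 0 ^ (2 ^ (n + 3) * e₅) ∧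
      (f 1)⁻¹ * f 0 * f 1 = f 0 ^ (1 + 2 ^ (n + 3) * e₂) ∧
      (f 2)⁻¹ * f 0 * f 2 = f 0 ^ (e₁ + 2 ^ (n + 3) * e₃) ∧
      (f 2)⁻¹ * f 1 * f 2 = f 1 * f 0 ^ (2 ^ (n + 3) * e₄) := by
  simp only [relNII, Nat.reduceSubDiff, Set.mem_insert_iff, Set.mem_singleton_iff,
    forall_eq_or_imp, forall_eq, map_mul, map_inv, map_pow, map_zpow, FreeGroup.lift_apply_of,
    mul_inv_eq_one]

theorem relMIIA_iff (n : ℕ) (e₁ e₂ e₃ e₄ e₅ e₆ e₇ e₈ : ℤ) (f : Fin 3 → H) :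
    (∀ r ∈ relMIIA (n + 7) e₁ e₂ e₃ e₄ e₅ e₆ e₇ e₈, FreeGroup.lift f r = 1) ↔
      f 0 ^ 2 ^ (n + 4) = 1 ∧ f 1 ^ 4 = 1 ∧
      f 2 ^ 2 = f 1 ^ (2 * e₃) * f 0 ^ (2 ^ (n + 3) * e₄) ∧
      (f 1)⁻¹ * f 0 * f 1 = f 0 ^ (1 + 2 ^ (n + 2) * e₇) ∧
      (f 2)⁻¹ * f 0 * f 2 = f 1 ^ (2 * e₁) * f 0 ^ (e₈ + 2 ^ (n + 3) * e₅) ∧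
      (f 2)⁻¹ * f 1 * f 2 = f 1 ^ (1 + 2 * e₂) * f 0 ^ (2 ^ (n + 2) * e₆) := by
  simp only [relMIIA, Nat.reduceSubDiff, Set.mem_insert_iff, Set.mem_singleton_iff,
    forall_eq_or_imp, forall_eq, map_mul, map_inv, map_pow, map_zpow, FreeGroup.lift_apply_of,
    mul_inv_eq_one]

theorem relMIIB_iff (n u : ℕ) (e₁ e₂ e₃ e₄ e₅ e₆ e₇ : ℤ) (f : Fin 3 → H) :
    (∀ r ∈ relMIIB (n + 7) u e₁ e₂ e₃ e₄ e₅ e₆ e₇, FreeGroup.lift f r = 1) ↔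
      f 0 ^ 2 ^ (n + 4) = 1 ∧ f 1 ^ 4 = 1 ∧ f 2 ^ 2 = f 1 ^ (2 * e₃) ∧
      (f 1)⁻¹ * f 0 * f 1 = f 0 ^ (-1 + 2 ^ (n + 2) * e₆) ∧
      (f 2)⁻¹ * f 0 * f 2 = f 1 ^ (2 * e₁) * f 0 ^ (e₇ + 2 ^ (n + 3) * e₅) ∧
      (f 2)⁻¹ * f 1 * f 2 = f 1 ^ (1 + 2 * e₂) * f 0 ^ (2 ^ u * e₄) := by
  simp only [relMIIB, Nat.reduceSubDiff, Set.mem_insert_iff, Set.mem_singleton_iff,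
    forall_eq_or_imp, forall_eq, map_mul, map_inv, map_pow, map_zpow, FreeGroup.lift_apply_of,
    mul_inv_eq_one]

theorem relMIIC_iff (n : ℕ) (e₁ e₂ : ℤ) (f : Fin 3 → H) :
    (∀ r ∈ relMIIC (n + 7) e₁ e₂, FreeGroup.lift f r = 1) ↔
      f 0 ^ 2 ^ (n + 4) = 1 ∧ f 1 ^ 4 = f 0 ^ 2 ^ (n + 3) ∧ f 2 ^ 2 = 1 ∧
      (f 1)⁻¹ * f 0 * f 1 * f 0 = 1 ∧
      (f 2)⁻¹ * f 0 * f 2 = f 0 ^ (1 + 2 ^ (n + 3) * e₂) ∧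
      (f 2)⁻¹ * f 1 * f 2 = f 1 ^ (1 + 2 * e₁) := by
  simp only [relMIIC, Nat.reduceSubDiff, Set.mem_insert_iff, Set.mem_singleton_iff,
    forall_eq_or_imp, forall_eq, map_mul, map_inv, map_pow, map_zpow, FreeGroup.lift_apply_of,
    mul_inv_eq_one]

theorem relMIID_iff (n u : ℕ) (e₁ e₂ e₃ e₄ e₅ e₆ e₇ e₈ : ℤ) (f : Fin 3 → H) :
    (∀ r ∈ relMIID (n + 7) u e₁ e₂ e₃ e₄ e₅ e₆ e₇ e₈, FreeGroup.lift f r = 1) ↔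
      f 0 ^ 2 ^ (n + 4) = 1 ∧ f 1 ^ 4 = 1 ∧ f 2 ^ 2 = f 1 ^ (2 * e₃) ∧
      (f 1)⁻¹ * f 0 * f 1 = f 1 ^ 2 * f 0 ^ (-1 + 2 ^ (n + 3) * e₇) ∧
      (f 1 ^ 2)⁻¹ * f 0 * f 1 ^ 2 = f 0 ^ (1 + 2 ^ (n + 3) * e₆) ∧
      (f 2)⁻¹ * f 0 * f 2 = f 1 ^ (2 * e₁) * f 0 ^ (e₈ + 2 ^ (n + 3) * e₅) ∧
      (f 2)⁻¹ * f 1 * f 2 = f 1 ^ (1 + 2 * e₂) * f 0 ^ (2 ^ u * e₄) := by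
  simp only [relMIID, Nat.reduceSubDiff, Set.mem_insert_iff, Set.mem_singleton_iff,
    forall_eq_or_imp, forall_eq, map_mul, map_inv, map_pow, map_zpow, FreeGroup.lift_apply_of,
    mul_inv_eq_one]

theorem relMIIE_iff (n : ℕ) (e₁ e₂ e₃ e₄ : ℤ) (f : Fin 3 → H) :
    (∀ r ∈ relMIIE (n + 7) e₁ e₂ e₃ e₄, FreeGroup.lift f r = 1) ↔
      f 0 ^ 2 ^ (n + 4) = 1 ∧ f 1 ^ 4 = 1 ∧ f 2 ^ 2 = 1 ∧
      (f 1)⁻¹ * f 0 * f 1 = f 1 ^ 2 * f 0 ^ (1 - 2 ^ (n + 2) * e₂) ∧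
      (f 1 ^ 2)⁻¹ * f 0 * f 1 ^ 2 = f 0 ^ (1 + 2 ^ (n + 3) * e₂) ∧
      (f 2)⁻¹ * f 0 * f 2 = f 0 ^ (e₁ + 2 ^ (n + 3) * e₄) ∧
      (f 2)⁻¹ * f 1 * f 2 = f 1 * f 0 ^ (2 ^ (n + 2) * e₃) := by
  simp only [relMIIE, Nat.reduceSubDiff, Set.mem_insert_iff, Set.mem_singleton_iff,
    forall_eq_or_imp, forall_eq, map_mul, map_inv, map_pow, map_zpow, FreeGroup.lift_apply_of,
    mul_inv_eq_one]

theorem relMIIF_iff (n : ℕ) (e₁ e₂ e₃ e₄ e₅ : ℤ) (f : Fin 3 → H) :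
    (∀ r ∈ relMIIF (n + 7) e₁ e₂ e₃ e₄ e₅, FreeGroup.lift f r = 1) ↔
      f 0 ^ 2 ^ (n + 4) = 1 ∧ f 1 ^ 4 = f 0 ^ 2 ^ (n + 3) ∧ f 2 ^ 2 = 1 ∧
      (f 1)⁻¹ * f 0 * f 1 = f 1 ^ 2 * f 0 ^ (-1 + 2 ^ (n + 3) * e₅) ∧
      (f 1 ^ 2)⁻¹ * f 0 * f 1 ^ 2 = f 0 ^ (1 + 2 ^ (n + 3) * e₁) ∧
      (f 2)⁻¹ * f 0 * f 2 = f 1 ^ (2 * e₃) * f 0 ^ (1 + 2 ^ (n + 3) * e₂) ∧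
      (f 2)⁻¹ * f 1 * f 2 = f 1 ^ (1 + 2 * e₃) * f 0 ^ (2 ^ (n + 3) * e₄) := by
  simp only [relMIIF, Nat.reduceSubDiff, Set.mem_insert_iff, Set.mem_singleton_iff,
    forall_eq_or_imp, forall_eq, map_mul, map_inv, map_pow, map_zpow, FreeGroup.lift_apply_of,
    mul_inv_eq_one]

theorem relMIIG_iff (n : ℕ) (e₁ e₂ e₃ e₄ : ℤ) (f : Fin 3 → H) :
    (∀ r ∈ relMIIG (n + 7) e₁ e₂ e₃ e₄, FreeGroup.lift f r = 1) ↔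
      f 0 ^ 2 ^ (n + 4) = 1 ∧ f 1 ^ 4 = f 0 ^ 4 ∧ f 2 ^ 2 = 1 ∧
      (f 1)⁻¹ * f 0 * f 1 = f 1 ^ 2 * f 0 ^ (-1 + 2 ^ (n + 2) * e₄) ∧
      (f 1 ^ 2)⁻¹ * f 0 * f 1 ^ 2 = f 0 ^ (1 + 2 ^ (n + 3) * e₁) ∧
      (f 2)⁻¹ * f 0 * f 2 = f 0 ^ (1 + 2 ^ (n + 3) * e₃) ∧
      (f 2)⁻¹ * f 1 * f 2 = f 1 * f 0 ^ (2 ^ (n + 3) * e₂) := by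
  simp only [relMIIG, Nat.reduceSubDiff, Set.mem_insert_iff, Set.mem_singleton_iff,
    forall_eq_or_imp, forall_eq, map_mul, map_inv, map_pow, map_zpow, FreeGroup.lift_apply_of,
    mul_inv_eq_one]

theorem relMIII_iff (n : ℕ) (e₁ e₂ e₃ e₄ e₅ e₆ e₇ e₈ : ℤ) (f : Fin 4 → H) :
    (∀ r ∈ relMIII (n + 7) e₁ e₂ e₃ e₄ e₅ e₆ e₇ e₈, FreeGroup.lift f r = 1) ↔
      f 0 ^ 2 ^ (n + 4) = 1 ∧ f 1 ^ 2 = 1 ∧ f 2 ^ 2 = f 0 ^ (2 ^ (n + 3) * e₈) ∧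
      f 3 ^ 2 = f 0 ^ (2 ^ (n + 3) * e₅) ∧ (f 1)⁻¹ * f 0 * f 1 = f 0 ∧
      (f 2)⁻¹ * f 0 * f 2 = f 0 ^ (e₂ + 2 ^ (n + 3) * e₃) ∧
      (f 3)⁻¹ * f 0 * f 3 = f 0 ^ (e₁ + 2 ^ (n + 3) * e₆) ∧
      (f 2)⁻¹ * f 1 * f 2 = f 1 ∧
      (f 3)⁻¹ * f 1 * f 3 = f 1 * f 0 ^ (2 ^ (n + 3) * e₄) ∧
      (f 3)⁻¹ * f 2 * f 3 = f 2 * f 0 ^ (2 ^ (n + 3) * e₇) := by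
  simp only [relMIII, Nat.reduceSubDiff, Set.mem_insert_iff, Set.mem_singleton_iff,
    forall_eq_or_imp, forall_eq, map_mul, map_inv, map_pow, map_zpow, FreeGroup.lift_apply_of,
    mul_inv_eq_one]

end Relators

/-! ### Upper bounds for the orders of the listed groups -/

section Bounds

open Subgroup

/-- The chain is `⟨p⟩ ≤ ⟨q ^ 2, p⟩ ≤ ⟨q, p⟩ ≤ ⟨r, q, p⟩`. The group `⟨q ^ 2, p⟩` is inserted because
`q` need not normalize `⟨p⟩`, whereas `q ^ 2` does. -/
theorem card_le_of_relations {G : Type*} [Group G] {p q r : G} {N : ℕ} (hN : 0 < N)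
    (htop : closure {r, q, p} = ⊤) (hp : p ^ N = 1)
    (hq : q ^ 4 ∈ closure {p}) (hqq : (q ^ 2)⁻¹ * p * q ^ 2 ∈ closure {p})
    (hqp : q⁻¹ * p * q ∈ closure {q ^ 2, p})
    (hr : r ^ 2 ∈ closure {q, p}) (hrp : r⁻¹ * p * r ∈ closure {q, p})
    (hrq : r⁻¹ * q * r ∈ closure {q, p}) :
    Finite G ∧ Nat.card G ≤ 8 * N := by
  have h1 : closure {q, p} ≤ closure {q, q ^ 2, p} := closure_mono (by
    intro x hx
    rcases hx with rfl | rfl <;> simp)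
  have h2 : closure {r, q, p} ≤ closure {r, q, q ^ 2, p} := closure_mono (by
    intro x hx
    rcases hx with rfl | rfl | rfl <;> simp)
  have h3 : q ^ 2 ∈ closure {q ^ 2, p} := subset_closure (by simp)
  refine card_le_of_extensions hN (a := q ^ 2) (top_le_iff.1 (htop ▸ h2)) hp ?_ hqq h3 hqp ?_
    (h1 hr) (h1 hrp) ?_ (h1 hrq)
  · rw [← pow_mul]
    exact hq
  · rw [show q⁻¹ * q ^ 2 * q = q ^ 2 by group]
    exact h3
  · rw [show r⁻¹ * q ^ 2 * r = (r⁻¹ * q * r) ^ 2 by rw [pow_two, pow_two]; group]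
    exact pow_mem (h1 hrq) 2

theorem conj_sq_mem {G : Type*} [Group G] {p q : G} (h : q⁻¹ * p * q ∈ closure {p}) :
    (q ^ 2)⁻¹ * p * q ^ 2 ∈ closure {p} := by
  have h1 : ∀ g ∈ closure {p}, q⁻¹ * g * q ∈ closure {p} := by
    intro g hg
    rw [mem_closure_singleton] at hg
    obtain ⟨i, rfl⟩ := hg
    rw [show q⁻¹ * p ^ i * q = (q⁻¹ * p * q) ^ i by simpa using (conj_zpow (a := q⁻¹) (b := p)).symm]
    exact zpow_mem h i
  have := h1 _ h
  rwa [show (q ^ 2)⁻¹ * p * q ^ 2 = q⁻¹ * (q⁻¹ * p * q) * q by rw [pow_two]; group]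

variable {α : Type*} {rels : Set (FreeGroup α)}

theorem lift_of_eq_one {r : FreeGroup α} (hr : r ∈ rels) :
    FreeGroup.lift (PresentedGroup.of (rels := rels)) r = 1 := by
  have h : FreeGroup.lift (PresentedGroup.of (rels := rels)) = PresentedGroup.mk rels :=
    FreeGroup.ext_hom _ _ fun a => FreeGroup.lift_apply_of
  rw [h]
  exact PresentedGroup.one_of_mem hr

variable {G : Type*} [Group G] {p q : G}

theorem zpow_mem_singleton (i : ℤ) : p ^ i ∈ closure {p} :=
  zpow_mem (subset_closure (Set.mem_singleton p)) i

theorem zpow_mem_pair_left (i : ℤ) : q ^ i ∈ closure {q, p} :=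
  zpow_mem (subset_closure (Set.mem_insert _ _)) i

theorem zpow_mem_pair_right (i : ℤ) : p ^ i ∈ closure {q, p} :=
  zpow_mem (subset_closure (Set.mem_insert_of_mem _ (Set.mem_singleton _))) i

theorem zpow_mul_zpow_mem_pair (i j : ℤ) : q ^ i * p ^ j ∈ closure {q, p} :=
  mul_mem (zpow_mem_pair_left i) (zpow_mem_pair_right j)

theorem mul_zpow_mem_pair (j : ℤ) : q * p ^ j ∈ closure {q, p} :=
  mul_mem (subset_closure (Set.mem_insert _ _)) (zpow_mem_pair_right j)

theorem closure_range_fin_three (f : Fin 3 → G) (h : closure (Set.range f) = ⊤) :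
    closure {f 2, f 1, f 0} = ⊤ := by
  rw [← h]
  congr 1
  ext g
  simp only [Set.mem_insert_iff, Set.mem_singleton_iff, Set.mem_range, Fin.exists_fin_succ,
    Fin.succ_zero_eq_one, Fin.succ_one_eq_two, IsEmpty.exists_iff, or_false, eq_comm (a := g)]
  tauto

theorem closure_range_fin_four (f : Fin 4 → G) (h : closure (Set.range f) = ⊤) :
    closure {f 3, f 2, f 1, f 0} = ⊤ := by
  rw [← h]
  congr 1
  ext g
  simp only [Set.mem_insert_iff, Set.mem_singleton_iff, Set.mem_range, Fin.exists_fin_succ,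
    Fin.succ_zero_eq_one, Fin.succ_one_eq_two, IsEmpty.exists_iff, or_false, eq_comm (a := g)]
  tauto

theorem card_le_of_relNII (n : ℕ) (e₁ e₂ e₃ e₄ e₅ : ℤ) (f : Fin 3 → G)
    (hf : closure (Set.range f) = ⊤)
    (h : ∀ r ∈ relNII (n + 6) e₁ e₂ e₃ e₄ e₅, FreeGroup.lift f r = 1) :
    Finite G ∧ Nat.card G ≤ 4 * 2 ^ (n + 4) := by
  obtain ⟨h0, h1, h2, h3, h4, h5⟩ := (relNII_iff n e₁ e₂ e₃ e₄ e₅ f).1 h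
  refine card_le_of_two_extensions (by positivity) (closure_range_fin_three _ hf) h0 ?_ ?_ ?_ ?_ ?_
  · rw [h1]; exact one_mem _
  · rw [h3]; exact zpow_mem_singleton _
  · rw [h2]; exact zpow_mem_pair_right _
  · rw [h4]; exact zpow_mem_pair_right _
  · rw [h5]; exact mul_zpow_mem_pair _

theorem card_le_of_relMIIA (n : ℕ) (e₁ e₂ e₃ e₄ e₅ e₆ e₇ e₈ : ℤ) (f : Fin 3 → G)
    (hf : closure (Set.range f) = ⊤)
    (h : ∀ r ∈ relMIIA (n + 7) e₁ e₂ e₃ e₄ e₅ e₆ e₇ e₈, FreeGroup.lift f r = 1) :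
    Finite G ∧ Nat.card G ≤ 8 * 2 ^ (n + 4) := by
  obtain ⟨h0, h1, h2, h3, h4, h5⟩ := (relMIIA_iff n e₁ e₂ e₃ e₄ e₅ e₆ e₇ e₈ f).1 h
  have h3' : (f 1)⁻¹ * f 0 * f 1 ∈ closure {f 0} := by rw [h3]; exact zpow_mem_singleton _
  refine card_le_of_relations (by positivity) (closure_range_fin_three _ hf) h0 ?_ (conj_sq_mem h3')
    (closure_mono (Set.subset_insert _ _) h3') ?_ ?_ ?_
  · rw [h1]; exact one_mem _
  · rw [h2]; exact zpow_mul_zpow_mem_pair _ _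
  · rw [h4]; exact zpow_mul_zpow_mem_pair _ _
  · rw [h5]; exact zpow_mul_zpow_mem_pair _ _

theorem card_le_of_relMIIB (n u : ℕ) (e₁ e₂ e₃ e₄ e₅ e₆ e₇ : ℤ) (f : Fin 3 → G)
    (hf : closure (Set.range f) = ⊤)
    (h : ∀ r ∈ relMIIB (n + 7) u e₁ e₂ e₃ e₄ e₅ e₆ e₇, FreeGroup.lift f r = 1) :
    Finite G ∧ Nat.card G ≤ 8 * 2 ^ (n + 4) := by
  obtain ⟨h0, h1, h2, h3, h4, h5⟩ := (relMIIB_iff n u e₁ e₂ e₃ e₄ e₅ e₆ e₇ f).1 h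
  have h3' : (f 1)⁻¹ * f 0 * f 1 ∈ closure {f 0} := by rw [h3]; exact zpow_mem_singleton _
  refine card_le_of_relations (by positivity) (closure_range_fin_three _ hf) h0 ?_ (conj_sq_mem h3')
    (closure_mono (Set.subset_insert _ _) h3') ?_ ?_ ?_
  · rw [h1]; exact one_mem _
  · rw [h2]; exact zpow_mem_pair_left _
  · rw [h4]; exact zpow_mul_zpow_mem_pair _ _
  · rw [h5]; exact zpow_mul_zpow_mem_pair _ _

theorem card_le_of_relMIIC (n : ℕ) (e₁ e₂ : ℤ) (f : Fin 3 → G)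
    (hf : closure (Set.range f) = ⊤)
    (h : ∀ r ∈ relMIIC (n + 7) e₁ e₂, FreeGroup.lift f r = 1) :
    Finite G ∧ Nat.card G ≤ 8 * 2 ^ (n + 4) := by
  obtain ⟨h0, h1, h2, h3, h4, h5⟩ := (relMIIC_iff n e₁ e₂ f).1 h
  have h3' : (f 1)⁻¹ * f 0 * f 1 ∈ closure {f 0} := by
    rw [eq_inv_of_mul_eq_one_left h3]
    exact inv_mem (subset_closure (Set.mem_singleton _))
  refine card_le_of_relations (by positivity) (closure_range_fin_three _ hf) h0 ?_ (conj_sq_mem h3')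
    (closure_mono (Set.subset_insert _ _) h3') ?_ ?_ ?_
  · rw [h1]; exact pow_mem (subset_closure (Set.mem_singleton _)) _
  · rw [h2]; exact one_mem _
  · rw [h4]; exact zpow_mem_pair_right _
  · rw [h5]; exact zpow_mem_pair_left _

theorem card_le_of_relMIID (n u : ℕ) (e₁ e₂ e₃ e₄ e₅ e₆ e₇ e₈ : ℤ) (f : Fin 3 → G)
    (hf : closure (Set.range f) = ⊤)
    (h : ∀ r ∈ relMIID (n + 7) u e₁ e₂ e₃ e₄ e₅ e₆ e₇ e₈, FreeGroup.lift f r = 1) :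
    Finite G ∧ Nat.card G ≤ 8 * 2 ^ (n + 4) := by
  obtain ⟨h0, h1, h2, h3, h4, h5, h6⟩ := (relMIID_iff n u e₁ e₂ e₃ e₄ e₅ e₆ e₇ e₈ f).1 h
  refine card_le_of_relations (by positivity) (closure_range_fin_three _ hf) h0 ?_ ?_ ?_ ?_ ?_ ?_
  · rw [h1]; exact one_mem _
  · rw [h4]; exact zpow_mem_singleton _
  · rw [h3]; exact mul_zpow_mem_pair _
  · rw [h2]; exact zpow_mem_pair_left _
  · rw [h5]; exact zpow_mul_zpow_mem_pair _ _
  · rw [h6]; exact zpow_mul_zpow_mem_pair _ _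

theorem card_le_of_relMIIE (n : ℕ) (e₁ e₂ e₃ e₄ : ℤ) (f : Fin 3 → G)
    (hf : closure (Set.range f) = ⊤)
    (h : ∀ r ∈ relMIIE (n + 7) e₁ e₂ e₃ e₄, FreeGroup.lift f r = 1) :
    Finite G ∧ Nat.card G ≤ 8 * 2 ^ (n + 4) := by
  obtain ⟨h0, h1, h2, h3, h4, h5, h6⟩ := (relMIIE_iff n e₁ e₂ e₃ e₄ f).1 h
  refine card_le_of_relations (by positivity) (closure_range_fin_three _ hf) h0 ?_ ?_ ?_ ?_ ?_ ?_
  · rw [h1]; exact one_mem _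
  · rw [h4]; exact zpow_mem_singleton _
  · rw [h3]; exact mul_zpow_mem_pair _
  · rw [h2]; exact one_mem _
  · rw [h5]; exact zpow_mem_pair_right _
  · rw [h6]; exact mul_zpow_mem_pair _

theorem card_le_of_relMIIF (n : ℕ) (e₁ e₂ e₃ e₄ e₅ : ℤ) (f : Fin 3 → G)
    (hf : closure (Set.range f) = ⊤)
    (h : ∀ r ∈ relMIIF (n + 7) e₁ e₂ e₃ e₄ e₅, FreeGroup.lift f r = 1) :
    Finite G ∧ Nat.card G ≤ 8 * 2 ^ (n + 4) := by
  obtain ⟨h0, h1, h2, h3, h4, h5, h6⟩ := (relMIIF_iff n e₁ e₂ e₃ e₄ e₅ f).1 h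
  refine card_le_of_relations (by positivity) (closure_range_fin_three _ hf) h0 ?_ ?_ ?_ ?_ ?_ ?_
  · rw [h1]; exact pow_mem (subset_closure (Set.mem_singleton _)) _
  · rw [h4]; exact zpow_mem_singleton _
  · rw [h3]; exact mul_zpow_mem_pair _
  · rw [h2]; exact one_mem _
  · rw [h5]; exact zpow_mul_zpow_mem_pair _ _
  · rw [h6]; exact zpow_mul_zpow_mem_pair _ _

theorem card_le_of_relMIIG (n : ℕ) (e₁ e₂ e₃ e₄ : ℤ) (f : Fin 3 → G)
    (hf : closure (Set.range f) = ⊤)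
    (h : ∀ r ∈ relMIIG (n + 7) e₁ e₂ e₃ e₄, FreeGroup.lift f r = 1) :
    Finite G ∧ Nat.card G ≤ 8 * 2 ^ (n + 4) := by
  obtain ⟨h0, h1, h2, h3, h4, h5, h6⟩ := (relMIIG_iff n e₁ e₂ e₃ e₄ f).1 h
  refine card_le_of_relations (by positivity) (closure_range_fin_three _ hf) h0 ?_ ?_ ?_ ?_ ?_ ?_
  · rw [h1]; exact pow_mem (subset_closure (Set.mem_singleton _)) _
  · rw [h4]; exact zpow_mem_singleton _
  · rw [h3]; exact mul_zpow_mem_pair _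
  · rw [h2]; exact one_mem _
  · rw [h5]; exact zpow_mem_pair_right _
  · rw [h6]; exact mul_zpow_mem_pair _

theorem card_le_of_relMIII (n : ℕ) (e₁ e₂ e₃ e₄ e₅ e₆ e₇ e₈ : ℤ) (f : Fin 4 → G)
    (hf : closure (Set.range f) = ⊤)
    (h : ∀ r ∈ relMIII (n + 7) e₁ e₂ e₃ e₄ e₅ e₆ e₇ e₈, FreeGroup.lift f r = 1) :
    Finite G ∧ Nat.card G ≤ 8 * 2 ^ (n + 4) := by
  obtain ⟨h0, h1, h2, h3, h4, h5, h6, h7, h8, h9⟩ := (relMIII_iff n e₁ e₂ e₃ e₄ e₅ e₆ e₇ e₈ f).1 h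
  have hp : ∀ {q r : G} (i : ℤ), f 0 ^ i ∈ closure {r, q, f 0} := fun i =>
    zpow_mem (subset_closure (Set.mem_insert_of_mem _ (Set.mem_insert_of_mem _ (Set.mem_singleton _)))) i
  have hq : ∀ {q r : G}, q ∈ closure {r, q, f 0} :=
    subset_closure (Set.mem_insert_of_mem _ (Set.mem_insert _ _))
  have hr : ∀ {q r : G}, r ∈ closure {r, q, f 0} := subset_closure (Set.mem_insert _ _)
  refine card_le_of_extensions (by positivity) (closure_range_fin_four _ hf) h0
    ?_ ?_ ?_ ?_ ?_ ?_ ?_ ?_ ?_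
  · rw [h1]; exact one_mem _
  · rw [h4]; exact subset_closure (Set.mem_singleton _)
  · rw [h2]; exact zpow_mem_pair_right _
  · rw [h5]; exact zpow_mem_pair_right _
  · rw [h7]; exact subset_closure (Set.mem_insert _ _)
  · rw [h3]; exact hp _
  · rw [h6]; exact hp _
  · rw [h8]; exact mul_mem hq (hp _)
  · rw [h9]; exact mul_mem hr (hp _)

end Bounds

/-! ### Equations of words -/

section Presented

set_option linter.unusedSimpArgs false

/-- The values of `v` satisfy the given equations of words. -/
def Satisfies {H : Type*} [Group H] (v : ℕ → H) (eqs : List (List (ℕ × ℤ) × List (ℕ × ℤ))) : Prop :=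
  ∀ e ∈ eqs, wordEval v e.1 = wordEval v e.2

/-- A bound for the order of a presented group, and equations of words that imply its relations.
The letter `4` stands for a power of the generator `0`. -/
structure IsPresented (n J : ℕ) {k : ℕ} (rels : Set (FreeGroup (Fin k)))
    (eqs : List (List (ℕ × ℤ) × List (ℕ × ℤ))) : Prop where
  card_le : Finite (PresentedGroup rels) ∧ Nat.card (PresentedGroup rels) ≤ J * 2 ^ (n + 4)
  lift_eq_one : ∀ {H : Type} [Group H] (v : ℕ → H), v 0 ^ 2 ^ (n + 4) = 1 →
    v 4 = v 0 ^ 2 ^ (n + 2) → Satisfies v eqs →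
    ∀ r ∈ rels, FreeGroup.lift (fun i : Fin k => v i) r = 1

variable {H : Type*} [Group H]

theorem zpow_eq_wordEval_four {v : ℕ → H} {n : ℕ} (h : v 4 = v 0 ^ 2 ^ (n + 2)) (e : ℤ) :
    v 0 ^ ((2 : ℤ) ^ (n + 2) * e) = v 4 ^ e := by
  rw [h, zpow_mul]
  norm_cast

theorem zpow_eq_wordEval_four' {v : ℕ → H} {n : ℕ} (h : v 4 = v 0 ^ 2 ^ (n + 2)) (e : ℤ) :
    v 0 ^ ((2 : ℤ) ^ (n + 3) * e) = v 4 ^ (2 * e) := by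
  rw [← zpow_eq_wordEval_four h]
  congr 1
  ring

theorem pow_eq_wordEval_four {v : ℕ → H} {n : ℕ} (h : v 4 = v 0 ^ 2 ^ (n + 2)) :
    v 0 ^ 2 ^ (n + 3) = v 4 ^ 2 := by
  rw [h, ← pow_mul]
  congr 1

theorem closure_range_of_eq_top {k : ℕ} (rels : Set (FreeGroup (Fin k))) :
    Subgroup.closure (Set.range (PresentedGroup.of (rels := rels))) = ⊤ :=
  PresentedGroup.closure_range_of rels

/-- The equations of the family `NII`. -/
def eqsNII (e₁ e₂ e₃ e₄ e₅ : ℤ) : List (List (ℕ × ℤ) × List (ℕ × ℤ)) :=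
  [([(1, 2)], []), ([(2, 2)], [(4, 2 * e₅)]),
    ([(1, -1), (0, 1), (1, 1)], [(0, 1), (4, 2 * e₂)]),
    ([(2, -1), (0, 1), (2, 1)], [(0, e₁), (4, 2 * e₃)]),
    ([(2, -1), (1, 1), (2, 1)], [(1, 1), (4, 2 * e₄)])]

/-- The equations of the family `MIIA`. -/
def eqsMIIA (e₁ e₂ e₃ e₄ e₅ e₆ e₇ e₈ : ℤ) : List (List (ℕ × ℤ) × List (ℕ × ℤ)) :=
  [([(1, 4)], []), ([(2, 2)], [(1, 2 * e₃), (4, 2 * e₄)]),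
    ([(1, -1), (0, 1), (1, 1)], [(0, 1), (4, e₇)]),
    ([(2, -1), (0, 1), (2, 1)], [(1, 2 * e₁), (0, e₈), (4, 2 * e₅)]),
    ([(2, -1), (1, 1), (2, 1)], [(1, 1 + 2 * e₂), (4, e₆)])]

/-- The equations of the family `MIIB`, where `x` is the last letter of the last relation. -/
def eqsMIIB (x : ℕ × ℤ) (e₁ e₂ e₃ e₅ e₆ e₇ : ℤ) : List (List (ℕ × ℤ) × List (ℕ × ℤ)) :=
  [([(1, 4)], []), ([(2, 2)], [(1, 2 * e₃)]),
    ([(1, -1), (0, 1), (1, 1)], [(0, -1), (4, e₆)]),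
    ([(2, -1), (0, 1), (2, 1)], [(1, 2 * e₁), (0, e₇), (4, 2 * e₅)]),
    ([(2, -1), (1, 1), (2, 1)], [(1, 1 + 2 * e₂), x])]

/-- The equations of the family `MIIC`. -/
def eqsMIIC (e₁ e₂ : ℤ) : List (List (ℕ × ℤ) × List (ℕ × ℤ)) :=
  [([(1, 4)], [(4, 2)]), ([(2, 2)], []),
    ([(1, -1), (0, 1), (1, 1), (0, 1)], []),
    ([(2, -1), (0, 1), (2, 1)], [(0, 1), (4, 2 * e₂)]),
    ([(2, -1), (1, 1), (2, 1)], [(1, 1 + 2 * e₁)])]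

/-- The equations of the family `MIID`, where `x` is the last letter of the last relation. -/
def eqsMIID (x : ℕ × ℤ) (e₁ e₂ e₃ e₅ e₆ e₇ e₈ : ℤ) : List (List (ℕ × ℤ) × List (ℕ × ℤ)) :=
  [([(1, 4)], []), ([(2, 2)], [(1, 2 * e₃)]),
    ([(1, -1), (0, 1), (1, 1)], [(1, 2), (0, -1), (4, 2 * e₇)]),
    ([(1, -2), (0, 1), (1, 2)], [(0, 1), (4, 2 * e₆)]),
    ([(2, -1), (0, 1), (2, 1)], [(1, 2 * e₁), (0, e₈), (4, 2 * e₅)]),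
    ([(2, -1), (1, 1), (2, 1)], [(1, 1 + 2 * e₂), x])]

/-- The equations of the family `MIIE`. -/
def eqsMIIE (e₁ e₂ e₃ e₄ : ℤ) : List (List (ℕ × ℤ) × List (ℕ × ℤ)) :=
  [([(1, 4)], []), ([(2, 2)], []),
    ([(1, -1), (0, 1), (1, 1)], [(1, 2), (0, 1), (4, -e₂)]),
    ([(1, -2), (0, 1), (1, 2)], [(0, 1), (4, 2 * e₂)]),
    ([(2, -1), (0, 1), (2, 1)], [(0, e₁), (4, 2 * e₄)]),
    ([(2, -1), (1, 1), (2, 1)], [(1, 1), (4, e₃)])]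

/-- The equations of the family `MIIF`. -/
def eqsMIIF (e₁ e₂ e₃ e₄ e₅ : ℤ) : List (List (ℕ × ℤ) × List (ℕ × ℤ)) :=
  [([(1, 4)], [(4, 2)]), ([(2, 2)], []),
    ([(1, -1), (0, 1), (1, 1)], [(1, 2), (0, -1), (4, 2 * e₅)]),
    ([(1, -2), (0, 1), (1, 2)], [(0, 1), (4, 2 * e₁)]),
    ([(2, -1), (0, 1), (2, 1)], [(1, 2 * e₃), (0, 1), (4, 2 * e₂)]),
    ([(2, -1), (1, 1), (2, 1)], [(1, 1 + 2 * e₃), (4, 2 * e₄)])]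

/-- The equations of the family `MIIG`. -/
def eqsMIIG (e₁ e₂ e₃ e₄ : ℤ) : List (List (ℕ × ℤ) × List (ℕ × ℤ)) :=
  [([(1, 4)], [(0, 4)]), ([(2, 2)], []),
    ([(1, -1), (0, 1), (1, 1)], [(1, 2), (0, -1), (4, e₄)]),
    ([(1, -2), (0, 1), (1, 2)], [(0, 1), (4, 2 * e₁)]),
    ([(2, -1), (0, 1), (2, 1)], [(0, 1), (4, 2 * e₃)]),
    ([(2, -1), (1, 1), (2, 1)], [(1, 1), (4, 2 * e₂)])]

/-- The equations of the family `MIII`. -/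
def eqsMIII (e₁ e₂ e₃ e₄ e₅ e₆ e₇ e₈ : ℤ) : List (List (ℕ × ℤ) × List (ℕ × ℤ)) :=
  [([(1, 2)], []), ([(2, 2)], [(4, 2 * e₈)]), ([(3, 2)], [(4, 2 * e₅)]),
    ([(1, -1), (0, 1), (1, 1)], [(0, 1)]),
    ([(2, -1), (0, 1), (2, 1)], [(0, e₂), (4, 2 * e₃)]),
    ([(3, -1), (0, 1), (3, 1)], [(0, e₁), (4, 2 * e₆)]),
    ([(2, -1), (1, 1), (2, 1)], [(1, 1)]),
    ([(3, -1), (1, 1), (3, 1)], [(1, 1), (4, 2 * e₄)]),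
    ([(3, -1), (2, 1), (3, 1)], [(2, 1), (4, 2 * e₇)])]

theorem wordEval_nil (v : ℕ → H) : wordEval v [] = 1 := rfl

theorem fin_four_val_three : ((3 : Fin 4) : ℕ) = 3 := rfl

theorem isPresented_relNII (n : ℕ) (e₁ e₂ e₃ e₄ e₅ : ℤ) :
    IsPresented n 4 (relNII (n + 6) e₁ e₂ e₃ e₄ e₅)
      (eqsNII e₁ e₂ e₃ e₄ e₅) where
  card_le := card_le_of_relNII _ _ _ _ _ _ _ (closure_range_of_eq_top _)
    fun _ => lift_of_eq_one
  lift_eq_one v h0 h4 h := by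
    rw [relNII_iff]
    simp only [Satisfies, eqsNII, List.forall_mem_cons, wordEval_cons, wordEval_nil, mul_one,
      zpow_one, zpow_neg, zpow_add] at h
    simp only [Fin.val_zero, Fin.val_one, Fin.val_two, fin_four_val_three, zpow_add, zpow_sub,
      zpow_neg, zpow_one, zpow_eq_wordEval_four h4, zpow_eq_wordEval_four' h4,
      pow_eq_wordEval_four h4, h0, true_and]
    norm_cast at h ⊢
    clear h0 h4
    simp_all [mul_assoc]

theorem isPresented_relMIIA (n : ℕ) (e₁ e₂ e₃ e₄ e₅ e₆ e₇ e₈ : ℤ) :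
    IsPresented n 8 (relMIIA (n + 7) e₁ e₂ e₃ e₄ e₅ e₆ e₇ e₈)
      (eqsMIIA e₁ e₂ e₃ e₄ e₅ e₆ e₇ e₈) where
  card_le := card_le_of_relMIIA _ _ _ _ _ _ _ _ _ _ (closure_range_of_eq_top _)
    fun _ => lift_of_eq_one
  lift_eq_one v h0 h4 h := by
    rw [relMIIA_iff]
    simp only [Satisfies, eqsMIIA, List.forall_mem_cons, wordEval_cons, wordEval_nil, mul_one,
      zpow_one, zpow_neg, zpow_add] at h
    simp only [Fin.val_zero, Fin.val_one, Fin.val_two, fin_four_val_three, zpow_add, zpow_sub,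
      zpow_neg, zpow_one, zpow_eq_wordEval_four h4, zpow_eq_wordEval_four' h4,
      pow_eq_wordEval_four h4, h0, true_and]
    norm_cast at h ⊢
    clear h0 h4
    simp_all [mul_assoc]

theorem isPresented_relMIIB (n u : ℕ) (e₁ e₂ e₃ e₄ e₅ e₆ e₇ : ℤ)
    (x : ℕ × ℤ) (hx : u = n + 3 ∧ x = (4, 2 * e₄) ∨ u = 1 ∧ x = (0, 2 * e₄)) :
    IsPresented n 8 (relMIIB (n + 7) u e₁ e₂ e₃ e₄ e₅ e₆ e₇)
      (eqsMIIB x e₁ e₂ e₃ e₅ e₆ e₇) where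
  card_le := card_le_of_relMIIB _ _ _ _ _ _ _ _ _ _ (closure_range_of_eq_top _)
    fun _ => lift_of_eq_one
  lift_eq_one v h0 h4 h := by
    rw [relMIIB_iff]
    simp only [Satisfies, eqsMIIB, List.forall_mem_cons, wordEval_cons, wordEval_nil, mul_one,
      zpow_one, zpow_neg, zpow_add] at h
    -- The last exponent has two shapes: for `u = n + 3` it gives an even power of the letter `4`,
    -- and for `u = 1` a fixed power of `p`.
    have h' : v 0 ^ ((2 : ℤ) ^ u * e₄) = v x.1 ^ x.2 := by
      rcases hx with ⟨rfl, rfl⟩ | ⟨rfl, rfl⟩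
      · exact zpow_eq_wordEval_four' h4 e₄
      · rfl
    simp only [Fin.val_zero, Fin.val_one, Fin.val_two, fin_four_val_three, zpow_add, zpow_sub,
      zpow_neg, zpow_one, zpow_eq_wordEval_four h4, zpow_eq_wordEval_four' h4,
      pow_eq_wordEval_four h4, h', h0, true_and]
    norm_cast at h ⊢
    clear h0 h4 hx
    simp_all [mul_assoc]

theorem isPresented_relMIIC (n : ℕ) (e₁ e₂ : ℤ) :
    IsPresented n 8 (relMIIC (n + 7) e₁ e₂)
      (eqsMIIC e₁ e₂) where
  card_le := card_le_of_relMIIC _ _ _ _ (closure_range_of_eq_top _)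
    fun _ => lift_of_eq_one
  lift_eq_one v h0 h4 h := by
    rw [relMIIC_iff]
    simp only [Satisfies, eqsMIIC, List.forall_mem_cons, wordEval_cons, wordEval_nil, mul_one,
      zpow_one, zpow_neg, zpow_add] at h
    simp only [Fin.val_zero, Fin.val_one, Fin.val_two, fin_four_val_three, zpow_add, zpow_sub,
      zpow_neg, zpow_one, zpow_eq_wordEval_four h4, zpow_eq_wordEval_four' h4,
      pow_eq_wordEval_four h4, h0, true_and]
    norm_cast at h ⊢
    clear h0 h4
    simp_all [mul_assoc]

theorem isPresented_relMIID (n u : ℕ) (e₁ e₂ e₃ e₄ e₅ e₆ e₇ e₈ : ℤ)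
    (x : ℕ × ℤ) (hx : u = n + 3 ∧ x = (4, 2 * e₄) ∨ u = 1 ∧ x = (0, 2 * e₄)) :
    IsPresented n 8 (relMIID (n + 7) u e₁ e₂ e₃ e₄ e₅ e₆ e₇ e₈)
      (eqsMIID x e₁ e₂ e₃ e₅ e₆ e₇ e₈) where
  card_le := card_le_of_relMIID _ _ _ _ _ _ _ _ _ _ _ (closure_range_of_eq_top _)
    fun _ => lift_of_eq_one
  lift_eq_one v h0 h4 h := by
    rw [relMIID_iff]
    simp only [Satisfies, eqsMIID, List.forall_mem_cons, wordEval_cons, wordEval_nil, mul_one,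
      zpow_one, zpow_neg, zpow_add] at h
    have h' : v 0 ^ ((2 : ℤ) ^ u * e₄) = v x.1 ^ x.2 := by
      rcases hx with ⟨rfl, rfl⟩ | ⟨rfl, rfl⟩
      · exact zpow_eq_wordEval_four' h4 e₄
      · rfl
    simp only [Fin.val_zero, Fin.val_one, Fin.val_two, fin_four_val_three, zpow_add, zpow_sub,
      zpow_neg, zpow_one, zpow_eq_wordEval_four h4, zpow_eq_wordEval_four' h4,
      pow_eq_wordEval_four h4, h', h0, true_and]
    norm_cast at h ⊢
    clear h0 h4 hx
    simp_all [mul_assoc]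

theorem isPresented_relMIIE (n : ℕ) (e₁ e₂ e₃ e₄ : ℤ) :
    IsPresented n 8 (relMIIE (n + 7) e₁ e₂ e₃ e₄)
      (eqsMIIE e₁ e₂ e₃ e₄) where
  card_le := card_le_of_relMIIE _ _ _ _ _ _ (closure_range_of_eq_top _)
    fun _ => lift_of_eq_one
  lift_eq_one v h0 h4 h := by
    rw [relMIIE_iff]
    simp only [Satisfies, eqsMIIE, List.forall_mem_cons, wordEval_cons, wordEval_nil, mul_one,
      zpow_one, zpow_neg, zpow_add] at h
    simp only [Fin.val_zero, Fin.val_one, Fin.val_two, fin_four_val_three, zpow_add, zpow_sub,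
      zpow_neg, zpow_one, zpow_eq_wordEval_four h4, zpow_eq_wordEval_four' h4,
      pow_eq_wordEval_four h4, h0, true_and]
    norm_cast at h ⊢
    clear h0 h4
    simp_all [mul_assoc]

theorem isPresented_relMIIF (n : ℕ) (e₁ e₂ e₃ e₄ e₅ : ℤ) :
    IsPresented n 8 (relMIIF (n + 7) e₁ e₂ e₃ e₄ e₅)
      (eqsMIIF e₁ e₂ e₃ e₄ e₅) where
  card_le := card_le_of_relMIIF _ _ _ _ _ _ _ (closure_range_of_eq_top _)
    fun _ => lift_of_eq_one
  lift_eq_one v h0 h4 h := by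
    rw [relMIIF_iff]
    simp only [Satisfies, eqsMIIF, List.forall_mem_cons, wordEval_cons, wordEval_nil, mul_one,
      zpow_one, zpow_neg, zpow_add] at h
    simp only [Fin.val_zero, Fin.val_one, Fin.val_two, fin_four_val_three, zpow_add, zpow_sub,
      zpow_neg, zpow_one, zpow_eq_wordEval_four h4, zpow_eq_wordEval_four' h4,
      pow_eq_wordEval_four h4, h0, true_and]
    norm_cast at h ⊢
    clear h0 h4
    simp_all [mul_assoc]

theorem isPresented_relMIIG (n : ℕ) (e₁ e₂ e₃ e₄ : ℤ) :
    IsPresented n 8 (relMIIG (n + 7) e₁ e₂ e₃ e₄)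
      (eqsMIIG e₁ e₂ e₃ e₄) where
  card_le := card_le_of_relMIIG _ _ _ _ _ _ (closure_range_of_eq_top _)
    fun _ => lift_of_eq_one
  lift_eq_one v h0 h4 h := by
    rw [relMIIG_iff]
    simp only [Satisfies, eqsMIIG, List.forall_mem_cons, wordEval_cons, wordEval_nil, mul_one,
      zpow_one, zpow_neg, zpow_add] at h
    simp only [Fin.val_zero, Fin.val_one, Fin.val_two, fin_four_val_three, zpow_add, zpow_sub,
      zpow_neg, zpow_one, zpow_eq_wordEval_four h4, zpow_eq_wordEval_four' h4,
      pow_eq_wordEval_four h4, h0, true_and]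
    norm_cast at h ⊢
    clear h0 h4
    simp_all [mul_assoc]

theorem isPresented_relMIII (n : ℕ) (e₁ e₂ e₃ e₄ e₅ e₆ e₇ e₈ : ℤ) :
    IsPresented n 8 (relMIII (n + 7) e₁ e₂ e₃ e₄ e₅ e₆ e₇ e₈)
      (eqsMIII e₁ e₂ e₃ e₄ e₅ e₆ e₇ e₈) where
  card_le := card_le_of_relMIII _ _ _ _ _ _ _ _ _ _ (closure_range_of_eq_top _)
    fun _ => lift_of_eq_one
  lift_eq_one v h0 h4 h := by
    rw [relMIII_iff]
    simp only [Satisfies, eqsMIII, List.forall_mem_cons, wordEval_cons, wordEval_nil, mul_one,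
      zpow_one, zpow_neg, zpow_add] at h
    simp only [Fin.val_zero, Fin.val_one, Fin.val_two, fin_four_val_three, zpow_add, zpow_sub,
      zpow_neg, zpow_one, zpow_eq_wordEval_four h4, zpow_eq_wordEval_four' h4,
      pow_eq_wordEval_four h4, h0, true_and]
    norm_cast at h ⊢
    clear h0 h4
    simp_all [mul_assoc]

end Presented

/-! ### The tables of the listed groups -/

open Family in
/-- The number of cosets of the subgroup generated by the generator `0`. -/
def Family.index : Family → ℕ
  | NII => 4
  | _ => 8

instance (F : Family) : NeZero F.index := ⟨by cases F <;> decide⟩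

open Family in
/-- Words for representatives of the cosets of the subgroup generated by the generator `0`. -/
def Family.rep (F : Family) (j : ℕ) : List (ℕ × ℤ) :=
  match F with
  | NII => [(1, (j % 2 : ℕ)), (2, (j / 2 : ℕ))]
  | MIII => [(1, (j % 2 : ℕ)), (2, (j / 2 % 2 : ℕ)), (3, (j / 4 : ℕ))]
  | _ => [(1, (j % 4 : ℕ)), (2, (j / 4 : ℕ))]

open Family in
/-- The tables of the listed groups. -/
def Family.table : Family → ℕ → List ℕ
  | NII, 1 => [10085765704, 43302813761, 8740963906]
  | NII, 2 => [8001327688, 43302813761, 8740963906]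
  | NII, 3 => [7934087752, 43302813761, 8740963906]
  | NII, 4 => [8001327688, 8875966529, 8740963906]
  | NII, 5 => [7934087752, 8875966529, 8740963906]
  | NII, 6 => [42360934984, 8875966529, 8740963906]
  | NII, 7 => [7934087752, 8875966529, 43167811138]
  | NII, 8 => [44512612936, 8875966529, 8740963906]
  | NII, 9 => [10085765704, 8875966529, 8740963906]
  | MIIA, 1 => [730054228424683721288, 628470788456595620929, 619157168162675919428]
  | MIIA, 2 => [3091246477093120938568, 628470788456595620929, 619157168162675919428]
  | MIIA, 3 => [1915271045976651698760, 628470788456595620929, 619157168162675919428]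
  | MIIA, 4 => [4253350909421432836680, 628470788456595620929, 619157168162675919428]
  | MIIA, 5 => [1915271045976651698760, 2994274740701286401089, 619157168162675919428]
  | MIIA, 6 => [711571526060138336840, 628470788456595620929, 619157168162675919428]
  | MIIA, 7 => [3072763774728575554120, 628470788456595620929, 619157168162675919428]
  | MIIA, 8 => [3095858180669374501448, 628470788456595620929, 619157168162675919428]
  | MIIA, 9 => [730054228424683721288, 2994274740701286401089, 619157168162675919428]
  | MIIA, 10 => [711571526060138336840, 2994274740701286401089, 619157168162675919428]
  | MIIA, 11 => [4253350909421432836680, 2994274740701286401089, 619157168162675919428]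
  | MIIA, 12 => [2947995433654081327688, 628470788456595620929, 619157168162675919428]
  | MIIA, 13 => [586803185054363849288, 628470788456595620929, 619157168162675919428]
  | MIIA, 14 => [586803185054363849288, 3012685385746671764545, 619157168162675919428]
  | MIIA, 15 => [563708779044845163080, 3012685385746671764545, 619157168162675919428]
  | MIIA, 16 => [2924901027713282380360, 3012685385746671764545, 619157168162675919428]
  | MIIA, 17 => [730054228424683721288, 646881433501980984385, 600674465798130534980]
  | MIIA, 18 => [3095858180669374501448, 646881433501980984385, 600674465798130534980]
  | MIIA, 19 => [582191481409390547528, 628470788456595620929, 2984961120407366699588]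
  | MIIA, 20 => [2943383730077827764808, 628470788456595620929, 2984961120407366699588]
  | MIIA, 21 => [563708779044845163080, 646881433501980984385, 2984961120407366699588]
  | MIIA, 22 => [2929512731289535943240, 646881433501980984385, 600674465798130534980]
  | MIIA, 23 => [2924901027713282380360, 646881433501980984385, 2984961120407366699588]
  | MIIA, 24 => [568320482689818464840, 3012685385746671764545, 600674465798130534980]
  | MIIA, 25 => [582191481409390547528, 646881433501980984385, 2984961120407366699588]
  | MIIA, 26 => [582191481409390547528, 646881433501980984385, 600674465798130534980]
  | MIIA, 27 => [2943383730077827764808, 646881433501980984385, 600674465798130534980]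
  | MIIA, 28 => [2947995433654081327688, 646881433501980984385, 600674465798130534980]
  | MIIA, 29 => [582191481409390547528, 3012685385746671764545, 600674465798130534980]
  | MIIA, 30 => [582191481409390547528, 628470788456595620929, 619157168162675919428]
  | MIIA, 31 => [2943383730077827764808, 628470788456595620929, 619157168162675919428]
  | MIIA, 32 => [582191481409390547528, 3012685385746671764545, 619157168162675919428]
  | MIIA, 33 => [563708779044845163080, 646881433501980984385, 619157168162675919428]
  | MIIA, 34 => [2924901027713282380360, 646881433501980984385, 619157168162675919428]
  | MIIA, 35 => [2947995433654081327688, 646881433501980984385, 619157168162675919428]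
  | MIIA, 36 => [3095858180669374501448, 646881433501980984385, 619157168162675919428]
  | MIIA, 37 => [730054228424683721288, 646881433501980984385, 619157168162675919428]
  | MIIA, 38 => [3091246477093120938568, 646881433501980984385, 619157168162675919428]
  | MIIA, 39 => [582191481409390547528, 646881433501980984385, 619157168162675919428]
  | MIIA, 40 => [2943383730077827764808, 646881433501980984385, 619157168162675919428]
  | MIIA, 41 => [582191481409390547528, 1811372764578941011009, 619157168162675919428]
  | MIIA, 42 => [2943383730077827764808, 1811372764578941011009, 619157168162675919428]
  | MIIA, 43 => [4128582533196926390856, 628470788456595620929, 619157168162675919428]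
  | MIIA, 44 => [1762796630535117181512, 1811372764578941011009, 619157168162675919428]
  | MIIA, 45 => [730054228424683721288, 1829783409624326374465, 619157168162675919428]
  | MIIA, 46 => [3091246477093120938568, 1829783409624326374465, 619157168162675919428]
  | MIIB, 1 => [582479712882906395208, 628470788456595620929, 619157168162675919428]
  | MIIB, 2 => [2943671961551343612488, 628470788456595620929, 619157168162675919428]
  | MIIB, 3 => [1767696530434874372680, 628470788456595620929, 619157168162675919428]
  | MIIB, 4 => [4105776393879655510600, 3012685385746671764545, 619157168162675919428]
  | MIIB, 5 => [1767696530434874372680, 2994274740701286401089, 619157168162675919428]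
  | MIIB, 6 => [563997010518361010760, 2994274740701286401089, 619157168162675919428]
  | MIIB, 7 => [2948283665127597175368, 628470788456595620929, 619157168162675919428]
  | MIIB, 8 => [582479712882906395208, 3012685385746671764545, 619157168162675919428]
  | MIIB, 9 => [582479712882906395208, 2994274740701286401089, 619157168162675919428]
  | MIIB, 10 => [2925189259186798228040, 628470788456595620929, 619157168162675919428]
  | MIIB, 11 => [2929800962763051790920, 628470788456595620929, 619157168162675919428]
  | MIIB, 12 => [587091416527879696968, 3012685385746671764545, 619157168162675919428]
  | MIIB, 13 => [2929800962763051790920, 2994274740701286401089, 619157168162675919428]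
  | MIIB, 14 => [563997010518361010760, 628470788456595620929, 619157168162675919428]
  | MIIB, 15 => [568608714163334312520, 628470788456595620929, 619157168162675919428]
  | MIIB, 16 => [563997010518361010760, 2994274740701286401089, 600674465798130534980]
  | MIIB, 17 => [2929800962763051790920, 2994274740701286401089, 600674465798130534980]
  | MIIB, 18 => [568608714163334312520, 2994274740701286401089, 600674465798130534980]
  | MIIB, 19 => [582479712882906395208, 646881433501980984385, 619157168162675919428]
  | MIIB, 20 => [587091416527879696968, 646881433501980984385, 619157168162675919428]
  | MIIB, 21 => [563997010518361010760, 628470788456595620929, 600674465798130534980]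
  | MIIB, 22 => [2925189259186798228040, 628470788456595620929, 600674465798130534980]
  | MIIB, 23 => [568608714163334312520, 628470788456595620929, 600674465798130534980]
  | MIIB, 24 => [2943671961551343612488, 646881433501980984385, 619157168162675919428]
  | MIIB, 25 => [2948283665127597175368, 646881433501980984385, 619157168162675919428]
  | MIIB, 26 => [4105776393879655510600, 646881433501980984385, 619157168162675919428]
  | MIIB, 27 => [1891888443708054139464, 798779421176560911425, 619157168162675919428]
  | MIIB, 28 => [4257674346369863348808, 798779421176560911425, 619157168162675919428]
  | MIIC, 1 => [582479712882906395208, 2989654029925777966145, 619157168162675919428]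
  | MIIC, 2 => [2948283665127597175368, 2989654029925777966145, 619157168162675919428]
  | MIIC, 3 => [582479712882906395208, 3012685368188845458497, 619157168162675919428]
  | MIIC, 4 => [2948283665127597175368, 3012685368188845458497, 619157168162675919428]
  | MIIC, 5 => [582479712882906395208, 646881451128526767169, 619157168162675919428]
  | MIID, 1 => [2929827966665349428808, 2994274740701286401089, 619157168162675919428]
  | MIID, 2 => [582452709048925582920, 3012685385746671764545, 619157168162675919428]
  | MIID, 3 => [582452709048925582920, 646881433501980984385, 619157168162675919428]
  | MIID, 4 => [2929827966665349428808, 628470788456595620929, 619157168162675919428]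
  | MIID, 5 => [564033039177672586824, 628470788456595620929, 619157168162675919428]
  | MIID, 6 => [2929836991422363366984, 2994274740701286401089, 619157168162675919428]
  | MIID, 7 => [2948247636467748730440, 3012685385746671764545, 619157168162675919428]
  | MIID, 8 => [587055387868031252040, 2994274740701286401089, 600674465798130534980]
  | MIID, 9 => [715931026886612383304, 628470788456595620929, 619157168162675919428]
  | MIID, 10 => [715931026886612383304, 794167717565947479105, 619157168162675919428]
  | MIID, 11 => [3077123275486329861704, 794167717565947479105, 619157168162675919428]
  | MIID, 12 => [2929836991422363366984, 628470788456595620929, 619157168162675919428]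
  | MIID, 13 => [564033039177672586824, 2994274740701286401089, 619157168162675919428]
  | MIID, 14 => [582443684223057950280, 3012685385746671764545, 619157168162675919428]
  | MIID, 15 => [582443684223057950280, 2994274740701286401089, 600674465798130534980]
  | MIID, 16 => [3077123275486329861704, 628470788456595620929, 619157168162675919428]
  | MIID, 17 => [2948247636467748730440, 646881433501980984385, 619157168162675919428]
  | MIID, 18 => [711319323241639081544, 628470788456595620929, 619157168162675919428]
  | MIID, 19 => [582443684223057950280, 646881433501980984385, 619157168162675919428]
  | MIID, 20 => [2943635932891495167560, 646881433501980984385, 619157168162675919428]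
  | MIID, 21 => [568644742822645888584, 2994274740701286401089, 619157168162675919428]
  | MIID, 22 => [587055387868031252040, 3012685385746671764545, 619157168162675919428]
  | MIID, 23 => [2925225287846109804104, 628470788456595620929, 619157168162675919428]
  | MIIE, 1 => [1748961625256124716616, 1811372764578941011009, 619157168162675919428]
  | MIIE, 2 => [1748961625256124716616, 4177176716823631791169, 619157168162675919428]
  | MIIE, 3 => [4105524191065451238984, 1811372764578941011009, 619157168162675919428]
  | MIIE, 4 => [4253386938080744412744, 2994274740701286401089, 619157168162675919428]
  | MIIE, 5 => [711607554719449912904, 628470788456595620929, 619157168162675919428]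
  | MIIE, 6 => [1896824372271417890376, 628470788456595620929, 619157168162675919428]
  | MIIE, 7 => [711607554719449912904, 2994274740701286401089, 619157168162675919428]
  | MIIE, 8 => [3077411506964140693064, 628470788456595620929, 619157168162675919428]
  | MIIF, 1 => [2925216280646854932040, 2989654029925777966145, 619157168162675919428]
  | MIIF, 2 => [568644725196167083592, 2989654029925777966145, 619157168162675919428]
  | MIIF, 3 => [2929836973864604300872, 2989654029925777966145, 619157168162675919428]
  | MIIF, 4 => [568653750021900498504, 2989654029925777966145, 619157168162675919428]
  | MIIF, 5 => [2925225305404003087944, 2989654029925777966145, 619157168162675919428]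
  | MIIF, 6 => [582443701849603733064, 3012685368188845458497, 619157168162675919428]
  | MIIF, 7 => [2948247618909922424392, 3012685368188845458497, 619157168162675919428]
  | MIIF, 8 => [2948247618909922424392, 646881451128526767169, 619157168162675919428]
  | MIIF, 9 => [582443701849603733064, 646881451128526767169, 619157168162675919428]
  | MIIG, 1 => [859180944361320379976, 923618693640243414081, 619157168162675919428]
  | MIIG, 2 => [3224984896606011160136, 3289422645884934194241, 619157168162675919428]
  | MIIG, 3 => [3224984896606011160136, 923618693640243414081, 619157168162675919428]
  | MIIG, 4 => [3224975871848997221960, 923618693640243414081, 619157168162675919428]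
  | MIIG, 5 => [4405571996183215830600, 923618693640243414081, 619157168162675919428]
  | MIIG, 6 => [859189969187188012616, 923618693640243414081, 619157168162675919428]
  | MIIG, 7 => [4405571996183215830600, 3289422645884934194241, 619157168162675919428]
  | MIII, 1 => [730054228424683721288, 646917462161829429313, 3003444104795837728322, 619157168162675919428]
  | MIII, 2 => [582200506235258180168, 646917462161829429313, 3003444104795837728322, 619157168162675919428]
  | MIII, 3 => [582191481409390547528, 646917462161829429313, 3003444104795837728322, 619157168162675919428]
  | MIII, 4 => [582200506235258180168, 646917462161829429313, 637640152551146948162, 619157168162675919428]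
  | MIII, 5 => [582191481409390547528, 646917462161829429313, 637640152551146948162, 619157168162675919428]
  | MIII, 6 => [2947995433654081327688, 646917462161829429313, 637640152551146948162, 619157168162675919428]
  | MIII, 7 => [582191481409390547528, 646917462161829429313, 637640152551146948162, 2984961120407366699588]
  | MIII, 8 => [3095858180669374501448, 646917462161829429313, 637640152551146948162, 619157168162675919428]
  | MIII, 9 => [730054228424683721288, 646917462161829429313, 637640152551146948162, 619157168162675919428]
  | MIII, 10 => [582192045456703918664, 3012721414406520209473, 637640152551146948162, 2984961120407366699588]
  | MIII, 11 => [2947986972944380760648, 3012721414406520209473, 637640152551146948162, 2984961120407366699588]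
  | MIII, 12 => [3095849155912360563272, 3012721414406520209473, 637640152551146948162, 619157168162675919428]
  | MIII, 13 => [2947986408897067389512, 3012721414406520209473, 637640152551146948162, 619157168162675919428]
  | MIII, 14 => [730053664373066994248, 3012721414406520209473, 3003435080038823790146, 619157168162675919428]
  | _, _ => []

open Family in
/-- The generators that a certain homomorphism maps to `-1`, as a bit mask. -/
def Family.mask : Family → ℕ → ℕ
  -- Bit `i` of the mask belongs to the generator `i`. The value 0 marks exactly the groups of
  -- `gamma`, where no such homomorphism exists.
  | NII, n => [1, 1, 0, 0, 0, 1, 4, 1, 1].getD (n - 1) 0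
  | MIIA, n => [2, 2, 2, 2, 2, 2, 2, 2, 2, 2, 2, 2, 2, 2, 2, 2, 4, 4, 4, 4, 4, 4, 4, 4, 4, 4, 4, 4, 4, 2, 2, 2, 1, 1, 1, 1, 1, 1, 0, 0, 2, 2, 2, 2, 1, 1].getD (n - 1) 0
  | MIIB, n => [2, 2, 2, 2, 2, 2, 2, 2, 2, 2, 2, 2, 3, 3, 3, 4, 4, 4, 0, 0, 6, 6, 6, 1, 1, 1, 2, 2].getD (n - 1) 0
  | MIIC, n => [2, 2, 2, 3, 0].getD (n - 1) 0
  | MIID, n => [3, 3, 0, 3, 3, 3, 3, 4, 2, 2, 3, 3, 3, 3, 4, 3, 0, 0, 0, 1, 2, 2, 2].getD (n - 1) 0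
  | MIIE, n => [0, 2, 2, 2, 2, 2, 2, 2].getD (n - 1) 0
  | MIIF, n => [3, 2, 3, 3, 3, 3, 3, 0, 0].getD (n - 1) 0
  | MIIG, n => [3, 3, 3, 3, 3, 3, 3].getD (n - 1) 0
  | MIII, n => [1, 1, 0, 0, 0, 1, 8, 1, 1, 0, 0, 1, 0, 0].getD (n - 1) 0

/-- The sign of a generator for a bit mask. -/
def signOf (mask i : ℕ) : ℤˣ := if mask.testBit i then -1 else 1

section

variable (J : ℕ) [NeZero J] (k : ℕ) (tr : ℕ → List (ℕ × ℤ)) (T : List ℕ)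
  (eqs : List (List (ℕ × ℤ) × List (ℕ × ℤ)))

/-- The table is a model of the equations. -/
def modelCheck : Bool :=
  T.length == k && 3 ≤ k && k ≤ 4 && isModel J T && isTransversal J T tr &&
    ((symEval J T [(4, 4)]).eqv 1) &&
    eqs.all fun e => (symEval J T e.1).eqv (symEval J T e.2)

/-- The signs given by the mask are a homomorphism that kills the involutions. -/
def signCheck (mask : ℕ) : Bool :=
  ((List.range k).any fun i => mask.testBit i) && decide (mask < 2 ^ k) &&
    (eqs.all fun e => wordEval (signOf mask) e.1 == wordEval (signOf mask) e.2) &&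
    allReps J tr (fun w => wordEval (signOf mask) w == 1 || notInvolution J T w)

/-- The equations hold for the signs that are `-1` for a single generator. -/
def rankCheck : Bool :=
  (List.range k).all fun j =>
    eqs.all fun e => wordEval (signOf (2 ^ j)) e.1 == wordEval (signOf (2 ^ j)) e.2

end

/-- The group is presented by equations which the table satisfies, and for the groups outside the
list `gamma` there is a homomorphism that kills the involutions. -/
def Family.Checked (F : Family) (k n : ℕ) : Prop :=
  ∃ eqs, IsPresented n F.index (F.relators (n + F.minM) k) eqs ∧
    modelCheck F.index F.rank F.rep (F.table k) eqs = true ∧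
    ((F, k) ∈ gamma ∧ rankCheck F.rank eqs = true ∨
      signCheck F.index F.rank F.rep (F.table k) eqs (F.mask k) = true)

/-- Tables and equations are free of `n`, so one kernel evaluation per listed group settles all
orders. -/
theorem checked_NII (n k : ℕ) (h1 : 1 ≤ k) (h2 : k ≤ 9) : Family.NII.Checked k n := by
  interval_cases k <;>
    exact ⟨_, isPresented_relNII n _ _ _ _ _, by decide +kernel, by decide +kernel⟩

theorem checked_MIIA (n k : ℕ) (h1 : 1 ≤ k) (h2 : k ≤ 46) : Family.MIIA.Checked k n := by
  interval_cases k <;>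
    exact ⟨_, isPresented_relMIIA n _ _ _ _ _ _ _ _, by decide +kernel, by decide +kernel⟩

theorem checked_MIIB (n k : ℕ) (h1 : 1 ≤ k) (h2 : k ≤ 28) : Family.MIIB.Checked k n := by
  interval_cases k <;>
    exact ⟨_, isPresented_relMIIB n _ _ _ _ _ _ _ _ _ 
      (by first | exact Or.inl ⟨rfl, rfl⟩ | exact Or.inr ⟨rfl, rfl⟩),
      by decide +kernel, by decide +kernel⟩

theorem checked_MIIC (n k : ℕ) (h1 : 1 ≤ k) (h2 : k ≤ 5) : Family.MIIC.Checked k n := by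
  interval_cases k <;>
    exact ⟨_, isPresented_relMIIC n _ _, by decide +kernel, by decide +kernel⟩

theorem checked_MIID (n k : ℕ) (h1 : 1 ≤ k) (h2 : k ≤ 23) : Family.MIID.Checked k n := by
  interval_cases k <;>
    exact ⟨_, isPresented_relMIID n _ _ _ _ _ _ _ _ _ _ 
      (by first | exact Or.inl ⟨rfl, rfl⟩ | exact Or.inr ⟨rfl, rfl⟩),
      by decide +kernel, by decide +kernel⟩

theorem checked_MIIE (n k : ℕ) (h1 : 1 ≤ k) (h2 : k ≤ 8) : Family.MIIE.Checked k n := by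
  interval_cases k <;>
    exact ⟨_, isPresented_relMIIE n _ _ _ _, by decide +kernel, by decide +kernel⟩

theorem checked_MIIF (n k : ℕ) (h1 : 1 ≤ k) (h2 : k ≤ 9) : Family.MIIF.Checked k n := by
  interval_cases k <;>
    exact ⟨_, isPresented_relMIIF n _ _ _ _ _, by decide +kernel, by decide +kernel⟩

theorem checked_MIIG (n k : ℕ) (h1 : 1 ≤ k) (h2 : k ≤ 7) : Family.MIIG.Checked k n := by
  interval_cases k <;>
    exact ⟨_, isPresented_relMIIG n _ _ _ _, by decide +kernel, by decide +kernel⟩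

theorem checked_MIII (n k : ℕ) (h1 : 1 ≤ k) (h2 : k ≤ 14) : Family.MIII.Checked k n := by
  interval_cases k <;>
    exact ⟨_, isPresented_relMIII n _ _ _ _ _ _ _ _, by decide +kernel, by decide +kernel⟩

theorem Family.checked (F : Family) (n k : ℕ) (h1 : 1 ≤ k) (h2 : k ≤ F.count) :
    F.Checked k n := by
  cases F with
  | NII => exact checked_NII n k h1 h2
  | MIIA => exact checked_MIIA n k h1 h2
  | MIIB => exact checked_MIIB n k h1 h2
  | MIIC => exact checked_MIIC n k h1 h2
  | MIID => exact checked_MIID n k h1 h2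
  | MIIE => exact checked_MIIE n k h1 h2
  | MIIF => exact checked_MIIF n k h1 h2
  | MIIG => exact checked_MIIG n k h1 h2
  | MIII => exact checked_MIII n k h1 h2

instance (F : Family) : NeZero F.rank := ⟨by cases F <;> decide⟩

/-- The letters of words in a presented group. -/
def letters (n : ℕ) {k : ℕ} [NeZero k] (rels : Set (FreeGroup (Fin k))) (i : ℕ) :
    PresentedGroup rels :=
  if h : i < k then PresentedGroup.of ⟨i, h⟩ else
    if i = 4 then PresentedGroup.of 0 ^ 2 ^ (n + 2) else 1

theorem letters_of_lt (n : ℕ) {k : ℕ} [NeZero k] (rels : Set (FreeGroup (Fin k))) {i : ℕ}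
    (h : i < k) : letters n rels i = PresentedGroup.of ⟨i, h⟩ := dif_pos h

theorem letters_zero (n : ℕ) {k : ℕ} [NeZero k] (rels : Set (FreeGroup (Fin k))) :
    letters n rels 0 = PresentedGroup.of 0 := letters_of_lt n rels (NeZero.pos k)

/-- The permutations in the table satisfy the equations and hence the relators, so the universal
property of the presented group provides the representation. The order bound comes from
`IsPresented`. -/
theorem realizes_of_modelCheck {n J k : ℕ} [NeZero J] [NeZero k] {rels : Set (FreeGroup (Fin k))}
    {eqs : List (List (ℕ × ℤ) × List (ℕ × ℤ))} (hP : IsPresented n J rels eqs)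
    {tr : ℕ → List (ℕ × ℤ)} {T : List ℕ} (hT : modelCheck J k tr T eqs = true) :
    Realizes n J T tr (letters n rels) := by
  simp only [modelCheck, Bool.and_eq_true, beq_iff_eq, decide_eq_true_eq, List.all_eq_true] at hT
  obtain ⟨⟨⟨⟨⟨⟨h1, h2⟩, h3⟩, h4⟩, h5⟩, h6⟩, h7⟩ := hT
  -- The equations do not contain the relation for the order of `p`. It is the fourth power of the
  -- letter `4`, which the model check tests separately.
  have h0 : letterUnit n h4 0 ^ 2 ^ (n + 4) = 1 := by
    have := wordEval_letterUnit_eq n h4 (w := [(4, 4)]) (w' := []) h6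
    rw [wordEval_nil, wordEval_cons, wordEval_nil, mul_one, letterUnit_four_eq] at this
    have h24 : 2 ^ (n + 4) = 2 ^ (n + 2) * 4 := by ring
    exact (congrArg (letterUnit n h4 0 ^ ·) h24).trans <|
      (pow_mul _ (2 ^ (n + 2)) 4).trans ((zpow_natCast _ 4).symm.trans this)
  have hl := hP.lift_eq_one (letterUnit n h4) h0 (letterUnit_four_eq n h4)
    fun e he => wordEval_letterUnit_eq n h4 (h7 e he)
  refine ⟨hP.card_le.1, hP.card_le.2, h4, h5, PresentedGroup.toGroup hl, fun i => ?_⟩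
  have hof : ∀ i : Fin k, PresentedGroup.toGroup hl (PresentedGroup.of i) = letterUnit n h4 i :=
    fun i => PresentedGroup.toGroup.of hl
  unfold letters
  split_ifs with hi hi4
  · exact hof _
  · rw [map_pow, hof, hi4]
    rfl
  · rw [map_one, letterUnit, if_neg hi4]
    refine Units.ext (Eq.symm ?_)
    change Mono.map (symVal n) (gen J T i) = 1
    rw [gen, List.getElem?_eq_none (by omega), map_one]

/-- Signs of the generators that satisfy the equations define a homomorphism. -/
theorem exists_hom_signOf {n J k : ℕ} [NeZero k] {rels : Set (FreeGroup (Fin k))}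
    {eqs : List (List (ℕ × ℤ) × List (ℕ × ℤ))} (hP : IsPresented n J rels eqs) (hk4 : k ≤ 4)
    {mask : ℕ} (hlt : mask < 2 ^ k)
    (he : ∀ e ∈ eqs, wordEval (signOf mask) e.1 = wordEval (signOf mask) e.2) :
    ∃ φ : PresentedGroup rels →* ℤˣ, ∀ j, φ (letters n rels j) = signOf mask j := by
  have hk : ∀ j, ¬ j < k → signOf mask j = 1 := fun j hj => if_neg (by
    rw [Nat.testBit_lt_two_pow (hlt.trans_le (Nat.pow_le_pow_right two_pos (not_lt.1 hj)))]
    simp)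
  have h2 : ∀ (u : ℤˣ) (e : ℕ), u ^ 2 ^ (e + 1) = 1 := fun u e => by
    rw [pow_succ', pow_mul, Int.units_sq, one_pow]
  -- The letter `4` is an even power of the generator `0`, so both sides are 1.
  have hs4 : signOf mask 4 = signOf mask 0 ^ 2 ^ (n + 2) := by
    rw [h2, hk 4 (by omega)]
  have hl := hP.lift_eq_one (signOf mask) (h2 _ _) hs4 he
  have hof : ∀ i : Fin k, PresentedGroup.toGroup hl (PresentedGroup.of i) = signOf mask i :=
    fun i => PresentedGroup.toGroup.of hl
  refine ⟨PresentedGroup.toGroup hl, fun j => ?_⟩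
  unfold letters
  split_ifs with h h'
  · exact hof _
  · rw [map_pow, hof, h', hs4]
    rfl
  · rw [map_one, hk j h]

theorem exists_hom_of_signCheck {n J k : ℕ} [NeZero J] [NeZero k] {rels : Set (FreeGroup (Fin k))}
    {eqs : List (List (ℕ × ℤ) × List (ℕ × ℤ))} (hP : IsPresented n J rels eqs)
    {tr : ℕ → List (ℕ × ℤ)} {T : List ℕ} (hT : modelCheck J k tr T eqs = true) {mask : ℕ}
    (hs : signCheck J k tr T eqs mask = true) :
    ∃ X : Finset (Fin k), X.Nonempty ∧ ∃ φ : PresentedGroup rels →* ℤˣ,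
      (∀ i : Fin k, φ (PresentedGroup.of i) = if i ∈ X then -1 else 1) ∧
      ∀ g : PresentedGroup rels, orderOf g = 2 → φ g = 1 := by
  have R := realizes_of_modelCheck hP hT
  simp only [signCheck, Bool.and_eq_true, beq_iff_eq, List.all_eq_true, List.any_eq_true,
    List.mem_range, decide_eq_true_eq] at hs
  obtain ⟨⟨⟨⟨i, hi, him⟩, hlt⟩, he⟩, hinv⟩ := hs
  have hk4 : k ≤ 4 := by
    simp only [modelCheck, Bool.and_eq_true, decide_eq_true_eq] at hT
    omega
  obtain ⟨φ, hφ⟩ := exists_hom_signOf hP hk4 hlt he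
  refine ⟨Finset.univ.filter fun i => mask.testBit i, ⟨⟨i, hi⟩, by simpa using him⟩, φ,
    fun i => ?_, fun g hg => ?_⟩
  · have h := hφ i
    rw [letters_of_lt n rels i.2] at h
    rw [h]
    simp [signOf]
  · exact R.apply_eq_one_of_sq_eq_one φ (signOf mask) hφ hinv g (hg ▸ pow_orderOf_eq_one g)

theorem realizes_listed (F : Family) {k : ℕ} (n : ℕ) (h1 : 1 ≤ k) (h2 : k ≤ F.count) :
    Realizes n F.index (F.table k) F.rep (letters n (F.relators (n + F.minM) k)) := by
  obtain ⟨eqs, hP, hT, -⟩ := F.checked n k h1 h2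
  exact realizes_of_modelCheck hP hT

/-- For the listed groups outside `gamma` there is a homomorphism that kills the involutions. -/
theorem exists_hom_of_not_mem_gamma (F : Family) {k m : ℕ} (h1 : 1 ≤ k) (h2 : k ≤ F.count)
    (hm : F.minM ≤ m) (hk : (F, k) ∉ gamma) :
    ∃ X : Finset (Fin F.rank), X.Nonempty ∧ ∃ φ : Grp F k m →* ℤˣ,
      (∀ i : Fin F.rank, φ (PresentedGroup.of i) = if i ∈ X then -1 else 1) ∧
      ∀ g : Grp F k m, orderOf g = 2 → φ g = 1 := by
  obtain ⟨n, rfl⟩ := Nat.exists_eq_add_of_le' hm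
  obtain ⟨eqs, hP, hT, hs⟩ := F.checked n k h1 h2
  exact exists_hom_of_signCheck hP hT (hs.resolve_left fun h => hk h.1)

theorem not_generatedByInvolutions_of_hom {G : Type*} [Group G] (φ : G →* ℤˣ)
    (hφ : ∀ g : G, orderOf g = 2 → φ g = 1) {g : G} (hg : φ g ≠ 1) :
    ¬ GeneratedByInvolutions G := by
  intro h
  have hle : Subgroup.closure {g : G | orderOf g = 2} ≤ φ.ker :=
    (Subgroup.closure_le _).2 fun x hx => hφ x hx
  rw [h] at hle
  exact hg (hle (Subgroup.mem_top g))

theorem mem_gamma_of_generatedByInvolutions (F : Family) {k m : ℕ} (h1 : 1 ≤ k) (h2 : k ≤ F.count)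
    (hm : F.minM ≤ m) (h : GeneratedByInvolutions (Grp F k m)) : (F, k) ∈ gamma := by
  by_contra hk
  obtain ⟨X, ⟨i, hi⟩, φ, hφ, hinv⟩ := exists_hom_of_not_mem_gamma F h1 h2 hm hk
  refine not_generatedByInvolutions_of_hom φ hinv (g := PresentedGroup.of i) ?_ h
  rw [hφ, if_pos hi]
  decide

/-! ### Presentations by an element of maximal order and involutions -/

/-- The names of the presentations, with their parameters. -/
inductive Std
  -- Here `0, 1, 2` are `p`, `t`, `w`, where `t` inverts `p`. The forms `one` arise when `w`
  -- normalizes `⟨p⟩` and the forms `two` when it need not. In the forms `A` the element `w` is an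
  -- involution, and in the forms `B` it is inverted by `t`. The forms `three` and `nii` belong to
  -- the classes in which all squares lie in `⟨p⟩`.
  | oneA (u c : Bool)
  | oneB (u : Bool)
  | twoA (a b c : Bool)
  | twoB (c : Bool)
  | three (a b c d e : Bool)
  | nii (a d : Bool)
  deriving DecidableEq

/-- A parameter as an exponent. -/
abbrev bit (b : Bool) : ℤ := (b.toNat : ℤ)

/-- The commutator of two letters. -/
def comm (i j : ℕ) : List (ℕ × ℤ) := [(i, -1), (j, -1), (i, 1), (j, 1)]

namespace Std

/-- The letter `4` stands for the generator `0` to the power `2 ^ (n + level)`. -/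
def level : Std → ℕ
  -- Only the involution of `⟨p⟩` occurs in these equations, and the letter `4` denotes it directly.
  | twoA _ _ _ => 3
  | _ => 2

/-- The order of the group is `index * 2 ^ (n + 4)`. -/
def index : Std → ℕ
  | nii _ _ => 4
  | _ => 8

/-- The equations that distinguish the presentations. -/
def special : Std → List (List (ℕ × ℤ) × List (ℕ × ℤ))
  | oneA u c => [([(4, 4)], []), ([(2, 2)], []), ([(2, -1), (0, 1), (2, 1)], [(0, 1), (4, 2 * bit u)]),
      ([(2, 1), (1, 1), (2, 1), (1, 1), (2, 1), (1, 1), (2, 1), (1, 1)], [(4, 2 * bit c)]),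
      ([(3, 1)], [])]
  | oneB u => [([(4, 4)], []), ([(1, 1), (2, 1), (1, 1)], [(2, -1)]), ([(2, 4)], []),
      ([(2, -1), (0, 1), (2, 1)], [(0, 1), (4, 2 * bit u)]), ([(3, 1)], [])]
  | twoA a b c => [([(4, 2)], []), ([(2, 2)], []), ([(1, 1), (2, 1), (1, 1)], [(2, 1), (4, bit a)]),
      ([(2, -1), (0, 2), (2, 1)], [(0, 2), (4, bit b)]), (comm 0 2 ++ comm 0 2, [(4, bit c)]),
      ([(3, 1)], [])]
  | twoB c => [([(4, 4)], []), ([(1, 1), (2, 1), (1, 1)], [(2, -1)]),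
      ([(2, 2)], [(0, 2), (4, bit c)]), (comm 0 2 ++ comm 0 2, [(4, 2 * bit c)]), ([(3, 1)], [])]
  | three a b c d e => [([(4, 4)], []), ([(2, 2)], []), ([(3, 2)], []), (comm 0 2, [(4, 2 * bit a)]),
      (comm 0 3, [(4, 2 * bit b)]), (comm 2 3, [(4, 2 * bit c)]), (comm 2 1, [(4, 2 * bit d)]),
      (comm 3 1, [(4, 2 * bit e)])]
  | nii a d => [([(4, 4)], []), ([(2, 2)], []), (comm 0 2, [(4, 2 * bit a)]), (comm 2 1, [(4, 2 * bit d)]),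
      ([(3, 1)], [])]

/-- The equations of a presentation. -/
def eqs (s : Std) : List (List (ℕ × ℤ) × List (ℕ × ℤ)) :=
  ([(1, 2)], []) :: ([(1, 1), (0, 1), (1, 1)], [(0, -1)]) :: s.special

end Std

/-- The values of `v` generate the group and satisfy the equations of a presentation. -/
structure IsStd (n : ℕ) (s : Std) {G : Type*} [Group G] (v : ℕ → G) : Prop where
  four : v 4 = v 0 ^ 2 ^ (n + s.level)
  one : ∀ i, 4 < i → v i = 1
  satisfies : Satisfies v s.eqs
  closure_eq_top : Subgroup.closure {v 3, v 2, v 1, v 0} = ⊤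

section

variable {n : ℕ} {s : Std} {G H : Type*} [Group G] [Group H] {v : ℕ → G}

theorem IsStd.closure_range (hv : IsStd n s v) : Subgroup.closure (Set.range v) = ⊤ := by
  refine top_le_iff.1 (hv.closure_eq_top ▸ Subgroup.closure_mono ?_)
  rintro _ (rfl | rfl | rfl | rfl) <;> exact Set.mem_range_self _

theorem IsStd.of_closure_range (h4 : v 4 = v 0 ^ 2 ^ (n + s.level)) (h1 : ∀ i, 4 < i → v i = 1)
    (hs : Satisfies v s.eqs) (hc : Subgroup.closure (Set.range v) = ⊤) : IsStd n s v := by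
  refine ⟨h4, h1, hs, top_le_iff.1 (hc ▸ (Subgroup.closure_le _).2 ?_)⟩
  have h : ∀ x ∈ ({v 3, v 2, v 1, v 0} : Set G), x ∈ Subgroup.closure {v 3, v 2, v 1, v 0} :=
    fun x hx => Subgroup.subset_closure hx
  rintro _ ⟨i, rfl⟩
  rcases lt_or_ge 4 i with hi | hi
  · rw [h1 i hi]
    exact one_mem _
  · interval_cases i
    · exact h _ (by simp)
    · exact h _ (by simp)
    · exact h _ (by simp)
    · exact h _ (by simp)
    · rw [h4]
      exact pow_mem (h (v 0) (by simp)) _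

/-- Two groups with the same presentation are isomorphic if they have the largest possible
order. -/
theorem IsStd.nonempty_mulEquiv {v' : ℕ → H} (hv : IsStd n s v) (hv' : IsStd n s v') {c : ℕ}
    (hc : Nat.card G = c) (hc' : Nat.card H = c)
    (hle : ∀ (K : Subgroup (G × H)) (w : ℕ → K), IsStd n s w → Finite K ∧ Nat.card K ≤ c) :
    Nonempty (G ≃* H) := by
  let f : ℕ → G × H := fun i => (v i, v' i)
  -- The subgroup generated by the pairs of generators again satisfies the presentation, so it has
  -- at most `c` elements. It projects onto both groups of order `c`, hence it is the graph of an
  -- isomorphism.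
  let K : Subgroup (G × H) := Subgroup.closure (Set.range f)
  let w : ℕ → K := fun i => ⟨f i, Subgroup.subset_closure (Set.mem_range_self i)⟩
  let π : K →* G := (MonoidHom.fst G H).comp K.subtype
  let π' : K →* H := (MonoidHom.snd G H).comp K.subtype
  have hext : ∀ {a b : K}, π a = π b → π' a = π' b → a = b := fun h h' =>
    Subtype.ext (Prod.ext h h')
  have hw : IsStd n s w := by
    refine IsStd.of_closure_range (hext ?_ ?_) (fun i hi => hext (hv.one i hi) (hv'.one i hi))
      (fun e he => ?_) ?_
    · rw [map_pow]; exact hv.four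
    · rw [map_pow]; exact hv'.four
    · exact hext (by rw [map_wordEval, map_wordEval]; exact hv.satisfies e he)
        (by rw [map_wordEval, map_wordEval]; exact hv'.satisfies e he)
    · rw [show Set.range w = ((↑) : K → G × H) ⁻¹' (Set.range f) by
        ext x; simp [w, Subtype.ext_iff]]
      exact Subgroup.closure_closure_coe_preimage
  obtain ⟨hfin, hcard⟩ := hle K w hw
  have hsurj : Function.Surjective π := by
    rw [← MonoidHom.range_eq_top, ← top_le_iff, ← hv.closure_range, Subgroup.closure_le]
    rintro _ ⟨i, rfl⟩
    exact ⟨w i, rfl⟩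
  have hsurj' : Function.Surjective π' := by
    rw [← MonoidHom.range_eq_top, ← top_le_iff, ← hv'.closure_range, Subgroup.closure_le]
    rintro _ ⟨i, rfl⟩
    exact ⟨w i, rfl⟩
  have hG : Finite G := Finite.of_surjective _ hsurj
  have hH : Finite H := Finite.of_surjective _ hsurj'
  have hb : Function.Bijective π := (Nat.bijective_iff_surjective_and_card _).2
    ⟨hsurj, le_antisymm (hcard.trans hc.ge) (Nat.card_le_card_of_surjective _ hsurj)⟩
  have hb' : Function.Bijective π' := (Nat.bijective_iff_surjective_and_card _).2
    ⟨hsurj', le_antisymm (hcard.trans hc'.ge) (Nat.card_le_card_of_surjective _ hsurj')⟩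
  exact ⟨(MulEquiv.ofBijective π hb).symm.trans (MulEquiv.ofBijective π' hb')⟩

end

/-! ### Explicit forms of the equations -/

section

variable {n : ℕ} {G : Type*} [Group G] {v : ℕ → G}

theorem satisfies_oneA_iff {u c : Bool} : Satisfies v (Std.oneA u c).eqs ↔
    v 1 ^ 2 = 1 ∧ v 1 * v 0 * v 1 = (v 0)⁻¹ ∧ v 4 ^ 4 = 1 ∧ v 2 ^ 2 = 1 ∧
    (v 2)⁻¹ * v 0 * v 2 = v 0 * v 4 ^ (2 * bit u) ∧ (v 2 * v 1) ^ 4 = v 4 ^ (2 * bit c) ∧ v 3 = 1 := by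
  rw [show (v 2 * v 1) ^ 4 = v 2 * v 1 * v 2 * v 1 * v 2 * v 1 * v 2 * v 1 by
    simp only [pow_succ, pow_zero, one_mul, mul_assoc]]
  simp only [Satisfies, Std.eqs, Std.special, List.forall_mem_cons, wordEval_cons, wordEval_nil,
    mul_one, zpow_one, zpow_neg, mul_assoc]
  norm_cast
  simp

theorem satisfies_oneB_iff {u : Bool} : Satisfies v (Std.oneB u).eqs ↔
    v 1 ^ 2 = 1 ∧ v 1 * v 0 * v 1 = (v 0)⁻¹ ∧ v 4 ^ 4 = 1 ∧ v 1 * v 2 * v 1 = (v 2)⁻¹ ∧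
    v 2 ^ 4 = 1 ∧ (v 2)⁻¹ * v 0 * v 2 = v 0 * v 4 ^ (2 * bit u) ∧ v 3 = 1 := by
  simp only [Satisfies, Std.eqs, Std.special, List.forall_mem_cons, wordEval_cons, wordEval_nil,
    mul_one, zpow_one, zpow_neg, mul_assoc]
  norm_cast
  simp

theorem satisfies_twoA_iff {a b c : Bool} : Satisfies v (Std.twoA a b c).eqs ↔
    v 1 ^ 2 = 1 ∧ v 1 * v 0 * v 1 = (v 0)⁻¹ ∧ v 4 ^ 2 = 1 ∧ v 2 ^ 2 = 1 ∧
    v 1 * v 2 * v 1 = v 2 * v 4 ^ bit a ∧ (v 2)⁻¹ * v 0 ^ 2 * v 2 = v 0 ^ 2 * v 4 ^ bit b ∧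
    ((v 0)⁻¹ * (v 2)⁻¹ * v 0 * v 2) ^ 2 = v 4 ^ bit c ∧ v 3 = 1 := by
  rw [pow_two ((v 0)⁻¹ * (v 2)⁻¹ * v 0 * v 2)]
  simp only [Satisfies, Std.eqs, Std.special, comm, List.cons_append, List.nil_append,
    List.forall_mem_cons, wordEval_cons, wordEval_nil, mul_one, zpow_one, zpow_neg, mul_assoc]
  norm_cast
  simp

theorem satisfies_twoB_iff {c : Bool} : Satisfies v (Std.twoB c).eqs ↔
    v 1 ^ 2 = 1 ∧ v 1 * v 0 * v 1 = (v 0)⁻¹ ∧ v 4 ^ 4 = 1 ∧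
    v 1 * v 2 * v 1 = (v 2)⁻¹ ∧ v 2 ^ 2 = v 0 ^ 2 * v 4 ^ bit c ∧
    ((v 0)⁻¹ * (v 2)⁻¹ * v 0 * v 2) ^ 2 = v 4 ^ (2 * bit c) ∧ v 3 = 1 := by
  rw [pow_two ((v 0)⁻¹ * (v 2)⁻¹ * v 0 * v 2)]
  simp only [Satisfies, Std.eqs, Std.special, comm, List.cons_append, List.nil_append,
    List.forall_mem_cons, wordEval_cons, wordEval_nil, mul_one, zpow_one, zpow_neg, mul_assoc]
  norm_cast
  simp

theorem satisfies_three_iff {a b c d e : Bool} : Satisfies v (Std.three a b c d e).eqs ↔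
    v 1 ^ 2 = 1 ∧ v 1 * v 0 * v 1 = (v 0)⁻¹ ∧ v 4 ^ 4 = 1 ∧ v 2 ^ 2 = 1 ∧ v 3 ^ 2 = 1 ∧
    (v 0)⁻¹ * (v 2)⁻¹ * v 0 * v 2 = v 4 ^ (2 * bit a) ∧ (v 0)⁻¹ * (v 3)⁻¹ * v 0 * v 3 = v 4 ^ (2 * bit b) ∧
    (v 2)⁻¹ * (v 3)⁻¹ * v 2 * v 3 = v 4 ^ (2 * bit c) ∧ (v 2)⁻¹ * (v 1)⁻¹ * v 2 * v 1 = v 4 ^ (2 * bit d) ∧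
    (v 3)⁻¹ * (v 1)⁻¹ * v 3 * v 1 = v 4 ^ (2 * bit e) := by
  simp only [Satisfies, Std.eqs, Std.special, comm,
    List.forall_mem_cons, wordEval_cons, wordEval_nil, mul_one, zpow_one, zpow_neg, mul_assoc]
  norm_cast
  simp

theorem satisfies_nii_iff {a d : Bool} : Satisfies v (Std.nii a d).eqs ↔
    v 1 ^ 2 = 1 ∧ v 1 * v 0 * v 1 = (v 0)⁻¹ ∧ v 4 ^ 4 = 1 ∧ v 2 ^ 2 = 1 ∧
    (v 0)⁻¹ * (v 2)⁻¹ * v 0 * v 2 = v 4 ^ (2 * bit a) ∧ (v 2)⁻¹ * (v 1)⁻¹ * v 2 * v 1 = v 4 ^ (2 * bit d) ∧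
    v 3 = 1 := by
  simp only [Satisfies, Std.eqs, Std.special, comm,
    List.forall_mem_cons, wordEval_cons, wordEval_nil, mul_one, zpow_one, zpow_neg, mul_assoc]
  norm_cast
  simp

end

/-! ### Bounds for the orders of the groups with these presentations -/

section

open Subgroup

variable {G : Type*} [Group G] {p t w z h : G} {N : ℕ}

theorem conj_mem_of_mem_closure_singleton {a : G} (hp : a⁻¹ * p * a ∈ closure {p}) {g : G}
    (hg : g ∈ closure {p}) : a⁻¹ * g * a ∈ closure {p} := by
  rw [mem_closure_singleton] at hg
  obtain ⟨i, rfl⟩ := hg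
  rw [show a⁻¹ * p ^ i * a = (a⁻¹ * p * a) ^ i by simpa using (conj_zpow (a := a⁻¹) (b := p)).symm]
  exact zpow_mem hp i

theorem inv_eq_self_of_sq {g : G} (hg : g ^ 2 = 1) : g⁻¹ = g :=
  inv_eq_of_mul_eq_one_right (by rw [← pow_two, hg])

/-- Modulo `⟨p⟩` the involutions `w` and `t` generate a dihedral group of order at most 8. The chain
adjoins `(w * t) ^ 2`, which both of them invert, then `w`, then `t`. -/
theorem card_le_oneA (hN : 0 < N) (hgen : ∀ K : Subgroup G, p ∈ K → t ∈ K → w ∈ K → K = ⊤)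
    (hp : p ^ N = 1) (ht : t ^ 2 = 1) (htp : t * p * t = p⁻¹) (hw : w ^ 2 = 1)
    (hwp : w⁻¹ * p * w ∈ closure {p}) (hwt : (w * t) ^ 4 ∈ closure {p}) :
    Finite G ∧ Nat.card G ≤ 8 * N := by
  have ht' := inv_eq_self_of_sq ht
  have hw' := inv_eq_self_of_sq hw
  have htp' : t⁻¹ * p * t ∈ closure {p} := by
    rw [ht', htp]
    exact inv_mem (subset_closure (Set.mem_singleton _))
  have hz : ((w * t) ^ 2)⁻¹ = t * (w * t) ^ 2 * t := by
    rw [pow_two, mul_inv_rev, mul_inv_rev, ht', hw']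
    simp only [mul_assoc, ← pow_two t, ht, mul_one]
  refine card_le_of_extensions (p := p) (a := (w * t) ^ 2) (q := w) (r := t) hN
    (hgen _ (subset_closure (by simp)) (subset_closure (by simp)) (subset_closure (by simp))) hp
    ?_ ?_ ?_ ?_ ?_ ?_ ?_ ?_ ?_
  · rwa [← pow_mul]
  · rw [show ((w * t) ^ 2)⁻¹ * p * (w * t) ^ 2 =
      t⁻¹ * (w⁻¹ * (t⁻¹ * (w⁻¹ * p * w) * t) * w) * t by rw [pow_two]; group]
    exact conj_mem_of_mem_closure_singleton htp' <| conj_mem_of_mem_closure_singleton hwp <|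
      conj_mem_of_mem_closure_singleton htp' hwp
  · rw [hw]; exact one_mem _
  · exact closure_mono (by simp) hwp
  · rw [show w⁻¹ * (w * t) ^ 2 * w = ((w * t) ^ 2)⁻¹ by
      rw [hz, pow_two, hw']
      simp only [← mul_assoc, ← pow_two w, hw, one_mul]
      simp only [mul_assoc, ← pow_two t, ht, mul_one]]
    exact inv_mem (subset_closure (by simp))
  · rw [ht]; exact one_mem _
  · exact closure_mono (by simp) htp'
  · rw [ht', ← hz]
    exact inv_mem (subset_closure (by simp))
  · rw [show t⁻¹ * w * t = w⁻¹ * (w * t) ^ 2 by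
      rw [pow_two, ht', hw']
      simp only [← mul_assoc, ← pow_two w, hw, one_mul]]
    exact mul_mem (inv_mem (subset_closure (by simp))) (subset_closure (by simp))

theorem card_le_oneB (hN : 0 < N) (hgen : ∀ K : Subgroup G, p ∈ K → t ∈ K → w ∈ K → K = ⊤)
    (hp : p ^ N = 1) (ht : t ^ 2 = 1) (htp : t * p * t = p⁻¹) (htw : t * w * t = w⁻¹)
    (hw : w ^ 4 = 1) (hwp : w⁻¹ * p * w ∈ closure {p}) :
    Finite G ∧ Nat.card G ≤ 8 * N := by
  have ht' := inv_eq_self_of_sq ht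
  have htp' : t⁻¹ * p * t ∈ closure {p} := by
    rw [ht', htp]
    exact inv_mem (subset_closure (Set.mem_singleton _))
  refine card_le_of_extensions (p := p) (a := w ^ 2) (q := w) (r := t) hN
    (hgen _ (subset_closure (by simp)) (subset_closure (by simp)) (subset_closure (by simp))) hp
    ?_ ?_ ?_ ?_ ?_ ?_ ?_ ?_ ?_
  · rw [← pow_mul, hw]; exact one_mem _
  · exact conj_sq_mem hwp
  · exact subset_closure (by simp)
  · exact closure_mono (by simp) hwp
  · rw [show w⁻¹ * w ^ 2 * w = w ^ 2 by group]
    exact subset_closure (by simp)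
  · rw [ht]; exact one_mem _
  · exact closure_mono (by simp) htp'
  · rw [show t⁻¹ * w ^ 2 * t = (t⁻¹ * w * t) ^ 2 by rw [pow_two, pow_two]; group, ht', htw]
    exact pow_mem (inv_mem (subset_closure (by simp))) 2
  · rw [ht', htw]
    exact inv_mem (subset_closure (by simp))

/-- As `w` may fail to normalize `⟨p⟩`, the chain passes through `⟨z, p⟩` with the commutator `z` of
`p` and `w`. This `z` normalizes `⟨p⟩`, because `z⁻¹ * p * z` equals `z ^ (-2) * p⁻¹` times the
conjugate of `p ^ 2` by `w`. -/
theorem card_le_two (hN : 0 < N) (hgen : ∀ K : Subgroup G, p ∈ K → t ∈ K → w ∈ K → K = ⊤)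
    (hp : p ^ N = 1) (ht : t ^ 2 = 1) (htp : t * p * t = p⁻¹)
    (htw : t * w * t ∈ closure {w, p}) (hw : w ^ 2 ∈ closure {p})
    (hw2 : w⁻¹ * p ^ 2 * w ∈ closure {p})
    (hz : (p⁻¹ * w⁻¹ * p * w) ^ 2 ∈ closure {p}) :
    Finite G ∧ Nat.card G ≤ 8 * N := by
  have ht' := inv_eq_self_of_sq ht
  set z := p⁻¹ * w⁻¹ * p * w with hzdef
  have hwp : w⁻¹ * p * w = p * z := by rw [hzdef]; group
  have hpp : p ∈ closure {p} := subset_closure (Set.mem_singleton _)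
  have hp3 : p ∈ closure {w, z, p} := subset_closure (by simp)
  have hw3 : w ∈ closure {w, z, p} := subset_closure (by simp)
  have h1 : closure {p} ≤ closure {z, p} := closure_mono (by simp)
  have h3 : closure {w, p} ≤ closure {w, z, p} := closure_mono (by
    rintro _ (rfl | rfl) <;> simp)
  have hzz : z ∈ closure {z, p} := subset_closure (by simp)
  have hpz : p ∈ closure {z, p} := subset_closure (by simp)
  obtain ⟨i, hi⟩ := mem_closure_singleton.1 hw
  refine card_le_of_extensions (p := p) (a := z) (q := w) (r := t) hN
    (hgen _ (subset_closure (by simp)) (subset_closure (by simp)) (subset_closure (by simp))) hp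
    hz ?_ (h1 hw) ?_ ?_ ?_ ?_ ?_ (h3 ?_)
  · rw [show z⁻¹ * p * z = (z ^ 2)⁻¹ * (p⁻¹ * (w⁻¹ * p ^ 2 * w)) by
      rw [show w⁻¹ * p ^ 2 * w = (w⁻¹ * p * w) ^ 2 by rw [pow_two, pow_two]; group, hwp, pow_two,
        pow_two]
      group]
    exact mul_mem (inv_mem hz) (mul_mem (inv_mem hpp) hw2)
  · rw [hwp]; exact mul_mem hpz hzz
  · rw [show w⁻¹ * z * w = (w⁻¹ * p * w)⁻¹ * ((w ^ 2)⁻¹ * p * w ^ 2) by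
      rw [hzdef, pow_two]; group, hwp, ← hi]
    exact mul_mem (inv_mem (mul_mem hpz hzz)) (mul_mem (mul_mem (inv_mem (zpow_mem hpz _)) hpz)
      (zpow_mem hpz _))
  · rw [ht]; exact one_mem _
  · rw [ht', htp]; exact inv_mem hp3
  · rw [show t⁻¹ * z * t = (t⁻¹ * p * t)⁻¹ * (t⁻¹ * w * t)⁻¹ * (t⁻¹ * p * t) * (t⁻¹ * w * t) by
      rw [hzdef]; group, ht', htp]
    exact mul_mem (mul_mem (mul_mem (inv_mem (inv_mem hp3)) (inv_mem (h3 htw))) (inv_mem hp3))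
      (h3 htw)
  · rwa [ht']

/-- The commutator relation as a conjugation. -/
theorem conj_eq_of_commutator {a b c : G} (hab : a⁻¹ * b⁻¹ * a * b = c) : b⁻¹ * a * b = a * c := by
  rw [← hab]; group

theorem card_le_three {x : G} (hN : 0 < N)
    (hgen : ∀ K : Subgroup G, p ∈ K → t ∈ K → w ∈ K → x ∈ K → K = ⊤)
    (hp : p ^ N = 1) (ht : t ^ 2 = 1) (htp : t * p * t = p⁻¹) (hw : w ^ 2 = 1) (hx : x ^ 2 = 1)
    (hpw : p⁻¹ * w⁻¹ * p * w ∈ closure {p}) (hpx : p⁻¹ * x⁻¹ * p * x ∈ closure {p})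
    (hwx : w⁻¹ * x⁻¹ * w * x ∈ closure {p}) (hwt : w⁻¹ * t⁻¹ * w * t ∈ closure {p})
    (hxt : x⁻¹ * t⁻¹ * x * t ∈ closure {p}) :
    Finite G ∧ Nat.card G ≤ 8 * N := by
  have hmem : ∀ {a b : G} {S : Set G}, a ∈ S → p ∈ S → a⁻¹ * b⁻¹ * a * b ∈ closure {p} →
      b⁻¹ * a * b ∈ closure S := by
    intro a b S ha hp h
    rw [conj_eq_of_commutator rfl]
    exact mul_mem (subset_closure ha) (closure_mono (Set.singleton_subset_iff.2 hp) h)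
  refine card_le_of_extensions (p := p) (a := w) (q := x) (r := t) hN
    (hgen _ (subset_closure (by simp)) (subset_closure (by simp)) (subset_closure (by simp))
      (subset_closure (by simp))) hp ?_ (hmem (by simp) (by simp) hpw) ?_
    (hmem (by simp) (by simp) hpx) (hmem (by simp) (by simp) hwx) ?_ ?_
    (hmem (by simp) (by simp) hwt) (hmem (by simp) (by simp) hxt)
  · rw [hw]; exact one_mem _
  · rw [hx]; exact one_mem _
  · rw [ht]; exact one_mem _
  · rw [inv_eq_self_of_sq ht, htp]
    exact inv_mem (subset_closure (by simp))

theorem card_le_nii (hN : 0 < N)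
    (hgen : ∀ K : Subgroup G, p ∈ K → t ∈ K → w ∈ K → K = ⊤)
    (hp : p ^ N = 1) (ht : t ^ 2 = 1) (htp : t * p * t = p⁻¹) (hw : w ^ 2 = 1)
    (hpw : p⁻¹ * w⁻¹ * p * w ∈ closure {p}) (hwt : w⁻¹ * t⁻¹ * w * t ∈ closure {p}) :
    Finite G ∧ Nat.card G ≤ 4 * N := by
  have hpp : p ∈ closure {p} := subset_closure (Set.mem_singleton _)
  refine card_le_of_two_extensions (p := p) (q := w) (r := t) hN
    (hgen _ (subset_closure (by simp)) (subset_closure (by simp)) (subset_closure (by simp))) hp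
    ?_ ?_ ?_ ?_ ?_
  · rw [hw]; exact one_mem _
  · rw [conj_eq_of_commutator rfl]
    exact mul_mem hpp hpw
  · rw [ht]; exact one_mem _
  · rw [inv_eq_self_of_sq ht, htp]
    exact inv_mem (subset_closure (by simp))
  · rw [conj_eq_of_commutator rfl]
    exact mul_mem (subset_closure (by simp)) (closure_mono (by simp) hwt)

end

section

open Subgroup

variable {n : ℕ} {s : Std} {G : Type*} [Group G] {v : ℕ → G}

theorem IsStd.eq_top (hv : IsStd n s v) (K : Subgroup G) (h0 : v 0 ∈ K) (h1 : v 1 ∈ K)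
    (h2 : v 2 ∈ K) (h3 : v 3 ∈ K) : K = ⊤ := by
  rw [← top_le_iff, ← hv.closure_eq_top, closure_le]
  rintro _ (rfl | rfl | rfl | rfl) <;> assumption

theorem IsStd.mem_closure (hv : IsStd n s v) (e : ℤ) : v 4 ^ e ∈ closure {v 0} := by
  rw [hv.four]
  exact zpow_mem (pow_mem (subset_closure (Set.mem_singleton _)) _) e

theorem IsStd.pow_eq_one (hv : IsStd n s v) : v 0 ^ 2 ^ (n + 4) = 1 := by
  obtain ⟨h4, -, hs, -⟩ := hv
  have key : v 4 ^ 2 ^ (4 - s.level) = 1 := by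
    cases s with
    | oneA u c => exact (satisfies_oneA_iff.1 hs).2.2.1
    | oneB u => exact (satisfies_oneB_iff.1 hs).2.2.1
    | twoA a b c => exact (satisfies_twoA_iff.1 hs).2.2.1
    | twoB c => exact (satisfies_twoB_iff.1 hs).2.2.1
    | three a b c d e => exact (satisfies_three_iff.1 hs).2.2.1
    | nii a d => exact (satisfies_nii_iff.1 hs).2.2.1
  have hl : s.level ≤ 4 := by cases s <;> simp [Std.level]
  rw [h4, ← pow_mul, ← pow_add] at key
  rwa [show n + 4 = n + s.level + (4 - s.level) by omega]

/-- In the last family but one, the square of the generator `0` is a power of the square of the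
generator `2`. -/
theorem sq_mem_of_sq_eq {p w y : G} {c : ℤ} (hy : y = p ^ 2 ^ (n + 2)) (hp : p ^ 2 ^ (n + 4) = 1)
    (hw : w ^ 2 = p ^ 2 * y ^ c) : p ^ 2 ∈ closure {w ^ 2} := by
  have hw' : w ^ 2 = p ^ ((2 : ℤ) + 2 ^ (n + 2) * c) := by
    rw [hw, hy, zpow_add, zpow_mul]
    norm_cast
  -- With `x = 2 ^ (n + 1) * c` one has `w ^ 2 = p ^ (2 * (1 + x))` and `(1 + x) * (1 - x + x ^ 2) =
  -- 1 + x ^ 3`, where `2 * x ^ 3` is a multiple of `2 ^ (n + 4)`.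
  refine mem_closure_singleton.2 ⟨1 - 2 ^ (n + 1) * c + 2 ^ (2 * n + 2) * c ^ 2, ?_⟩
  have hp' : p ^ ((2 : ℤ) ^ (n + 4)) = 1 := by exact_mod_cast hp
  rw [hw', ← zpow_mul, show ((2 : ℤ) + 2 ^ (n + 2) * c) *
    (1 - 2 ^ (n + 1) * c + 2 ^ (2 * n + 2) * c ^ 2) = 2 + 2 ^ (n + 4) * (2 ^ (2 * n) * c ^ 3) by
      ring, zpow_add, zpow_mul, hp', one_zpow, mul_one]
  norm_cast

/-- The upper bound for the order of a group with one of the presentations. -/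
theorem IsStd.card_le (hv : IsStd n s v) : Finite G ∧ Nat.card G ≤ s.index * 2 ^ (n + 4) := by
  have hp := hv.pow_eq_one
  have hN : 0 < 2 ^ (n + 4) := by positivity
  have htop := hv.eq_top
  have h4 := hv.mem_closure
  have hpp : v 0 ∈ closure {v 0} := subset_closure (Set.mem_singleton _)
  have hs := hv.satisfies
  cases s with
  | oneA u c =>
    obtain ⟨ht, htp, -, hw, hwp, hwt, h3⟩ := satisfies_oneA_iff.1 hs
    refine card_le_oneA hN (fun K h0 h1 h2 => htop K h0 h1 h2 (h3 ▸ one_mem K)) hp ht htp hw ?_ ?_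
    · rw [hwp]; exact mul_mem hpp (h4 _)
    · rw [hwt]; exact h4 _
  | oneB u =>
    obtain ⟨ht, htp, -, htw, hw, hwp, h3⟩ := satisfies_oneB_iff.1 hs
    refine card_le_oneB hN (fun K h0 h1 h2 => htop K h0 h1 h2 (h3 ▸ one_mem K)) hp ht htp htw hw ?_
    rw [hwp]; exact mul_mem hpp (h4 _)
  | twoA a b c =>
    obtain ⟨ht, htp, -, hw, htw, hw2, hz, h3⟩ := satisfies_twoA_iff.1 hs
    refine card_le_two hN (fun K h0 h1 h2 => htop K h0 h1 h2 (h3 ▸ one_mem K)) hp ht htp ?_ ?_ ?_ ?_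
    · rw [htw]
      exact mul_mem (subset_closure (by simp)) (closure_mono (by simp) (h4 _))
    · rw [hw]; exact one_mem _
    · rw [hw2]; exact mul_mem (pow_mem hpp 2) (h4 _)
    · rw [hz]; exact h4 _
  | twoB c =>
    obtain ⟨ht, htp, -, htw, hw, hz, h3⟩ := satisfies_twoB_iff.1 hs
    refine card_le_two hN (fun K h0 h1 h2 => htop K h0 h1 h2 (h3 ▸ one_mem K)) hp ht htp ?_ ?_ ?_ ?_
    · rw [htw]
      exact inv_mem (subset_closure (by simp))
    · rw [hw]; exact mul_mem (pow_mem hpp 2) (h4 _)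
    -- As a power of `w ^ 2`, the element `p ^ 2` commutes with `w`; the presentation does not say
    -- this explicitly.
    · obtain ⟨i, hi⟩ := mem_closure_singleton.1 (sq_mem_of_sq_eq hv.four hp hw)
      rw [show (v 2)⁻¹ * v 0 ^ 2 * v 2 = v 0 ^ 2 by
        rw [← hi, ← zpow_natCast, ← zpow_mul]; group]
      exact pow_mem hpp 2
    · rw [hz]; exact h4 _
  | three a b c d e =>
    obtain ⟨ht, htp, -, hw, hx, h1, h2, h3, h5, h6⟩ := satisfies_three_iff.1 hs
    exact card_le_three hN htop hp ht htp hw hx (h1 ▸ h4 _) (h2 ▸ h4 _) (h3 ▸ h4 _) (h5 ▸ h4 _)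
      (h6 ▸ h4 _)
  | nii a d =>
    obtain ⟨ht, htp, -, hw, h1, h2, h3⟩ := satisfies_nii_iff.1 hs
    exact card_le_nii hN (fun K k0 k1 k2 => htop K k0 k1 k2 (h3 ▸ one_mem K)) hp ht htp hw
      (h1 ▸ h4 _) (h2 ▸ h4 _)

/-- The groups with these presentations are generated by involutions. -/
theorem IsStd.generatedByInvolutions (hv : IsStd n s v) : GeneratedByInvolutions G := by
  set K : Subgroup G := closure {g : G | orderOf g = 2} with hK
  have hinv : ∀ g : G, g ^ 2 = 1 → g ∈ K := by
    intro g hg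
    by_cases h1 : g = 1
    · rw [h1]; exact one_mem _
    · exact subset_closure (orderOf_eq_prime hg h1)
  -- An element `g` inverted by `t` is the product of `t` and `t * g`, both of which square to 1.
  have hmul : ∀ t g : G, t ^ 2 = 1 → t * g * t = g⁻¹ → g ∈ K := by
    intro t g ht htg
    have h1 := mul_mem (hinv t ht) (hinv (t * g) (by rw [pow_two, ← mul_assoc, htg]; simp))
    rwa [← mul_assoc, ← pow_two, ht, one_mul] at h1
  have hs := hv.satisfies
  have htop := hv.eq_top K
  cases s with
  | oneA u c =>
    obtain ⟨ht, htp, -, hw, -, -, h3⟩ := satisfies_oneA_iff.1 hs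
    exact htop (hmul _ _ ht htp) (hinv _ ht) (hinv _ hw) (h3 ▸ one_mem K)
  | oneB u =>
    obtain ⟨ht, htp, -, htw, -, -, h3⟩ := satisfies_oneB_iff.1 hs
    exact htop (hmul _ _ ht htp) (hinv _ ht) (hmul _ _ ht htw) (h3 ▸ one_mem K)
  | twoA a b c =>
    obtain ⟨ht, htp, -, hw, -, -, -, h3⟩ := satisfies_twoA_iff.1 hs
    exact htop (hmul _ _ ht htp) (hinv _ ht) (hinv _ hw) (h3 ▸ one_mem K)
  | twoB c =>
    obtain ⟨ht, htp, -, htw, -, -, h3⟩ := satisfies_twoB_iff.1 hs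
    exact htop (hmul _ _ ht htp) (hinv _ ht) (hmul _ _ ht htw) (h3 ▸ one_mem K)
  | three a b c d e =>
    obtain ⟨ht, htp, -, hw, hx, -⟩ := satisfies_three_iff.1 hs
    exact htop (hmul _ _ ht htp) (hinv _ ht) (hinv _ hw) (hinv _ hx)
  | nii a d =>
    obtain ⟨ht, htp, -, hw, -, -, h3⟩ := satisfies_nii_iff.1 hs
    exact htop (hmul _ _ ht htp) (hinv _ ht) (hinv _ hw) (h3 ▸ one_mem K)

end

/-! ### The listed groups that have these presentations -/

open Family in
/-- The listed group with a given presentation, the generators of the presentation as products of a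
power of the generator `0`, a power of the letter `4` and a representative of a coset, and the
generators of the group as words in the generators of the presentation. -/
def Std.data : Std → (Family × ℕ) × List (ℤ × ℤ × ℕ) × List (List (ℕ × ℤ))
  | oneA false false =>
    ((MIIB, 19), [(1, 0, 0), (0, 0, 5), (0, 0, 4)],
      [[(0, 1)], [(1, 1), (2, 1)], [(2, 1)]])
  | oneA false true =>
    ((MIIC, 5), [(1, 0, 0), (0, 0, 5), (0, 0, 4)],
      [[(0, 1)], [(1, 1), (2, 1)], [(2, 1)]])
  | oneA true false =>
    ((MIIB, 20), [(1, 0, 0), (0, 0, 5), (0, 0, 4)],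
      [[(0, 1)], [(1, 1), (2, 1)], [(2, 1)]])
  | oneA true true =>
    ((MIIC, 5), [(1, 0, 2), (0, 0, 5), (0, 0, 4)],
      [[(0, 1), (2, 1), (1, 1), (2, 1), (1, 1)], [(1, 1), (2, 1)], [(2, 1)]])
  | oneB false =>
    ((MIIA, 39), [(1, 0, 0), (0, 0, 4), (0, 0, 1)],
      [[(0, 1)], [(2, 1)], [(1, 1)]])
  | oneB true =>
    ((MIIA, 40), [(1, 0, 0), (0, 0, 4), (0, 0, 1)],
      [[(0, 1)], [(2, 1)], [(1, 1)]])
  | twoA false false false =>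
    ((MIID, 19), [(1, 0, 0), (1, 0, 5), (0, 0, 4)],
      [[(0, 1)], [(0, -1), (1, 1), (2, 1)], [(2, 1)]])
  | twoA false true false =>
    ((MIID, 3), [(1, 0, 0), (1, 0, 7), (0, 0, 6)],
      [[(0, 1)], [(0, -1), (1, 1), (2, 1)], [(0, -1), (2, 1), (0, 1)]])
  | twoA false true true =>
    ((MIIF, 9), [(1, 0, 0), (1, 0, 5), (0, 0, 6)],
      [[(0, 1)], [(1, 1), (2, 1), (0, 1)], [(0, -1), (2, 1), (0, 1)]])
  | twoA true false false =>
    ((MIID, 17), [(1, 0, 4), (1, 0, 1), (0, 0, 4)],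
      [[(0, 1), (2, 1)], [(2, 1), (0, -1), (1, 1)], [(2, 1)]])
  | twoA true true false =>
    ((MIID, 3), [(1, 0, 0), (1, 0, 7), (0, 0, 4)],
      [[(0, 1)], [(2, 1), (0, -1), (1, 1)], [(2, 1)]])
  | twoA true true true =>
    ((MIIF, 9), [(1, 0, 0), (1, 0, 5), (0, 0, 4)],
      [[(0, 1)], [(0, -1), (1, 1), (2, 1)], [(2, 1)]])
  | twoB false =>
    ((MIID, 18), [(1, 0, 0), (0, 0, 4), (1, 0, 5)],
      [[(0, 1)], [(0, 1), (1, 1), (2, 1)], [(1, 1)]])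
  | three false false false false false =>
    ((MIII, 5), [(1, 0, 0), (0, 0, 4), (0, 0, 1), (0, 0, 2)],
      [[(0, 1)], [(2, 1)], [(3, 1)], [(1, 1)]])
  | three false false false false true =>
    ((MIII, 3), [(1, 0, 0), (0, 0, 4), (0, 0, 1), (0, 0, 2)],
      [[(0, 1)], [(2, 1)], [(3, 1)], [(1, 1)]])
  | three false false false true false =>
    ((MIII, 3), [(1, 0, 0), (0, 0, 4), (0, 0, 2), (0, 0, 1)],
      [[(0, 1)], [(3, 1)], [(2, 1)], [(1, 1)]])
  | three false false false true true =>
    ((MIII, 3), [(1, 0, 0), (0, 0, 4), (0, 0, 2), (0, 0, 3)],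
      [[(0, 1)], [(2, 1), (3, 1)], [(2, 1)], [(1, 1)]])
  | three false false true false false =>
    ((MIII, 10), [(1, 0, 0), (0, 0, 2), (0, 0, 1), (0, 0, 5)],
      [[(0, 1)], [(2, 1)], [(1, 1)], [(2, 1), (3, 1)]])
  | three false false true false true =>
    ((MIII, 10), [(1, 0, 0), (0, 0, 2), (0, 0, 1), (0, 1, 4)],
      [[(0, 1)], [(2, 1)], [(1, 1)], [(3, 1), (4, -1)]])
  | three false false true true false =>
    ((MIII, 10), [(1, 0, 0), (0, 0, 2), (0, 1, 4), (0, 0, 1)],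
      [[(0, 1)], [(3, 1)], [(1, 1)], [(2, 1), (4, -1)]])
  | three false false true true true =>
    ((MIII, 14), [(1, 0, 0), (0, 0, 4), (0, 0, 1), (0, 1, 6)],
      [[(0, 1)], [(2, 1)], [(1, 1), (3, 1), (4, -1)], [(1, 1)]])
  | three false true false false false =>
    ((MIII, 4), [(1, 0, 0), (0, 0, 6), (0, 0, 1), (0, 0, 2)],
      [[(0, 1)], [(2, 1)], [(3, 1)], [(1, 1), (3, 1)]])
  | three false true false false true =>
    ((MIII, 4), [(1, 0, 0), (1, 0, 6), (0, 0, 1), (0, 0, 2)],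
      [[(0, 1)], [(2, 1)], [(3, 1)], [(0, -1), (1, 1), (3, 1)]])
  | three false true false true false =>
    ((MIII, 13), [(1, 0, 0), (0, 0, 4), (0, 0, 1), (0, 0, 2)],
      [[(0, 1)], [(2, 1)], [(3, 1)], [(1, 1)]])
  | three false true false true true =>
    ((MIII, 13), [(1, 0, 0), (0, 0, 4), (0, 0, 1), (0, 0, 3)],
      [[(0, 1)], [(2, 1)], [(2, 1), (3, 1)], [(1, 1)]])
  | three false true true false false =>
    ((MIII, 10), [(1, 0, 1), (0, 0, 2), (0, 0, 1), (0, 0, 5)],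
      [[(0, 1), (2, 1)], [(2, 1)], [(1, 1)], [(2, 1), (3, 1)]])
  | three false true true false true =>
    ((MIII, 10), [(1, 0, 1), (0, 0, 2), (0, 0, 1), (0, 1, 4)],
      [[(0, 1), (2, 1)], [(2, 1)], [(1, 1)], [(3, 1), (4, -1)]])
  | three false true true true false =>
    ((MIII, 11), [(1, 0, 1), (0, 0, 7), (0, 0, 1), (0, 1, 4)],
      [[(0, 1), (2, 1)], [(2, 1)], [(1, 1), (2, 1), (3, 1), (4, -1)], [(3, 1), (4, -1)]])
  | three false true true true true =>
    ((MIII, 11), [(1, 0, 1), (1, 0, 6), (0, 0, 1), (0, 1, 4)],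
      [[(0, 1), (2, 1)], [(2, 1)], [(0, -1), (1, 1), (2, 1), (3, 1), (4, -1)], [(3, 1), (4, -1)]])
  | three true false false false false =>
    ((MIII, 4), [(1, 0, 0), (0, 0, 6), (0, 0, 2), (0, 0, 1)],
      [[(0, 1)], [(3, 1)], [(2, 1)], [(1, 1), (2, 1)]])
  | three true false false false true =>
    ((MIII, 13), [(1, 0, 0), (0, 0, 4), (0, 0, 2), (0, 0, 1)],
      [[(0, 1)], [(3, 1)], [(2, 1)], [(1, 1)]])
  | three true false false true false =>
    ((MIII, 4), [(1, 0, 0), (1, 0, 6), (0, 0, 2), (0, 0, 1)],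
      [[(0, 1)], [(3, 1)], [(2, 1)], [(0, -1), (1, 1), (2, 1)]])
  | three true false false true true =>
    ((MIII, 13), [(1, 0, 0), (0, 0, 4), (0, 0, 3), (0, 0, 1)],
      [[(0, 1)], [(3, 1)], [(2, 1), (3, 1)], [(1, 1)]])
  | three true false true false false =>
    ((MIII, 10), [(1, 0, 1), (0, 0, 2), (0, 0, 5), (0, 0, 1)],
      [[(0, 1), (3, 1)], [(3, 1)], [(1, 1)], [(3, 1), (2, 1)]])
  | three true false true false true =>
    ((MIII, 11), [(1, 0, 1), (0, 0, 7), (0, 1, 4), (0, 0, 1)],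
      [[(0, 1), (3, 1)], [(3, 1)], [(1, 1), (2, 1), (3, 1), (4, 1)], [(2, 1), (4, -1)]])
  | three true false true true false =>
    ((MIII, 10), [(1, 0, 1), (0, 0, 2), (0, 1, 4), (0, 0, 1)],
      [[(0, 1), (3, 1)], [(3, 1)], [(1, 1)], [(2, 1), (4, -1)]])
  | three true false true true true =>
    ((MIII, 11), [(1, 0, 1), (1, 0, 6), (0, 1, 4), (0, 0, 1)],
      [[(0, 1), (3, 1)], [(3, 1)], [(0, -1), (1, 1), (2, 1), (3, 1), (4, 1)], [(2, 1), (4, -1)]])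
  | three true true false false false =>
    ((MIII, 4), [(1, 0, 0), (0, 0, 6), (0, 0, 2), (0, 0, 3)],
      [[(0, 1)], [(2, 1), (3, 1)], [(2, 1)], [(1, 1), (2, 1)]])
  | three true true false false true =>
    ((MIII, 13), [(1, 0, 0), (0, 0, 4), (0, 0, 2), (0, 0, 3)],
      [[(0, 1)], [(2, 1), (3, 1)], [(2, 1)], [(1, 1)]])
  | three true true false true false =>
    ((MIII, 13), [(1, 0, 0), (0, 0, 4), (0, 0, 3), (0, 0, 2)],
      [[(0, 1)], [(2, 1), (3, 1)], [(3, 1)], [(1, 1)]])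
  | three true true false true true =>
    ((MIII, 4), [(1, 0, 0), (1, 0, 6), (0, 0, 2), (0, 0, 3)],
      [[(0, 1)], [(2, 1), (3, 1)], [(2, 1)], [(0, -1), (1, 1), (2, 1)]])
  | three true true true false false =>
    ((MIII, 11), [(1, 0, 1), (0, 0, 7), (0, 1, 4), (0, 0, 5)],
      [[(0, 1), (2, 1), (3, 1), (4, -1)], [(2, 1), (3, 1), (4, -1)], [(1, 1), (3, 1)], [(2, 1), (4, -1)]])
  | three true true true false true =>
    ((MIII, 10), [(1, 0, 1), (0, 0, 2), (0, 0, 5), (0, 1, 4)],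
      [[(0, 1), (2, 1), (3, 1), (4, 1)], [(2, 1), (3, 1), (4, 1)], [(1, 1)], [(3, 1), (4, -1)]])
  | three true true true true false =>
    ((MIII, 10), [(1, 0, 1), (0, 0, 2), (0, 1, 4), (0, 0, 5)],
      [[(0, 1), (2, 1), (3, 1), (4, -1)], [(2, 1), (3, 1), (4, -1)], [(1, 1)], [(2, 1), (4, -1)]])
  | three true true true true true =>
    ((MIII, 11), [(1, 0, 1), (1, 0, 6), (0, 1, 4), (0, 0, 5)],
      [[(0, 1), (2, 1), (3, 1), (4, -1)], [(2, 1), (3, 1), (4, -1)], [(0, -1), (1, 1), (3, 1)], [(2, 1), (4, -1)]])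
  | nii false false =>
    ((NII, 5), [(1, 0, 0), (0, 0, 2), (0, 0, 1)],
      [[(0, 1)], [(2, 1)], [(1, 1)]])
  | nii false true =>
    ((NII, 3), [(1, 0, 0), (0, 0, 2), (0, 0, 1)],
      [[(0, 1)], [(2, 1)], [(1, 1)]])
  | nii true false =>
    ((NII, 4), [(1, 0, 0), (0, 0, 3), (0, 0, 1)],
      [[(0, 1)], [(2, 1)], [(1, 1), (2, 1)]])
  | nii true true =>
    ((NII, 4), [(1, 0, 0), (1, 0, 3), (0, 0, 1)],
      [[(0, 1)], [(2, 1)], [(0, -1), (1, 1), (2, 1)]])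
  | twoA false false true =>
    ((MIIF, 9), [(1, 0, 4), (-1, 0, 1), (0, 0, 4)],
      [[(0, 1), (2, 1)], [(0, 1), (1, 1), (2, 1)], [(2, 1)]])
  | twoA true false true =>
    ((MIIF, 8), [(1, 0, 4), (-1, 0, 1), (0, 0, 4)],
      [[(0, 1), (2, 1)], [(0, 1), (2, 1), (1, 1)], [(2, 1)]])
  | twoB true =>
    ((MIIE, 1), [(1, 0, 0), (0, 0, 4), (1, 1, 1)],
      [[(0, 1)], [(0, 1), (2, -1)], [(1, 1)]])

/-- The inverse of a word. -/
def invWord (w : List (ℕ × ℤ)) : List (ℕ × ℤ) := (w.map fun x => (x.1, -x.2)).reverse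

/-- Substitution of words for the letters of a word. -/
def substWord (sw : ℕ → List (ℕ × ℤ)) (w : List (ℕ × ℤ)) : List (ℕ × ℤ) :=
  w.flatMap fun x =>
    match x.2 with
    | Int.ofNat e => (List.replicate e (sw x.1)).flatten
    | Int.negSucc e => (List.replicate (e + 1) (invWord (sw x.1))).flatten

section

variable {G : Type*} [Group G] (v : ℕ → G)

theorem wordEval_invWord (w : List (ℕ × ℤ)) : wordEval v (invWord w) = (wordEval v w)⁻¹ := by
  induction w with
  | nil => simp [invWord, wordEval]
  | cons x w ih =>
    rw [wordEval_cons, mul_inv_rev, ← ih, invWord, List.map_cons, List.reverse_cons,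
      wordEval_append]
    simp [invWord, wordEval]

theorem wordEval_flatten_replicate (w : List (ℕ × ℤ)) (e : ℕ) :
    wordEval v (List.replicate e w).flatten = wordEval v w ^ e := by
  induction e with
  | zero => simp [wordEval]
  | succ e ih => rw [List.replicate_succ, List.flatten_cons, wordEval_append, ih, pow_succ']

theorem wordEval_substWord (sw : ℕ → List (ℕ × ℤ)) (w : List (ℕ × ℤ)) :
    wordEval v (substWord sw w) = wordEval (fun i => wordEval v (sw i)) w := by
  induction w with
  | nil => rfl
  | cons x w ih =>
    rw [wordEval_cons, ← ih, substWord, List.flatMap_cons, wordEval_append]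
    congr 1
    cases x.2 with
    | ofNat e => rw [wordEval_flatten_replicate, Int.ofNat_eq_natCast, zpow_natCast]
    | negSucc e => rw [wordEval_flatten_replicate, wordEval_invWord, inv_pow, zpow_negSucc]

end

/-- The generators of the presentation as words in the generators of the listed group. -/
def Std.word (s : Std) (i : ℕ) : List (ℕ × ℤ) :=
  if i = 4 then [(4, 2 ^ (s.level - 2))] else
    match s.data.2.1[i]? with
    | some (a, b, j) => (0, a) :: (4, b) :: s.data.1.1.rep j
    | none => []

/-- The table of the listed group confirms the equations of the presentation. -/
def Std.check (s : Std) : Bool :=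
  let J := s.data.1.1.index
  let T := s.data.1.1.table s.data.1.2
  s.index == J && s.data.2.1.length ≤ 4 && s.data.1 ∈ gamma &&
    -- The new generator `0` may differ from the old one, but their powers of exponent `2 ^ level`
    -- agree. Hence the letter `4`, a power of the old generator, is also the required power of the
    -- new one.
    agree J T (substWord s.word [(0, 2 ^ s.level)]) [(0, 2 ^ s.level)] &&
    (s.eqs.all fun e => agree J T (substWord s.word e.1) (substWord s.word e.2)) &&
    -- Recovering the old generators from the new ones shows that the new ones generate the group.
    (List.range s.data.1.1.rank).all fun i =>
      agree J T (substWord s.word (s.data.2.2.getD i [])) [(i, 1)]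

theorem Std.check_eq_true (s : Std) : s.check = true := by
  cases s with
  | oneA u c => revert u c; decide +kernel
  | oneB u => revert u; decide +kernel
  | twoA a b c => revert a b c; decide +kernel
  | twoB c => revert c; decide +kernel
  | three a b c d e => revert a b c d e; decide +kernel
  | nii a d => revert a d; decide +kernel

theorem le_count_of_mem_gamma {F : Family} {k : ℕ} (h : (F, k) ∈ gamma) : 1 ≤ k ∧ k ≤ F.count := by
  have : ∀ x ∈ gamma, 1 ≤ x.2 ∧ x.2 ≤ x.1.count := by decide
  exact this _ h

namespace Std

variable (s : Std)

/-- The family of the listed group with the presentation `s`. -/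
abbrev family : Family := s.data.1.1

/-- The number of the listed group with the presentation `s`. -/
abbrev number : ℕ := s.data.1.2

theorem check_iff : s.check = true ↔ s.index = s.family.index ∧ s.data.2.1.length ≤ 4 ∧
    s.data.1 ∈ gamma ∧
    agree s.family.index (s.family.table s.number) (substWord s.word [(0, 2 ^ s.level)])
      [(0, 2 ^ s.level)] = true ∧
    (∀ e ∈ s.eqs, agree s.family.index (s.family.table s.number) (substWord s.word e.1)
      (substWord s.word e.2) = true) ∧
    ∀ i < s.family.rank, agree s.family.index (s.family.table s.number)
      (substWord s.word (s.data.2.2.getD i [])) [(i, 1)] = true := by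
  simp [Std.check, and_assoc]

theorem mem_gamma : (s.family, s.number) ∈ gamma := (s.check_iff.1 s.check_eq_true).2.2.1

/-- The listed group with the presentation `s` is realized by its table. -/
theorem realizes (n : ℕ) : Realizes n s.family.index (s.family.table s.number) s.family.rep
    (letters n (s.family.relators (n + s.family.minM) s.number)) :=
  realizes_listed _ n (le_count_of_mem_gamma s.mem_gamma).1 (le_count_of_mem_gamma s.mem_gamma).2

theorem card_grp (n : ℕ) :
    Nat.card (Grp s.family s.number (n + s.family.minM)) = s.index * 2 ^ (n + 4) := by
  rw [(s.check_iff.1 s.check_eq_true).1]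
  exact (s.realizes n).card_eq

theorem closure_letters (n : ℕ) {k : ℕ} [NeZero k] (rels : Set (FreeGroup (Fin k)))
    {K : Subgroup (PresentedGroup rels)} (h : ∀ i < k, letters n rels i ∈ K) : K = ⊤ := by
  rw [← top_le_iff, ← PresentedGroup.closure_range_of rels, Subgroup.closure_le]
  rintro _ ⟨i, rfl⟩
  have := h i i.2
  rwa [letters_of_lt n rels i.2] at this

/-- The listed group has the presentation `s`. -/
theorem isStd (n : ℕ) : IsStd n s fun i =>
    wordEval (letters n (s.family.relators (n + s.family.minM) s.number)) (s.word i) := by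
  obtain ⟨-, h1, -, h2, h3, h4⟩ := s.check_iff.1 s.check_eq_true
  have R := s.realizes n
  refine IsStd.of_closure_range ?_ (fun i hi => ?_) (fun e he => ?_) ?_
  · have h := R.wordEval_eq h2
    have hl : 2 ≤ s.level := by cases s <;> simp [level]
    have h40 : letters n (s.family.relators (n + s.family.minM) s.number) 4 =
        letters n (s.family.relators (n + s.family.minM) s.number) 0 ^ 2 ^ (n + 2) := by
      have h4k : ¬ 4 < s.family.rank := by unfold Family.rank; split <;> omega
      rw [letters, dif_neg h4k, if_pos rfl, letters_zero]
    rw [wordEval_substWord] at h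
    simp only [wordEval_cons, wordEval_nil, mul_one] at h
    rw [pow_add, mul_comm, pow_mul, ← zpow_natCast _ (2 ^ s.level), Nat.cast_pow, Nat.cast_ofNat, h,
      word, if_pos rfl, wordEval_cons, wordEval_nil, mul_one]
    simp only
    rw [h40, ← zpow_natCast, ← zpow_mul, ← zpow_natCast, ← zpow_mul]
    congr 1
    push_cast
    rw [← pow_add, ← pow_add]
    congr 1
    omega
  · rw [word, if_neg (by omega), List.getElem?_eq_none (by omega)]
    rfl
  · have h := R.wordEval_eq (h3 e he)
    rwa [wordEval_substWord, wordEval_substWord] at h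
  · refine closure_letters n _ fun i hi => ?_
    have h := R.wordEval_eq (h4 i hi)
    rw [wordEval_substWord, wordEval_cons, wordEval_nil, mul_one, zpow_one] at h
    rw [← h]
    refine Subgroup.list_prod_mem _ fun x hx => ?_
    obtain ⟨y, -, rfl⟩ := List.mem_map.1 hx
    exact Subgroup.zpow_mem _ (Subgroup.subset_closure (Set.mem_range_self _)) _

variable {s}

/-- A group with the presentation `s` and the largest possible order is the listed group. -/
theorem nonempty_mulEquiv_grp {G : Type*} [Group G] {n : ℕ} {v : ℕ → G} (hv : IsStd n s v)
    (hG : Nat.card G = s.index * 2 ^ (n + 4)) :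
    Nonempty (G ≃* Grp s.family s.number (n + s.family.minM)) :=
  hv.nonempty_mulEquiv (s.isStd n) hG (s.card_grp n) fun _ _ hw => hw.card_le

end Std

theorem exists_std_of_mem_gamma {F : Family} {k : ℕ} (h : (F, k) ∈ gamma) :
    ∃ s : Std, s.family = F ∧ s.number = k := by
  have : ∀ x ∈ gamma, x ∈ [Std.nii false true, .nii true false, .nii false false, .oneB false,
      .oneB true, .oneA false false, .oneA true false, .oneA false true, .twoA false true false,
      .twoA true false false, .twoB false, .twoA false false false, .twoB true,
      .twoA true false true, .twoA false false true, .three false false false false true,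
      .three false true false false false, .three false false false false false,
      .three false false true false false, .three false true true true false,
      .three false true false true false, .three false false true true true].map
      fun s => s.data.1 := by decide
  obtain ⟨s, -, hs⟩ := List.mem_map.1 (this _ h)
  exact ⟨s, congrArg Prod.fst hs, congrArg Prod.snd hs⟩

theorem generatedByInvolutions_of_mem_gamma {F : Family} {k m : ℕ} (h : (F, k) ∈ gamma)
    (hm : F.minM ≤ m) : GeneratedByInvolutions (Grp F k m) := by
  obtain ⟨n, rfl⟩ := Nat.exists_eq_add_of_le' hm
  obtain ⟨s, rfl, rfl⟩ := exists_std_of_mem_gamma h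
  exact (s.isStd n).generatedByInvolutions

theorem generatedByInvolutions_iff_mem_gamma (F : Family) {k m : ℕ} (h1 : 1 ≤ k)
    (h2 : k ≤ F.count) (hm : F.minM ≤ m) :
    GeneratedByInvolutions (Grp F k m) ↔ (F, k) ∈ gamma :=
  ⟨mem_gamma_of_generatedByInvolutions F h1 h2 hm, fun h => generatedByInvolutions_of_mem_gamma h hm⟩

theorem GeneratedByInvolutions.of_mulEquiv {G H : Type*} [Group G] [Group H] (e : G ≃* H)
    (h : GeneratedByInvolutions H) : GeneratedByInvolutions G := by
  unfold GeneratedByInvolutions at *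
  have h2 := congrArg (Subgroup.map e.symm.toMonoidHom) h
  rw [MonoidHom.map_closure, Subgroup.map_top_of_surjective _ e.symm.surjective] at h2
  rw [← h2]
  congr 1
  ext g
  constructor
  · exact fun hg => ⟨e g, by simpa using hg, by simp⟩
  · rintro ⟨x, hx, rfl⟩
    simpa using hx

/-! ### Orders, exponents and ranks -/

namespace Realizes

variable {n J : ℕ} [NeZero J] {T : List ℕ} {tr : ℕ → List (ℕ × ℤ)} {H : Type*} [Group H]
  {x : ℕ → H}

theorem pt_zpow (R : Realizes n J T tr x) (e : ℤ) :
    R.pt (x 0 ^ e) = ((e : ZMod (2 ^ (n + 4))), 0) := by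
  rw [pt, act_zpow_zero, zero_add]

theorem zpow_zero_eq_one_iff (R : Realizes n J T tr x) (e : ℤ) :
    x 0 ^ e = 1 ↔ (2 : ℤ) ^ (n + 4) ∣ e := by
  rw [← R.pt_bijective.1.eq_iff, pt_zpow, pt, act_one, Prod.mk.injEq, and_iff_left rfl,
    ZMod.intCast_zmod_eq_zero_iff_dvd]
  norm_cast

theorem orderOf_zero (R : Realizes n J T tr x) : orderOf (x 0) = 2 ^ (n + 4) := by
  have h := fun e : ℕ => R.zpow_zero_eq_one_iff e
  refine Nat.dvd_antisymm (orderOf_dvd_of_pow_eq_one ?_) ?_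
  · exact_mod_cast (h (2 ^ (n + 4))).2 (by push_cast; exact dvd_rfl)
  · exact_mod_cast (h _).1 (by rw [zpow_natCast, pow_orderOf_eq_one])

theorem pow_eq_zpow (R : Realizes n J T tr x) (s : ℤ) {w : List (ℕ × ℤ)} {e : ℕ}
    (h : (powerPath J T w e).1 = 0) :
    (x 0 ^ (4 * s) * wordEval x w) ^ e = x 0 ^ (4 * s * (powerPath J T w e).2.2 +
      (powerPath J T w e).2.1.1 + (powerPath J T w e).2.1.2 * 2 ^ (n + 2)) := by
  apply R.pt_bijective.1
  rw [R.pt_pow, pt_zpow, h, symVal_apply]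

/-- The test that all elements have their powers of exponent `e` in the subgroup generated by the
generator `0`. -/
theorem pow_mem_zpowers (R : Realizes n J T tr x) {e : ℕ}
    (ht : allReps J tr (fun w => (powerPath J T w e).1 == 0) = true) (g : H) :
    g ^ e ∈ Subgroup.zpowers (x 0) := by
  obtain ⟨s, w, hw, rfl⟩ := R.of_allReps ht g
  rw [R.pow_eq_zpow s (by simpa using hw)]
  exact Subgroup.zpow_mem_zpowers _ _

/-- Membership in `⟨p ^ 4⟩` rather than `⟨p⟩` is what bounds the exponent, and it makes the fourth
powers exactly the elements of `⟨p ^ 4⟩`. -/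
theorem pow_four_mem_zpowers (R : Realizes n J T tr x)
    (ht : allReps J tr (fun w => (powerPath J T w 4).1 == 0 &&
      (powerPath J T w 4).2.1.1 % 4 == 0) = true) (g : H) :
    g ^ 4 ∈ Subgroup.zpowers (x 0 ^ 4) := by
  obtain ⟨s, w, hw, rfl⟩ := R.of_allReps ht g
  simp only [Bool.and_eq_true, beq_iff_eq] at hw
  rw [R.pow_eq_zpow s hw.1]
  obtain ⟨c, hc⟩ := Int.dvd_of_emod_eq_zero hw.2
  refine Subgroup.mem_zpowers_iff.2 ⟨s * (powerPath J T w 4).2.2 + c +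
    (powerPath J T w 4).2.1.2 * 2 ^ n, ?_⟩
  rw [hc, ← zpow_natCast, ← zpow_mul]
  congr 1
  push_cast
  ring

theorem exponent_eq (R : Realizes n J T tr x)
    (ht : allReps J tr (fun w => (powerPath J T w 4).1 == 0 &&
      (powerPath J T w 4).2.1.1 % 4 == 0) = true) : Monoid.exponent H = 2 ^ (n + 4) := by
  refine Nat.dvd_antisymm (Monoid.exponent_dvd_of_forall_pow_eq_one fun g => ?_) ?_
  · obtain ⟨i, hi⟩ := Subgroup.mem_zpowers_iff.1 (R.pow_four_mem_zpowers ht g)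
    rw [show 2 ^ (n + 4) = 4 * 2 ^ (n + 2) by ring, pow_mul, ← hi, ← zpow_natCast, ← zpow_natCast,
      ← zpow_mul, ← zpow_mul, R.zpow_zero_eq_one_iff]
    exact ⟨i, by push_cast; ring⟩
  · rw [← R.orderOf_zero]
    exact Monoid.order_dvd_exponent _

theorem wordEval_notMem_zpowers (R : Realizes n J T tr x) {w : List (ℕ × ℤ)}
    (hw : (symEval J T w).idx 0 ≠ 0) : wordEval x w ∉ Subgroup.zpowers (x 0) := by
  intro h
  obtain ⟨i, hi⟩ := Subgroup.mem_zpowers_iff.1 h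
  have := R.pt_zpow i
  rw [hi, pt, act_word] at this
  exact hw (congrArg Prod.snd this)

/-- The elements `x 0 ^ e * tr j` with `j < d` are distinct. -/
theorem le_card_of_forall_mem (R : Realizes n J T tr x) {d : ℕ} (hd : d ≤ J) (K : Subgroup H)
    (h0 : x 0 ∈ K) (h : ∀ j < d, wordEval x (tr j) ∈ K) : d * 2 ^ (n + 4) ≤ Nat.card K := by
  have := R.finite
  let f : ZMod (2 ^ (n + 4)) × Fin d → K := fun a =>
    ⟨x 0 ^ (a.1.cast : ℤ) * wordEval x (tr a.2), K.mul_mem (K.zpow_mem h0 _) (h _ a.2.2)⟩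
  have hf : Function.Injective f := by
    intro a b hab
    have h1 := congrArg (fun k : K => R.pt k) hab
    have h2 := R.pt_zpow_mul_tr (a.1.cast : ℤ) (Fin.castLE hd a.2)
    have h3 := R.pt_zpow_mul_tr (b.1.cast : ℤ) (Fin.castLE hd b.2)
    change R.pt (x 0 ^ (a.1.cast : ℤ) * wordEval x (tr (Fin.castLE hd a.2))) =
      R.pt (x 0 ^ (b.1.cast : ℤ) * wordEval x (tr (Fin.castLE hd b.2))) at h1
    rw [h2, h3, Prod.mk.injEq, ZMod.intCast_zmod_cast, ZMod.intCast_zmod_cast] at h1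
    exact Prod.ext h1.1 (Fin.castLE_injective hd h1.2)
  have hle := Nat.card_le_card_of_injective f hf
  rwa [Nat.card_prod, Nat.card_zmod, Nat.card_eq_fintype_card, Fintype.card_fin, mul_comm] at hle

end Realizes

/-- The relations respect an independent choice of sign at every generator. This gives the rank, and
in `ClassMII` the properness of the subgroup `⟨p, q⟩`. -/
theorem exists_hom_single (F : Family) {k : ℕ} (n : ℕ) (hk : (F, k) ∈ gamma) {i : ℕ}
    (hi : i < F.rank) :
    ∃ φ : Grp F k (n + F.minM) →* ℤˣ,
      ∀ j, φ (letters n (F.relators (n + F.minM) k) j) = if j = i then -1 else 1 := by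
  obtain ⟨h1, h2⟩ := le_count_of_mem_gamma hk
  obtain ⟨eqs, hP, hT, hs⟩ := F.checked n k h1 h2
  have hr : rankCheck F.rank eqs = true := by
    rcases hs with hs | hs
    · exact hs.2
    -- The other alternative of the check is impossible: a nontrivial sign homomorphism cannot kill
    -- involutions that generate the group.
    · obtain ⟨X, ⟨i, hi⟩, φ, hφ, hinv⟩ := exists_hom_of_signCheck hP hT hs
      refine absurd (generatedByInvolutions_of_mem_gamma hk (Nat.le_add_left _ n))
        (not_generatedByInvolutions_of_hom φ hinv (g := PresentedGroup.of i) ?_)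
      rw [hφ, if_pos hi]
      decide
  simp only [rankCheck, List.all_eq_true, List.mem_range, beq_iff_eq] at hr
  obtain ⟨φ, hφ⟩ := exists_hom_signOf hP (by unfold Family.rank; split <;> omega)
    (Nat.pow_lt_pow_right one_lt_two hi) (hr i hi)
  refine ⟨φ, fun j => ?_⟩
  rw [hφ, signOf]
  congr 1
  rw [Nat.testBit_two_pow, decide_eq_true_eq]
  exact propext eq_comm

/-- The single signs combine to a surjection onto the elementary abelian group of order `2 ^
F.rank`, which needs that many generators. -/
theorem rank_grp {F : Family} {k m : ℕ} (hk : (F, k) ∈ gamma) (hm : F.minM ≤ m) :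
    Group.rank (Grp F k m) = F.rank := by
  obtain ⟨n, rfl⟩ := Nat.exists_eq_add_of_le' hm
  apply le_antisymm
  · have h := PresentedGroup.closure_range_of (F.relators (n + F.minM) k)
    classical
    have h' : Subgroup.closure ((Finset.univ.image PresentedGroup.of :
        Finset (Grp F k (n + F.minM))) : Set (Grp F k (n + F.minM))) = ⊤ := by
      rw [Finset.coe_image, Finset.coe_univ, Set.image_univ, h]
    refine (Group.rank_le h').trans (Finset.card_image_le.trans ?_)
    rw [Finset.card_univ, Fintype.card_fin]
  · choose φ hφ using fun i : Fin F.rank => exists_hom_single F n hk i.2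
    let ψ : Grp F k (n + F.minM) →* (Fin F.rank → ℤˣ) := MonoidHom.pi φ
    have hψ : ∀ i : Fin F.rank, ψ (PresentedGroup.of i) = Pi.mulSingle i (-1) := by
      intro i
      funext j
      have h := hφ j i
      rw [letters_of_lt _ _ i.2] at h
      refine h.trans ?_
      rw [Pi.mulSingle_apply]
      congr 1
      rw [Fin.ext_iff]
      exact propext eq_comm
    have hsurj : Function.Surjective ψ := by
      intro f
      have hf : f ∈ ψ.range := by
        rw [← Finset.univ_prod_mulSingle f]
        refine Subgroup.prod_mem _ fun i _ => ?_
        rcases Int.units_eq_one_or (f i) with h | h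
        · rw [h, Pi.mulSingle_one]
          exact one_mem _
        · exact ⟨_, (hψ i).trans (by rw [h])⟩
      exact hf
    refine le_trans ?_ (Group.rank_le_of_surjective ψ hsurj)
    have hd := card_dvd_exponent_pow_rank (Fin F.rank → ℤˣ)
    have he : Monoid.exponent (Fin F.rank → ℤˣ) ∣ 2 :=
      Monoid.exponent_dvd_of_forall_pow_eq_one fun f => funext fun i => Int.units_sq (f i)
    have hc : Nat.card (Fin F.rank → ℤˣ) = 2 ^ F.rank := by
      rw [Nat.card_eq_fintype_card]
      simp
    rw [hc] at hd
    exact (Nat.pow_dvd_pow_iff_le_right one_lt_two).1 (hd.trans (pow_dvd_pow_of_dvd he _))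

/-- The checks for the classes of the groups in the list `gamma`. -/
def Family.classCheck (F : Family) (k : ℕ) : Bool :=
  let J := F.index
  let T := F.table k
  allReps J F.rep (fun w => (powerPath J T w 4).1 == 0 && (powerPath J T w 4).2.1.1 % 4 == 0) &&
    if F = .NII ∨ F = .MIII then allReps J F.rep (fun w => (powerPath J T w 2).1 == 0)
    else (symEval J T [(1, 2)]).idx 0 != 0

theorem classCheck_of_mem_gamma {F : Family} {k : ℕ} (hk : (F, k) ∈ gamma) :
    F.classCheck k = true := by
  have : ∀ x ∈ gamma, x.1.classCheck x.2 = true := by decide +kernel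
  exact this _ hk

theorem realizes_of_mem_gamma {F : Family} {k : ℕ} (n : ℕ) (hk : (F, k) ∈ gamma) :
    Realizes n F.index (F.table k) F.rep (letters n (F.relators (n + F.minM) k)) :=
  realizes_listed F n (le_count_of_mem_gamma hk).1 (le_count_of_mem_gamma hk).2

theorem exponent_grp {F : Family} {k : ℕ} (n : ℕ) (hk : (F, k) ∈ gamma) :
    Monoid.exponent (Grp F k (n + F.minM)) = 2 ^ (n + 4) := by
  have h := classCheck_of_mem_gamma hk
  simp only [Family.classCheck, Bool.and_eq_true] at h
  exact (realizes_of_mem_gamma n hk).exponent_eq h.1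

theorem card_grp_of_mem_gamma {F : Family} {k : ℕ} (n : ℕ) (hk : (F, k) ∈ gamma) :
    Nat.card (Grp F k (n + F.minM)) = 2 ^ (n + F.minM) := by
  rw [(realizes_of_mem_gamma n hk).card_eq]
  cases F <;> simp only [Family.index, Family.minM] <;> ring

theorem sq_mem_zpowers_of_mem_gamma {F : Family} {k : ℕ} (n : ℕ) (hk : (F, k) ∈ gamma)
    (hF : F = .NII ∨ F = .MIII) (g : Grp F k (n + F.minM)) :
    g ^ 2 ∈ Subgroup.zpowers (letters n (F.relators (n + F.minM) k) 0) := by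
  have h := classCheck_of_mem_gamma hk
  simp only [Family.classCheck, Bool.and_eq_true, if_pos hF] at h
  exact (realizes_of_mem_gamma n hk).pow_mem_zpowers h.2 g

theorem classMII_of_mem_gamma {F : Family} {k : ℕ} (n : ℕ) (hk : (F, k) ∈ gamma)
    (hF : ¬ (F = .NII ∨ F = .MIII)) : ClassMII (n + 7) (Grp F k (n + F.minM)) := by
  have R := realizes_of_mem_gamma n hk
  have hm : F.minM = 7 := by cases F <;> simp_all [Family.minM]
  have hJ : F.index = 8 := by cases F <;> simp_all [Family.index]
  have hrk : F.rank = 3 := by cases F <;> simp_all [Family.rank]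
  have hrep : ∀ j < 4, F.rep j = [(1, (j : ℤ)), (2, 0)] := by
    intro j hj
    have : F.rep j = [(1, ((j % 4 : ℕ) : ℤ)), (2, ((j / 4 : ℕ) : ℤ))] := by cases F <;> simp_all [Family.rep]
    rw [this, Nat.mod_eq_of_lt hj, Nat.div_eq_of_lt hj, Nat.cast_zero]
  have h := classCheck_of_mem_gamma hk
  simp only [Family.classCheck, Bool.and_eq_true, if_neg hF, bne_iff_ne] at h
  have hcard := card_grp_of_mem_gamma n hk
  refine ⟨by rw [hcard, hm], by rw [exponent_grp n hk]; rfl,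
    letters n _ 0, by rw [R.orderOf_zero]; rfl, fun g => ?_, letters n _ 1, ?_, ?_⟩
  · exact Subgroup.zpowers_le.2 (pow_mem (Subgroup.mem_zpowers _) 4) (R.pow_four_mem_zpowers h.1 g)
  · have := R.wordEval_notMem_zpowers h.2
    rw [wordEval_cons, wordEval_nil, mul_one] at this
    exact_mod_cast this
  · set K := Subgroup.closure {letters n (F.relators (n + F.minM) k) 0,
      letters n (F.relators (n + F.minM) k) 1} with hK
    -- Four cosets of `⟨p⟩` lie in `⟨p, q⟩`, so its order is at least `2 ^ (n + 6)`. The sign that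
    -- is `-1` only at `r` shows that it is proper, and the order must divide `2 ^ (n + 7)`.
    have hle := R.le_card_of_forall_mem (d := 4) (by omega) K (Subgroup.subset_closure (by simp))
      fun j hj => by
        rw [hrep j hj, wordEval_cons, wordEval_cons, wordEval_nil, mul_one, zpow_zero, mul_one]
        exact zpow_mem (Subgroup.subset_closure (by simp)) _
    obtain ⟨φ, hφ⟩ := exists_hom_single F n hk (i := 2) (by omega)
    have hker : K ≤ φ.ker := by
      rw [hK, Subgroup.closure_le]
      rintro _ (rfl | rfl) <;> exact hφ _
    have hne : Nat.card K ≠ 2 ^ (n + 7) := by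
      intro hc
      have := R.finite
      have htop : K = ⊤ := Subgroup.eq_top_of_card_eq K (by rw [hc, hcard, hm])
      have : letters n (F.relators (n + F.minM) k) 2 ∈ φ.ker := hker (htop ▸ Subgroup.mem_top _)
      rw [MonoidHom.mem_ker, hφ] at this
      exact absurd this (by decide)
    have hdvd : Nat.card K ∣ 2 ^ (n + 7) := by
      have hc : Nat.card (Grp F k (n + F.minM)) = 2 ^ (n + 7) := by rw [hcard, hm]
      exact hc ▸ K.card_subgroup_dvd_card
    obtain ⟨i, hi, hKi⟩ := (Nat.dvd_prime_pow Nat.prime_two).1 hdvd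
    rw [hKi] at hne hle ⊢
    have h1 : n + 6 ≤ i := (Nat.pow_le_pow_iff_right one_lt_two).1
      (by rw [show n + 6 = n + 4 + 2 by ring, pow_add]; linarith)
    have h2 : i ≠ n + 7 := fun h => hne (by rw [h])
    rw [show i = n + 6 by omega]
    rfl

theorem inClass_of_mem_gamma {F : Family} {k m : ℕ} (hk : (F, k) ∈ gamma) (hm : F.minM ≤ m) :
    F.InClass m (Grp F k m) ∧ Monoid.exponent (Grp F k m) = 2 ^ (m - F.coexp) := by
  obtain ⟨n, rfl⟩ := Nat.exists_eq_add_of_le' hm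
  have R := realizes_of_mem_gamma n hk
  have he := exponent_grp n hk
  have he' : Monoid.exponent (Grp F k (n + F.minM)) = 2 ^ (n + F.minM - F.coexp) := by
    rw [he]
    cases F <;> rfl
  refine ⟨?_, he'⟩
  by_cases hF : F = .NII ∨ F = .MIII
  · have hsq := sq_mem_zpowers_of_mem_gamma n hk hF
    have hc := card_grp_of_mem_gamma n hk
    rcases hF with rfl | rfl
    · exact ⟨hc, he', _, by rw [R.orderOf_zero]; rfl, hsq⟩
    · exact ⟨hc, he', _, by rw [R.orderOf_zero]; rfl, hsq⟩
  · have := classMII_of_mem_gamma n hk hF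
    cases F <;> first | exact this | simp at hF

/-! ### Invariants -/

section Invariants

variable (G : Type*) [Group G]

/-- The element commutes with all fourth powers. -/
def CentralizesFourth {G : Type*} [Group G] (g : G) : Prop := ∀ x : G, Commute g (x ^ 4)

/-- The element is a fourth power. -/
def IsFourth {G : Type*} [Group G] (g : G) : Prop := ∃ x : G, x ^ 4 = g

/-- The number of involutions that do not centralize the fourth powers. -/
noncomputable def outerCount : ℕ := Nat.card {g : G // ¬ CentralizesFourth g ∧ g ^ 2 = 1}

/-- Four properties of a group. -/
def invariant : Fin 4 → Prop
  | 0 => ∀ g h : G, CentralizesFourth g → CentralizesFourth h → g * h = h * g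
  | 1 => ∃ g h : G, CentralizesFourth g ∧ CentralizesFourth h ∧ ¬ IsFourth (g⁻¹ * h⁻¹ * g * h)
  | 2 => ∃ g h : G, CentralizesFourth g ∧ CentralizesFourth h ∧ g ^ 2 = 1 ∧
      ¬ IsFourth (g⁻¹ * h⁻¹ * g * h)
  | 3 => ∃ g : G, ¬ IsFourth g ∧ ∀ h : G, g * h = h * g

variable {G} {H : Type*} [Group H]

theorem centralizesFourth_iff (e : G ≃* H) (g : G) : CentralizesFourth (e g) ↔ CentralizesFourth g := by
  unfold CentralizesFourth
  rw [← e.toEquiv.forall_congr_right]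
  refine forall_congr' fun x => ?_
  change Commute (e g) (e x ^ 4) ↔ _
  rw [← map_pow]
  exact ⟨fun h => by simpa using h.map e.symm, fun h => h.map e⟩

theorem isFourth_iff (e : G ≃* H) (g : G) : IsFourth (e g) ↔ IsFourth g := by
  unfold IsFourth
  rw [← e.toEquiv.exists_congr_right]
  refine exists_congr fun x => ?_
  change e x ^ 4 = e g ↔ _
  rw [← map_pow, e.injective.eq_iff]

theorem outerCount_congr (e : G ≃* H) : outerCount G = outerCount H := by
  refine Nat.card_congr (e.toEquiv.subtypeEquiv fun g => ?_)
  have h := centralizesFourth_iff e g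
  change _ ↔ ¬ CentralizesFourth (e g) ∧ (e g) ^ 2 = 1
  rw [h, ← map_pow, e.map_eq_one_iff]

theorem invariant_mp (e : G ≃* H) (i : Fin 4) (h : invariant G i) : invariant H i := by
  have hc := centralizesFourth_iff e
  have hf := isFourth_iff e
  have key : ∀ h : H, ∃ g, e g = h := e.surjective
  fin_cases i
  · intro g' h' hg hh
    obtain ⟨g, rfl⟩ := key g'
    obtain ⟨k, rfl⟩ := key h'
    rw [← map_mul, ← map_mul, h g k ((hc g).1 hg) ((hc k).1 hh)]
  · obtain ⟨g, k, h1, h2, h3⟩ := h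
    refine ⟨e g, e k, (hc g).2 h1, (hc k).2 h2, ?_⟩
    rwa [← map_inv, ← map_inv, ← map_mul, ← map_mul, ← map_mul, hf]
  · obtain ⟨g, k, h1, h2, h4, h3⟩ := h
    refine ⟨e g, e k, (hc g).2 h1, (hc k).2 h2, by rw [← map_pow, h4, map_one], ?_⟩
    rwa [← map_inv, ← map_inv, ← map_mul, ← map_mul, ← map_mul, hf]
  · obtain ⟨g, h1, h2⟩ := h
    refine ⟨e g, by rwa [hf], fun h' => ?_⟩
    obtain ⟨k, rfl⟩ := key h'
    rw [← map_mul, ← map_mul, h2]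

end Invariants

/-! ### Tests for the invariants -/

section Tests

variable (J : ℕ) [NeZero J] (k : ℕ) (tr : ℕ → List (ℕ × ℤ)) (T : List ℕ)

/-- The element centralizes the fourth powers. -/
def innerTest (w : List (ℕ × ℤ)) : Bool := sgn J T ((symEval J T w).idx 0) == 1

/-- The element is not a fourth power. -/
def notFourthTest (w : List (ℕ × ℤ)) : Bool :=
  (symEval J T w).idx 0 != 0 || ((symEval J T w).sh 0).1 % 4 != 0

/-- The commutator of two words. -/
def commWord (w w' : List (ℕ × ℤ)) : List (ℕ × ℤ) := invWord w ++ (invWord w' ++ (w ++ w'))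

/-- The letter `i` does not commute with the elements `x ^ (4 * s) * w`, where `x` is the
generator `0`. -/
def notCommuteTest (w : List (ℕ × ℤ)) (i : ℕ) : Bool :=
  let f := symEval J T (w ++ [(i, 1)])
  let g := symEval J T ((i, 1) :: w)
  let c := 1 - sgn J T ((symEval J T [(i, 1)]).idx 0)
  f.idx 0 != g.idx 0 || (c % 2 == 0 &&
    nonzeroTest c ((f.sh 0).1 - (g.sh 0).1) ((f.sh 0).2 - (g.sh 0).2))

/-- A test for all pairs of elements that centralize the fourth powers. -/
def innerPairs (test : List (ℕ × ℤ) → List (ℕ × ℤ) → Bool) : Bool :=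
  allReps J tr fun w => !innerTest J T w ||
    allReps J tr fun w' => !innerTest J T w' || test w w'

/-- A sufficient criterion for an invariant to have a certain truth value. -/
def invariantTest : Fin 4 → Bool → Bool
  -- Each truth value has its own test, since the failure of a merely sufficient test proves
  -- nothing. Universal statements are tested on all cosets of `⟨p ^ 4⟩`; existential ones are
  -- tested on words, which serve as witnesses.
  | 0, true => innerPairs J tr T fun w w' => agree J T (w ++ w') (w' ++ w)
  | 0, false => !innerPairs J tr T fun w w' => !nonCommute w w'
  | 1, true => !innerPairs J tr T fun w w' => !notFourthTest J T (commWord w w')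
  | 1, false => innerPairs J tr T fun w w' => !notFourthTest J T (commWord w w')
  | 2, true => !innerPairs J tr T fun w w' =>
      !(agree J T (w ++ w) [] && notFourthTest J T (commWord w w'))
  | 2, false => innerPairs J tr T fun w w' =>
      notInvolution J T w || !notFourthTest J T (commWord w w')
  -- The representatives contain only `p ^ r` with `r < 4`. A central witness may need the
  -- additional factor `p ^ 2 ^ (n + 2)`, so this variant is tried as well.
  | 3, true => !allReps J tr fun w => !(central w || central ((4, 1) :: w))
  | 3, false => allReps J tr fun w => !notFourthTest J T w ||
      (List.range k).any fun i => notCommuteTest J T w i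
where
  /-- The element is central and not a fourth power. -/
  central (w : List (ℕ × ℤ)) : Bool := notFourthTest J T w &&
    (List.range k).all fun i => agree J T (w ++ [(i, 1)]) ((i, 1) :: w)
  /-- The elements do not commute. -/
  nonCommute (w w' : List (ℕ × ℤ)) : Bool :=
    let f := symEval J T (w ++ w')
    let g := symEval J T (w' ++ w)
    f.idx 0 != g.idx 0 ||
      nonzeroTest 0 ((f.sh 0).1 - (g.sh 0).1) ((f.sh 0).2 - (g.sh 0).2)

/-- A representative whose coset consists of involutions that do not centralize the fourth
powers. -/
def outerRep (w : List (ℕ × ℤ)) : Bool := !innerTest J T w && agree J T (w ++ w) []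

/-- The number of these representatives. -/
def outerReps : ℕ :=
  (((List.finRange 4).product (List.finRange J)).filter fun a =>
    outerRep J T ((0, (a.1.val : ℤ)) :: tr a.2.val)).length

/-- All the other cosets do not contain such involutions. -/
def outerTest : Bool :=
  allReps J tr fun w => innerTest J T w || agree J T (w ++ w) [] || notInvolution J T w

end Tests

namespace Realizes

theorem exists_of_not_allReps {J : ℕ} {tr : ℕ → List (ℕ × ℤ)}
    {test : List (ℕ × ℤ) → Bool} (h : allReps J tr test = false) :
    ∃ w, test w = false := by
  by_contra hc
  push Not at hc
  rw [allReps, List.all_eq_false] at h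
  obtain ⟨r, -, h⟩ := h
  simp [hc] at h

variable {n J : ℕ} [NeZero J] {T : List ℕ} {tr : ℕ → List (ℕ × ℤ)} {H : Type*} [Group H]
  {x : ℕ → H}

theorem pt_word (R : Realizes n J T tr x) (w : List (ℕ × ℤ)) : R.pt (wordEval x w) =
    (symVal n ((symEval J T w).sh 0), (symEval J T w).idx 0) := by
  rw [pt, act_word, zero_add]

theorem pt_mul_zpow (R : Realizes n J T tr x) (g : H) (s : ℤ) : R.pt (g * x 0 ^ (4 * s)) =
    ((R.pt g).1 + ((4 * s * sgn J T (R.pt g).2 : ℤ) : ZMod (2 ^ (n + 4))), (R.pt g).2) := by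
  rw [pt, act_mul, act_zpow, pt]

theorem pt_zpow_mul_word (R : Realizes n J T tr x) (s : ℤ) (w : List (ℕ × ℤ)) :
    R.pt (x 0 ^ (4 * s) * wordEval x w) =
      (((4 * s : ℤ) : ZMod (2 ^ (n + 4))) + symVal n ((symEval J T w).sh 0),
        (symEval J T w).idx 0) := by
  rw [pt, act_mul, act_zpow_zero, act_word, zero_add]

theorem isFourth_iff_mem (_ : Realizes n J T tr x)
    (h4 : ∀ g : H, g ^ 4 ∈ Subgroup.zpowers (x 0 ^ 4)) (g : H) :
    IsFourth g ↔ ∃ i : ℤ, g = x 0 ^ (4 * i) := by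
  constructor
  · rintro ⟨y, rfl⟩
    obtain ⟨i, hi⟩ := Subgroup.mem_zpowers_iff.1 (h4 y)
    refine ⟨i, ?_⟩
    rw [← hi, zpow_mul]
    norm_cast
  · rintro ⟨i, rfl⟩
    refine ⟨x 0 ^ i, ?_⟩
    rw [mul_comm, zpow_mul]
    norm_cast

theorem notFourthTest_iff (R : Realizes n J T tr x)
    (h4 : ∀ g : H, g ^ 4 ∈ Subgroup.zpowers (x 0 ^ 4)) (w : List (ℕ × ℤ)) :
    notFourthTest J T w = true ↔ ¬ IsFourth (wordEval x w) := by
  rw [R.isFourth_iff_mem h4, iff_not_comm]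
  simp only [notFourthTest, Bool.or_eq_true, bne_iff_ne, ne_eq, not_or, not_not]
  have hw := R.pt_word w
  constructor
  · rintro ⟨i, hi⟩
    rw [hi, pt_zpow, Prod.mk.injEq, ← sub_eq_zero, ← Prod.mk.eta (p := (symEval J T w).sh 0),
      symVal_apply, ← Int.cast_sub, ZMod.intCast_zmod_eq_zero_iff_dvd] at hw
    refine ⟨hw.2.symm, Int.emod_eq_zero_of_dvd ?_⟩
    obtain ⟨c, hc⟩ := hw.1
    push_cast at hc
    refine ⟨i - ((symEval J T w).sh 0).2 * 2 ^ n - 2 ^ (n + 2) * c, ?_⟩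
    rw [pow_add] at hc
    rw [pow_add] at hc ⊢
    linear_combination -hc
  · rintro ⟨h0, ha⟩
    obtain ⟨c, hc⟩ := Int.dvd_of_emod_eq_zero ha
    refine ⟨c + ((symEval J T w).sh 0).2 * 2 ^ n, R.pt_bijective.1 ?_⟩
    rw [hw, pt_zpow, h0, ← Prod.mk.eta (p := (symEval J T w).sh 0), symVal_apply, hc]
    congr 2
    ring

theorem centralizesFourth_iff_commute (R : Realizes n J T tr x)
    (h4 : ∀ g : H, g ^ 4 ∈ Subgroup.zpowers (x 0 ^ 4)) (g : H) :
    CentralizesFourth g ↔ ∀ s : ℤ, Commute (x 0 ^ (4 * s)) g := by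
  constructor
  · intro h s
    have := (h (x 0 ^ s)).symm
    rwa [← zpow_natCast, ← zpow_mul, mul_comm, Nat.cast_ofNat] at this
  · intro h y
    obtain ⟨i, hi⟩ := (R.isFourth_iff_mem h4 (y ^ 4)).1 ⟨y, rfl⟩
    rw [hi]
    exact (h i).symm

/-- If `g` sends the base point to the fibre `j`, then `g * p ^ 4 = p ^ (4 * sgn j) * g`. The sign
`-1` is incompatible with commuting because `2 ^ (n + 4)` does not divide 8. -/
theorem innerTest_iff (R : Realizes n J T tr x)
    (h4 : ∀ g : H, g ^ 4 ∈ Subgroup.zpowers (x 0 ^ 4)) (s : ℤ) (w : List (ℕ × ℤ)) :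
    innerTest J T w = true ↔ CentralizesFourth (x 0 ^ (4 * s) * wordEval x w) := by
  rw [R.centralizesFourth_iff_commute h4, innerTest, beq_iff_eq]
  constructor
  · intro h i
    refine Commute.mul_right (Commute.zpow_zpow_self _ _ _) (R.pt_bijective.1 ?_)
    rw [pt_zpow_mul_word, pt_mul_zpow, pt_word]
    simp only [h, mul_one]
    congr 1
    exact add_comm _ _
  · intro h
    have h1 : Commute (x 0 ^ (4 * (1 : ℤ))) (wordEval x w) := by
      have := (Commute.zpow_zpow_self (x 0) (4 * 1) (-(4 * s))).mul_right (h 1)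
      rwa [← mul_assoc, ← zpow_add, neg_add_cancel, zpow_zero, one_mul] at this
    have h2 := congrArg (fun g => (R.pt g).1) h1.eq
    simp only [pt_zpow_mul_word, pt_mul_zpow, pt_word] at h2
    rcases (isModel_iff.1 R.model).2.2.2 ((symEval J T w).idx 0) with h3 | h3
    · exact h3
    · exfalso
      rw [h3, add_comm (symVal n _), add_left_inj, ← sub_eq_zero, ← Int.cast_sub,
        ZMod.intCast_zmod_eq_zero_iff_dvd] at h2
      have h5 := Int.le_of_dvd (by norm_num) h2
      push_cast at h5
      have h6 : (2 : ℤ) ^ 4 ≤ 2 ^ (n + 4) := pow_le_pow_right₀ (by norm_num) (by omega)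
      linarith

/-- Such a word inverts `p ^ 4`. Consequently all elements of the coset `⟨p ^ 4⟩ * w` have the same
square. -/
theorem zpow_mul_word_mul_zpow (R : Realizes n J T tr x) (s : ℤ) {w : List (ℕ × ℤ)}
    (hw : innerTest J T w = false) :
    x 0 ^ (4 * s) * wordEval x w * x 0 ^ (4 * s) = wordEval x w := by
  have h3 : sgn J T ((symEval J T w).idx 0) = -1 := by
    refine ((isModel_iff.1 R.model).2.2.2 _).resolve_left fun h => ?_
    simp [innerTest, h] at hw
  apply R.pt_bijective.1
  rw [pt_mul_zpow, pt_zpow_mul_word, pt_word]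
  simp only [h3]
  push_cast
  congr 1
  ring

/-- The elements that centralize the fourth powers, up to fourth powers. -/
theorem exists_inner_word (R : Realizes n J T tr x)
    (h4 : ∀ g : H, g ^ 4 ∈ Subgroup.zpowers (x 0 ^ 4)) {g : H} (hg : CentralizesFourth g) {s : ℤ}
    {w : List (ℕ × ℤ)} (h : g = x 0 ^ (4 * s) * wordEval x w) :
    innerTest J T w = true ∧ CentralizesFourth (wordEval x w) := by
  have h1 := (R.innerTest_iff h4 s w).2 (h ▸ hg)
  have h2 := (R.innerTest_iff h4 0 w).1 h1
  rw [mul_zero, zpow_zero, one_mul] at h2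
  exact ⟨h1, h2⟩

theorem centralizesFourth_word (R : Realizes n J T tr x)
    (h4 : ∀ g : H, g ^ 4 ∈ Subgroup.zpowers (x 0 ^ 4)) {w : List (ℕ × ℤ)}
    (h1 : innerTest J T w = true) : CentralizesFourth (wordEval x w) := by
  have h2 := (R.innerTest_iff h4 0 w).1 h1
  rwa [mul_zero, zpow_zero, one_mul] at h2

theorem innerPairs_true (R : Realizes n J T tr x)
    (h4 : ∀ g : H, g ^ 4 ∈ Subgroup.zpowers (x 0 ^ 4))
    {test : List (ℕ × ℤ) → List (ℕ × ℤ) → Bool} (ht : innerPairs J tr T test = true) {g h : H}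
    (hg : CentralizesFourth g) (hh : CentralizesFourth h) : ∃ (s s' : ℤ) (w w' : List (ℕ × ℤ)),
      CentralizesFourth (wordEval x w) ∧ CentralizesFourth (wordEval x w') ∧
      g = x 0 ^ (4 * s) * wordEval x w ∧ h = x 0 ^ (4 * s') * wordEval x w' ∧
      test w w' = true := by
  obtain ⟨s, w, hw, hgw⟩ := R.of_allReps ht g
  obtain ⟨h1, h2⟩ := R.exists_inner_word h4 hg hgw
  rw [h1, Bool.not_true, Bool.false_or] at hw
  obtain ⟨s', w', hw', hhw⟩ := R.of_allReps hw h
  obtain ⟨h1', h2'⟩ := R.exists_inner_word h4 hh hhw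
  rw [h1', Bool.not_true, Bool.false_or] at hw'
  exact ⟨s, s', w, w', h2, h2', hgw, hhw, hw'⟩

theorem innerPairs_false (R : Realizes n J T tr x)
    (h4 : ∀ g : H, g ^ 4 ∈ Subgroup.zpowers (x 0 ^ 4))
    {test : List (ℕ × ℤ) → List (ℕ × ℤ) → Bool} (ht : innerPairs J tr T test = false) :
    ∃ w w', CentralizesFourth (wordEval x w) ∧ CentralizesFourth (wordEval x w') ∧
      test w w' = false := by
  obtain ⟨w, hw⟩ := exists_of_not_allReps ht
  rw [Bool.or_eq_false_iff, Bool.not_eq_false'] at hw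
  obtain ⟨w', hw'⟩ := exists_of_not_allReps hw.2
  rw [Bool.or_eq_false_iff, Bool.not_eq_false'] at hw'
  exact ⟨w, w', R.centralizesFourth_word h4 hw.1, R.centralizesFourth_word h4 hw'.1, hw'.2⟩

/-- Applied with `a` and `b` powers of `p ^ 4`, which commute with all elements that centralize
fourth powers, so that a commutator of two such elements depends only on the words. -/
theorem commutator_mul {a b g h : H} (hab : Commute a b) (hah : Commute a h)
    (hbg : Commute b g) :
    (a * g)⁻¹ * (b * h)⁻¹ * (a * g) * (b * h) = g⁻¹ * h⁻¹ * g * h := by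
  have h1 : a * g * (b * h) = a * b * (g * h) := by
    rw [mul_assoc, ← mul_assoc g, ← hbg.eq]; group
  have h2 : b * h * (a * g) = a * b * (h * g) := by
    rw [mul_assoc, ← mul_assoc h, ← hah.eq, hab.eq]; group
  calc _ = (b * h * (a * g))⁻¹ * (a * g * (b * h)) := by group
    _ = _ := by rw [h1, h2]; group

theorem wordEval_commWord (w w' : List (ℕ × ℤ)) : wordEval x (commWord w w') =
    (wordEval x w)⁻¹ * (wordEval x w')⁻¹ * wordEval x w * wordEval x w' := by
  rw [commWord, wordEval_append, wordEval_append, wordEval_append, wordEval_invWord,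
    wordEval_invWord]
  group

theorem pt_ne_of_nonzeroTest (R : Realizes n J T tr x) {w w' : List (ℕ × ℤ)}
    (h : (symEval J T w).idx 0 ≠ (symEval J T w').idx 0 ∨
      nonzeroTest 0 (((symEval J T w).sh 0).1 - ((symEval J T w').sh 0).1)
        (((symEval J T w).sh 0).2 - ((symEval J T w').sh 0).2) = true) :
    wordEval x w ≠ wordEval x w' := by
  intro heq
  have h1 := R.pt_word w
  rw [heq, pt_word, Prod.mk.injEq] at h1
  rcases h with h | h
  · exact h h1.2.symm
  · have h2 := symVal_ne_zero_of_nonzeroTest (n := n) 0 rfl h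
    apply h2
    rw [show 4 * (0 : ℤ) * 0 = 0 by norm_num, zero_add, ← Prod.mk_sub_mk, map_sub, sub_eq_zero]
    exact h1.1.symm

/-- Moving `x 0 ^ (4 * s)` to the left across the letter `i` multiplies `s` by the sign of its
fibre, so the two products differ by a term with slope `4 * (1 - sgn)` in `s`. -/
theorem ne_of_notCommuteTest (R : Realizes n J T tr x) (s : ℤ) {w : List (ℕ × ℤ)} {i : ℕ}
    (h : notCommuteTest J T w i = true) :
    x 0 ^ (4 * s) * wordEval x w * x i ≠ x i * (x 0 ^ (4 * s) * wordEval x w) := by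
  intro heq
  have hi : x i = wordEval x [(i, 1)] := by simp [wordEval]
  have h1 : x 0 ^ (4 * s) * wordEval x w * x i = x 0 ^ (4 * s) * wordEval x (w ++ [(i, 1)]) := by
    rw [wordEval_append, ← hi, mul_assoc]
  have h2 : R.pt (x i * (x 0 ^ (4 * s) * wordEval x w)) =
      (((4 * s * sgn J T ((symEval J T [(i, 1)]).idx 0) : ℤ) : ZMod (2 ^ (n + 4))) +
        symVal n ((symEval J T ((i, 1) :: w)).sh 0), (symEval J T ((i, 1) :: w)).idx 0) := by
    rw [← mul_assoc, pt, act_mul, ← pt, pt_mul_zpow, act_word, hi, pt_word]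
    have h3 : symEval J T ((i, 1) :: w) = symEval J T [(i, 1)] * symEval J T w := by
      change letter J T i 1 * symEval J T w = letter J T i 1 * 1 * symEval J T w
      rw [mul_one]
    rw [h3, Mono.mul_sh, Mono.mul_idx, map_add]
    simp only
    rw [← add_assoc]
    congr 2
    exact add_comm _ _
  have h3 := congrArg R.pt heq
  rw [h1, h2, pt_zpow_mul_word, Prod.mk.injEq] at h3
  simp only [notCommuteTest, Bool.or_eq_true, Bool.and_eq_true, bne_iff_ne, ne_eq,
    beq_iff_eq] at h
  rcases h with h | ⟨hc, h⟩
  · exact h h3.2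
  · refine symVal_ne_zero_of_nonzeroTest (n := n) s hc h ?_
    have h4 := sub_eq_zero.2 h3.1
    rw [← h4, ← Prod.mk.eta (p := (symEval J T (w ++ [(i, 1)])).sh 0),
      ← Prod.mk.eta (p := (symEval J T ((i, 1) :: w)).sh 0), symVal_apply, symVal_apply,
      symVal_apply]
    push_cast
    ring

/-- The tests for the invariants are correct. -/
theorem invariant_iff (R : Realizes n J T tr x)
    (h4 : ∀ g : H, g ^ 4 ∈ Subgroup.zpowers (x 0 ^ 4)) {k : ℕ}
    (hgen : ∀ K : Subgroup H, (∀ i < k, x i ∈ K) → K = ⊤) {i : Fin 4} {b : Bool}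
    (h : invariantTest J k tr T i b = true) : invariant H i ↔ b = true := by
  have hcomm : ∀ {g : H}, CentralizesFourth g → ∀ s : ℤ, Commute (x 0 ^ (4 * s)) g :=
    fun hg => (R.centralizesFourth_iff_commute h4 _).1 hg
  have hself : ∀ s s' : ℤ, Commute (x 0 ^ (4 * s)) (x 0 ^ (4 * s')) :=
    fun s s' => Commute.zpow_zpow_self _ _ _
  have hnot : ∀ w w', notFourthTest J T (commWord w w') = true ↔ ¬ IsFourth
      ((wordEval x w)⁻¹ * (wordEval x w')⁻¹ * wordEval x w * wordEval x w') := fun w w' => by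
    rw [R.notFourthTest_iff h4, wordEval_commWord]
  fin_cases i <;> cases b <;> simp only [invariantTest] at h
  · rw [Bool.not_eq_true'] at h
    obtain ⟨w, w', h1, h2, h3⟩ := R.innerPairs_false h4 h
    simp only [Bool.not_eq_false', invariantTest.nonCommute, Bool.or_eq_true, bne_iff_ne] at h3
    refine iff_of_false (fun hc => R.pt_ne_of_nonzeroTest h3 ?_) (by simp)
    rw [wordEval_append, wordEval_append]
    exact hc _ _ h1 h2
  · refine iff_of_true (fun g g' hg hg' => ?_) rfl
    obtain ⟨s, s', w, w', h1, h2, rfl, rfl, h3⟩ := R.innerPairs_true h4 h hg hg'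
    have h5 := R.wordEval_eq h3
    rw [wordEval_append, wordEval_append] at h5
    exact ((hself s s').mul_right (hcomm h2 s)).mul_left
      ((hcomm h1 s').symm.mul_right h5)
  · refine iff_of_false (fun hc => ?_) (by simp)
    obtain ⟨g, g', hg, hg', hgg⟩ := hc
    obtain ⟨s, s', w, w', h1, h2, rfl, rfl, h3⟩ := R.innerPairs_true h4 h hg hg'
    rw [commutator_mul (hself _ _) (hcomm h2 _) (hcomm h1 _),
      ← hnot] at hgg
    simp [hgg] at h3
  · rw [Bool.not_eq_true'] at h
    obtain ⟨w, w', h1, h2, h3⟩ := R.innerPairs_false h4 h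
    rw [Bool.not_eq_false', hnot] at h3
    exact iff_of_true ⟨_, _, h1, h2, h3⟩ rfl
  · refine iff_of_false (fun hc => ?_) (by simp)
    obtain ⟨g, g', hg, hg', hsq, hgg⟩ := hc
    obtain ⟨s, s', w, w', h1, h2, rfl, rfl, h3⟩ := R.innerPairs_true h4 h hg hg'
    rw [commutator_mul (hself _ _) (hcomm h2 _) (hcomm h1 _),
      ← hnot] at hgg
    rw [hgg, Bool.not_true, Bool.or_false] at h3
    exact R.pow_two_ne_one s h3 hsq
  · rw [Bool.not_eq_true'] at h
    obtain ⟨w, w', h1, h2, h3⟩ := R.innerPairs_false h4 h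
    rw [Bool.not_eq_false', Bool.and_eq_true, hnot] at h3
    have h5 := R.wordEval_eq h3.1
    rw [wordEval_append, wordEval_nil] at h5
    exact iff_of_true ⟨_, _, h1, h2, by rw [pow_two, h5], h3.2⟩ rfl
  · refine iff_of_false (fun hc => ?_) (by simp)
    obtain ⟨g, hg, hcg⟩ := hc
    obtain ⟨s, w, hw, rfl⟩ := R.of_allReps h g
    have hw4 : notFourthTest J T w = true := by
      rw [R.notFourthTest_iff h4]
      intro hf
      obtain ⟨i, hi⟩ := (R.isFourth_iff_mem h4 _).1 hf
      exact hg ((R.isFourth_iff_mem h4 _).2 ⟨s + i, by rw [hi, ← zpow_add, mul_add]⟩)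
    rw [hw4, Bool.not_true, Bool.false_or, List.any_eq_true] at hw
    obtain ⟨i, -, hi⟩ := hw
    exact R.ne_of_notCommuteTest s hi (hcg _)
  · rw [Bool.not_eq_true'] at h
    obtain ⟨w, hw⟩ := exists_of_not_allReps h
    have key : ∀ w, invariantTest.central J k T w = true → ∃ g : H, ¬ IsFourth g ∧
        ∀ h : H, g * h = h * g := by
      intro w hw
      simp only [invariantTest.central, Bool.and_eq_true, List.all_eq_true, List.mem_range] at hw
      refine ⟨wordEval x w, (R.notFourthTest_iff h4 w).1 hw.1, fun g => ?_⟩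
      have htop := hgen (Subgroup.centralizer {wordEval x w}) fun i hi => by
        have h5 := R.wordEval_eq (hw.2 i hi)
        rw [wordEval_append, wordEval_cons, wordEval_cons, wordEval_nil, mul_one, zpow_one] at h5
        rw [Subgroup.mem_centralizer_singleton_iff]
        exact h5.symm
      have hg : g ∈ Subgroup.centralizer {wordEval x w} := htop ▸ Subgroup.mem_top g
      rw [Subgroup.mem_centralizer_singleton_iff] at hg
      exact hg.symm
    rw [Bool.not_eq_false', Bool.or_eq_true] at hw
    exact iff_of_true (hw.elim (key _) (key _)) rfl

/-- Outside the centralizer of the fourth powers, involutions come in full cosets of `⟨p ^ 4⟩`,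
since squares are constant there, and `⟨p ^ 4⟩` has order `2 ^ (n + 2)`. So it suffices to count
cosets. -/
theorem outerCount_eq (R : Realizes n J T tr x)
    (h4 : ∀ g : H, g ^ 4 ∈ Subgroup.zpowers (x 0 ^ 4)) (ht : outerTest J tr T = true) :
    outerCount H = outerReps J tr T * 2 ^ (n + 2) := by
  have key : ∀ (s : ℤ) (w : List (ℕ × ℤ)),
      (innerTest J T w || agree J T (w ++ w) [] || notInvolution J T w) = true →
      (outerRep J T w = true ↔ ¬ CentralizesFourth (x 0 ^ (4 * s) * wordEval x w) ∧
        (x 0 ^ (4 * s) * wordEval x w) ^ 2 = 1) := by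
    intro s w hw
    rw [← R.innerTest_iff h4, outerRep, Bool.and_eq_true, Bool.not_eq_true', Bool.not_eq_true]
    refine and_congr_right fun hi => ?_
    constructor
    · intro ha
      have h5 := R.wordEval_eq ha
      rw [wordEval_append, wordEval_nil] at h5
      rw [pow_two, ← mul_assoc, R.zpow_mul_word_mul_zpow s hi, h5]
    · intro ha
      rw [hi, Bool.false_or, Bool.or_eq_true] at hw
      exact hw.resolve_right fun hw => R.pow_two_ne_one s hw ha
  have htw : ∀ (r : Fin 4) (j : Fin J), (innerTest J T ((0, (r.val : ℤ)) :: tr j) ||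
      agree J T (((0, (r.val : ℤ)) :: tr j) ++ ((0, (r.val : ℤ)) :: tr j)) [] ||
      notInvolution J T ((0, (r.val : ℤ)) :: tr j)) = true := by
    intro r j
    simp only [outerTest, allReps, List.all_eq_true, List.mem_range] at ht
    exact ht r r.2 j j.2
  let A : Finset (Fin 4 × Fin J) :=
    (((List.finRange 4).product (List.finRange J)).filter fun a =>
      outerRep J T ((0, (a.1.val : ℤ)) :: tr a.2.val)).toFinset
  have hA : ∀ a, a ∈ A ↔ outerRep J T ((0, (a.1.val : ℤ)) :: tr a.2.val) = true := by
    intro a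
    have h5 : a ∈ (List.finRange 4).product (List.finRange J) :=
      List.mem_product.2 ⟨List.mem_finRange _, List.mem_finRange _⟩
    rw [List.mem_toFinset, List.mem_filter, and_iff_right h5]
  have hcard : A.card = outerReps J tr T :=
    List.toFinset_card_of_nodup
      (((List.nodup_finRange 4).product (List.nodup_finRange J)).filter _)
  have hpt : ∀ (a : Fin 4 × Fin J) (s : ℤ),
      R.pt (x 0 ^ (4 * s) * wordEval x ((0, (a.1.val : ℤ)) :: tr a.2.val)) =
        (((4 * s + a.1.val : ℤ) : ZMod (2 ^ (n + 4))), a.2) := by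
    intro a s
    rw [wordEval_cons, ← mul_assoc, ← zpow_add, pt_zpow_mul_tr]
  let f : A × Fin (2 ^ (n + 2)) → {g : H // ¬ CentralizesFourth g ∧ g ^ 2 = 1} := fun a =>
    ⟨x 0 ^ (4 * (a.2.val : ℤ)) * wordEval x ((0, (a.1.val.1.val : ℤ)) :: tr a.1.val.2.val),
      (key _ _ (htw _ _)).1 ((hA _).1 a.1.2)⟩
  have hf : Function.Bijective f := by
    constructor
    · rintro ⟨⟨⟨r, j⟩, hr⟩, s⟩ ⟨⟨⟨r', j'⟩, hr'⟩, s'⟩ hab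
      have h1 := congrArg (fun g => R.pt g.1) hab
      simp only [f] at h1
      rw [hpt (r, j), hpt (r', j'), Prod.mk.injEq, ZMod.intCast_eq_intCast_iff_dvd_sub] at h1
      dsimp only at h1
      obtain ⟨h1, rfl⟩ := h1
      have hs := s.2
      have hs' := s'.2
      have h2 : 2 ^ (n + 4) = 2 ^ (n + 2) * 4 := by ring
      have h3 : (4 * (s.val : ℤ) + r.val : ℤ) = 4 * (s'.val : ℤ) + r'.val := by
        have h5 := Int.eq_zero_of_abs_lt_dvd h1 (by
          have h6 : (2 : ℤ) ^ (n + 4) = 2 ^ (n + 2) * 4 := by ring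
          have h7 : (s.val : ℤ) < 2 ^ (n + 2) := by exact_mod_cast hs
          have h8 : (s'.val : ℤ) < 2 ^ (n + 2) := by exact_mod_cast hs'
          push_cast
          rw [h6, abs_lt]
          constructor <;> linarith [r.2, r'.2, s.val.zero_le])
        omega
      have h5 : r = r' := Fin.ext (by omega)
      have h6 : s = s' := Fin.ext (by omega)
      subst h5 h6
      rfl
    · rintro ⟨g, hg⟩
      obtain ⟨e, he⟩ := ZMod.natCast_zmod_surjective (R.pt g).1
      have hlt := ZMod.val_lt (R.pt g).1
      set e := (R.pt g).1.val with he
      have hr : e % 4 < 4 := Nat.mod_lt _ (by norm_num)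
      have hs : e / 4 < 2 ^ (n + 2) := by
        have h2 : 2 ^ (n + 4) = 2 ^ (n + 2) * 4 := by ring
        omega
      have hge : x 0 ^ (4 * ((e / 4 : ℕ) : ℤ)) *
          wordEval x ((0, ((e % 4 : ℕ) : ℤ)) :: tr (R.pt g).2) = g := by
        apply R.pt_bijective.1
        rw [hpt (⟨e % 4, hr⟩, (R.pt g).2)]
        refine Prod.ext ?_ rfl
        simp only
        rw [show (4 * ((e / 4 : ℕ) : ℤ) + ((e % 4 : ℕ) : ℤ) : ℤ) = (e : ℤ) by omega,
          Int.cast_natCast, he, ZMod.natCast_zmod_val]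
      refine ⟨⟨⟨(⟨e % 4, hr⟩, (R.pt g).2), (hA _).2 ?_⟩, ⟨e / 4, hs⟩⟩, Subtype.ext hge⟩
      refine (key ((e / 4 : ℕ) : ℤ) _ (htw ⟨e % 4, hr⟩ _)).2 ?_
      rw [← hge] at hg
      exact hg
  rw [outerCount, ← Nat.card_congr (Equiv.ofBijective f hf), Nat.card_prod,
    Nat.card_eq_fintype_card, Nat.card_eq_fintype_card, Fintype.card_fin, Fintype.card_coe, hcard]

end Realizes

/-! ### The groups are pairwise non-isomorphic -/

/-- The invariants of the two groups can be computed and are different. -/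
def separated (a b : Family × ℕ) : Bool :=
  (outerReps a.1.index a.1.rep (a.1.table a.2) != outerReps b.1.index b.1.rep (b.1.table b.2)) ||
    (List.finRange 4).any fun i => [true, false].any fun v =>
      invariantTest a.1.index a.1.rank a.1.rep (a.1.table a.2) i v &&
        invariantTest b.1.index b.1.rank b.1.rep (b.1.table b.2) i !v

/-- The elements of a list are separated. -/
def separatedList : List (Family × ℕ) → Bool
  | [] => true
  | a :: l => l.all (separated a) && separatedList l

theorem eq_or_separated {l : List (Family × ℕ)} (h : separatedList l = true) {a b : Family × ℕ}
    (ha : a ∈ l) (hb : b ∈ l) : a = b ∨ separated a b = true ∨ separated b a = true := by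
  induction l with
  | nil => simp at ha
  | cons c l ih =>
    rw [separatedList, Bool.and_eq_true, List.all_eq_true] at h
    rcases List.mem_cons.1 ha with h1 | h1 <;> rcases List.mem_cons.1 hb with h2 | h2
    · exact Or.inl (h1.trans h2.symm)
    · exact Or.inr (Or.inl (h1 ▸ h.1 _ h2))
    · exact Or.inr (Or.inr (h2 ▸ h.1 _ h1))
    · exact ih h.2 h1 h2

theorem outerTest_of_mem_gamma : ∀ a ∈ gamma,
    outerTest a.1.index a.1.rep (a.1.table a.2) = true := by
  decide +kernel

open Family in
theorem separatedList_nii : separatedList [(NII, 3), (NII, 4), (NII, 5)] = true := by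
  decide +kernel

open Family in
theorem separatedList_mii : separatedList [(MIIA, 39), (MIIA, 40), (MIIB, 19), (MIIB, 20),
    (MIIC, 5), (MIID, 3), (MIID, 17), (MIID, 18), (MIID, 19), (MIIE, 1), (MIIF, 8),
    (MIIF, 9)] = true := by
  decide +kernel

open Family in
theorem separatedList_miii : separatedList [(MIII, 3), (MIII, 4), (MIII, 5), (MIII, 10),
    (MIII, 11), (MIII, 13), (MIII, 14)] = true := by
  decide +kernel

theorem isEmpty_mulEquiv_of_separated {a b : Family × ℕ} (n : ℕ) (ha : a ∈ gamma) (hb : b ∈ gamma)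
    (h : separated a b = true) :
    IsEmpty (Grp a.1 a.2 (n + a.1.minM) ≃* Grp b.1 b.2 (n + b.1.minM)) := by
  refine ⟨fun e => ?_⟩
  have key : ∀ a ∈ gamma, (∀ g : Grp a.1 a.2 (n + a.1.minM), g ^ 4 ∈ Subgroup.zpowers
      (letters n (a.1.relators (n + a.1.minM) a.2) 0 ^ 4)) := by
    intro a ha
    have h := classCheck_of_mem_gamma ha
    simp only [Family.classCheck, Bool.and_eq_true] at h
    exact (realizes_of_mem_gamma n ha).pow_four_mem_zpowers h.1
  have hrank : ∀ F : Family, NeZero F.rank := fun F => ⟨by unfold Family.rank; split <;> omega⟩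
  simp only [separated, Bool.or_eq_true, bne_iff_ne, ne_eq, List.any_eq_true] at h
  rcases h with h | ⟨i, -, v, -, h⟩
  · have h1 := outerCount_congr e
    rw [(realizes_of_mem_gamma n ha).outerCount_eq (key a ha) (outerTest_of_mem_gamma a ha),
      (realizes_of_mem_gamma n hb).outerCount_eq (key b hb) (outerTest_of_mem_gamma b hb)] at h1
    exact h (Nat.eq_of_mul_eq_mul_right (by positivity) h1)
  · rw [Bool.and_eq_true] at h
    have h1 := (realizes_of_mem_gamma n ha).invariant_iff (key a ha)
      (fun K => Std.closure_letters n _) h.1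
    have h2 := (realizes_of_mem_gamma n hb).invariant_iff (key b hb)
      (fun K => Std.closure_letters n _) h.2
    have h3 : v = true ↔ (!v) = true := by
      rw [← h1, ← h2]
      exact ⟨invariant_mp e i, invariant_mp e.symm i⟩
    cases v <;> simp at h3

open Family in
theorem mem_gamma_cases {a : Family × ℕ} (h : a ∈ gamma) :
    (a.1 = NII ∧ a ∈ [(NII, 3), (NII, 4), (NII, 5)]) ∨
    ((a.1 ≠ NII ∧ a.1.rank = 3 ∧ a.1.minM = 7) ∧ a ∈ [(MIIA, 39), (MIIA, 40), (MIIB, 19),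
      (MIIB, 20), (MIIC, 5), (MIID, 3), (MIID, 17), (MIID, 18), (MIID, 19), (MIIE, 1), (MIIF, 8),
      (MIIF, 9)]) ∨
    ((a.1 ≠ NII ∧ a.1.rank = 4 ∧ a.1.minM = 7) ∧ a ∈ [(MIII, 3), (MIII, 4), (MIII, 5), (MIII, 10),
      (MIII, 11), (MIII, 13), (MIII, 14)]) := by
  revert a
  decide

/-- Different groups in the list `gamma` of the same order are not isomorphic. -/
theorem eq_of_nonempty_mulEquiv {F F' : Family} {k k' m : ℕ} (h : (F, k) ∈ gamma)
    (h' : (F', k') ∈ gamma) (hm : F.minM ≤ m) (hm' : F'.minM ≤ m)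
    (he : Nonempty (Grp F k m ≃* Grp F' k' m)) : F = F' ∧ k = k' := by
  obtain ⟨e⟩ := he
  -- For equal `m` the exponent separates the family `NII` from the others, and the rank separates
  -- `MIII` from the rest. The finer invariants are needed only within the three parts.
  have hexp : 2 ^ (m - F.coexp) = 2 ^ (m - F'.coexp) := by
    rw [← (inClass_of_mem_gamma h hm).2, ← (inClass_of_mem_gamma h' hm').2]
    exact Monoid.exponent_eq_of_mulEquiv e
  have hco : F = .NII ↔ F' = .NII := by
    have h1 := Nat.pow_right_injective le_rfl hexp
    cases F <;> cases F' <;> simp_all [Family.coexp, Family.minM] <;> omega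
  have hrank : F.rank = F'.rank := by
    rw [← rank_grp h hm, ← rank_grp h' hm']
    exact le_antisymm (Group.rank_le_of_surjective e.symm.toMonoidHom e.symm.surjective)
      (Group.rank_le_of_surjective e.toMonoidHom e.surjective)
  have key : ∀ {l : List (Family × ℕ)}, separatedList l = true → (F, k) ∈ l → (F', k') ∈ l →
      F.minM = F'.minM → F = F' ∧ k = k' := by
    intro l hl h1 h2 hmm
    rw [← Prod.mk.injEq]
    obtain ⟨n, rfl⟩ := Nat.exists_eq_add_of_le' hm
    refine (eq_or_separated hl h1 h2).resolve_right fun hs => ?_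
    rcases hs with hs | hs
    · have := isEmpty_mulEquiv_of_separated n h h' hs
      rw [← hmm] at this
      exact this.false e
    · have := isEmpty_mulEquiv_of_separated n h' h hs
      rw [← hmm] at this
      exact this.false e.symm
  rcases mem_gamma_cases h with ⟨h1, h2⟩ | ⟨h1, h2⟩ | ⟨h1, h2⟩ <;>
    rcases mem_gamma_cases h' with ⟨h3, h4⟩ | ⟨h3, h4⟩ | ⟨h3, h4⟩ <;> dsimp only at h1 h3
  · exact key separatedList_nii h2 h4 (by rw [h1, h3])
  · exact absurd (hco.1 h1) h3.1
  · exact absurd (hco.1 h1) h3.1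
  · exact absurd (hco.2 h3) h1.1
  · exact key separatedList_mii h2 h4 (by omega)
  · omega
  · exact absurd (hco.2 h3) h1.1
  · omega
  · exact key separatedList_miii h2 h4 (by omega)

/-! ### Subgroups of index 2 -/

section

variable {G : Type*} [Group G] {A B : Subgroup G}

/-- `A` is a subgroup of `B` of index at most 2. -/
structure Half (A B : Subgroup G) : Prop where
  le : A ≤ B
  mul : ∀ a ∈ B, ∀ b ∈ B, a ∉ A → b ∉ A → a * b ∈ A

theorem Half.sq_mem (h : Half A B) {b : G} (hb : b ∈ B) : b ^ 2 ∈ A := by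
  by_cases hA : b ∈ A
  · exact pow_mem hA 2
  · rw [pow_two]
    exact h.mul b hb b hb hA hA

theorem Half.conj_mem (h : Half A B) {a b : G} (ha : a ∈ A) (hb : b ∈ B) : b⁻¹ * a * b ∈ A := by
  by_cases hA : b ∈ A
  · exact mul_mem (mul_mem (inv_mem hA) ha) hA
  · rw [mul_assoc]
    exact h.mul _ (inv_mem hb) _ (mul_mem (h.le ha) hb) (by rwa [inv_mem_iff])
      (by rwa [Subgroup.mul_mem_cancel_left _ ha])

theorem Half.inv_mul_mem (h : Half A B) {a b : G} (ha : a ∈ B) (hb : b ∈ B) (haA : a ∉ A)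
    (hbA : b ∉ A) : a⁻¹ * b ∈ A :=
  h.mul _ (inv_mem ha) _ hb (by rwa [inv_mem_iff]) hbA

theorem Half.of_card [Finite G] (hle : A ≤ B) (hc : Nat.card B = 2 * Nat.card A) : Half A B := by
  have h1 := Subgroup.card_mul_index (A.subgroupOf B)
  rw [Nat.card_congr (Subgroup.subgroupOfEquivOfLe hle).toEquiv, hc, mul_comm] at h1
  have h2 : (A.subgroupOf B).index = 2 := Nat.eq_of_mul_eq_mul_right Nat.card_pos h1
  refine ⟨hle, fun a ha b hb haA hbA => ?_⟩
  have := (Subgroup.mul_mem_iff_of_index_two h2 (a := ⟨a, ha⟩) (b := ⟨b, hb⟩)).2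
  simp only [Subgroup.mem_subgroupOf] at this
  exact this (iff_of_false haA hbA)

theorem exists_subgroup_between [Finite G] {i j k : ℕ} (hle : A ≤ B) (hA : Nat.card A = 2 ^ i)
    (hB : Nat.card B = 2 ^ k) (hij : i ≤ j) (hjk : j ≤ k) :
    ∃ C : Subgroup G, A ≤ C ∧ C ≤ B ∧ Nat.card C = 2 ^ j := by
  have : Fact (Nat.Prime 2) := ⟨Nat.prime_two⟩
  obtain ⟨C, hC, hAC⟩ := Sylow.exists_subgroup_card_pow_prime_le 2 (n := i) (m := j)
    (by rw [hB]; exact pow_dvd_pow _ hjk) (A.subgroupOf B)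
    (by rw [Nat.card_congr (Subgroup.subgroupOfEquivOfLe hle).toEquiv, hA]) hij
  refine ⟨C.map B.subtype, fun a ha => ⟨⟨a, hle ha⟩, hAC ha, rfl⟩, Subgroup.map_subtype_le C, ?_⟩
  rw [← hC]
  exact Nat.card_congr (C.equivMapOfInjective _ B.subtype_injective).symm.toEquiv

theorem two_mul_card_le [Finite G] (hAB : A < B) :
    2 * Nat.card A ≤ Nat.card B := by
  obtain ⟨c, hc⟩ := Subgroup.card_dvd_of_le hAB.le
  rcases Nat.lt_or_ge c 2 with h | h
  · exfalso
    interval_cases c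
    · exact Nat.card_pos.ne' (hc.trans (mul_zero _))
    · exact hAB.ne (Subgroup.eq_of_le_of_card_ge hAB.le (by rw [hc, mul_one]))
  · rw [hc, mul_comm]
    exact Nat.mul_le_mul_left _ h

/-- The sign homomorphism of a subgroup of index at most 2. -/
theorem Half.exists_hom (h : Half A ⊤) : ∃ φ : G →* ℤˣ, ∀ g, φ g = 1 ↔ g ∈ A := by
  classical
  refine ⟨MonoidHom.mk' (fun g => if g ∈ A then 1 else -1) fun a b => ?_, fun g => ?_⟩
  · by_cases ha : a ∈ A
    · simp only [Subgroup.mul_mem_cancel_left _ ha, if_pos ha, one_mul]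
    · by_cases hb : b ∈ A
      · simp only [Subgroup.mul_mem_cancel_right _ hb, if_pos hb, mul_one]
      · simp [if_neg ha, if_neg hb, if_pos (h.mul a trivial b trivial ha hb)]
  · by_cases hg : g ∈ A <;> simp [hg]

end

/-! ### Towers of subgroups above an element of maximal order -/

section

variable {G : Type*} [Group G] {n : ℕ} {p : G} {K H : Subgroup G}

theorem zpow_eq_one_iff_of_order (hp : orderOf p = 2 ^ (n + 4)) (i : ℤ) :
    p ^ i = 1 ↔ (2 : ℤ) ^ (n + 4) ∣ i := by
  rw [← orderOf_dvd_iff_zpow_eq_one, hp]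
  norm_cast

theorem zpow_eq_zpow_iff_of_order (hp : orderOf p = 2 ^ (n + 4)) (i j : ℤ) :
    p ^ i = p ^ j ↔ (2 : ℤ) ^ (n + 4) ∣ i - j := by
  rw [← zpow_eq_one_iff_of_order hp, zpow_sub, mul_inv_eq_one]

/-- The group `⟨p⟩`, a group `K` that contains it with index at most 2, and a group `H` that
contains `K` with index at most 2, where `p` has the largest possible order `2 ^ (n + 4)`, and the
elements of `H` centralize the subgroup of `⟨p⟩` of order 4. -/
structure IsTower (n : ℕ) (p : G) (K H : Subgroup G) : Prop where
  order : orderOf p = 2 ^ (n + 4)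
  pow_eq_one : ∀ x : G, x ^ 2 ^ (n + 4) = 1
  pow_four_mem : ∀ x : G, x ^ 4 ∈ Subgroup.zpowers p
  half : Half (Subgroup.zpowers p) K
  half' : Half K H
  commute : ∀ x ∈ H, Commute x (p ^ 2 ^ (n + 2))

theorem conj_zpow_eq (x g : G) (i : ℤ) : x⁻¹ * g ^ i * x = (x⁻¹ * g * x) ^ i := by
  have := conj_zpow (i := i) (a := x⁻¹) (b := g)
  rw [inv_inv] at this
  exact this.symm

theorem conj_pow_eq (x g : G) (i : ℕ) : x⁻¹ * g ^ i * x = (x⁻¹ * g * x) ^ i := by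
  have := conj_zpow_eq x g i
  simpa using this

theorem commute_iff_conj {x g : G} : Commute x g ↔ x⁻¹ * g * x = g := by
  rw [mul_assoc, inv_mul_eq_iff_eq_mul, eq_comm]
  rfl

/-- A power of `p` that is an involution or trivial. -/
theorem eq_one_or_of_sq_eq_one (hp : orderOf p = 2 ^ (n + 4)) {i : ℤ} (h : (2 : ℤ) ^ (n + 3) ∣ i) :
    p ^ i = 1 ∨ p ^ i = p ^ 2 ^ (n + 3) := by
  obtain ⟨c, rfl⟩ := h
  rcases Int.even_or_odd' c with ⟨d, rfl | rfl⟩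
  · left
    rw [zpow_eq_one_iff_of_order hp]
    exact ⟨d, by ring⟩
  · right
    rw [← zpow_natCast, zpow_eq_zpow_iff_of_order hp]
    exact ⟨d, by push_cast; ring⟩

namespace IsTower

variable (T : IsTower n p K H)

include T

theorem mem : p ∈ K := T.half.le (Subgroup.mem_zpowers p)

theorem mem' : p ∈ H := T.half'.le T.mem

/-- If `x ^ 4 = p ^ b`, the bound on the order of `x` gives `p ^ (b * 2 ^ (n + 2)) = 1`, which
forces `4 ∣ b`. -/
theorem exists_pow_four (x : G) : ∃ a : ℤ, x ^ 4 = p ^ (4 * a) := by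
  obtain ⟨b, hb⟩ := Subgroup.mem_zpowers_iff.1 (T.pow_four_mem x)
  have h := T.pow_eq_one x
  rw [show 2 ^ (n + 4) = 4 * 2 ^ (n + 2) by ring, pow_mul, ← hb, ← zpow_natCast, ← zpow_mul,
    zpow_eq_one_iff_of_order T.order] at h
  obtain ⟨c, hc⟩ := h
  refine ⟨c, ?_⟩
  rw [← hb]
  congr 1
  push_cast at hc
  have h2 : (2 : ℤ) ^ (n + 2) ≠ 0 := by positivity
  apply mul_right_cancel₀ h2
  rw [hc]
  ring

theorem even_of_sq_eq {x : G} {i : ℤ} (h : x ^ 2 = p ^ i) : ∃ j, i = 2 * j := by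
  have h1 := T.pow_eq_one x
  rw [show 2 ^ (n + 4) = 2 * 2 ^ (n + 3) by ring, pow_mul, h, ← zpow_natCast, ← zpow_mul,
    zpow_eq_one_iff_of_order T.order] at h1
  obtain ⟨c, hc⟩ := h1
  refine ⟨c, ?_⟩
  push_cast at hc
  have h2 : (2 : ℤ) ^ (n + 3) ≠ 0 := by positivity
  apply mul_right_cancel₀ h2
  rw [hc]
  ring

theorem pow_half (x : G) : x ^ 2 ^ (n + 3) = 1 ∨ x ^ 2 ^ (n + 3) = p ^ 2 ^ (n + 3) := by
  obtain ⟨a, ha⟩ := T.exists_pow_four x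
  have h : x ^ 2 ^ (n + 3) = p ^ (4 * a * 2 ^ (n + 1)) := by
    rw [show 2 ^ (n + 3) = 4 * 2 ^ (n + 1) by ring, pow_mul, ha, ← zpow_natCast, ← zpow_mul]
    norm_cast
  rw [h]
  exact eq_one_or_of_sq_eq_one T.order ⟨a, by ring⟩

theorem half_ne_one : p ^ 2 ^ (n + 3) ≠ 1 := by
  intro h
  have := orderOf_dvd_of_pow_eq_one h
  rw [T.order] at this
  have h2 := Nat.le_of_dvd (by positivity) this
  have h3 : 2 ^ (n + 3) < 2 ^ (n + 4) := Nat.pow_lt_pow_right one_lt_two (by omega)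
  omega

theorem half_sq : (p ^ 2 ^ (n + 3)) ^ 2 = 1 := by
  rw [← pow_mul, ← pow_succ]
  exact T.pow_eq_one p

/-- A conjugate of `p` has the same order as `p`, so its power of exponent `2 ^ (n + 3)` is not 1;
by `pow_half` it can only be `p ^ 2 ^ (n + 3)`. This involution is therefore central. -/
theorem commute_half (x : G) : Commute x (p ^ 2 ^ (n + 3)) := by
  rw [commute_iff_conj, conj_pow_eq]
  refine (T.pow_half _).resolve_left fun h => T.half_ne_one ?_
  rw [← conj_pow_eq, mul_assoc, inv_mul_eq_iff_eq_mul, mul_one] at h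
  exact mul_eq_right.1 h

/-- An automorphism of `⟨p⟩` that fixes the elements of order 4 has an exponent congruent to 1
modulo 4; in particular it is not inversion. -/
theorem exists_of_conj {x : G} (hx : x ∈ H) {e : ℤ} (h : x⁻¹ * p * x = p ^ e) :
    ∃ f, e = 1 + 4 * f := by
  have h1 := commute_iff_conj.1 (T.commute x hx)
  rw [conj_pow_eq, h, ← zpow_natCast, ← zpow_natCast, ← zpow_mul,
    zpow_eq_zpow_iff_of_order T.order] at h1
  obtain ⟨c, hc⟩ := h1
  refine ⟨c, ?_⟩
  have h2 : (2 : ℤ) ^ (n + 2) ≠ 0 := by positivity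
  have h3 : e - 1 = 4 * c := by
    apply mul_right_cancel₀ h2
    push_cast at hc
    linear_combination hc
  linarith

/-- An element whose square centralizes `p` and that normalizes `⟨p⟩`. -/
theorem conj_of_sq {x : G} (hx : x ∈ H) {e : ℤ} (h : x⁻¹ * p * x = p ^ e)
    (h2 : Commute (x ^ 2) p) : x⁻¹ * p * x = p ∨ x⁻¹ * p * x = p * p ^ 2 ^ (n + 3) := by
  obtain ⟨f, rfl⟩ := T.exists_of_conj hx h
  have h3 := commute_iff_conj.1 h2
  have h4 : (x ^ 2)⁻¹ * p * x ^ 2 = x⁻¹ * (x⁻¹ * p * x) * x := by rw [pow_two]; group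
  rw [h4, h, conj_zpow_eq, h, ← zpow_mul] at h3
  nth_rw 2 [← zpow_one p] at h3
  rw [zpow_eq_zpow_iff_of_order T.order,
    show (1 + 4 * f) * (1 + 4 * f) - 1 = 8 * f * (1 + 2 * f) by ring] at h3
  -- Conjugating twice squares the exponent `1 + 4 * f`. As `1 + 2 * f` is odd, `2 ^ (n + 4) ∣ 8 *
  -- f`, so `p ^ (4 * f)` has order at most 2.
  have hcop : IsCoprime ((2 : ℤ) ^ (n + 4)) (1 + 2 * f) :=
    IsCoprime.pow_left ⟨-f, 1, by ring⟩
  obtain ⟨c, hc⟩ := hcop.dvd_of_dvd_mul_right h3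
  rw [h, zpow_add, zpow_one]
  rcases eq_one_or_of_sq_eq_one T.order (i := 4 * f) ⟨c, by
      rw [pow_succ] at hc; linarith⟩ with h5 | h5
  · left; rw [h5, mul_one]
  · right; rw [h5]

theorem conj_of_mem {y : G} (hy : y ∈ K) :
    y⁻¹ * p * y = p ∨ y⁻¹ * p * y = p * p ^ 2 ^ (n + 3) := by
  obtain ⟨e, he⟩ := Subgroup.mem_zpowers_iff.1 (T.half.conj_mem (Subgroup.mem_zpowers p) hy)
  obtain ⟨i, hi⟩ := Subgroup.mem_zpowers_iff.1 (T.half.sq_mem hy)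
  exact T.conj_of_sq (T.half'.le hy) he.symm (by rw [← hi]; exact (Commute.refl p).zpow_left i)

theorem commute_even {y : G} (hy : y ∈ K) (i : ℤ) : Commute y (p ^ (2 * i)) := by
  rw [commute_iff_conj, conj_zpow_eq]
  have h : p ^ (2 * i) = (p ^ 2) ^ i := by rw [zpow_mul]; norm_cast
  rcases T.conj_of_mem hy with h1 | h1
  · rw [h1]
  · rw [h1, (T.commute_half p).mul_zpow, zpow_mul (p ^ 2 ^ (n + 3)), zpow_ofNat, T.half_sq, one_zpow,
      mul_one]

theorem exists_sq {y : G} (hy : y ∈ K) : ∃ j : ℤ, y ^ 2 = p ^ (2 * j) := by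
  obtain ⟨i, hi⟩ := Subgroup.mem_zpowers_iff.1 (T.half.sq_mem hy)
  obtain ⟨j, rfl⟩ := T.even_of_sq_eq hi.symm
  exact ⟨j, hi.symm⟩

theorem conj_zpow_of_mem {y : G} (hy : y ∈ K) (i : ℤ) :
    y⁻¹ * p ^ i * y = p ^ i ∨ y⁻¹ * p ^ i * y = p ^ i * p ^ 2 ^ (n + 3) := by
  rw [conj_zpow_eq]
  rcases T.conj_of_mem hy with h1 | h1
  · left; rw [h1]
  · rw [h1, (T.commute_half p).mul_zpow]
    have := eq_one_or_of_sq_eq_one T.order (i := 2 ^ (n + 3) * i) ⟨i, rfl⟩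
    rw [zpow_mul, show p ^ (2 : ℤ) ^ (n + 3) = p ^ 2 ^ (n + 3) by norm_cast] at this
    exact this.imp (fun h => by rw [h, mul_one]) fun h => by rw [h]

theorem conj_of_mem_of_mem {g y : G} (hg : g ∈ K) (hy : y ∈ K) :
    y⁻¹ * g * y = g ∨ y⁻¹ * g * y = g * p ^ 2 ^ (n + 3) := by
  by_cases hgp : g ∈ Subgroup.zpowers p
  · obtain ⟨i, rfl⟩ := Subgroup.mem_zpowers_iff.1 hgp
    exact T.conj_zpow_of_mem hy i
  have key : ∀ i : ℤ, (p ^ i)⁻¹ * g * p ^ i = g ∨ (p ^ i)⁻¹ * g * p ^ i = g * p ^ 2 ^ (n + 3) := by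
    intro i
    rcases T.conj_zpow_of_mem (inv_mem hg) i with h | h
    · left
      rw [inv_inv] at h
      rw [mul_assoc, inv_mul_eq_iff_eq_mul]
      nth_rw 2 [← h]
      group
    · right
      rw [inv_inv] at h
      have h1 : (p ^ i)⁻¹ * (g * p ^ i * g⁻¹) = p ^ 2 ^ (n + 3) := by rw [h]; group
      calc _ = (p ^ i)⁻¹ * (g * p ^ i * g⁻¹) * g := by group
        _ = _ := by rw [h1, (T.commute_half g).eq]
  by_cases hyp : y ∈ Subgroup.zpowers p
  · obtain ⟨i, rfl⟩ := Subgroup.mem_zpowers_iff.1 hyp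
    exact key i
  · obtain ⟨i, hi⟩ := Subgroup.mem_zpowers_iff.1 (T.half.inv_mul_mem hg hy hgp hyp)
    have : y = g * p ^ i := by rw [hi]; group
    rw [this, show (g * p ^ i)⁻¹ * g * (g * p ^ i) = (p ^ i)⁻¹ * g * p ^ i by group]
    exact key i

theorem exists_sq_mul {x y : G} (hx : x ∈ K) (hy : y ∈ K) :
    ∃ b : ℤ, (x * y) ^ 2 = x ^ 2 * y ^ 2 * p ^ (2 ^ (n + 3) * b) := by
  have h : (x * y) ^ 2 = x ^ 2 * (x⁻¹ * y * x) * y := by simp only [pow_two]; group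
  rcases T.conj_of_mem_of_mem hy hx with h1 | h1
  · exact ⟨0, by rw [h, h1, mul_zero, zpow_zero, mul_one, pow_two y, mul_assoc]⟩
  · refine ⟨1, ?_⟩
    rw [h, h1, mul_one, show p ^ (2 : ℤ) ^ (n + 3) = p ^ 2 ^ (n + 3) by norm_cast, pow_two y]
    simp only [mul_assoc]
    rw [(T.commute_half y).eq]

/-- The conjugate of `p` lies in `K`, so its square is an even power of `p`. Since `x` fixes the
power of `p ^ 2` with exponent `2 ^ (n + 1)`, the exponent is determined modulo 8. -/
theorem exists_conj_sq {x : G} (hx : x ∈ H) : ∃ l : ℤ, x⁻¹ * p ^ 2 * x = p ^ (2 + 8 * l) := by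
  obtain ⟨k, hk⟩ := T.exists_sq (T.half'.conj_mem T.mem hx)
  rw [← conj_pow_eq] at hk
  have h1 := commute_iff_conj.1 (T.commute x hx)
  rw [show 2 ^ (n + 2) = 2 * 2 ^ (n + 1) by ring, pow_mul, conj_pow_eq, hk, ← pow_mul,
    ← zpow_natCast, ← zpow_natCast, ← zpow_mul, zpow_eq_zpow_iff_of_order T.order] at h1
  obtain ⟨c, hc⟩ := h1
  refine ⟨c, ?_⟩
  rw [hk]
  congr 1
  have h2 : (2 : ℤ) ^ (n + 1) ≠ 0 := by positivity
  apply mul_right_cancel₀ h2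
  push_cast at hc
  linear_combination hc

theorem pow_half_mul_of_mem {x y : G} (hx : x ∈ K) (hy : y ∈ K) :
    (x * y) ^ 2 ^ (n + 3) = x ^ 2 ^ (n + 3) * y ^ 2 ^ (n + 3) := by
  obtain ⟨i, hi⟩ := T.exists_sq hx
  obtain ⟨j, hj⟩ := T.exists_sq hy
  obtain ⟨b, hb⟩ := T.exists_sq_mul hx hy
  rw [show 2 ^ (n + 3) = 2 * 2 ^ (n + 2) by ring, pow_mul, pow_mul, pow_mul, hb, hi, hj]
  simp only [← zpow_natCast, ← zpow_mul, ← zpow_add]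
  rw [zpow_eq_zpow_iff_of_order T.order]
  exact ⟨2 ^ (n + 1) * b, by push_cast; ring⟩

/-- Here `(x * y) ^ 2 = x ^ 2 * ((x⁻¹ * y * x) * y)` is a product of elements of `K`, where squaring
is multiplicative up to the central involution. After raising to the power `2 ^ (n + 1)`, all
corrections are multiples of `2 ^ (n + 4)` in the exponent of `p`. -/
theorem pow_half_mul_of_mem_right {x y : G} (hx : x ∈ H) (hy : y ∈ K) :
    (x * y) ^ 2 ^ (n + 3) = x ^ 2 ^ (n + 3) * y ^ 2 ^ (n + 3) := by
  obtain ⟨a, ha⟩ := T.exists_pow_four x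
  obtain ⟨j, hj⟩ := T.exists_sq hy
  obtain ⟨l, hl⟩ := T.exists_conj_sq hx
  have hy' : x⁻¹ * y * x ∈ K := T.half'.conj_mem hy hx
  obtain ⟨b', hb'⟩ := T.exists_sq_mul hy' hy
  obtain ⟨b, hb⟩ := T.exists_sq_mul (T.half'.sq_mem hx) (mul_mem hy' hy)
  have hj' : (x⁻¹ * y * x) ^ 2 = p ^ ((2 + 8 * l) * j) := by
    rw [← conj_pow_eq, hj, zpow_mul, conj_zpow_eq, zpow_ofNat, hl, ← zpow_mul]
  have h4 : (x * y) ^ 4 = p ^ (4 * a + ((2 + 8 * l) * j + 2 * j + 2 ^ (n + 3) * b') +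
      2 ^ (n + 3) * b) := by
    calc (x * y) ^ 4 = (x ^ 2 * ((x⁻¹ * y * x) * y)) ^ 2 := by
          simp only [pow_succ, pow_zero, one_mul]; group
      _ = _ := by
          rw [hb, ← pow_mul, ha, hb', hj', hj]
          simp only [← zpow_add]
  rw [show 2 ^ (n + 3) = 4 * 2 ^ (n + 1) by ring, pow_mul, pow_mul, h4, ha,
    show 4 * 2 ^ (n + 1) = 2 * 2 ^ (n + 2) by ring, pow_mul y, hj]
  simp only [← zpow_natCast, ← zpow_mul, ← zpow_add]
  rw [zpow_eq_zpow_iff_of_order T.order]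
  exact ⟨l * j + 2 ^ n * (b + b'), by push_cast; ring⟩

theorem pow_half_mul_self (x : G) : x ^ 2 ^ (n + 3) * x ^ 2 ^ (n + 3) = 1 := by
  rw [← pow_add, ← two_mul, ← pow_succ']
  exact T.pow_eq_one x

/-- The map that sends `x` to the power of `x` that is trivial or an involution is multiplicative
on `H`. -/
theorem pow_half_mul {x y : G} (hx : x ∈ H) (hy : y ∈ H) :
    (x * y) ^ 2 ^ (n + 3) = x ^ 2 ^ (n + 3) * y ^ 2 ^ (n + 3) := by
  by_cases hyK : y ∈ K
  · exact T.pow_half_mul_of_mem_right hx hyK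
  by_cases hxK : x ∈ K
  · have h1 := T.pow_half_mul_of_mem_right hy (T.half'.conj_mem hxK hy)
    have h2 : x * y = y * (y⁻¹ * x * y) := by group
    rw [h2, h1, ← conj_pow_eq]
    rcases T.pow_half x with h | h <;> rw [h]
    · group
    · rw [commute_iff_conj.1 (T.commute_half y), (T.commute_half _).eq]
  · have hg := T.half'.inv_mul_mem hx hy hxK hyK
    have h1 := T.pow_half_mul_of_mem_right hx hg
    have h2 := T.pow_half_mul_of_mem (T.half'.sq_mem hx) hg
    rw [mul_inv_cancel_left] at h1
    rw [show x ^ 2 * (x⁻¹ * y) = x * y by rw [pow_two]; group] at h2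
    rw [h2, h1, ← mul_assoc, T.pow_half_mul_self, one_mul, ← pow_mul, mul_comm 2, pow_mul, pow_two,
      T.pow_half_mul_self, one_mul]

end IsTower

end

/-! ### Involutions that invert an element of maximal order -/

section

variable {G : Type*} [Group G] {n : ℕ} {p : G} {K H : Subgroup G}

theorem GeneratedByInvolutions.exists_notMem (hG : GeneratedByInvolutions G) {S : Subgroup G}
    (hS : S ≠ ⊤) : ∃ s : G, s ^ 2 = 1 ∧ s ∉ S := by
  by_contra hc
  push Not at hc
  refine hS (top_le_iff.1 (hG ▸ (Subgroup.closure_le _).2 fun s hs => hc s ?_))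
  rw [← show orderOf s = 2 from hs]
  exact pow_orderOf_eq_one s

/-- The homomorphism that extends the one of `IsTower.pow_half_mul` to a group that contains `H`
with index 2. -/
theorem IsTower.exists_hom (T : IsTower n p K H) (hH : Half H ⊤) {t : G} (ht : t ^ 2 = 1)
    (htH : t ∉ H) : ∃ f : G →* G, (∀ x ∈ H, f x = x ^ 2 ^ (n + 3)) ∧ f t = 1 := by
  classical
  have htt : t * t = 1 := by rw [← pow_two, ht]
  -- These powers lie in the central subgroup of order 2, so conjugation by `t` leaves them fixed.
  have hconj : ∀ x, (t * x * t) ^ 2 ^ (n + 3) = x ^ 2 ^ (n + 3) := by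
    intro x
    have h1 := conj_pow_eq t x (2 ^ (n + 3))
    rw [inv_eq_self_of_sq ht] at h1
    rw [← h1]
    rcases T.pow_half x with h | h
    · rw [h, mul_one, htt]
    · rw [h, (T.commute_half t).eq, mul_assoc, htt, mul_one]
  have hmem : ∀ x ∈ H, t * x * t ∈ H := by
    intro x hx
    have := hH.conj_mem hx (b := t) trivial
    rwa [inv_eq_self_of_sq ht] at this
  refine ⟨MonoidHom.mk' (fun x => if x ∈ H then x ^ 2 ^ (n + 3) else (x * t) ^ 2 ^ (n + 3))
    fun a b => ?_, fun x hx => if_pos hx, ?_⟩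
  · by_cases ha : a ∈ H <;> by_cases hb : b ∈ H
    · simp only [if_pos ha, if_pos hb, if_pos (mul_mem ha hb), T.pow_half_mul ha hb]
    · have hab : a * b ∉ H := by rwa [Subgroup.mul_mem_cancel_left _ ha]
      simp only [if_pos ha, if_neg hb, if_neg hab]
      rw [mul_assoc, T.pow_half_mul ha (hH.mul b trivial t trivial hb htH)]
    · have hab : a * b ∉ H := by rwa [Subgroup.mul_mem_cancel_right _ hb]
      simp only [if_neg ha, if_pos hb, if_neg hab]
      rw [show a * b * t = a * t * (t * b * t) by simp only [mul_assoc, ← mul_assoc t t, htt, one_mul],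
        T.pow_half_mul (hH.mul a trivial t trivial ha htH) (hmem b hb), hconj]
    · simp only [if_neg ha, if_neg hb, if_pos (hH.mul a trivial b trivial ha hb)]
      rw [show a * b = a * t * (t * (b * t) * t) by
          simp only [mul_assoc, ← mul_assoc t t, htt, one_mul, mul_one],
        T.pow_half_mul (hH.mul a trivial t trivial ha htH)
          (hmem _ (hH.mul b trivial t trivial hb htH)), hconj]
  · change (if t ∈ H then _ else _) = (1 : G)
    rw [if_neg htH, htt, one_pow]

/-- In a group that is generated by involutions there is an involution that inverts an element of
maximal order. -/
theorem IsTower.exists_dihedral (T : IsTower n p K H) (hH : Half H ⊤) (hne : H ≠ ⊤)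
    (hG : GeneratedByInvolutions G) : ∃ t q : G, t ^ 2 = 1 ∧ t ∉ H ∧ q ∈ H ∧ t * q * t = q⁻¹ ∧
      orderOf q = 2 ^ (n + 4) ∧ ∃ φ : G →* ℤˣ, φ t = 1 ∧ φ q = -1 := by
  obtain ⟨t, ht, htH⟩ := hG.exists_notMem hne
  obtain ⟨f, hf, hft⟩ := T.exists_hom hH ht htH
  have hker : f.ker ≠ ⊤ := fun h => T.half_ne_one (by
    rw [← hf p T.mem', ← MonoidHom.mem_ker, h]; trivial)
  -- On `H` the homomorphism is the power map, which kills involutions, so `s` lies outside `H` like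
  -- `t`. Then `t * s` lies in `H` and is not killed, that is, it has maximal order.
  obtain ⟨s, hs, hsf⟩ := hG.exists_notMem hker
  rw [MonoidHom.mem_ker] at hsf
  have hsH : s ∉ H := fun h => hsf (by
    rw [hf s h, show 2 ^ (n + 3) = 2 * 2 ^ (n + 2) by ring, pow_mul, hs, one_pow])
  have hq := hH.mul t trivial s trivial htH hsH
  have hfq : f (t * s) ≠ 1 := by rwa [map_mul, hft, one_mul]
  have hval : ∀ x, f x = 1 ∨ f x = p ^ 2 ^ (n + 3) := by
    intro x
    by_cases hx : x ∈ H
    · rw [hf x hx]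
      exact T.pow_half x
    · have h1 : f x = f (x * t) := by rw [map_mul, hft, mul_one]
      rw [h1, hf _ (hH.mul x trivial t trivial hx htH)]
      exact T.pow_half _
  obtain ⟨φ, hφ⟩ := Half.exists_hom (A := f.ker) ⟨le_top, fun a _ b _ ha hb => by
    rw [MonoidHom.mem_ker] at ha hb ⊢
    rw [map_mul, (hval a).resolve_left ha, (hval b).resolve_left hb, ← pow_two, T.half_sq]⟩
  refine ⟨t, t * s, ht, htH, hq, ?_, ?_, φ, (hφ t).2 hft, ?_⟩
  · rw [mul_inv_rev, inv_eq_self_of_sq ht, inv_eq_self_of_sq hs, ← mul_assoc, ← pow_two, ht, one_mul]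
  · refine orderOf_eq_prime_pow (n := n + 3) ?_ (T.pow_eq_one _)
    rwa [← hf _ hq]
  · exact (Int.units_eq_one_or _).resolve_left fun h => hfq ((hφ _).1 h)

theorem Half.card_le [Finite G] {A : Subgroup G} (h : Half A ⊤) : Nat.card G ≤ 2 * Nat.card A := by
  obtain ⟨φ, hφ⟩ := h.exists_hom
  have h1 : φ.ker = A := by
    ext g
    rw [MonoidHom.mem_ker, hφ]
  rw [← A.card_mul_index, mul_comm, ← h1, Subgroup.index_ker]
  refine Nat.mul_le_mul_right _ ((Nat.card_le_card_of_injective _ Subtype.val_injective).trans ?_)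
  rw [Nat.card_eq_fintype_card]
  rfl

theorem Half.refl (A : Subgroup G) : Half A A := ⟨le_rfl, fun _ ha _ _ h => absurd ha h⟩

/-- Every conjugate of `p ^ 2 ^ (n + 2)` lies in `⟨p⟩`, as it is a fourth power, and it has the same
square. So it is this element or its product with the central involution, and the centralizer has
index at most 2. -/
theorem IsTower.half_centralizer (T : IsTower n p K H) :
    Half (Subgroup.centralizer {p ^ 2 ^ (n + 2)}) ⊤ := by
  have hz : (p ^ 2 ^ (n + 2)) ^ 2 = p ^ 2 ^ (n + 3) := by rw [← pow_mul, ← pow_succ]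
  have key : ∀ x : G, x ∉ Subgroup.centralizer {p ^ 2 ^ (n + 2)} →
      x⁻¹ * p ^ 2 ^ (n + 2) * x = p ^ 2 ^ (n + 2) * p ^ 2 ^ (n + 3) := by
    intro x hx
    rw [Subgroup.mem_centralizer_singleton_iff] at hx
    have hx' : x⁻¹ * p ^ 2 ^ (n + 2) * x ≠ p ^ 2 ^ (n + 2) := fun h =>
      hx (commute_iff_conj.2 h).eq
    obtain ⟨a, ha⟩ := T.exists_pow_four (x⁻¹ * p ^ 2 ^ n * x)
    have h1 : x⁻¹ * p ^ 2 ^ (n + 2) * x = p ^ (4 * a) := by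
      rw [← ha, ← conj_pow_eq, ← pow_mul, pow_add]
      norm_num
    have h2 : (x⁻¹ * p ^ 2 ^ (n + 2) * x) ^ 2 = p ^ 2 ^ (n + 3) := by
      rw [← conj_pow_eq, hz, commute_iff_conj.1 (T.commute_half x)]
    rw [h1, ← zpow_natCast, ← zpow_natCast p, ← zpow_mul, zpow_eq_zpow_iff_of_order T.order] at h2
    obtain ⟨c, hc⟩ := h2
    have h3 : 4 * a = 2 ^ (n + 2) * (1 + 2 * c) := by
      push_cast at hc
      have : (2 : ℤ) * (4 * a) = 2 * (2 ^ (n + 2) * (1 + 2 * c)) := by linear_combination hc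
      linarith
    have h4 : p ^ (4 * a) = p ^ 2 ^ (n + 2) * p ^ (2 ^ (n + 3) * c) := by
      rw [h3, mul_add, zpow_add, mul_one]
      congr 1
      · norm_cast
      · congr 1
        ring
    rw [h1] at hx' ⊢
    rw [h4] at hx' ⊢
    rcases eq_one_or_of_sq_eq_one T.order (i := 2 ^ (n + 3) * c) ⟨c, rfl⟩ with h5 | h5
    · rw [h5, mul_one] at hx'
      exact absurd rfl hx'
    · rw [h5]
  refine ⟨le_top, fun a _ b _ ha hb => ?_⟩
  rw [Subgroup.mem_centralizer_singleton_iff]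
  refine (commute_iff_conj.2 ?_).eq
  rw [show (a * b)⁻¹ * p ^ 2 ^ (n + 2) * (a * b) = b⁻¹ * (a⁻¹ * p ^ 2 ^ (n + 2) * a) * b by group,
    key a ha, show b⁻¹ * (p ^ 2 ^ (n + 2) * p ^ 2 ^ (n + 3)) * b =
      (b⁻¹ * p ^ 2 ^ (n + 2) * b) * (b⁻¹ * p ^ 2 ^ (n + 3) * b) by group, key b hb,
    commute_iff_conj.1 (T.commute_half b), mul_assoc, ← pow_two, T.half_sq, mul_one]

/-- The exponent `a` is odd, since otherwise `q` would have smaller order, and odd numbers are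
invertible modulo `2 ^ (n + 4)`. -/
theorem pow_mem_zpowers_of_order {q : G} (hp : orderOf p = 2 ^ (n + 4))
    (hq : orderOf q = 2 ^ (n + 4)) {c : ℕ} (hc : c ≤ n + 3) {a : ℤ}
    (h : q ^ 2 ^ c = p ^ (2 ^ c * a)) : p ^ 2 ^ c ∈ Subgroup.zpowers (q ^ 2 ^ c) := by
  obtain ⟨d, hd⟩ := Nat.exists_eq_add_of_le hc
  rcases Int.even_or_odd' a with ⟨b, rfl | rfl⟩
  · exfalso
    have h1 : (q ^ 2 ^ c) ^ (2 : ℕ) ^ d = 1 := by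
      rw [h, ← zpow_natCast, ← zpow_mul, zpow_eq_one_iff_of_order hp]
      refine ⟨b, ?_⟩
      rw [show n + 4 = c + d + 1 by omega]
      push_cast
      ring
    rw [← pow_mul, ← pow_add, ← hd] at h1
    have h2 := orderOf_dvd_of_pow_eq_one h1
    rw [hq] at h2
    have h3 := (Nat.pow_dvd_pow_iff_le_right one_lt_two).1 h2
    omega
  · have hcop : IsCoprime (1 + 2 * b) ((2 : ℤ) ^ (n + 4)) :=
      IsCoprime.pow_right ⟨1, -b, by ring⟩
    obtain ⟨u, v, huv⟩ := hcop
    refine Subgroup.mem_zpowers_iff.2 ⟨u, ?_⟩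
    rw [h, ← zpow_mul, ← zpow_natCast, zpow_eq_zpow_iff_of_order hp]
    refine ⟨-2 ^ c * v, ?_⟩
    push_cast
    linear_combination 2 ^ c * huv

/-- An involution `t` that inverts the element `p` of maximal order. -/
structure IsFrame (n : ℕ) (p t : G) (K H : Subgroup G) : Prop extends IsTower n p K H where
  half_top : Half H ⊤
  sq_eq_one : t ^ 2 = 1
  notMem : t ∉ H
  conj_eq : t * p * t = p⁻¹

theorem Half.of_card_pow [Finite G] {A B : Subgroup G} (hle : A ≤ B) {i j : ℕ}
    (hA : Nat.card A = 2 ^ i) (hB : Nat.card B = 2 ^ j) (hij : j ≤ i + 1) : Half A B := by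
  have h1 := Subgroup.card_le_of_le hle
  rw [hA, hB, Nat.pow_le_pow_iff_right one_lt_two] at h1
  rcases h1.eq_or_lt with rfl | h
  · rw [Subgroup.eq_of_le_of_card_ge hle (by rw [hA, hB])]
    exact Half.refl B
  · refine Half.of_card hle ?_
    rw [hA, hB, ← pow_succ']
    congr 1
    omega

/-- For `j = 2` the group `K` is all of `C`. A tower asks only for indices at most 2, so it covers
both values of `j`. -/
theorem exists_isTower [Finite G] {j : ℕ} (hj : 2 ≤ j) (hj3 : j ≤ 3) (hp : orderOf p = 2 ^ (n + 4))
    {C : Subgroup G} (hC : Nat.card C = 2 ^ (n + 3 + j)) (hpC : p ∈ C)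
    (h1 : ∀ x : G, x ^ 2 ^ (n + 4) = 1) (h4 : ∀ x : G, x ^ 4 ∈ Subgroup.zpowers p)
    (hcomm : ∀ x ∈ C, Commute x (p ^ 2 ^ (n + 2))) :
    ∃ K : Subgroup G, Nat.card K = 2 ^ (n + 5) ∧ IsTower n p K C := by
  have hcp : Nat.card (Subgroup.zpowers p) = 2 ^ (n + 4) := by rw [Nat.card_zpowers, hp]
  obtain ⟨K, hK1, hK2, hK⟩ := exists_subgroup_between (Subgroup.zpowers_le.2 hpC) hcp hC
    (j := n + 5) (by omega) (by omega)
  exact ⟨K, hK, hp, h1, h4, Half.of_card_pow hK1 hcp hK (by omega),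
    Half.of_card_pow hK2 hK hC (by omega), hcomm⟩

/-- A group with an element of maximal order that is generated by involutions has a frame. -/
theorem exists_isFrame {j : ℕ} (hj : 2 ≤ j) (hj3 : j ≤ 3) (hp : orderOf p = 2 ^ (n + 4))
    (hc : Nat.card G = 2 ^ (n + 4 + j)) (h1 : ∀ x : G, x ^ 2 ^ (n + 4) = 1)
    (h4 : ∀ x : G, x ^ 4 ∈ Subgroup.zpowers p) (hG : GeneratedByInvolutions G) :
    ∃ (q t : G) (K H : Subgroup G), IsFrame n q t K H ∧ Nat.card K = 2 ^ (n + 5) ∧ Nat.card H = 2 ^ (n + 3 + j) ∧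
      (∃ φ : G →* ℤˣ, φ t = 1 ∧ φ q = -1) ∧
      ((∀ x : G, x ^ 2 ∈ Subgroup.zpowers p) → ∀ x : G, x ^ 2 ∈ Subgroup.zpowers q) := by
  have hfin : Finite G := Nat.finite_of_card_ne_zero (by rw [hc]; positivity)
  -- This degenerate tower already suffices to show that the centralizer of `p ^ 2 ^ (n + 2)` has
  -- index at most 2.
  have T₀ : IsTower n p (Subgroup.zpowers p) (Subgroup.zpowers p) :=
    ⟨hp, h1, h4, Half.refl _, Half.refl _, fun x hx => by
      obtain ⟨i, rfl⟩ := Subgroup.mem_zpowers_iff.1 hx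
      exact ((Commute.refl p).zpow_left i).pow_right _⟩
  have hcp : Nat.card (Subgroup.zpowers p) = 2 ^ (n + 4) := by rw [Nat.card_zpowers, hp]
  set C := Subgroup.centralizer {p ^ 2 ^ (n + 2)} with hCdef
  have hpC : p ∈ C := Subgroup.mem_centralizer_singleton_iff.2 ((Commute.refl p).pow_right _).eq
  have hhalf : Half C ⊤ := T₀.half_centralizer
  obtain ⟨k, hk, hCk⟩ := (Nat.dvd_prime_pow Nat.prime_two).1 (hc ▸ C.card_subgroup_dvd_card)
  have hkj : n + 3 + j ≤ k := by
    have := hhalf.card_le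
    rw [hc, hCk, ← pow_succ', Nat.pow_le_pow_iff_right one_lt_two] at this
    omega
  obtain ⟨H, hH1, hH2, hH⟩ := exists_subgroup_between (Subgroup.zpowers_le.2 hpC) hcp hCk
    (j := n + 3 + j) (by omega) hkj
  have hcommC : ∀ x ∈ H, Commute x (p ^ 2 ^ (n + 2)) := fun x hx =>
    (Subgroup.mem_centralizer_singleton_iff.1 (hH2 hx))
  obtain ⟨K, hK, T⟩ := exists_isTower hj hj3 hp hH (Subgroup.zpowers_le.1 hH1) h1 h4 hcommC
  have hctop : Nat.card (⊤ : Subgroup G) = 2 ^ (n + 4 + j) := by rw [Subgroup.card_top, hc]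
  have hHtop : Half H ⊤ := Half.of_card_pow le_top hH hctop (by omega)
  have hne : H ≠ ⊤ := by
    rintro rfl
    rw [hctop] at hH
    have := Nat.pow_right_injective le_rfl hH
    omega
  obtain ⟨t, q, ht, htH, hqH, htq, hq, φ, hφ1, hφ2⟩ := T.exists_dihedral hHtop hne hG
  obtain ⟨a, ha⟩ := T.exists_pow_four q
  have hpq : p ^ 4 ∈ Subgroup.zpowers (q ^ 4) :=
    pow_mem_zpowers_of_order (c := 2) (a := a) hp hq (by omega) ha
  -- The tower is rebuilt over `q` with the same `H`: the elements `p` and `q` generate the same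
  -- group of fourth powers, and the power of `q` that `H` must centralize is a power of the one of
  -- `p`.
  obtain ⟨K', hK', T'⟩ := exists_isTower hj hj3 hq hH hqH h1 (fun x => by
      obtain ⟨b, hb⟩ := T.exists_pow_four x
      rw [hb, zpow_mul, zpow_ofNat]
      exact zpow_mem (Subgroup.zpowers_le.2 (pow_mem (Subgroup.mem_zpowers q) 4) hpq) b)
    fun x hx => by
      have h5 : q ^ 2 ^ (n + 2) = (p ^ 2 ^ (n + 2)) ^ a := by
        rw [show 2 ^ (n + 2) = 4 * 2 ^ n by ring, pow_mul, ha, ← zpow_natCast, ← zpow_natCast p,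
          ← zpow_mul, ← zpow_mul]
        congr 1
        push_cast
        ring
      rw [h5]
      exact (hcommC x hx).zpow_right a
  refine ⟨q, t, K', H, ⟨T', hHtop, ht, htH, htq⟩, hK', hH, ⟨φ, hφ1, hφ2⟩, fun hsq x => ?_⟩
  have key : ∀ x : G, ∃ b : ℤ, x ^ 2 = p ^ (2 * b) := by
    intro x
    obtain ⟨i, hi⟩ := Subgroup.mem_zpowers_iff.1 (hsq x)
    obtain ⟨b, rfl⟩ := T.even_of_sq_eq hi.symm
    exact ⟨b, hi.symm⟩
  obtain ⟨b, hb⟩ := key q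
  have hpq2 : p ^ 2 ∈ Subgroup.zpowers (q ^ 2) :=
    pow_mem_zpowers_of_order (c := 1) (a := b) hp hq (by omega) hb
  obtain ⟨d, hd⟩ := key x
  rw [hd, zpow_mul, zpow_ofNat]
  exact zpow_mem (Subgroup.zpowers_le.2 (pow_mem (Subgroup.mem_zpowers q) 2) hpq2) d

end

/-! ### Presentations for the classes in which all squares lie in a cyclic subgroup -/

section

variable {G : Type*} [Group G] {n : ℕ} {p t : G} {K H : Subgroup G}

/-- The letters of a presentation. -/
def stdLetters (n : ℕ) (s : Std) (p t w x : G) : ℕ → G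
  | 0 => p
  | 1 => t
  | 2 => w
  | 3 => x
  | 4 => p ^ 2 ^ (n + s.level)
  | _ => 1

theorem isStd_stdLetters {s : Std} {w x : G} (h : Satisfies (stdLetters n s p t w x) s.eqs)
    (hc : Subgroup.closure {x, w, t, p} = ⊤) : IsStd n s (stdLetters n s p t w x) := by
  refine ⟨rfl, fun i hi => ?_, h, hc⟩
  obtain ⟨k, rfl⟩ := Nat.exists_eq_add_of_lt hi
  rw [show 4 + k + 1 = k + 5 by omega]
  rfl

theorem Half.eq_top_of_le {A S : Subgroup G} (hA : Half A ⊤) (hAS : A ≤ S) (htS : t ∈ S)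
    (htA : t ∉ A) : S = ⊤ := by
  rw [eq_top_iff]
  intro g _
  by_cases hg : g ∈ A
  · exact hAS hg
  · have h := S.mul_mem (hAS (hA.mul g trivial t⁻¹ trivial hg (by rwa [inv_mem_iff]))) htS
    rwa [inv_mul_cancel_right] at h

theorem IsTower.pow_four_eq_one (T : IsTower n p K H) : (p ^ 2 ^ (n + 2)) ^ 4 = 1 := by
  rw [← pow_mul, show 2 ^ (n + 2) * 4 = 2 ^ (n + 4) by ring]
  exact T.pow_eq_one p

theorem exists_bit {g : G} (h : g = 1 ∨ g = p ^ 2 ^ (n + 3)) :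
    ∃ b : Bool, g = (p ^ 2 ^ (n + 2)) ^ (2 * bit b) := by
  rcases h with h | h
  · exact ⟨false, by simp [h, bit]⟩
  · refine ⟨true, ?_⟩
    rw [h, show 2 * bit true = ((2 : ℕ) : ℤ) by rfl, zpow_natCast, ← pow_mul, ← pow_succ]

theorem exists_conj_zpow {w : G}
    (h : w⁻¹ * p * w = p ∨ w⁻¹ * p * w = p * p ^ 2 ^ (n + 3)) :
    ∃ b : ℤ, ∀ i : ℤ, w⁻¹ * p ^ i * w = p ^ (i * (1 + 2 ^ (n + 3) * b)) := by
  have h3 : ∃ b : ℤ, w⁻¹ * p * w = p ^ (1 + 2 ^ (n + 3) * b) := by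
    rcases h with h | h
    · exact ⟨0, by rw [h]; simp⟩
    · exact ⟨1, by rw [h, zpow_add, zpow_one, mul_one]; norm_cast⟩
  obtain ⟨b, hb⟩ := h3
  exact ⟨b, fun i => by rw [conj_zpow_eq, hb, ← zpow_mul, mul_comm]⟩

/-- The identity `x⁻¹ * p * x = (x⁻¹ * p) ^ 2 * p⁻¹ * x ^ 2` shows that `⟨p⟩` is normal when it
contains all squares. Since `x ^ 2` commutes with `p`, the action is trivial up to the central
involution. -/
theorem IsTower.conj_of_sq_mem (T : IsTower n p K H) (hsq : ∀ x : G, x ^ 2 ∈ Subgroup.zpowers p)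
    {x : G} (hx : x ∈ H) : ∃ b : ℤ, ∀ i : ℤ, x⁻¹ * p ^ i * x = p ^ (i * (1 + 2 ^ (n + 3) * b)) := by
  have h1 : x⁻¹ * p * x ∈ Subgroup.zpowers p := by
    rw [show x⁻¹ * p * x = (x⁻¹ * p) ^ 2 * p⁻¹ * x ^ 2 by simp only [pow_two]; group]
    exact mul_mem (mul_mem (hsq _) (inv_mem (Subgroup.mem_zpowers p))) (hsq x)
  obtain ⟨e, he⟩ := Subgroup.mem_zpowers_iff.1 h1
  obtain ⟨i, hi⟩ := Subgroup.mem_zpowers_iff.1 (hsq x)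
  have h2 := T.conj_of_sq hx he.symm (by rw [← hi]; exact (Commute.refl p).zpow_left i)
  exact exists_conj_zpow h2

theorem IsTower.exists_sq_eq_one (T : IsTower n p K H) (hsq : ∀ x : G, x ^ 2 ∈ Subgroup.zpowers p)
    {x : G} (hx : x ∈ H) : ∃ i : ℤ, (x * p ^ i) ^ 2 = 1 := by
  obtain ⟨b, hb⟩ := T.conj_of_sq_mem hsq hx
  obtain ⟨j', hj'⟩ := Subgroup.mem_zpowers_iff.1 (hsq x)
  obtain ⟨j, rfl⟩ := T.even_of_sq_eq hj'.symm
  -- With `x ^ 2 = p ^ (2 * j)` the condition on the exponent `i` is `2 * j + 2 * i * (1 + 2 ^ (n +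
  -- 2) * b) ≡ 0` modulo `2 ^ (n + 4)`, and `1 + 2 ^ (n + 2) * b` is its own inverse modulo `2 ^ (n
  -- + 3)`.
  refine ⟨-j * (1 + 2 ^ (n + 2) * b), ?_⟩
  rw [show ∀ i : ℤ, (x * p ^ i) ^ 2 = x ^ 2 * (x⁻¹ * p ^ i * x) * p ^ i by
      intro i; simp only [pow_two]; group, hb, ← hj', ← zpow_add, ← zpow_add,
    zpow_eq_one_iff_of_order T.order]
  exact ⟨-j * b * (1 + 2 ^ (n + 1) * b), by ring⟩

theorem mul_sq_eq_commutator {w g : G} (hw : w ^ 2 = 1) (hg : g ^ 2 = 1) :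
    w⁻¹ * g⁻¹ * w * g = (w * g) ^ 2 := by
  rw [inv_eq_self_of_sq hw, inv_eq_self_of_sq hg, pow_two]
  simp only [mul_assoc]

/-- Conjugation by the involution `w` inverts `w * g`. On `⟨p⟩`, however, it acts trivially up to
the central involution. So a power of `w * g` that lies in `⟨p⟩` has order at most 2. -/
theorem IsTower.commutator_of_sq (T : IsTower n p K H) {w g : G} (hw : w ^ 2 = 1) (hg : g ^ 2 = 1)
    {b : ℤ} (hb : ∀ i : ℤ, w⁻¹ * p ^ i * w = p ^ (i * (1 + 2 ^ (n + 3) * b)))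
    {k : ℕ} (hk : (w * g) ^ k ∈ Subgroup.zpowers p) :
    (w * g) ^ k = 1 ∨ (w * g) ^ k = p ^ 2 ^ (n + 3) := by
  obtain ⟨i, hi⟩ := Subgroup.mem_zpowers_iff.1 hk
  have h1 : w⁻¹ * (w * g) ^ k * w = ((w * g) ^ k)⁻¹ := by
    rw [conj_pow_eq, ← inv_pow, mul_inv_rev, inv_eq_self_of_sq hw, inv_eq_self_of_sq hg]
    congr 1
    rw [← mul_assoc, ← pow_two, hw, one_mul]
  rw [← hi, hb, ← zpow_neg, zpow_eq_zpow_iff_of_order T.order] at h1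
  rw [← hi]
  refine eq_one_or_of_sq_eq_one T.order ?_
  rw [show i * (1 + 2 ^ (n + 3) * b) - -i = 2 * (i * (1 + 2 * (2 ^ (n + 1) * b))) by ring,
    show (2 : ℤ) ^ (n + 4) = 2 * 2 ^ (n + 3) by ring] at h1
  have h2 := Int.dvd_of_mul_dvd_mul_left two_ne_zero h1
  exact (IsCoprime.pow_left ⟨-(2 ^ (n + 1) * b), 1, by ring⟩ :
    IsCoprime ((2 : ℤ) ^ (n + 3)) (1 + 2 * (2 ^ (n + 1) * b))).dvd_of_dvd_mul_right h2

theorem IsTower.comm_of_conj (T : IsTower n p K H) {x : G} {b : ℤ}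
    (hb : ∀ i : ℤ, x⁻¹ * p ^ i * x = p ^ (i * (1 + 2 ^ (n + 3) * b))) :
    p⁻¹ * x⁻¹ * p * x = 1 ∨ p⁻¹ * x⁻¹ * p * x = p ^ 2 ^ (n + 3) := by
  have h := hb 1
  rw [zpow_one, one_mul, zpow_add, zpow_one] at h
  have h2 : p⁻¹ * x⁻¹ * p * x = p ^ (2 ^ (n + 3) * b) := by
    rw [show p⁻¹ * x⁻¹ * p * x = p⁻¹ * (x⁻¹ * p * x) by group, h]
    group
  rw [h2]
  exact eq_one_or_of_sq_eq_one T.order ⟨b, rfl⟩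

theorem exponent_pow_eq_one {N : ℕ} (h : Monoid.exponent G = N) (x : G) : x ^ N = 1 :=
  h ▸ Monoid.pow_exponent_eq_one x

theorem pow_four_mem_of_sq_mem (hsq : ∀ x : G, x ^ 2 ∈ Subgroup.zpowers p) (x : G) :
    x ^ 4 ∈ Subgroup.zpowers p := by
  rw [show 4 = 2 * 2 by rfl, pow_mul]
  exact pow_mem (hsq x) 2

theorem two_mul_card_closure_le [Finite G] {S : Set G} {g : G} (hg : g ∉ Subgroup.closure S) :
    2 * Nat.card (Subgroup.closure S) ≤ Nat.card (Subgroup.closure (insert g S)) :=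
  two_mul_card_le ⟨Subgroup.closure_mono (Set.subset_insert _ _), fun h =>
    hg (h (Subgroup.subset_closure (Set.mem_insert _ _)))⟩

/-- Here `H` contains `⟨p⟩` with index 2. An element of `H` outside `⟨p⟩` becomes an involution `w`
after multiplication by a power of `p`, and the commutators of `w` with `p` and `t` lie in the
central group of order 2. -/
theorem exists_isStd_of_classNII {n : ℕ} (h : ClassNII (n + 6) G)
    (hG : GeneratedByInvolutions G) : ∃ a d v, IsStd (G := G) n (.nii a d) v := by
  obtain ⟨hc, he, p₀, hp₀, hsq₀⟩ := h
  obtain ⟨p, t, K, H, F, -, hH, -, hsq⟩ := exists_isFrame (n := n) (j := 2) le_rfl (by omega) hp₀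
    hc (exponent_pow_eq_one he) (pow_four_mem_of_sq_mem hsq₀) hG
  replace hsq := hsq hsq₀
  have T := F.toIsTower
  have hfin : Finite G := Nat.finite_of_card_ne_zero (by rw [hc]; positivity)
  have hcp : Nat.card (Subgroup.closure {p}) = 2 ^ (n + 4) := by
    rw [← Subgroup.zpowers_eq_closure, Nat.card_zpowers, T.order]
  obtain ⟨w₀, hw₀H, hw₀⟩ : ∃ w ∈ H, w ∉ Subgroup.closure {p} := by
    by_contra hcon
    push Not at hcon
    have := Subgroup.card_le_of_le hcon
    rw [hH, hcp, Nat.pow_le_pow_iff_right one_lt_two] at this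
    omega
  obtain ⟨i, hw⟩ := T.exists_sq_eq_one hsq hw₀H
  have hpi : p ^ i ∈ Subgroup.closure {p} :=
    zpow_mem (Subgroup.subset_closure (Set.mem_singleton p)) i
  set w := w₀ * p ^ i
  have hwp : w ∉ Subgroup.closure {p} := by rwa [Subgroup.mul_mem_cancel_right _ hpi]
  have hwH : w ∈ H := mul_mem hw₀H (zpow_mem T.mem' i)
  have hle : Subgroup.closure {w, p} ≤ H := by
    rw [Subgroup.closure_le]
    rintro _ (rfl | rfl)
    exacts [hwH, T.mem']
  have hHle : H ≤ Subgroup.closure {w, p} := by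
    refine (Subgroup.eq_of_le_of_card_ge hle ?_).ge
    have := two_mul_card_closure_le hwp
    rw [hH]
    rw [hcp] at this
    exact le_trans (by rw [← pow_succ']) this
  obtain ⟨b, hb⟩ := T.conj_of_sq_mem hsq hwH
  obtain ⟨a, ha⟩ := exists_bit (T.comm_of_conj hb)
  obtain ⟨d, hd⟩ := exists_bit (T.commutator_of_sq hw F.sq_eq_one hb (hsq (w * t)))
  refine ⟨a, d, stdLetters n _ p t w 1, isStd_stdLetters (satisfies_nii_iff.2
    ⟨F.sq_eq_one, F.conj_eq, T.pow_four_eq_one, hw, ha, ?_, rfl⟩) ?_⟩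
  · rw [← mul_sq_eq_commutator hw F.sq_eq_one] at hd
    exact hd
  · refine F.half_top.eq_top_of_le (t := t) (hHle.trans (Subgroup.closure_mono ?_))
      (Subgroup.subset_closure (by simp)) F.notMem
    rintro _ (rfl | rfl) <;> simp

/-- Now `H` contains `⟨p⟩` with index 4, and the adjustment by powers of `p` yields two involutions
`w` and `x`. The order bound for `⟨w, p⟩` guarantees room for the second one. -/
theorem exists_isStd_of_classMIII {n : ℕ} (h : ClassMIII (n + 7) G)
    (hG : GeneratedByInvolutions G) : ∃ a b c d e v, IsStd (G := G) n (.three a b c d e) v := by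
  obtain ⟨hc, he, p₀, hp₀, hsq₀⟩ := h
  obtain ⟨p, t, K, H, F, -, hH, -, hsq⟩ := exists_isFrame (n := n) (j := 3) (by omega) le_rfl hp₀
    hc (exponent_pow_eq_one he) (pow_four_mem_of_sq_mem hsq₀) hG
  replace hsq := hsq hsq₀
  have T := F.toIsTower
  have hfin : Finite G := Nat.finite_of_card_ne_zero (by rw [hc]; positivity)
  have hcp : Nat.card (Subgroup.closure {p}) = 2 ^ (n + 4) := by
    rw [← Subgroup.zpowers_eq_closure, Nat.card_zpowers, T.order]
  obtain ⟨w₀, hw₀H, hw₀⟩ : ∃ w ∈ H, w ∉ Subgroup.closure {p} := by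
    by_contra hcon
    push Not at hcon
    have := Subgroup.card_le_of_le hcon
    rw [hH, hcp, Nat.pow_le_pow_iff_right one_lt_two] at this
    omega
  obtain ⟨i, hw⟩ := T.exists_sq_eq_one hsq hw₀H
  have hpi : p ^ i ∈ Subgroup.closure {p} :=
    zpow_mem (Subgroup.subset_closure (Set.mem_singleton p)) i
  set w := w₀ * p ^ i
  have hwp : w ∉ Subgroup.closure {p} := by rwa [Subgroup.mul_mem_cancel_right _ hpi]
  have hwH : w ∈ H := mul_mem hw₀H (zpow_mem T.mem' i)
  obtain ⟨b, hb⟩ := T.conj_of_sq_mem hsq hwH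
  have hcw : Nat.card (Subgroup.closure {w, p}) ≤ 2 * 2 ^ (n + 4) := by
    refine (card_closure_insert_le two_pos inferInstance hcp.le ?_ ?_).2
    · rintro _ rfl
      have := hb 1
      rw [zpow_one] at this
      rw [this]
      exact zpow_mem (Subgroup.subset_closure (Set.mem_singleton _)) _
    · rw [hw]
      exact one_mem _
  obtain ⟨x₀, hx₀H, hx₀⟩ : ∃ x ∈ H, x ∉ Subgroup.closure {w, p} := by
    by_contra hcon
    push Not at hcon
    have := (Subgroup.card_le_of_le hcon).trans hcw
    rw [hH, ← pow_succ', Nat.pow_le_pow_iff_right one_lt_two] at this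
    omega
  obtain ⟨j, hx⟩ := T.exists_sq_eq_one hsq hx₀H
  have hpj : p ^ j ∈ Subgroup.closure {w, p} :=
    zpow_mem (Subgroup.subset_closure (by simp)) j
  set x := x₀ * p ^ j
  have hxp : x ∉ Subgroup.closure {w, p} := by rwa [Subgroup.mul_mem_cancel_right _ hpj]
  have hxH : x ∈ H := mul_mem hx₀H (zpow_mem T.mem' j)
  have hle : Subgroup.closure {x, w, p} ≤ H := by
    rw [Subgroup.closure_le]
    rintro _ (rfl | rfl | rfl)
    exacts [hxH, hwH, T.mem']
  have hHle : H ≤ Subgroup.closure {x, w, p} := by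
    refine (Subgroup.eq_of_le_of_card_ge hle ?_).ge
    have h1 := two_mul_card_closure_le hwp
    have h2 := two_mul_card_closure_le hxp
    rw [hcp] at h1
    rw [hH, show 2 ^ (n + 3 + 3) = 2 * (2 * 2 ^ (n + 4)) by ring]
    omega
  obtain ⟨b', hb'⟩ := T.conj_of_sq_mem hsq hxH
  obtain ⟨a, ha⟩ := exists_bit (T.comm_of_conj hb)
  obtain ⟨a', ha'⟩ := exists_bit (T.comm_of_conj hb')
  obtain ⟨c, hcc⟩ := exists_bit (T.commutator_of_sq hw hx hb (hsq (w * x)))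
  obtain ⟨d, hd⟩ := exists_bit (T.commutator_of_sq hw F.sq_eq_one hb (hsq (w * t)))
  obtain ⟨e, he⟩ := exists_bit (T.commutator_of_sq hx F.sq_eq_one hb' (hsq (x * t)))
  rw [← mul_sq_eq_commutator hw hx] at hcc
  rw [← mul_sq_eq_commutator hw F.sq_eq_one] at hd
  rw [← mul_sq_eq_commutator hx F.sq_eq_one] at he
  refine ⟨a, a', c, d, e, stdLetters n _ p t w x, isStd_stdLetters (satisfies_three_iff.2
    ⟨F.sq_eq_one, F.conj_eq, T.pow_four_eq_one, hw, hx, ha, ha', hcc, hd, he⟩) ?_⟩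
  refine F.half_top.eq_top_of_le (t := t) (hHle.trans (Subgroup.closure_mono ?_))
    (Subgroup.subset_closure (by simp)) F.notMem
  rintro _ (rfl | rfl | rfl) <;> simp

end

section

variable {G : Type*} [Group G]

/-! ### Generation by a further involution -/

theorem exists_half_of_ne_top [Finite G] {M : ℕ} (hc : Nat.card G = 2 ^ M) {S : Subgroup G}
    (hS : S ≠ ⊤) : ∃ A : Subgroup G, S ≤ A ∧ Half A ⊤ ∧ A ≠ ⊤ := by
  obtain ⟨i, hi, hSi⟩ := (Nat.dvd_prime_pow Nat.prime_two).1 (hc ▸ S.card_subgroup_dvd_card)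
  have hctop : Nat.card (⊤ : Subgroup G) = 2 ^ M := by rw [Subgroup.card_top, hc]
  have hiM : i ≠ M := by
    rintro rfl
    exact hS (Subgroup.eq_top_of_card_eq _ (by rw [hSi, hc]))
  obtain ⟨A, hSA, -, hA⟩ := exists_subgroup_between (le_top : S ≤ ⊤) hSi hctop (j := M - 1)
    (by omega) (by omega)
  refine ⟨A, hSA, Half.of_card_pow le_top hA hctop (by omega), ?_⟩
  rintro rfl
  rw [hctop] at hA
  have := Nat.pow_right_injective le_rfl hA
  omega

theorem exists_hom_of_ne_top [Finite G] {M : ℕ} (hc : Nat.card G = 2 ^ M) {S : Subgroup G}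
    (hS : S ≠ ⊤) : ∃ φ : G →* ℤˣ, (∀ x ∈ S, φ x = 1) ∧ φ ≠ 1 := by
  obtain ⟨A, hSA, hA, hne⟩ := exists_half_of_ne_top hc hS
  obtain ⟨φ, hφ⟩ := hA.exists_hom
  refine ⟨φ, fun x hx => (hφ x).2 (hSA hx), ?_⟩
  rintro rfl
  exact hne (top_le_iff.1 fun x _ => (hφ x).1 rfl)

/-- A group that is generated by three elements has at most 8 sign homomorphisms. -/
theorem not_injective_of_closure {a b c : G} (h : Subgroup.closure {a, b, c} = ⊤)
    (f : Bool × Bool × Bool × Bool → (G →* ℤˣ)) : ¬ Function.Injective f := by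
  intro hf
  let e : Bool × Bool × Bool × Bool → ℤˣ × ℤˣ × ℤˣ := fun x => (f x a, f x b, f x c)
  have he : Function.Injective e := by
    intro x y hxy
    simp only [e, Prod.mk.injEq] at hxy
    refine hf (MonoidHom.eq_of_eqOn_dense h ?_)
    rintro _ (rfl | rfl | rfl)
    exacts [hxy.1, hxy.2.1, hxy.2.2]
  have := Fintype.card_le_of_injective e he
  revert this
  decide

/-- Three generators allow at most 8 sign homomorphisms. Choose `f ≠ 1` that kills `t` and `p`, and
an involution `s` with `f s = -1`. If `s, t, p` did not generate `G`, some `g ≠ 1` would kill all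
three. Evaluation at `t`, `p`, `s` and a point where `g` is `-1` shows that `f, g, φ, ψ` are
independent, which makes 16. -/
theorem exists_sq_eq_one_of_closure [Finite G] {M : ℕ} (hc : Nat.card G = 2 ^ M) {a b c p t : G}
    (h : Subgroup.closure {a, b, c} = ⊤) (hG : GeneratedByInvolutions G) {φ ψ : G →* ℤˣ}
    (hφt : φ t = -1) (hφp : φ p = 1) (hψt : ψ t = 1) (hψp : ψ p = -1)
    (hpt : Subgroup.closure {t, p} ≠ ⊤) : ∃ s, s ^ 2 = 1 ∧ Subgroup.closure {s, t, p} = ⊤ := by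
  obtain ⟨f, hf, hf1⟩ := exists_hom_of_ne_top hc hpt
  obtain ⟨s, hs, hsf⟩ := hG.exists_notMem (S := f.ker) fun hk => hf1 (by
    ext x
    have : x ∈ f.ker := hk ▸ Subgroup.mem_top x
    rw [MonoidHom.mem_ker.1 this]
    rfl)
  refine ⟨s, hs, ?_⟩
  by_contra hne
  obtain ⟨g, hg, hg1⟩ := exists_hom_of_ne_top hc hne
  obtain ⟨r, hr⟩ := DFunLike.ne_iff.1 hg1
  have hgr : g r = -1 := (Int.units_eq_one_or _).resolve_left hr
  have hfs : f s = -1 := (Int.units_eq_one_or _).resolve_left hsf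
  have hfp := hf p (Subgroup.subset_closure (by simp))
  have hft := hf t (Subgroup.subset_closure (by simp))
  have hgs := hg s (Subgroup.subset_closure (by simp))
  have hgp := hg p (Subgroup.subset_closure (by simp))
  have hgt := hg t (Subgroup.subset_closure (by simp))
  have hbit : ∀ a b : Bool, (-1 : ℤˣ) ^ a.toNat = (-1) ^ b.toNat → a = b := by decide
  refine not_injective_of_closure h (fun x => f ^ x.1.toNat * g ^ x.2.1.toNat *
    φ ^ x.2.2.1.toNat * ψ ^ x.2.2.2.toNat) ?_
  rintro ⟨x₁, x₂, x₃, x₄⟩ ⟨y₁, y₂, y₃, y₄⟩ hxy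
  have hxy' := fun z => DFunLike.congr_fun hxy z
  simp only [MonoidHom.mul_apply, MonoidHom.pow_apply] at hxy'
  have h3 := hxy' t
  simp only [hft, hgt, hφt, hψt, one_pow, one_mul, mul_one] at h3
  have h4 := hxy' p
  simp only [hfp, hgp, hφp, hψp, one_pow, one_mul] at h4
  obtain rfl := hbit _ _ h3
  obtain rfl := hbit _ _ h4
  have h1 := hxy' s
  simp only [hfs, hgs, one_pow, mul_one, mul_left_inj] at h1
  obtain rfl := hbit _ _ h1
  have h2 := hxy' r
  simp only [hgr, mul_left_inj, mul_right_inj] at h2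
  obtain rfl := hbit _ _ h2
  rfl

end

section

variable {G : Type*} [Group G] {n : ℕ} {p t w : G} {K H : Subgroup G}

/-! ### The case that `⟨p⟩` is normal -/

theorem closure_eq_top_of_forall (hgen : ∀ S : Subgroup G, p ∈ S → t ∈ S → w ∈ S → S = ⊤) :
    Subgroup.closure {1, w, t, p} = ⊤ :=
  hgen _ (Subgroup.subset_closure (by simp)) (Subgroup.subset_closure (by simp))
    (Subgroup.subset_closure (by simp))

theorem exists_bit_of_conj (h : w⁻¹ * p * w = p ∨ w⁻¹ * p * w = p * p ^ 2 ^ (n + 3)) :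
    ∃ u : Bool, w⁻¹ * p * w = p * (p ^ 2 ^ (n + 2)) ^ (2 * bit u) := by
  have h' : p⁻¹ * (w⁻¹ * p * w) = 1 ∨ p⁻¹ * (w⁻¹ * p * w) = p ^ 2 ^ (n + 3) := by
    rcases h with h | h <;> rw [h]
    · left; group
    · right; group
  obtain ⟨u, hu⟩ := exists_bit h'
  exact ⟨u, by rw [← hu]; group⟩

namespace IsFrame

theorem mul_conj (F : IsFrame n p t K H) (x : G) : t * p * x * (t * p) = p⁻¹ * (t * x * t) * p := by
  have htt : t * t = 1 := by rw [← pow_two, F.sq_eq_one]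
  have h1 : t * p = p⁻¹ * t := by rw [← F.conj_eq, mul_assoc _ t t, htt, mul_one]
  nth_rw 1 [h1]
  simp only [mul_assoc]

/-- The involution `t` can be replaced by `t * p`. -/
theorem mul_right (F : IsFrame n p t K H) : IsFrame n p (t * p) K H := by
  refine ⟨F.toIsTower, F.half_top, ?_, ?_, ?_⟩
  · rw [pow_two, ← mul_assoc, F.conj_eq, inv_mul_cancel]
  · rw [Subgroup.mul_mem_cancel_right _ F.mem']
    exact F.notMem
  · rw [F.mul_conj, F.conj_eq]
    group

theorem conj_conj (F : IsFrame n p t K H) (x g : G) : t * (x⁻¹ * g * x) * t =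
    (t * x * t)⁻¹ * (t * g * t) * (t * x * t) := by
  have htt : t * t = 1 := by rw [← pow_two, F.sq_eq_one]
  rw [mul_inv_rev, mul_inv_rev, inv_eq_self_of_sq F.sq_eq_one]
  simp only [mul_assoc, ← mul_assoc t t, htt, one_mul]

theorem conj_zpow (F : IsFrame n p t K H) (i : ℤ) : t * p ^ i * t = p ^ (-i) := by
  have h := conj_zpow_eq t p i
  rw [inv_eq_self_of_sq F.sq_eq_one, F.conj_eq] at h
  rw [h, inv_zpow, zpow_neg]

theorem conj_mem (F : IsFrame n p t K H) {x : G} (hx : x ∈ Subgroup.zpowers p) :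
    t * x * t ∈ Subgroup.zpowers p := by
  obtain ⟨i, rfl⟩ := Subgroup.mem_zpowers_iff.1 hx
  rw [F.conj_zpow]
  exact Subgroup.zpow_mem_zpowers _ _

theorem conj_mul (F : IsFrame n p t K H) (x y : G) : t * (x * y) * t = t * x * t * (t * y * t) := by
  have htt : t * t = 1 := by rw [← pow_two, F.sq_eq_one]
  simp only [mul_assoc, ← mul_assoc t t, htt, one_mul]

/-- Since `w ^ 2 = 1`, conjugation by `w` multiplies `p` by an element of order at most 2, and
`commutator_of_sq` applies to the fourth power of `w * t`. -/
theorem exists_oneA (F : IsFrame n p t K H) (hw : w ∈ H)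
    (hgen : ∀ S : Subgroup G, p ∈ S → t ∈ S → w ∈ S → S = ⊤) (hw2 : w ^ 2 = 1)
    (hpw : w⁻¹ * p * w ∈ Subgroup.zpowers p) : ∃ u c v, IsStd (G := G) n (.oneA u c) v := by
  have T := F.toIsTower
  obtain ⟨e, he⟩ := Subgroup.mem_zpowers_iff.1 hpw
  have h := T.conj_of_sq hw he.symm (by rw [hw2]; exact Commute.one_left p)
  obtain ⟨u, hu⟩ := exists_bit_of_conj h
  obtain ⟨b, hb⟩ := exists_conj_zpow h
  obtain ⟨c, hc⟩ := exists_bit (T.commutator_of_sq hw2 F.sq_eq_one hb (T.pow_four_mem (w * t)))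
  exact ⟨u, c, stdLetters n _ p t w 1, isStd_stdLetters (satisfies_oneA_iff.2
    ⟨F.sq_eq_one, F.conj_eq, T.pow_four_eq_one, hw2, hu, hc, rfl⟩) (closure_eq_top_of_forall hgen)⟩

/-- Conjugating `w⁻¹ * p * w = p ^ e` by `t` gives `w * p * w⁻¹ = p ^ e`, so `w ^ 2` centralizes
`p`. If `w ^ 4 = p ^ (4 * a)`, then `w * p ^ (-a)` has trivial fourth power, and it is inverted by
`t` or by `t * p`. -/
theorem exists_oneB (F : IsFrame n p t K H) (hw : w ∈ H)
    (hgen : ∀ S : Subgroup G, p ∈ S → t ∈ S → w ∈ S → S = ⊤) (htw : t * w * t = w⁻¹)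
    (hpw : w⁻¹ * p * w ∈ Subgroup.zpowers p) : ∃ u v, IsStd (G := G) n (.oneB u) v := by
  have T := F.toIsTower
  obtain ⟨e, he⟩ := Subgroup.mem_zpowers_iff.1 hpw
  have hcomm : Commute (w ^ 2) p := by
    have h1 := F.conj_conj w p
    rw [← he, F.conj_zpow, htw, F.conj_eq, inv_inv] at h1
    have h2 : w⁻¹ * p ^ e * w = p := by
      rw [← inv_inj, ← mul_left_inj w⁻¹, ← mul_right_inj w]
      rw [zpow_neg] at h1
      simp only [mul_inv_rev, inv_inv, mul_assoc] at h1 ⊢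
      rw [mul_inv_cancel_left, mul_inv_cancel, mul_one]
      exact h1
    rw [commute_iff_conj, pow_two, show (w * w)⁻¹ * p * (w * w) = w⁻¹ * (w⁻¹ * p * w) * w by group,
      ← he, h2]
  have h := T.conj_of_sq hw he.symm hcomm
  obtain ⟨u, hu⟩ := exists_bit_of_conj h
  obtain ⟨b, hb⟩ := exists_conj_zpow h
  obtain ⟨a, ha⟩ := T.exists_pow_four w
  have hsq : ∀ i : ℤ, (w * p ^ i) ^ 4 = w ^ 4 * p ^ (4 * i) := by
    intro i
    have h2 : (w * p ^ i) ^ 2 = w ^ 2 * p ^ (i * (1 + 2 ^ (n + 3) * b) + i) := by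
      rw [zpow_add, ← hb, pow_two, pow_two]
      group
    rw [show 4 = 2 * 2 by rfl, pow_mul, h2, (hcomm.zpow_right _).mul_pow, ← pow_mul,
      ← zpow_natCast (p ^ _), ← zpow_mul]
    congr 1
    rw [zpow_eq_zpow_iff_of_order T.order]
    exact ⟨i * b, by push_cast; ring⟩
  have hw4 : (w * p ^ (-a)) ^ 4 = 1 := by
    rw [hsq, ha, ← zpow_add, zpow_eq_one_iff_of_order T.order]
    exact ⟨0, by ring⟩
  have hgen' : ∀ S : Subgroup G, p ∈ S → t ∈ S → w * p ^ (-a) ∈ S → S = ⊤ := fun S h1 h2 h3 =>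
    hgen S h1 h2 ((Subgroup.mul_mem_cancel_right _ (zpow_mem h1 _)).1 h3)
  have hu' : (w * p ^ (-a))⁻¹ * p * (w * p ^ (-a)) = p * (p ^ 2 ^ (n + 2)) ^ (2 * bit u) := by
    rw [← hu, show (w * p ^ (-a))⁻¹ * p * (w * p ^ (-a)) =
      (p ^ (-a))⁻¹ * (w⁻¹ * p * w) * p ^ (-a) by group, ← he]
    group
  have key : ∀ t', IsFrame n p t' K H → t' * (w * p ^ (-a)) * t' = (w * p ^ (-a))⁻¹ →
      (∀ S : Subgroup G, p ∈ S → t' ∈ S → w * p ^ (-a) ∈ S → S = ⊤) →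
      ∃ u v, IsStd (G := G) n (.oneB u) v := fun t' F' h1 h2 =>
    ⟨u, stdLetters n _ p t' (w * p ^ (-a)) 1, isStd_stdLetters (satisfies_oneB_iff.2
      ⟨F'.sq_eq_one, F'.conj_eq, T.pow_four_eq_one, h1, hw4, hu', rfl⟩)
      (closure_eq_top_of_forall h2)⟩
  have h1 : t * (w * p ^ (-a)) * t = w⁻¹ * p ^ a := by
    rw [F.conj_mul, htw, F.conj_zpow, neg_neg]
  have h2 : (w * p ^ (-a))⁻¹ = w⁻¹ * (w * p ^ a * w⁻¹) := by group
  have h3 : w * p ^ a * w⁻¹ = p ^ a ∨ w * p ^ a * w⁻¹ = p ^ a * p ^ 2 ^ (n + 3) := by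
    have h4 : w⁻¹ * (p ^ a * p ^ (-(2 ^ (n + 3) * a * b))) * w = p ^ a := by
      rw [← zpow_add, hb, zpow_eq_zpow_iff_of_order T.order]
      exact ⟨-(2 ^ (n + 2) * a * b ^ 2), by ring⟩
    have h5 : w * p ^ a * w⁻¹ = p ^ a * p ^ (-(2 ^ (n + 3) * a * b)) := by
      nth_rw 1 [← h4]
      group
    rw [h5]
    rcases eq_one_or_of_sq_eq_one T.order (i := -(2 ^ (n + 3) * a * b)) ⟨-(a * b), by ring⟩ with
      h | h
    · left; rw [h, mul_one]
    · right; rw [h]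
  rcases h3 with h3 | h3
  · exact key t F (by rw [h1, h2, h3]) hgen'
  -- Inversion by `t` fails by the central involution. In this case `w` does not commute with `p`,
  -- and passing from `t` to `t * p` supplies exactly the missing factor.
  · refine key (t * p) F.mul_right ?_ fun S h4 h5 h6 =>
      hgen' S h4 ((Subgroup.mul_mem_cancel_right _ h4).1 h5) h6
    have h4 : w * p * w⁻¹ = p * p ^ 2 ^ (n + 3) := by
      rcases h with h | h
      · exfalso
        have h5 : Commute w (p ^ a) := (commute_iff_conj.2 h).zpow_right a
        rw [h5.eq, mul_inv_cancel_right] at h3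
        exact T.half_ne_one (mul_eq_left.1 h3.symm)
      · have h5 : w⁻¹ * (p * p ^ 2 ^ (n + 3)) * w = p := by
          rw [show w⁻¹ * (p * p ^ 2 ^ (n + 3)) * w =
            w⁻¹ * p * w * (w⁻¹ * p ^ 2 ^ (n + 3) * w) by group, h,
            commute_iff_conj.1 (T.commute_half w), mul_assoc, ← pow_two, T.half_sq, mul_one]
        nth_rw 1 [← h5]
        group
    rw [F.mul_conj, h1, h2, h3]
    have h5 : p⁻¹ * (w⁻¹ * p ^ a) * p = w⁻¹ * (w * p * w⁻¹)⁻¹ * p ^ a * p := by group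
    rw [h5, h4, mul_inv_rev, inv_eq_self_of_sq T.half_sq]
    simp only [mul_assoc]
    congr 1
    rw [← (T.commute_half _).eq, ← mul_assoc]
    congr 1
    group

end IsFrame

end

section

variable {G : Type*} [Group G] {n : ℕ} {p t w : G} {K H : Subgroup G}

/-! ### The case that `⟨p⟩` is not normal -/

theorem IsTower.notMem_of_conj (T : IsTower n p K H) (hpw : w⁻¹ * p * w ∉ Subgroup.zpowers p) :
    w ∉ K :=
  fun h => hpw (T.half.conj_mem (Subgroup.mem_zpowers p) h)

/-- The commutator is a product of `p⁻¹` and a conjugate of `p`, both in `K`, where squaring is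
multiplicative up to the central involution; their squares cancel up to that involution. -/
theorem IsTower.commutator_sq (T : IsTower n p K H) (hw : w ∈ H) {l : ℤ}
    (hl : w⁻¹ * p ^ 2 * w = p ^ (2 + 2 ^ (n + 3) * l)) :
    (p⁻¹ * w⁻¹ * p * w) ^ 2 = 1 ∨ (p⁻¹ * w⁻¹ * p * w) ^ 2 = p ^ 2 ^ (n + 3) := by
  obtain ⟨b, hb⟩ := T.exists_sq_mul (inv_mem T.mem) (T.half'.conj_mem T.mem hw)
  have h : (p⁻¹ * w⁻¹ * p * w) ^ 2 = p ^ (2 ^ (n + 3) * (l + b)) := by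
    rw [show p⁻¹ * w⁻¹ * p * w = p⁻¹ * (w⁻¹ * p * w) by group, hb, ← conj_pow_eq, hl, inv_pow,
      ← zpow_natCast, ← zpow_neg, ← zpow_add, ← zpow_add]
    congr 1
    push_cast
    ring
  rw [h]
  exact eq_one_or_of_sq_eq_one T.order ⟨_, rfl⟩

/-- Conjugation by `w` sends `p ^ 2` to `p ^ (2 * (1 + 4 * l))` and has trivial square on `⟨p ^ 2⟩`.
So `2 ^ (n + 4)` divides `16 * l * (1 + 2 * l)`, and hence `2 ^ n ∣ l`. -/
theorem IsTower.exists_conj_sq_of_commute (T : IsTower n p K H) (hw : w ∈ H)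
    (h : Commute (w ^ 2) p) : ∃ l : ℤ, w⁻¹ * p ^ 2 * w = p ^ (2 + 2 ^ (n + 3) * l) := by
  obtain ⟨l, hl⟩ := T.exists_conj_sq hw
  have h1 : w⁻¹ * (w⁻¹ * p ^ 2 * w) * w = p ^ 2 := by
    rw [show w⁻¹ * (w⁻¹ * p ^ 2 * w) * w = (w ^ 2)⁻¹ * p ^ 2 * w ^ 2 by rw [pow_two w]; group]
    exact commute_iff_conj.1 (h.pow_right 2)
  have h2 : w⁻¹ * (w⁻¹ * p ^ 2 * w) * w = p ^ ((2 + 8 * l) * (1 + 4 * l)) := by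
    rw [hl, show 2 + 8 * l = 2 * (1 + 4 * l) by ring, zpow_mul, conj_zpow_eq, zpow_ofNat, hl,
      ← zpow_mul, show 2 + 8 * l = 2 * (1 + 4 * l) by ring]
  rw [h2, ← zpow_natCast, zpow_eq_zpow_iff_of_order T.order,
    show (2 + 8 * l) * (1 + 4 * l) - ((2 : ℕ) : ℤ) = 16 * (l * (1 + 2 * l)) by push_cast; ring,
    show (2 : ℤ) ^ (n + 4) = 16 * 2 ^ n by ring] at h1
  have h3 := Int.dvd_of_mul_dvd_mul_left (by norm_num) h1
  obtain ⟨c, hc⟩ := (IsCoprime.pow_left ⟨-l, 1, by ring⟩ :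
    IsCoprime ((2 : ℤ) ^ n) (1 + 2 * l)).dvd_of_dvd_mul_right h3
  refine ⟨c, ?_⟩
  rw [hl, hc]
  congr 1
  ring

theorem mem_zpowers_of_odd (hp : orderOf p = 2 ^ (n + 4)) {d : ℤ}
    (h : w⁻¹ * p ^ (2 * d + 1) * w ∈ Subgroup.zpowers p) : w⁻¹ * p * w ∈ Subgroup.zpowers p := by
  obtain ⟨u, v, huv⟩ : IsCoprime (2 * d + 1) ((2 : ℤ) ^ (n + 4)) :=
    IsCoprime.pow_right ⟨1, -d, by ring⟩
  have h1 : p = (p ^ (2 * d + 1)) ^ u := by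
    rw [← zpow_mul]
    nth_rw 1 [← zpow_one p]
    rw [zpow_eq_zpow_iff_of_order hp]
    exact ⟨v, by linear_combination -huv⟩
  rw [h1, conj_zpow_eq, ← h1]
  exact zpow_mem h u

theorem exists_bit_sq {g : G} (h : g = 1 ∨ g = p ^ 2 ^ (n + 3)) :
    ∃ b : Bool, g = (p ^ 2 ^ (n + 3)) ^ bit b := by
  rcases h with h | h
  · exact ⟨false, by simp [h, bit]⟩
  · exact ⟨true, by simp [h, bit]⟩

namespace IsFrame

/-- Write `t * w * t = w * p ^ i`. Both `w` and `w * p ^ i` square to 1, so `w` inverts `p ^ i`. An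
odd `i` would make `w` normalize `⟨p⟩`. For even `i`, conjugation by `w` fixes `p ^ i` up to the
central involution, so `p ^ i` has order at most 2. -/
theorem exists_twoA_of_mem (F : IsFrame n p t K H) (hw : w ∈ H)
    (hgen : ∀ S : Subgroup G, p ∈ S → t ∈ S → w ∈ S → S = ⊤) (hw2 : w ^ 2 = 1)
    (hpw : w⁻¹ * p * w ∉ Subgroup.zpowers p) (hc : w⁻¹ * (t * w * t) ∈ Subgroup.zpowers p) :
    ∃ a b c v, IsStd (G := G) n (.twoA a b c) v := by
  have T := F.toIsTower
  obtain ⟨i, hi⟩ := Subgroup.mem_zpowers_iff.1 hc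
  have htw : t * w * t = w * p ^ i := by rw [hi, mul_inv_cancel_left]
  obtain ⟨l, hl⟩ := T.exists_conj_sq_of_commute hw (by rw [hw2]; exact Commute.one_left p)
  have h1 : w⁻¹ * p ^ i * w = p ^ (-i) := by
    have h2 : (t * w * t) ^ 2 = 1 := by
      have := conj_pow_eq t w 2
      rwa [inv_eq_self_of_sq F.sq_eq_one, hw2, mul_one, ← pow_two, F.sq_eq_one, eq_comm] at this
    rw [htw, pow_two, ← mul_assoc] at h2
    rw [inv_eq_self_of_sq hw2, eq_mul_inv_of_mul_eq h2, one_mul, zpow_neg]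
  obtain ⟨j, rfl | rfl⟩ := Int.even_or_odd' i
  · have h2 : p ^ (2 * j) = 1 ∨ p ^ (2 * j) = p ^ 2 ^ (n + 3) := by
      rw [zpow_mul, conj_zpow_eq, zpow_ofNat, hl, ← zpow_mul,
        zpow_eq_zpow_iff_of_order T.order,
        show (2 + 2 ^ (n + 3) * l) * j - -(2 * j) = 4 * (j * (1 + 2 * (2 ^ n * l))) by ring,
        show (2 : ℤ) ^ (n + 4) = 4 * 2 ^ (n + 2) by ring] at h1
      have h3 := Int.dvd_of_mul_dvd_mul_left (by norm_num) h1
      obtain ⟨c, hc⟩ := (IsCoprime.pow_left ⟨-(2 ^ n * l), 1, by ring⟩ :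
        IsCoprime ((2 : ℤ) ^ (n + 2)) (1 + 2 * (2 ^ n * l))).dvd_of_dvd_mul_right h3
      exact eq_one_or_of_sq_eq_one T.order ⟨c, by rw [hc]; ring⟩
    obtain ⟨a, ha⟩ := exists_bit_sq h2
    have h3 : (p ^ 2)⁻¹ * (w⁻¹ * p ^ 2 * w) = 1 ∨
        (p ^ 2)⁻¹ * (w⁻¹ * p ^ 2 * w) = p ^ 2 ^ (n + 3) := by
      rw [hl, zpow_add, zpow_ofNat, inv_mul_cancel_left]
      exact eq_one_or_of_sq_eq_one T.order ⟨l, rfl⟩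
    obtain ⟨b, hb⟩ := exists_bit_sq h3
    obtain ⟨c, hc⟩ := exists_bit_sq (T.commutator_sq hw hl)
    refine ⟨a, b, c, stdLetters n _ p t w 1, isStd_stdLetters (satisfies_twoA_iff.2
      ⟨F.sq_eq_one, F.conj_eq, T.half_sq, hw2, ?_, ?_, hc, rfl⟩) (closure_eq_top_of_forall hgen)⟩
    · rw [ha] at htw
      exact htw
    · rw [inv_mul_eq_iff_eq_mul] at hb
      exact hb
  · exact absurd (mem_zpowers_of_odd T.order (h1 ▸ Subgroup.zpow_mem_zpowers _ _)) hpw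

theorem conj_notMem (F : IsFrame n p t K H) (hpw : w⁻¹ * p * w ∉ Subgroup.zpowers p) :
    (t * w * t)⁻¹ * p * (t * w * t) ∉ Subgroup.zpowers p := by
  intro h
  have h1 := F.conj_conj w p⁻¹
  have h2 := F.conj_zpow (-1)
  rw [zpow_neg_one, neg_neg, zpow_one] at h2
  rw [h2] at h1
  rw [← h1] at h
  have h3 := F.conj_mem h
  have htt : t * t = 1 := by rw [← pow_two, F.sq_eq_one]
  rw [show t * (t * (w⁻¹ * p⁻¹ * w) * t) * t = t * t * (w⁻¹ * p⁻¹ * w) * (t * t) by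
    simp only [mul_assoc], htt, one_mul, mul_one] at h3
  apply hpw
  rw [← inv_mem_iff]
  rwa [show (w⁻¹ * p * w)⁻¹ = w⁻¹ * p⁻¹ * w by group]

/-- If `w⁻¹ * (t * w * t)` is not in `⟨p⟩`, replace `t` by `t * p`. This multiplies it by another
element of `K` outside `⟨p⟩`, and by `p`, and so moves it into `⟨p⟩`. -/
theorem exists_twoA (F : IsFrame n p t K H) (hw : w ∈ H)
    (hgen : ∀ S : Subgroup G, p ∈ S → t ∈ S → w ∈ S → S = ⊤) (hw2 : w ^ 2 = 1)
    (hpw : w⁻¹ * p * w ∉ Subgroup.zpowers p) :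
    ∃ a b c v, IsStd (G := G) n (.twoA a b c) v := by
  have T := F.toIsTower
  have hcK : w⁻¹ * (t * w * t) ∈ K := by
    refine T.half'.inv_mul_mem hw ?_ (T.notMem_of_conj hpw) (T.notMem_of_conj (F.conj_notMem hpw))
    have := F.half_top.conj_mem hw (b := t) trivial
    rwa [inv_eq_self_of_sq F.sq_eq_one] at this
  by_cases hc : w⁻¹ * (t * w * t) ∈ Subgroup.zpowers p
  · exact F.exists_twoA_of_mem hw hgen hw2 hpw hc
  · refine F.mul_right.exists_twoA_of_mem hw
      (fun S h1 h2 h3 => hgen S h1 ((Subgroup.mul_mem_cancel_right _ h1).1 h2) h3) hw2 hpw ?_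
    rw [F.mul_conj, show w⁻¹ * (p⁻¹ * (t * w * t) * p) =
      (w⁻¹ * p * w)⁻¹ * (w⁻¹ * (t * w * t)) * p by group]
    exact mul_mem (T.half.inv_mul_mem (T.half'.conj_mem T.mem hw) hcK hpw hc)
      (Subgroup.mem_zpowers p)

/-- Write `w ^ 2 = p ^ (2 * c)`. For even `c` a power of `p ^ 2` turns `w` into an involution, which
leads back to `twoA`. For odd `c` the elements `w ^ 2` and `p ^ 2` generate the same group, so `w`
centralizes `p ^ 2`. -/
theorem exists_twoB_of_mem (F : IsFrame n p t K H) (hw : w ∈ H)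
    (hgen : ∀ S : Subgroup G, p ∈ S → t ∈ S → w ∈ S → S = ⊤) (htw : t * w * t = w⁻¹)
    (hpw : w⁻¹ * p * w ∉ Subgroup.zpowers p) (hw2 : w ^ 2 ∈ Subgroup.zpowers p) :
    (∃ a b c v, IsStd (G := G) n (.twoA a b c) v) ∨ ∃ c v, IsStd (G := G) n (.twoB c) v := by
  have T := F.toIsTower
  obtain ⟨c', hc'⟩ := Subgroup.mem_zpowers_iff.1 hw2
  obtain ⟨c, rfl⟩ := T.even_of_sq_eq hc'.symm
  obtain ⟨l, hl⟩ := T.exists_conj_sq_of_commute hw (by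
    rw [← hc']; exact (Commute.refl p).zpow_left _)
  have hconj : ∀ i : ℤ, w⁻¹ * p ^ (2 * i) * w = p ^ ((2 + 2 ^ (n + 3) * l) * i) := by
    intro i
    rw [zpow_mul, conj_zpow_eq, zpow_ofNat, hl, ← zpow_mul]
  have hsq : ∀ i : ℤ, (w * p ^ (2 * i)) ^ 2 =
      p ^ (2 * c + (2 + 2 ^ (n + 3) * l) * i + 2 * i) := by
    intro i
    rw [zpow_add, zpow_add, ← hconj, hc', pow_two, pow_two]
    group
  have hgen' : ∀ (i : ℤ) (S : Subgroup G), p ∈ S → t ∈ S → w * p ^ (2 * i) ∈ S → S = ⊤ :=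
    fun i S h1 h2 h3 => hgen S h1 h2 ((Subgroup.mul_mem_cancel_right _ (zpow_mem h1 _)).1 h3)
  obtain ⟨d, rfl | rfl⟩ := Int.even_or_odd' c
  · left
    -- With `c = 2 * d` the square is trivial when `4 * d + 4 * i * (1 + 2 ^ (n + 1) * l) ≡ 0`; the
    -- factor `1 - 2 ^ (n + 1) * l` inverts `1 + 2 ^ (n + 1) * l` modulo `2 ^ (n + 2)`.
    refine F.exists_twoA (w := w * p ^ (2 * (-d * (1 - 2 ^ (n + 1) * l))))
      (mul_mem hw (zpow_mem T.mem' _)) (hgen' _) ?_ fun h => hpw ?_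
    · rw [hsq, zpow_eq_one_iff_of_order T.order]
      exact ⟨2 ^ n * d * l ^ 2, by ring⟩
    · have h1 := mul_mem (mul_mem (Subgroup.zpow_mem_zpowers p
        (2 * (-d * (1 - 2 ^ (n + 1) * l)))) h) (Subgroup.zpow_mem_zpowers p
        (-(2 * (-d * (1 - 2 ^ (n + 1) * l)))))
      convert h1 using 1
      group
  · right
    have hp2 : ∀ i : ℤ, Commute w (p ^ (2 * i)) := by
      intro i
      have h1 : Commute w (w ^ 2) := (Commute.refl w).pow_right 2
      rw [← hc', commute_iff_conj, hconj, zpow_eq_zpow_iff_of_order T.order,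
        show (2 + 2 ^ (n + 3) * l) * (2 * d + 1) - 2 * (2 * d + 1) =
          2 ^ (n + 3) * (l * (1 + 2 * d)) by ring,
        show (2 : ℤ) ^ (n + 4) = 2 ^ (n + 3) * 2 by ring] at h1
      have h2 := Int.dvd_of_mul_dvd_mul_left (by positivity) h1
      have h3 : IsCoprime (2 : ℤ) (1 + 2 * d) := ⟨-d, 1, by ring⟩
      obtain ⟨e, rfl⟩ := h3.dvd_of_dvd_mul_right h2
      rw [commute_iff_conj, hconj, zpow_eq_zpow_iff_of_order T.order]
      exact ⟨e * i, by ring⟩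
    obtain ⟨γ, hγ⟩ := exists_bit (T.commutator_sq hw hl)
    -- The term `-d` reduces `w ^ 2` to `p ^ 2`. The second term inserts `p ^ 2 ^ (n + 2)` exactly
    -- when the squared commutator is nontrivial, so that a single parameter describes both
    -- relations.
    set i : ℤ := -d + 2 ^ n * bit γ with hi
    have hyK : w⁻¹ * p * w ∈ K := T.half'.conj_mem T.mem hw
    refine ⟨γ, stdLetters n _ p t (w * p ^ (2 * i)) 1, isStd_stdLetters (satisfies_twoB_iff.2
      ⟨F.sq_eq_one, F.conj_eq, T.pow_four_eq_one, ?_, ?_, ?_, rfl⟩)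
      (closure_eq_top_of_forall (hgen' i))⟩
    · change t * (w * p ^ (2 * i)) * t = (w * p ^ (2 * i))⁻¹
      rw [F.conj_mul, htw, F.conj_zpow, mul_inv_rev, ← zpow_neg]
      have h1 := (hp2 (-i)).inv_left.eq
      rwa [mul_neg] at h1
    · change (w * p ^ (2 * i)) ^ 2 = p ^ 2 * (p ^ 2 ^ (n + 2)) ^ bit γ
      rw [pow_two, ← mul_assoc, mul_assoc w, ← (hp2 i).eq, ← mul_assoc, ← pow_two, ← hc',
        ← zpow_add, ← zpow_add, ← zpow_natCast, ← zpow_natCast, ← zpow_mul, ← zpow_add, hi]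
      congr 1
      push_cast
      ring
    · change (p⁻¹ * (w * p ^ (2 * i))⁻¹ * p * (w * p ^ (2 * i))) ^ 2 =
        (p ^ 2 ^ (n + 2)) ^ (2 * bit γ)
      rw [← hγ]
      congr 1
      calc p⁻¹ * (w * p ^ (2 * i))⁻¹ * p * (w * p ^ (2 * i)) =
            p⁻¹ * ((p ^ (2 * i))⁻¹ * (w⁻¹ * p * w) * p ^ (2 * i)) := by group
        _ = p⁻¹ * (w⁻¹ * p * w) := by
            rw [commute_iff_conj.1 (T.commute_even hyK i).symm]
        _ = _ := by group

/-- If `w ^ 2` is not in `⟨p⟩`, replace `t` by `t * p` and `w` by `p⁻¹ * w`. The new square contains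
the product of `(w * p * w⁻¹)⁻¹` and `w ^ 2`, both in `K` and outside `⟨p⟩`, so it lies in `⟨p⟩`. -/
theorem exists_twoB (F : IsFrame n p t K H) (hw : w ∈ H)
    (hgen : ∀ S : Subgroup G, p ∈ S → t ∈ S → w ∈ S → S = ⊤) (htw : t * w * t = w⁻¹)
    (hpw : w⁻¹ * p * w ∉ Subgroup.zpowers p) :
    (∃ a b c v, IsStd (G := G) n (.twoA a b c) v) ∨ ∃ c v, IsStd (G := G) n (.twoB c) v := by
  have T := F.toIsTower
  by_cases hw2 : w ^ 2 ∈ Subgroup.zpowers p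
  · exact F.exists_twoB_of_mem hw hgen htw hpw hw2
  · refine F.mul_right.exists_twoB_of_mem (w := p⁻¹ * w) (mul_mem (inv_mem T.mem') hw)
      (fun S h1 h2 h3 => hgen S h1 ((Subgroup.mul_mem_cancel_right _ h1).1 h2)
        ((Subgroup.mul_mem_cancel_left _ (inv_mem h1)).1 h3)) ?_ ?_ ?_
    · have h1 := F.conj_zpow (-1)
      rw [zpow_neg_one, neg_neg, zpow_one] at h1
      rw [F.mul_conj, F.conj_mul, h1, htw]
      group
    · rwa [show (p⁻¹ * w)⁻¹ * p * (p⁻¹ * w) = w⁻¹ * p * w by group]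
    · have h1 := F.conj_notMem hpw
      rw [htw, inv_inv] at h1
      have h2 : w * p * w⁻¹ ∈ K := by
        have := T.half'.conj_mem T.mem (inv_mem hw)
        rwa [inv_inv] at this
      rw [show (p⁻¹ * w) ^ 2 = p⁻¹ * ((w * p * w⁻¹)⁻¹ * w ^ 2) by rw [pow_two, pow_two]; group]
      exact mul_mem (inv_mem (Subgroup.mem_zpowers p))
        (T.half.inv_mul_mem h2 (T.half'.sq_mem hw) h1 hw2)

end IsFrame

theorem Std.mem_gammaMII (s : Std) (h : s ∈ [Std.oneA false false, .oneA false true,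
    .oneA true false, .oneA true true, .oneB false, .oneB true, .twoA false false false,
    .twoA false false true, .twoA false true false, .twoA false true true, .twoA true false false,
    .twoA true false true, .twoA true true false, .twoA true true true, .twoB false,
    .twoB true]) : (s.family, s.number) ∈ gammaMII := by
  revert s
  decide

/-- The groups in the class that are generated by involutions. -/
theorem exists_isStd_of_classMII (h : ClassMII (n + 7) G) (hG : GeneratedByInvolutions G) :
    ∃ s v, (s.family, s.number) ∈ gammaMII ∧ IsStd (G := G) n s v := by
  obtain ⟨hc, he, p₀, hp₀, h4, q, -, hq⟩ := h
  obtain ⟨p, t, K, H, F, -, -, ⟨ψ, hψt, hψp⟩, -⟩ := exists_isFrame (n := n) (j := 3) (by omega)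
    le_rfl hp₀ hc (exponent_pow_eq_one he) h4 hG
  have T := F.toIsTower
  have hfin : Finite G := Nat.finite_of_card_ne_zero (by rw [hc]; positivity)
  obtain ⟨g, hg⟩ : ∃ g, g ∉ Subgroup.closure {p₀, q} := by
    by_contra hcon
    push Not at hcon
    have h1 : Subgroup.closure {p₀, q} = ⊤ := top_le_iff.1 fun x _ => hcon x
    rw [h1, Subgroup.card_top, hc] at hq
    have := Nat.pow_right_injective le_rfl hq
    omega
  -- The group `⟨p₀, q⟩` has half the order of `G`, so one further element suffices; three
  -- generators are what the count of sign homomorphisms needs.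
  have hgen₀ : Subgroup.closure {g, p₀, q} = ⊤ := by
    refine Subgroup.eq_top_of_le_card _ ?_
    have h1 := two_mul_card_closure_le hg
    rw [hq, ← pow_succ'] at h1
    rw [hc]
    exact h1
  obtain ⟨φ, hφ⟩ := F.half_top.exists_hom
  have hpt : Subgroup.closure {t, p} ≠ ⊤ := by
    intro h1
    have hcp : Nat.card (Subgroup.closure {p}) = 2 ^ (n + 4) := by
      rw [← Subgroup.zpowers_eq_closure, Nat.card_zpowers, T.order]
    have h2 := (card_closure_insert_le (g := t) two_pos inferInstance hcp.le (by
      intro x hx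
      rw [Set.mem_singleton_iff.1 hx, inv_eq_self_of_sq F.sq_eq_one, F.conj_eq]
      exact inv_mem (Subgroup.subset_closure (Set.mem_singleton p)))
      (by rw [F.sq_eq_one]; exact one_mem _)).2
    rw [h1, Subgroup.card_top, hc, ← pow_succ', Nat.pow_le_pow_iff_right one_lt_two] at h2
    omega
  obtain ⟨s, hs, hst⟩ := exists_sq_eq_one_of_closure hc hgen₀ hG
    ((Int.units_eq_one_or _).resolve_left fun h => F.notMem ((hφ t).1 h)) ((hφ p).2 T.mem')
    hψt hψp hpt
  have hgen : ∀ S : Subgroup G, p ∈ S → t ∈ S → s ∈ S → S = ⊤ := by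
    intro S h1 h2 h3
    rw [eq_top_iff, ← hst, Subgroup.closure_le]
    rintro _ (rfl | rfl | rfl)
    exacts [h3, h2, h1]
  by_cases hsH : s ∈ H
  · by_cases hps : s⁻¹ * p * s ∈ Subgroup.zpowers p
    · obtain ⟨u, c, v, hv⟩ := F.exists_oneA hsH hgen hs hps
      exact ⟨_, v, Std.mem_gammaMII _ (by cases u <;> cases c <;> decide), hv⟩
    · obtain ⟨a, b, c, v, hv⟩ := F.exists_twoA hsH hgen hs hps
      exact ⟨_, v, Std.mem_gammaMII _ (by cases a <;> cases b <;> cases c <;> decide), hv⟩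
  · have hw := F.half_top.mul t trivial s trivial F.notMem hsH
    have hgen' : ∀ S : Subgroup G, p ∈ S → t ∈ S → t * s ∈ S → S = ⊤ := fun S h1 h2 h3 =>
      hgen S h1 h2 ((Subgroup.mul_mem_cancel_left _ h2).1 h3)
    have htw : t * (t * s) * t = (t * s)⁻¹ := by
      rw [← mul_assoc, ← pow_two, F.sq_eq_one, one_mul, mul_inv_rev, inv_eq_self_of_sq hs,
        inv_eq_self_of_sq F.sq_eq_one]
    by_cases hps : (t * s)⁻¹ * p * (t * s) ∈ Subgroup.zpowers p
    · obtain ⟨u, v, hv⟩ := F.exists_oneB hw hgen' htw hps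
      exact ⟨_, v, Std.mem_gammaMII _ (by cases u <;> decide), hv⟩
    · rcases F.exists_twoB hw hgen' htw hps with ⟨a, b, c, v, hv⟩ | ⟨c, v, hv⟩
      · exact ⟨_, v, Std.mem_gammaMII _ (by cases a <;> cases b <;> cases c <;> decide), hv⟩
      · exact ⟨_, v, Std.mem_gammaMII _ (by cases c <;> decide), hv⟩

end

/-! ### Classification of the groups in the classes that are generated by involutions -/

namespace Std

theorem mem_gammaNII (a d : Bool) : ((nii a d).family, (nii a d).number) ∈ gammaNII := by
  revert a d
  decide

theorem mem_gammaMIII (a b c d e : Bool) :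
    ((three a b c d e).family, (three a b c d e).number) ∈ gammaMIII := by
  revert a b c d e
  decide

end Std

theorem minM_of_mem_gammaMII {F : Family} {k : ℕ} (h : (F, k) ∈ gammaMII) : F.minM = 7 := by
  have : ∀ x ∈ gammaMII, x.1.minM = 7 := by decide
  exact this _ h

theorem minM_of_mem_gammaMIII {F : Family} {k : ℕ} (h : (F, k) ∈ gammaMIII) : F.minM = 7 := by
  have : ∀ x ∈ gammaMIII, x.1.minM = 7 := by decide
  exact this _ h

theorem minM_of_mem_gammaNII {F : Family} {k : ℕ} (h : (F, k) ∈ gammaNII) : F.minM = 6 := by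
  have : ∀ x ∈ gammaNII, x.1.minM = 6 := by decide
  exact this _ h

theorem gammaNII_subset : gammaNII ⊆ gamma :=
  Finset.subset_union_left.trans Finset.subset_union_left

theorem gammaMII_subset : gammaMII ⊆ gamma :=
  Finset.subset_union_right.trans Finset.subset_union_left

theorem gammaMIII_subset : gammaMIII ⊆ gamma := Finset.subset_union_right

theorem generatedByInvolutions_iff_of_classNII {m : ℕ} {G : Type*} [Group G] (hm : 6 ≤ m)
    (h : ClassNII m G) :
    GeneratedByInvolutions G ↔ ∃ x ∈ gammaNII, Nonempty (G ≃* Grp x.1 x.2 m) := by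
  constructor
  · intro hG
    obtain ⟨n, rfl⟩ := Nat.exists_eq_add_of_le' hm
    obtain ⟨a, d, v, hv⟩ := exists_isStd_of_classNII h hG
    have hs := Std.mem_gammaNII a d
    have := Std.nonempty_mulEquiv_grp hv (by rw [h.1, Std.index]; ring)
    rw [minM_of_mem_gammaNII hs] at this
    exact ⟨_, hs, this⟩
  · rintro ⟨x, hx, ⟨e⟩⟩
    exact GeneratedByInvolutions.of_mulEquiv e (generatedByInvolutions_of_mem_gamma
      (gammaNII_subset hx) (by rwa [minM_of_mem_gammaNII hx]))

theorem generatedByInvolutions_iff_of_classMII {m : ℕ} {G : Type*} [Group G] (hm : 7 ≤ m)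
    (h : ClassMII m G) :
    GeneratedByInvolutions G ↔ ∃ x ∈ gammaMII, Nonempty (G ≃* Grp x.1 x.2 m) := by
  constructor
  · intro hG
    obtain ⟨n, rfl⟩ := Nat.exists_eq_add_of_le' hm
    obtain ⟨s, v, hs, hv⟩ := exists_isStd_of_classMII h hG
    have hi : s.index = 8 := by
      have h1 := (s.check_iff.1 s.check_eq_true).1
      have h2 : ∀ x ∈ gammaMII, x.1.index = 8 := by decide
      rw [h1]
      exact h2 _ hs
    have := Std.nonempty_mulEquiv_grp hv (by rw [h.1, hi]; ring)
    rw [minM_of_mem_gammaMII hs] at this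
    exact ⟨_, hs, this⟩
  · rintro ⟨x, hx, ⟨e⟩⟩
    exact GeneratedByInvolutions.of_mulEquiv e (generatedByInvolutions_of_mem_gamma
      (gammaMII_subset hx) (by rwa [minM_of_mem_gammaMII hx]))

theorem generatedByInvolutions_iff_of_classMIII {m : ℕ} {G : Type*} [Group G] (hm : 7 ≤ m)
    (h : ClassMIII m G) :
    GeneratedByInvolutions G ↔ ∃ x ∈ gammaMIII, Nonempty (G ≃* Grp x.1 x.2 m) := by
  constructor
  · intro hG
    obtain ⟨n, rfl⟩ := Nat.exists_eq_add_of_le' hm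
    obtain ⟨a, b, c, d, e, v, hv⟩ := exists_isStd_of_classMIII h hG
    have hs := Std.mem_gammaMIII a b c d e
    have := Std.nonempty_mulEquiv_grp hv (by rw [h.1]; change _ = 8 * _; ring)
    rw [minM_of_mem_gammaMIII hs] at this
    exact ⟨_, hs, this⟩
  · rintro ⟨x, hx, ⟨e⟩⟩
    exact GeneratedByInvolutions.of_mulEquiv e (generatedByInvolutions_of_mem_gamma
      (gammaMIII_subset hx) (by rwa [minM_of_mem_gammaMIII hx]))

end TwoGroups

theorem mainTheorem4 :
    -- the sizes of the list and of its parts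
    (TwoGroups.gamma.card = 22 ∧ TwoGroups.gammaNII.card = 3 ∧
      TwoGroups.gammaMII.card = 12 ∧ TwoGroups.gammaMIII.card = 7) ∧
    -- among the listed groups, exactly those in the list `gamma` are generated by involutions
    (∀ (F : TwoGroups.Family) (n m : ℕ), 1 ≤ n → n ≤ F.count → F.minM ≤ m →
      (TwoGroups.GeneratedByInvolutions (TwoGroups.Grp F n m) ↔ (F, n) ∈ TwoGroups.gamma)) ∧
    -- for the other listed groups there is a homomorphism `φ_X` that kills all involutions
    (∀ (F : TwoGroups.Family) (n m : ℕ), 1 ≤ n → n ≤ F.count → F.minM ≤ m →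
      (F, n) ∉ TwoGroups.gamma →
      ∃ X : Finset (Fin F.rank), X.Nonempty ∧
        ∃ φ : TwoGroups.Grp F n m →* ℤˣ,
          (∀ i : Fin F.rank, φ (PresentedGroup.of i) = if i ∈ X then -1 else 1) ∧
          ∀ g : TwoGroups.Grp F n m, orderOf g = 2 → φ g = 1) ∧
    -- the groups in the list lie in the classes, and have the stated exponents and ranks
    (∀ (F : TwoGroups.Family) (n m : ℕ), (F, n) ∈ TwoGroups.gamma → F.minM ≤ m →
      F.InClass m (TwoGroups.Grp F n m) ∧
      Monoid.exponent (TwoGroups.Grp F n m) = 2 ^ (m - F.coexp) ∧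
      Group.rank (TwoGroups.Grp F n m) = F.rank) ∧
    -- the groups in the list are pairwise non-isomorphic
    (∀ (F F' : TwoGroups.Family) (n n' m : ℕ),
      (F, n) ∈ TwoGroups.gamma → (F', n') ∈ TwoGroups.gamma → F.minM ≤ m → F'.minM ≤ m →
      Nonempty (TwoGroups.Grp F n m ≃* TwoGroups.Grp F' n' m) → F = F' ∧ n = n') ∧
    -- the groups in the three classes that are generated by involutions
    (∀ (m : ℕ) (G : Type*) [Group G], 6 ≤ m → TwoGroups.ClassNII m G →
      (TwoGroups.GeneratedByInvolutions G ↔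
        ∃ x ∈ TwoGroups.gammaNII, Nonempty (G ≃* TwoGroups.Grp x.1 x.2 m))) ∧
    (∀ (m : ℕ) (G : Type*) [Group G], 7 ≤ m → TwoGroups.ClassMII m G →
      (TwoGroups.GeneratedByInvolutions G ↔
        ∃ x ∈ TwoGroups.gammaMII, Nonempty (G ≃* TwoGroups.Grp x.1 x.2 m))) ∧
    (∀ (m : ℕ) (G : Type*) [Group G], 7 ≤ m → TwoGroups.ClassMIII m G →
      (TwoGroups.GeneratedByInvolutions G ↔
        ∃ x ∈ TwoGroups.gammaMIII, Nonempty (G ≃* TwoGroups.Grp x.1 x.2 m))) := by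
  refine ⟨by decide, fun F n m h1 h2 hm =>
      TwoGroups.generatedByInvolutions_iff_mem_gamma F h1 h2 hm,
    fun F n m h1 h2 hm h => TwoGroups.exists_hom_of_not_mem_gamma F h1 h2 hm h,
    fun F n m h hm => ⟨(TwoGroups.inClass_of_mem_gamma h hm).1,
      (TwoGroups.inClass_of_mem_gamma h hm).2, TwoGroups.rank_grp h hm⟩,
    fun F F' n n' m h h' hm hm' he => TwoGroups.eq_of_nonempty_mulEquiv h h' hm hm' he,
    fun m G _ hm h => TwoGroups.generatedByInvolutions_iff_of_classNII hm h,
    fun m G _ hm h => TwoGroups.generatedByInvolutions_iff_of_classMII hm h,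
    fun m G _ hm h => TwoGroups.generatedByInvolutions_iff_of_classMIII hm h⟩
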